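/- Let $\mathcal H=\mathbb C^d$, $\mathcal K=\mathbb C^k$ and let $\mathscr V^{\rm irr}$ be the manifold of isometries $V:\mathcal H\to\mathcal H\otimes\mathcal K$, $V\psi=\sum_{i=1}^k K_i\psi\otimes|i\rangle$, whose channel $\rho\mapsto\sum_i K_i\rho K_i^*$ has a unique faithful invariant state $\rho^{\rm ss}_V$. Write $\mathcal T_V(X)=V^*(X\otimes\mathbf 1)V$. Represent tangent vectors at $V$ by the operators $L$ with $L^*V-V^*L=0$, so that a curve with tangent vector $L$ has velocity $iL$. The non-identifiable directions are the vectors $\theta V-(K\otimes\mathbf 1)V+VK$ with $\theta\in\mathbb R$, $K=K^*$, ${\rm Tr}(\rho^{\rm ss}_VK)=0$. The identifiable component of a tangent vector $A$ is $A^{\rm id}=P_V(A)=A-\big(\theta V-(K\otimes\mathbf 1)V+VK\big)$ with $\theta={\rm Tr}(\rho_V^{\rm ss}V^*A)$ and $K=({\rm Id}-\mathcal T_V)^{-1}(V^*A-\theta\mathbf 1)$, the inverse being taken on $\{X:{\rm Tr}(\rho_V^{\rm ss}X)=0\}$. The space of identifiable directions $T^{\rm id}_V={\rm ran}\,P_V$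 is identified with the operators $\mathcal H\to R(V)^\perp$, where $R(V)$ is the range of $V$; it is a complex Hilbert space with inner product $(A,B)_V={\rm Tr}(\rho^{\rm ss}_VA^*B)$ and real dimension $d_{\rm id}=2d^2(k-1)$. Let $\nu$ be any Riemannian metric on $\mathscr V^{\rm irr}$ that is invariant under $V\mapsto\bar c\,(W\otimes\mathbf 1)VW^*$ ($|c|=1$, $W$ unitary), makes identifiable and non-identifiable directions orthogonal, and satisfies $\nu_V(A,A)={\rm Tr}(\rho_V^{\rm ss}A^*A)$ for $A\in T_V^{\rm id}$. Fix $V_0\in\mathscr V^{\rm irr}$, a unit vector $\varphi\in\mathcal H$, $C>0$ and $\delta>0$. Let $\exp_{V_0}$ be the exponential map of $\nu$ at $V_0$, let $\|A\|=\nu_{V_0}(A,A)^{1/2}$, and let $$|\Psi_V(n)\rangle=\sum_{i_1,\dots,i_n}K_{i_n}\cdots K_{i_1}\varphi\otimes|i_1\rangle\otimes\cdots\otimes|i_n\rangle\in\mathcal H\otimes\mathcal K^{\otimes n}$$ be the system and output state after $n$ steps. On the symmetric Fock space over $(T^{\rm id}_{V_0},(\cdot,\cdot)_{V_0})$ let $|{\rm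 Coh}(A)\rangle=W(A)|\Omega\rangle=e^{-\|A\|^2/2}\bigoplus_{m\ge0}(m!)^{-1/2}A^{\otimes m}$ be the coherent vectors. Consider the pure state models $$\mathbf Q(n)=\{|\Psi_{\exp_{V_0}(n^{-1/2}A)}(n)\rangle: A\in T^{\rm id}_{V_0},\ \|A\|\le Cn^\delta\},\qquad \mathbf G(n)=\{|{\rm Coh}(A)\rangle: A\in T^{\rm id}_{V_0},\ \|A\|\le Cn^\delta\},$$ and the extended models $$\widehat{\mathbf Q}(n)=\{|\Psi_{\exp_{V_0}(n^{-1/2}A)}(n)\rangle: A\in T_{V_0}(\mathscr V^{\rm irr}),\ \|A\|\le Cn^\delta\},\qquad \widehat{\mathbf G}(n)=\{|{\rm Coh}(A^{\rm id})\rangle: A\in T_{V_0}(\mathscr V^{\rm irr}),\ \|A\|\le Cn^\delta\}$$ (for the finitely many $n$ for which $\exp_{V_0}(n^{-1/2}A)$ may be undefined for some such $A$, the models are irrelevant). Let $\Delta$ be the Le Cam distance: $\Delta(\{\rho_\theta\},\{\sigma_\theta\})$ is the maximum of $\inf_{\mathcal T}\sup_\theta\|\mathcal T(\rho_\theta)-\sigma_\theta\|_1$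 and $\inf_{\mathcal S}\sup_\theta\|\mathcal S(\sigma_\theta)-\rho_\theta\|_1$, the infima being over quantum channels. Then: 1. If $\delta<(2(d_{\rm id}+3))^{-1}$, then $\lim_{n\to\infty}\Delta(\mathbf Q(n),\mathbf G(n))=0$. 2. If $\delta<(2(11+2d_{\rm id}))^{-1}$, then $\lim_{n\to\infty}n^{2\delta}\,\Delta(\mathbf Q(n),\mathbf G(n))=0$. 3. If $\delta<(2(d_{\rm id}+3))^{-1}$, then $\lim_{n\to\infty}\Delta(\widehat{\mathbf Q}(n),\widehat{\mathbf G}(n))=0$. -/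

import Mathlib

open Set Filter Topology MeasureTheory
open scoped ENNReal ContDiff Matrix Kronecker ComplexOrder InnerProductSpace

attribute [local instance] Matrix.normedAddCommGroup Matrix.normedSpace

noncomputable section

namespace QMC

/-! ### Trace norm, quantum channels, statistical deficiency and Le Cam distance -/

section Models

variable {H K : Type*}
  [NormedAddCommGroup H] [InnerProductSpace ℂ H] [CompleteSpace H]
  [NormedAddCommGroup K] [InnerProductSpace ℂ K] [CompleteSpace K]

/-- The trace norm `‖T‖₁ = Tr |T| ∈ [0, ∞]` of a bounded operator on a Hilbert space, in its
variational form: the supremum of `∑ i, |⟪e i, T (f i)⟫|` over all pairs of finite orthonormal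
families `e`, `f` of the same length. -/
def traceNorm (T : H →L[ℂ] H) : ℝ≥0∞ :=
  ⨆ (N : ℕ) (e : Fin N → H) (f : Fin N → H) (_ : Orthonormal ℂ e) (_ : Orthonormal ℂ f),
    ∑ i, ‖⟪e i, T (f i)⟫_ℂ‖ₑ

variable (H K) in
/-- A quantum channel between (separable) Hilbert spaces, given by a sequence of Kraus operators
`Kᵢ : H → K` with `∑ Kᵢ* Kᵢ = 1` in the strong operator topology. -/
structure QuantumChannel where
  kraus : ℕ → (H →L[ℂ] K)
  hasSum_kraus : ∀ x : H, HasSum (fun i => (kraus i).adjoint (kraus i x)) x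

/-- The action `ρ ↦ ∑ Kᵢ ρ Kᵢ*` of a channel on states (Schrödinger picture). -/
def QuantumChannel.apply (T : QuantumChannel H K) (ρ : H →L[ℂ] H) : K →L[ℂ] K :=
  ∑' i, T.kraus i ∘L ρ ∘L (T.kraus i).adjoint

/-- The deficiency `inf_T sup_θ ‖T(ρ_θ) - σ_θ‖₁` of the model `ρ` with respect to the model `σ`,
the infimum being over all channels. -/
def deficiency {Θ : Type*} (ρ : Θ → (H →L[ℂ] H)) (σ : Θ → (K →L[ℂ] K)) : ℝ≥0∞ :=
  ⨅ T : QuantumChannel H K, ⨆ θ : Θ, traceNorm (T.apply (ρ θ) - σ θ)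

/-- The Le Cam distance of two quantum statistical models with the same parameter set. -/
def leCam {Θ : Type*} (ρ : Θ → (H →L[ℂ] H)) (σ : Θ → (K →L[ℂ] K)) : ℝ≥0∞ :=
  max (deficiency ρ σ) (deficiency σ ρ)

/-- The rank one operator `|ψ⟩⟨ψ|`. -/
def pureState (ψ : H) : H →L[ℂ] H := InnerProductSpace.rankOne ℂ ψ ψ

end Models

/-! ### Symmetric Fock space and coherent vectors -/

theorem continuous_coord {I : Type*} (i : I) :
    Continuous fun f : lp (fun _ : I => ℂ) 2 => f i := by
  refine continuous_iff_continuousAt.2 fun f => ?_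
  refine tendsto_iff_norm_sub_tendsto_zero.2 ?_
  have h0 : Tendsto (fun g : lp (fun _ : I => ℂ) 2 => ‖g - f‖) (𝓝 f) (𝓝 0) :=
    tendsto_iff_norm_sub_tendsto_zero.1 tendsto_id
  refine squeeze_zero (fun g => norm_nonneg _) (fun g => ?_) h0
  have := lp.norm_apply_le_norm (p := 2) (by simp) (g - f) i
  simpa using this

section Fock

variable (X : Type*) [NormedAddCommGroup X] [InnerProductSpace ℂ X] [FiniteDimensional ℂ X]

/-- Basis labels of the full Fock space `⨁ n, X^{⊗ n}`: the label `⟨n, w⟩` stands for the product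
vector `b (w 0) ⊗ ⋯ ⊗ b (w (n - 1))`, where `b` is the standard orthonormal basis of `X`. -/
abbrev FockIndex : Type := Σ n : ℕ, (Fin n → Fin (Module.finrank ℂ X))

/-- The full Fock space `⨁ n, X^{⊗ n}`, in coordinates. -/
abbrev FullFock : Type := lp (fun _ : FockIndex X => ℂ) 2

/-- The subspace of those vectors of the full Fock space whose `n`-particle component is symmetric
under permutations of the `n` tensor factors, for every `n`. -/
def symmetricSubspace : Submodule ℂ (FullFock X) where
  carrier := {f | ∀ (n : ℕ) (τ : Equiv.Perm (Fin n)) (w : Fin n → Fin (Module.finrank ℂ X)),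
    f ⟨n, w ∘ τ⟩ = f ⟨n, w⟩}
  zero_mem' := by intro n τ w; rfl
  add_mem' := by
    intro f g hf hg n τ w
    simp [hf n τ w, hg n τ w]
  smul_mem' := by
    intro c f hf n τ w
    simp [hf n τ w]

/-- The symmetric Fock space `𝔥(X) = ℂΩ ⊕ ⨁ n ≥ 1, X^{⊗ₛ n}`. -/
abbrev Fock : Type := symmetricSubspace X

instance : CompleteSpace (Fock X) := by
  have hc : IsClosed (symmetricSubspace X : Set (FullFock X)) := by
    have : (symmetricSubspace X : Set (FullFock X)) =
        ⋂ (n : ℕ) (τ : Equiv.Perm (Fin n)) (w : Fin n → Fin (Module.finrank ℂ X)),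
          {f : FullFock X | f ⟨n, w ∘ τ⟩ = f ⟨n, w⟩} := by
      ext f
      simp only [mem_iInter]
      rfl
    rw [this]
    exact isClosed_iInter fun n => isClosed_iInter fun τ => isClosed_iInter fun w =>
      isClosed_eq (continuous_coord _) (continuous_coord _)
  exact hc.completeSpace_coe

variable {X}

/-- The coordinates of `⨁ n, (n!)^{-1/2} x^{⊗ n}`. -/
def expCoord (x : X) (i : FockIndex X) : ℂ :=
  ((Real.sqrt (Nat.factorial i.1))⁻¹ : ℝ) * ∏ j, (stdOrthonormalBasis ℂ X).repr x (i.2 j)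

theorem memℓp_expCoord (x : X) : Memℓp (expCoord x) 2 := by
  rw [memℓp_gen_iff (by norm_num)]
  have hterm : ∀ i : FockIndex X, ‖expCoord x i‖ ^ (2 : ℝ≥0∞).toReal =
      (Nat.factorial i.1 : ℝ)⁻¹ * ∏ j, ‖(stdOrthonormalBasis ℂ X).repr x (i.2 j)‖ ^ 2 := by
    intro i
    have h2 : (2 : ℝ≥0∞).toReal = ((2 : ℕ) : ℝ) := by norm_num
    rw [h2, Real.rpow_natCast, expCoord, norm_mul, mul_pow, norm_prod, Finset.prod_pow,
      Complex.norm_real, Real.norm_eq_abs, sq_abs, inv_pow, Real.sq_sqrt (by positivity)]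
  simp_rw [hterm]
  refine (summable_sigma_of_nonneg (fun i => by positivity)).2 ⟨fun n => ?_, ?_⟩
  · exact Summable.of_finite
  · have : ∀ n : ℕ, ∑' w : Fin n → Fin (Module.finrank ℂ X), (Nat.factorial n : ℝ)⁻¹ *
        ∏ j, ‖(stdOrthonormalBasis ℂ X).repr x (w j)‖ ^ 2 =
        (∑ a, ‖(stdOrthonormalBasis ℂ X).repr x a‖ ^ 2) ^ n / (Nat.factorial n : ℝ) := by
      intro n
      rw [tsum_fintype, ← Finset.mul_sum, Finset.sum_pow', ← Fintype.piFinset_univ, div_eq_inv_mul]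
    simp_rw [this]
    exact Real.summable_pow_div_factorial _

/-- The exponential vector `|e^x⟩ = ⨁ n, (n!)^{-1/2} x^{⊗ n}`. -/
def expVector (x : X) : Fock X :=
  ⟨⟨expCoord x, memℓp_expCoord x⟩, by
    intro n τ w
    change expCoord x ⟨n, w ∘ τ⟩ = expCoord x ⟨n, w⟩
    simp only [expCoord, Function.comp]
    congr 1
    exact Equiv.prod_comp τ (fun j => (stdOrthonormalBasis ℂ X).repr x (w j))⟩

/-- The coherent vector `|Coh(x)⟩ = W(x)Ω = e^{-‖x‖²/2} |e^x⟩`. -/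
def coherent (x : X) : Fock X := ((Real.exp (-‖x‖ ^ 2 / 2) : ℝ) : ℂ) • expVector x

end Fock

/-! ### Irreducible isometries and the system and output state -/

variable {d k : ℕ}

/-- Operators `ℂ^d → ℂ^d ⊗ ℂ^k`, as matrices. -/
abbrev Op (d k : ℕ) : Type := Matrix (Fin d × Fin k) (Fin d) ℂ

/-- The Kraus operators of `V`: `V ψ = ∑ i, Kᵢ ψ ⊗ |i⟩`. -/
def kraus (V : Op d k) (i : Fin k) : Matrix (Fin d) (Fin d) ℂ := Matrix.of fun a b => V (a, i) b

/-- The channel `ρ ↦ ∑ i, Kᵢ ρ Kᵢ*` of `V` in the Schrödinger picture. -/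
def schrodinger (V : Op d k) (ρ : Matrix (Fin d) (Fin d) ℂ) : Matrix (Fin d) (Fin d) ℂ :=
  ∑ i, kraus V i * ρ * (kraus V i)ᴴ

/-- `X ⊗ 1` on `ℂ^d ⊗ ℂ^k`. -/
def ampliate (k : ℕ) (X : Matrix (Fin d) (Fin d) ℂ) : Matrix (Fin d × Fin k) (Fin d × Fin k) ℂ :=
  X ⊗ₖ (1 : Matrix (Fin k) (Fin k) ℂ)

/-- The dual map `X ↦ V* (X ⊗ 1) V` in the Heisenberg picture. -/
def heisenberg (V : Op d k) (X : Matrix (Fin d) (Fin d) ℂ) : Matrix (Fin d) (Fin d) ℂ :=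
  Vᴴ * ampliate k X * V

/-- `ρ` is a faithful state which is invariant under the channel of `V`. -/
def IsFaithfulStationary (V : Op d k) (ρ : Matrix (Fin d) (Fin d) ℂ) : Prop :=
  ρ.PosDef ∧ ρ.trace = 1 ∧ schrodinger V ρ = ρ

/-- The set of isometries whose channel is irreducible, i.e. has a unique faithful invariant
state. -/
def irreducibleIsometries (d k : ℕ) : Set (Op d k) :=
  {V | Vᴴ * V = 1 ∧ ∃! ρ, IsFaithfulStationary V ρ}

/-- The stationary state of an irreducible isometry. -/
def stationaryState (V : irreducibleIsometries d k) : Matrix (Fin d) (Fin d) ℂ :=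
  V.2.2.choose

theorem stationaryState_spec (V : irreducibleIsometries d k) :
    IsFaithfulStationary V.1 (stationaryState V) := V.2.2.choose_spec.1

/-- `K_{i_n} ⋯ K_{i_1}`. -/
def krausWord (V : Op d k) : (n : ℕ) → (Fin n → Fin k) → Matrix (Fin d) (Fin d) ℂ
  | 0, _ => 1
  | n + 1, i => kraus V (i (Fin.last n)) * krausWord V n (fun j => i j.castSucc)

/-- The system and output vector
`|Ψ_V(n)⟩ = ∑_{i₁, …, iₙ} K_{iₙ} ⋯ K_{i₁} φ ⊗ |i₁⟩ ⊗ ⋯ ⊗ |iₙ⟩ ∈ ℂ^d ⊗ (ℂ^k)^{⊗ n}`,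
for the initial system vector `φ`. -/
def systemOutput (φ : EuclideanSpace ℂ (Fin d)) (n : ℕ) (V : Op d k) :
    EuclideanSpace ℂ (Fin d × (Fin n → Fin k)) :=
  WithLp.toLp 2 fun p => (krausWord V n p.2 *ᵥ WithLp.ofLp φ) p.1

/-! ### Tangent spaces and identifiable directions

A tangent vector at `V` is represented by the operator `L` for which `V + i s L`, `s` small, is an
isometry to first order, so that the velocity of a curve with tangent vector `L` is `i L`. -/

/-- The tangent space `{L | L* V - V* L = 0}` of the manifold of isometries. -/
def tangentSpace (V : irreducibleIsometries d k) : Set (Op d k) :=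
  {L | Lᴴ * V.1 - V.1ᴴ * L = 0}

/-- The infinitesimal gauge action `(θ, K) ↦ θ V - (K ⊗ 1) V + V K`. -/
def gaugeTangent (V : irreducibleIsometries d k) (θ : ℂ) (K : Matrix (Fin d) (Fin d) ℂ) :
    Op d k :=
  θ • V.1 - ampliate k K * V.1 + V.1 * K

/-- The non-identifiable directions: tangent vectors to the orbit of `V` under the gauge group. -/
def nonidTangent (V : irreducibleIsometries d k) : Set (Op d k) :=
  {L | ∃ (θ : ℝ) (K : Matrix (Fin d) (Fin d) ℂ), K.IsHermitian ∧
    (stationaryState V * K).trace = 0 ∧ L = gaugeTangent V (θ : ℂ) K}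

/-- `M_V(A) = Tr (ρ V* A)`. -/
def meanPart (V : irreducibleIsometries d k) (A : Op d k) : ℂ :=
  (stationaryState V * (V.1ᴴ * A)).trace

/-- `C_V(A) = (Id - 𝒯_V)⁻¹ (V* A - M_V(A) 1)`, where the inverse is taken on the subspace
`{X | Tr (ρ X) = 0}`, on which `Id - 𝒯_V` is bijective. -/
def gaugePart (V : irreducibleIsometries d k) (A : Op d k) : Matrix (Fin d) (Fin d) ℂ :=
  Classical.epsilon fun X => (stationaryState V * X).trace = 0 ∧
    X - heisenberg V.1 X = V.1ᴴ * A - meanPart V A • (1 : Matrix (Fin d) (Fin d) ℂ)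

/-- The projection `P_V` of a tangent vector to its identifiable component. -/
def idProj (V : irreducibleIsometries d k) (A : Op d k) : Op d k :=
  A - gaugeTangent V (meanPart V A) (gaugePart V A)

/-- The identifiable directions, i.e. the range of `P_V`. -/
def idTangent (V : irreducibleIsometries d k) : Set (Op d k) :=
  idProj V '' tangentSpace V

/-- The real dimension `2 d² (k - 1)` of the space of identifiable directions. -/
def dId (d k : ℕ) : ℝ := 2 * (d : ℝ) ^ 2 * ((k : ℝ) - 1)

/-! ### The space of modes -/

/-- The complex vector space of operators from `ℂ^d` to the orthogonal complement `R(V)ᗮ` of the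
range of `V`. -/
def lowerBlock (V : irreducibleIsometries d k) : Submodule ℂ (Op d k) where
  carrier := {A | V.1ᴴ * A = 0}
  zero_mem' := by simp
  add_mem' := by
    intro A B hA hB
    have hA' : V.1ᴴ * A = 0 := hA
    have hB' : V.1ᴴ * B = 0 := hB
    change V.1ᴴ * (A + B) = 0
    rw [Matrix.mul_add, hA', hB', add_zero]
  smul_mem' := by
    intro c A hA
    have hA' : V.1ᴴ * A = 0 := hA
    change V.1ᴴ * (c • A) = 0
    rw [Matrix.mul_smul, hA', smul_zero]

/-- The space of modes: `L^∞(ℂ^d, R(V)ᗮ)` with the inner product `(A, B)_V = Tr (ρ A* B)`. -/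
def ModeSpace (V : irreducibleIsometries d k) : Type := lowerBlock V

instance (V : irreducibleIsometries d k) : AddCommGroup (ModeSpace V) :=
  inferInstanceAs (AddCommGroup (lowerBlock V))

instance (V : irreducibleIsometries d k) : Module ℂ (ModeSpace V) :=
  inferInstanceAs (Module ℂ (lowerBlock V))

instance (V : irreducibleIsometries d k) : FiniteDimensional ℂ (ModeSpace V) :=
  inferInstanceAs (FiniteDimensional ℂ (lowerBlock V))

theorem trace_mul_conjTranspose_mul_self {ρ : Matrix (Fin d) (Fin d) ℂ} (A : Op d k) :
    (ρ * (Aᴴ * A)).trace = (A * ρ * Aᴴ).trace := by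
  rw [← Matrix.mul_assoc, Matrix.trace_mul_comm, Matrix.mul_assoc]

/-- The inner product `(A, B)_V = Tr (ρ A* B)`. -/
@[reducible]
def modeCore (V : irreducibleIsometries d k) : InnerProductSpace.Core ℂ (ModeSpace V) where
  inner A B := (stationaryState V * ((A.1 : Op d k)ᴴ * (B.1 : Op d k))).trace
  conj_inner_symm A B := by
    have hρ := (stationaryState_spec V).1.isHermitian
    change star _ = _
    rw [← Matrix.trace_conjTranspose, Matrix.conjTranspose_mul, Matrix.conjTranspose_mul,
      Matrix.conjTranspose_conjTranspose, hρ.eq, Matrix.trace_mul_comm]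
  re_inner_nonneg A := by
    have hρ := (stationaryState_spec V).1.posSemidef
    rw [trace_mul_conjTranspose_mul_self]
    exact (Complex.le_def.1 (hρ.mul_mul_conjTranspose_same A.1).trace_nonneg).1
  add_left A B D := by
    change (stationaryState V * ((A.1 + B.1 : Op d k)ᴴ * (D.1 : Op d k))).trace = _
    rw [Matrix.conjTranspose_add, Matrix.add_mul, Matrix.mul_add, Matrix.trace_add]
  smul_left A B c := by
    change (stationaryState V * ((c • A.1 : Op d k)ᴴ * (B.1 : Op d k))).trace = _
    rw [Matrix.conjTranspose_smul, Matrix.smul_mul, Matrix.mul_smul, Matrix.trace_smul]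
    rfl
  definite A hA := by
    have hρ := (stationaryState_spec V).1
    rw [trace_mul_conjTranspose_mul_self] at hA
    have h0 : A.1 * stationaryState V * (A.1 : Op d k)ᴴ = 0 :=
      (hρ.posSemidef.mul_mul_conjTranspose_same A.1).trace_eq_zero_iff.1 hA
    have hrow : ∀ a, star ((A.1 : Op d k) a) = 0 := by
      intro a
      by_contra hne
      have hpos := hρ.dotProduct_mulVec_pos hne
      have haa : (A.1 * stationaryState V * (A.1 : Op d k)ᴴ) a a = 0 := by rw [h0]; rfl
      rw [Matrix.mul_assoc] at haa
      rw [star_star] at hpos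
      have : (A.1 : Op d k) a ⬝ᵥ (stationaryState V *ᵥ star ((A.1 : Op d k) a)) = 0 := haa
      rw [this] at hpos
      exact lt_irrefl _ hpos
    refine Subtype.ext (Matrix.ext fun a b => ?_)
    have := congrFun (hrow a) b
    exact star_eq_zero.1 this

instance (V : irreducibleIsometries d k) : NormedAddCommGroup (ModeSpace V) :=
  (modeCore V).toNormedAddCommGroup

instance (V : irreducibleIsometries d k) : InnerProductSpace ℂ (ModeSpace V) :=
  InnerProductSpace.ofCore (modeCore V).toCore

/-- The lower block `A ↦ (1 - V V*) A`. On identifiable directions this is the identification of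
the real space `idTangent V` with `ModeSpace V`. -/
def toMode (V : irreducibleIsometries d k) (A : Op d k) : ModeSpace V :=
  ⟨A - V.1 * (V.1ᴴ * A), by
    change V.1ᴴ * (A - V.1 * (V.1ᴴ * A)) = 0
    rw [Matrix.mul_sub, ← Matrix.mul_assoc V.1ᴴ V.1, V.2.1, Matrix.one_mul, sub_self]⟩

/-! ### Riemannian metrics and the exponential map -/

/-- The action `V ↦ c̄ (W ⊗ 1) V W*` of the gauge group. It is the restriction of a linear map, so
the same formula gives its differential. -/
def gaugeAction (c : ℂ) (W : Matrix (Fin d) (Fin d) ℂ) (A : Op d k) : Op d k :=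
  (starRingEnd ℂ c) • (ampliate k W * A * Wᴴ)

/-- A gauge invariant Riemannian metric on the manifold of irreducible isometries for which
identifiable and non-identifiable directions are orthogonal, and which is given by `Tr (ρ A* A)` on
identifiable directions. A smooth metric on this submanifold of the vector space `Op d k` is
represented by a smooth family of bilinear forms on `Op d k`, of which only the values at tangent
vectors are relevant. -/
structure GaugeMetric (d k : ℕ) where
  form : Op d k → LinearMap.BilinForm ℝ (Op d k)
  smooth : ∀ A B : Op d k, ContDiffOn ℝ ∞ (fun V => form V A B) (irreducibleIsometries d k)
  symm : ∀ V : irreducibleIsometries d k, ∀ A ∈ tangentSpace V, ∀ B ∈ tangentSpace V,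
    form V A B = form V B A
  pos : ∀ V : irreducibleIsometries d k, ∀ A ∈ tangentSpace V, A ≠ 0 → 0 < form V A A
  invariant : ∀ (V V' : irreducibleIsometries d k) (c : ℂ),
    ∀ W ∈ Matrix.unitaryGroup (Fin d) ℂ, ‖c‖ = 1 → V'.1 = gaugeAction c W V.1 →
    ∀ A ∈ tangentSpace V, ∀ B ∈ tangentSpace V,
      form V' (gaugeAction c W A) (gaugeAction c W B) = form V A B
  orthogonal : ∀ V : irreducibleIsometries d k, ∀ A ∈ idTangent V, ∀ B ∈ nonidTangent V,
    form V A B = 0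
  on_idTangent : ∀ V : irreducibleIsometries d k, ∀ A ∈ idTangent V,
    form V A A = (stationaryState V * (Aᴴ * A)).trace.re

/-- The tangent vector `L` of a curve, with `γ' = i L`. -/
def velocity (γ : ℝ → Op d k) (t : ℝ) : Op d k := (-Complex.I) • deriv γ t

/-- The energy `½ ∫₀¹ ν(γ', γ') dt` of a curve. -/
def energy (ν : GaugeMetric d k) (γ : ℝ → Op d k) : ℝ :=
  (1 / 2) * ∫ t in (0 : ℝ)..1, ν.form (γ t) (velocity γ t) (velocity γ t)

/-- Geodesics `[0, 1] → 𝒱^irr`: smooth curves that are critical points of the energy with respect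
to smooth variations with fixed end points. -/
structure IsGeodesic (ν : GaugeMetric d k) (γ : ℝ → Op d k) : Prop where
  smooth : ContDiffOn ℝ ∞ γ (Icc 0 1)
  mem : ∀ t ∈ Icc (0 : ℝ) 1, γ t ∈ irreducibleIsometries d k
  critical : ∀ Γ : ℝ → ℝ → Op d k,
    ContDiffOn ℝ ∞ (fun p : ℝ × ℝ => Γ p.1 p.2) (univ ×ˢ Icc 0 1) →
    (∀ s, ∀ t ∈ Icc (0 : ℝ) 1, Γ s t ∈ irreducibleIsometries d k) →
    (∀ t ∈ Icc (0 : ℝ) 1, Γ 0 t = γ t) →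
    (∀ s, Γ s 0 = γ 0) → (∀ s, Γ s 1 = γ 1) →
    HasDerivAt (fun s => energy ν (Γ s)) 0 0

open Classical in
/-- The Riemannian exponential map at `V`: the end point of the geodesic on `[0, 1]` which starts
at `V` with tangent vector `A`, that is with velocity `i A` (and `0` if there is none). -/
def riemannianExp (ν : GaugeMetric d k) (V : irreducibleIsometries d k) (A : Op d k) : Op d k :=
  if h : ∃ γ : ℝ → Op d k, IsGeodesic ν γ ∧ γ 0 = V.1 ∧
      derivWithin γ (Icc 0 1) 0 = Complex.I • A
  then h.choose 1 else 0

/-! ### The local models -/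

/-- The ball of radius `r` in the tangent space at `V`. -/
def tangentBall (ν : GaugeMetric d k) (V : irreducibleIsometries d k) (r : ℝ) : Set (Op d k) :=
  {A | A ∈ tangentSpace V ∧ Real.sqrt (ν.form V A A) ≤ r}

/-- The ball of radius `r` in the space of identifiable directions. -/
def idBall (ν : GaugeMetric d k) (V : irreducibleIsometries d k) (r : ℝ) : Set (Op d k) :=
  tangentBall ν V r ∩ idTangent V

/-- The system and output state after `n` steps at the local parameter `A`. -/
def localState (ν : GaugeMetric d k) (V : irreducibleIsometries d k)
    (φ : EuclideanSpace ℂ (Fin d)) (n : ℕ) (A : Op d k) :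
    EuclideanSpace ℂ (Fin d × (Fin n → Fin k)) →L[ℂ]
      EuclideanSpace ℂ (Fin d × (Fin n → Fin k)) :=
  pureState (systemOutput φ n (riemannianExp ν V ((Real.sqrt n)⁻¹ • A)))

/-- The coherent state `|Coh(A)⟩⟨Coh(A)|` of an identifiable direction `A`. -/
def gaussianState (V : irreducibleIsometries d k) (A : Op d k) :
    Fock (ModeSpace V) →L[ℂ] Fock (ModeSpace V) :=
  pureState (coherent (toMode V A))

/-- The Le Cam distance between the local system and output model and the Gaussian shift model,
over the identifiable directions of norm at most `r`. -/
def idDistance (ν : GaugeMetric d k) (V : irreducibleIsometries d k)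
    (φ : EuclideanSpace ℂ (Fin d)) (n : ℕ) (r : ℝ) : ℝ≥0∞ :=
  leCam (fun A : idBall ν V r => localState ν V φ n A)
    (fun A : idBall ν V r => gaussianState V A)

/-- The Le Cam distance between the extended models, over all tangent vectors of norm at most `r`:
the limit state only depends on the identifiable component of the tangent vector. -/
def extendedDistance (ν : GaugeMetric d k) (V : irreducibleIsometries d k)
    (φ : EuclideanSpace ℂ (Fin d)) (n : ℕ) (r : ℝ) : ℝ≥0∞ :=
  leCam (fun A : tangentBall ν V r => localState ν V φ n A)
    (fun A : tangentBall ν V r => gaussianState V (idProj V A))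

end QMC

end

/-! All states involved are pure, so the Le Cam distance is controlled by Gram kernels. Let `N` be
the complex dimension of the mode space, so that `2 N = dId d k`. Suppose that vectors `Ψ v`, for
`v` in a cube of half-width `R` in the `2 N` real coordinates, have overlaps within `ε` of those of
the coherent vectors `c v`. Coherent vectors resolve the identity, `π^{-N} ∫ |c v⟩⟨c v| dv = 1` on
their closed span. Hence `π^{-N} ∫ |Ψ v⟩⟨c v| dv` over the cube sends `c x` nearly to `Ψ x` for `x`
well inside, and its squared norm is at most `1 + ε (2R)^{2N} / π^N`. Rescaled to a contraction `S`,
it and its adjoint are both completed to channels by sending the lost weight to a fixed state. One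
lower bound on `Re ⟨ψ, S c x⟩` serves both deficiencies (`leCam_pureState_coherent_le`).

The overlap of two output states is `⟨φ, T^n(1) φ⟩` for the mixed transfer operator `T X = V* (X ⊗
1) V'`. For isometries within `τ` of `V₀`, with first order part in the modes, `T 1 = 1 + M` with `M
= O(τ²)`. Let `m = Tr(ρ M)` and let `N` now be the solution of the Poisson equation `N - T₀ N = M -
m`; it exists because the stationary state is unique. Then `T (1 + N) = (1 + m)(1 + N) + O(τ³)`, and
since all overlaps are bounded uniformly in `n`, the overlap is `exp(n m)` up to `O(τ + n τ³)`. The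
isometry constraint turns `n m` into the exponent of the Gaussian kernel plus a difference of
phases, which is absorbed in the choice of the vectors (`exists_norm_overlap_sub_gaussKernel_le`).

A general tangent vector differs from its identifiable component by an infinitesimal gauge
transformation. A genuine gauge transformation, with a Cayley transform as unitary, moves the
isometry into the identifiable direction up to second order. Along the output it telescopes to a
phase and two boundary terms of size `O(τ)` (`exists_gaugeAction_near`, `overlap_gaugeAction`).
Therefore the extended model obeys the same bound, and the identifiable model is a restriction of
it.

Of the exponential map only `exp A = V₀ + i A + O(|A|²)` is needed
(`exists_norm_riemannianExp_sub_le`). In a Cayley chart geodesics are the extremals of a Lagrangian.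
They exist for small initial velocity by Picard-Lindelöf, and every critical curve with small
initial velocity is nearly straight, because the force is quadratic in the velocity.

With `τ` of order `n^(δ - 1/2)` and `R` of order `n^δ`, the error `ε` is of order `n^(3δ - 1/2)` and
the squared Le Cam bound of order `n^((dId + 3) δ - 1/2)`, apart from a Gaussian tail. This gives
the exponents. -/

noncomputable section

namespace QMC

/-! ### Trace norm estimates for operators of rank one. -/

section TraceNorm

variable {H K : Type*} [NormedAddCommGroup H] [InnerProductSpace ℂ H]
  [NormedAddCommGroup K] [InnerProductSpace ℂ K]

theorem traceNorm_add_le (S T : H →L[ℂ] H) : traceNorm (S + T) ≤ traceNorm S + traceNorm T := by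
  unfold traceNorm
  refine iSup_le fun N => iSup_le fun e => iSup_le fun f => iSup_le fun he => iSup_le fun hf => ?_
  calc ∑ i, ‖⟪e i, (S + T) (f i)⟫_ℂ‖ₑ
      ≤ ∑ i, (‖⟪e i, S (f i)⟫_ℂ‖ₑ + ‖⟪e i, T (f i)⟫_ℂ‖ₑ) := by
        refine Finset.sum_le_sum fun i _ => ?_
        rw [_root_.add_apply, inner_add_right]
        exact enorm_add_le _ _
    _ = ∑ i, ‖⟪e i, S (f i)⟫_ℂ‖ₑ + ∑ i, ‖⟪e i, T (f i)⟫_ℂ‖ₑ := Finset.sum_add_distrib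
    _ ≤ _ := by
        gcongr
        · exact le_iSup_of_le N <| le_iSup_of_le e <| le_iSup_of_le f <| le_iSup_of_le he <|
            le_iSup_of_le hf le_rfl
        · exact le_iSup_of_le N <| le_iSup_of_le e <| le_iSup_of_le f <| le_iSup_of_le he <|
            le_iSup_of_le hf le_rfl

/-- Cauchy-Schwarz over the index of the two orthonormal families, followed by Bessel's inequality
for each of them. -/
theorem traceNorm_rankOne_le (x y : H) :
    traceNorm (InnerProductSpace.rankOne ℂ x y) ≤ ENNReal.ofReal (‖x‖ * ‖y‖) := by
  unfold traceNorm
  refine iSup_le fun N => iSup_le fun e => iSup_le fun f => iSup_le fun he => iSup_le fun hf => ?_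
  have h1 : ∀ i, ‖⟪e i, InnerProductSpace.rankOne ℂ x y (f i)⟫_ℂ‖ₑ =
      ENNReal.ofReal (‖⟪f i, y⟫_ℂ‖ * ‖⟪e i, x⟫_ℂ‖) := by
    intro i
    rw [InnerProductSpace.rankOne_apply, inner_smul_right, ← ofReal_norm, norm_mul,
      norm_inner_symm y]
  simp_rw [h1]
  rw [← ENNReal.ofReal_sum_of_nonneg (fun i _ => by positivity)]
  refine ENNReal.ofReal_le_ofReal ?_
  have hx := he.sum_inner_products_le x (s := Finset.univ)
  have hy := hf.sum_inner_products_le y (s := Finset.univ)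
  have hcs := Finset.sum_mul_sq_le_sq_mul_sq Finset.univ (fun i => ‖⟪f i, y⟫_ℂ‖)
    (fun i => ‖⟪e i, x⟫_ℂ‖)
  refine le_of_sq_le_sq ?_ (by positivity)
  calc _ ≤ _ := hcs
    _ ≤ ‖y‖ ^ 2 * ‖x‖ ^ 2 := by gcongr
    _ = _ := by ring

theorem traceNorm_pureState_sub_le (x y : H) :
    traceNorm (pureState x - pureState y) ≤ ENNReal.ofReal (‖x - y‖ * (‖x‖ + ‖y‖)) := by
  have h : pureState x - pureState y =
      InnerProductSpace.rankOne ℂ (x - y) x + InnerProductSpace.rankOne ℂ y (x - y) := by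
    ext z
    simp only [pureState, _root_.sub_apply, _root_.add_apply,
      InnerProductSpace.rankOne_apply, inner_sub_left, sub_smul, smul_sub]
    abel
  rw [h]
  refine (traceNorm_add_le _ _).trans ?_
  calc _ ≤ ENNReal.ofReal (‖x - y‖ * ‖x‖) + ENNReal.ofReal (‖y‖ * ‖x - y‖) :=
        add_le_add (traceNorm_rankOne_le _ _) (traceNorm_rankOne_le _ _)
    _ = _ := by
        rw [← ENNReal.ofReal_add (by positivity) (by positivity)]
        congr 1; ring

/-- Makes a nonnegative multiple of a pure state again of rank one form, so that the bound for such
operators applies to it. -/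
theorem smul_pureState (c : ℝ) (hc : 0 ≤ c) (e : H) :
    (c : ℂ) • pureState e = pureState ((Real.sqrt c : ℂ) • e) := by
  ext z
  simp only [pureState, _root_.smul_apply, InnerProductSpace.rankOne_apply,
    inner_smul_left, smul_smul, Complex.conj_ofReal]
  congr 1
  rw [mul_right_comm, ← Complex.ofReal_mul, Real.mul_self_sqrt hc]

theorem traceNorm_smul_pureState_le (c : ℝ) (hc : 0 ≤ c) (e : H) :
    traceNorm ((c : ℂ) • pureState e) ≤ ENNReal.ofReal (c * ‖e‖ ^ 2) := by
  rw [smul_pureState c hc]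
  refine (traceNorm_rankOne_le _ _).trans (le_of_eq ?_)
  rw [norm_smul, Complex.norm_real, Real.norm_of_nonneg (Real.sqrt_nonneg _)]
  congr 1
  nlinarith [Real.mul_self_sqrt hc]

/-- A unit scalar does not change a pure state. -/
theorem pureState_smul {c : ℂ} (hc : ‖c‖ = 1) (x : H) : pureState (c • x) = pureState x := by
  ext z
  simp only [pureState, InnerProductSpace.rankOne_apply, inner_smul_left, smul_smul]
  congr 1
  rw [mul_comm, ← mul_assoc, Complex.mul_conj, Complex.normSq_eq_norm_sq, hc]
  simp

theorem comp_pureState_comp_adjoint [CompleteSpace H] [CompleteSpace K] (S : H →L[ℂ] K) (x : H) :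
    S ∘L pureState x ∘L S.adjoint = pureState (S x) := by
  ext z
  simp [pureState, ContinuousLinearMap.adjoint_inner_right]

end TraceNorm

/-! ### Completing a contraction to a quantum channel. -/

section Completion

variable {H K : Type*}
  [NormedAddCommGroup H] [InnerProductSpace ℂ H] [CompleteSpace H]
  [NormedAddCommGroup K] [InnerProductSpace ℂ K] [CompleteSpace K]

/-- A positive defect operator `Q` of a contraction `S`, with `Q² = 1 - S* S`. -/
theorem exists_defect (S : H →L[ℂ] K) (hS : ‖S‖ ≤ 1) :
    ∃ Q : H →L[ℂ] H, (∀ x y, ⟪Q x, y⟫_ℂ = ⟪x, Q y⟫_ℂ) ∧ ∀ x, Q (Q x) = x - S.adjoint (S x) := by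
  have hpos : (0 : H →L[ℂ] H) ≤ 1 - S.adjoint ∘L S := by
    rw [ContinuousLinearMap.nonneg_iff_isPositive, ContinuousLinearMap.isPositive_def']
    refine ⟨?_, fun x => ?_⟩
    · rw [IsSelfAdjoint, star_sub, star_one, ContinuousLinearMap.star_eq_adjoint,
        ContinuousLinearMap.adjoint_comp, ContinuousLinearMap.adjoint_adjoint]
    · rw [ContinuousLinearMap.reApplyInnerSelf_apply]
      simp only [_root_.sub_apply, one_apply_eq_self,
        ContinuousLinearMap.comp_apply, inner_sub_left, ContinuousLinearMap.adjoint_inner_left,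
        map_sub]
      rw [← norm_sq_eq_re_inner, ← norm_sq_eq_re_inner (S x), sub_nonneg]
      have := S.le_of_opNorm_le hS x
      gcongr
      simpa using this
  refine ⟨CFC.sqrt (1 - S.adjoint ∘L S), fun x y => ?_, fun x => ?_⟩
  · have h : IsSelfAdjoint (CFC.sqrt (1 - S.adjoint ∘L S)) :=
      (CFC.sqrt_nonneg _).isSelfAdjoint
    conv_lhs => rw [← h.adjoint_eq]
    rw [ContinuousLinearMap.adjoint_inner_left]
  · have h := CFC.sqrt_mul_sqrt_self (1 - S.adjoint ∘L S) hpos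
    have := congrArg (fun T : H →L[ℂ] H => T x) h
    simpa using this

/-- A sequence which resolves the identity. -/
def IsParseval (g : ℕ → H) : Prop := ∀ x : H, HasSum (fun i => ⟪g i, x⟫_ℂ • g i) x

/-- The weight that `S` loses is sent to the fixed state `e`. The Kraus operators `|e⟩⟨Q (g j)|`
contribute `∑ |Q (g j)⟩⟨Q (g j)| = Q² = 1 - S* S`, which is exactly what is missing for trace
preservation. -/
theorem exists_channel_of_contraction {g : ℕ → H} (hg : IsParseval g) (S : H →L[ℂ] K)
    (hS : ‖S‖ ≤ 1) (e : K) (he : ‖e‖ = 1) :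
    ∃ T : QuantumChannel H K, ∀ ψ : H, T.apply (pureState ψ) =
      pureState (S ψ) + ((‖ψ‖ ^ 2 - ‖S ψ‖ ^ 2 : ℝ) : ℂ) • pureState e := by
  obtain ⟨Q, hQ, hQ2⟩ := exists_defect S hS
  -- Index `0` carries `S` itself; the index `j + 1` carries the `j`-th vector of the resolution of
  -- the identity.
  let κ : ℕ → (H →L[ℂ] K) := fun i => Nat.casesOn i S
    (fun j => InnerProductSpace.rankOne ℂ e (Q (g j)))
  have hκ : ∀ j, κ (j + 1) = InnerProductSpace.rankOne ℂ e (Q (g j)) := fun j => rfl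
  have hee : ⟪e, e⟫_ℂ = 1 := by rw [inner_self_eq_norm_sq_to_K, he]; simp
  have hsum : ∀ x : H, HasSum (fun i => (κ i).adjoint (κ i x)) x := by
    intro x
    rw [← hasSum_nat_add_iff' 1]
    have h1 : x - ∑ i ∈ Finset.range 1, (κ i).adjoint (κ i x) = Q (Q x) := by
      rw [hQ2, Finset.sum_range_one]; rfl
    rw [h1]
    convert! Q.hasSum (hg (Q x)) using 2 with j
    rw [hκ, InnerProductSpace.adjoint_rankOne, InnerProductSpace.rankOne_apply,
      InnerProductSpace.rankOne_apply, inner_smul_right, hee, mul_one, map_smul, hQ]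
  refine ⟨⟨κ, hsum⟩, fun ψ => ?_⟩
  have hn : HasSum (fun j => ((‖⟪g j, Q ψ⟫_ℂ‖ ^ 2 : ℝ) : ℂ)) (((‖ψ‖ ^ 2 - ‖S ψ‖ ^ 2 : ℝ)) : ℂ) := by
    have h := (innerSL ℂ (Q ψ)).hasSum (hg (Q ψ))
    have h2 : innerSL ℂ (Q ψ) (Q ψ) = ((‖ψ‖ ^ 2 - ‖S ψ‖ ^ 2 : ℝ) : ℂ) := by
      rw [innerSL_apply_apply, hQ, hQ2, inner_sub_right, ContinuousLinearMap.adjoint_inner_right,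
        inner_self_eq_norm_sq_to_K, inner_self_eq_norm_sq_to_K]
      push_cast; rfl
    rw [h2] at h
    convert! h using 2 with j
    rw [map_smul, innerSL_apply_apply, smul_eq_mul, ← inner_conj_symm (Q ψ) (g j), Complex.mul_conj,
      Complex.normSq_eq_norm_sq]
  unfold QuantumChannel.apply
  refine HasSum.tsum_eq ?_
  rw [← hasSum_nat_add_iff' 1, Finset.sum_range_one]
  have h0 : κ 0 ∘L pureState ψ ∘L (κ 0).adjoint = pureState (S ψ) :=
    comp_pureState_comp_adjoint S ψ
  simp only [h0, add_sub_cancel_left]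
  convert! hn.smul_const (pureState e) using 2 with j
  rw [comp_pureState_comp_adjoint, hκ, InnerProductSpace.rankOne_apply, hQ]
  ext z
  simp only [pureState, _root_.smul_apply, InnerProductSpace.rankOne_apply,
    inner_smul_left, smul_smul]
  congr 1
  rw [← Complex.normSq_eq_norm_sq, ← Complex.mul_conj]
  ring

/-- The trace norm error of the channel that completes a contraction, on pure states. -/
theorem exists_channel_traceNorm_le {g : ℕ → H} (hg : IsParseval g) (S : H →L[ℂ] K)
    (hS : ‖S‖ ≤ 1) (e : K) (he : ‖e‖ = 1) :
    ∃ T : QuantumChannel H K, ∀ (ψ : H) (χ : K) (η : ℝ), ‖ψ‖ = 1 → ‖χ‖ = 1 → ‖S ψ - χ‖ ≤ η →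
      traceNorm (T.apply (pureState ψ) - pureState χ) ≤ ENNReal.ofReal (4 * η) := by
  obtain ⟨T, hT⟩ := exists_channel_of_contraction hg S hS e he
  refine ⟨T, fun ψ χ η hψ hχ hη => ?_⟩
  have hη0 : 0 ≤ η := (norm_nonneg _).trans hη
  have hSψ : ‖S ψ‖ ≤ 1 := by simpa [hψ] using S.le_of_opNorm_le hS ψ
  have hlow : 1 - ‖S ψ‖ ≤ η := by
    have := norm_sub_norm_le χ (S ψ)
    rw [norm_sub_rev] at this
    linarith
  rw [hT, add_sub_right_comm]
  refine (traceNorm_add_le _ _).trans ?_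
  refine (add_le_add (traceNorm_pureState_sub_le _ _)
    (traceNorm_smul_pureState_le _ (by nlinarith [norm_nonneg (S ψ)]) _)).trans ?_
  rw [← ENNReal.ofReal_add (by positivity)
    (mul_nonneg (by nlinarith [norm_nonneg (S ψ)]) (by positivity))]
  refine ENNReal.ofReal_le_ofReal ?_
  rw [hψ, hχ, he]
  -- The constant `4` is `2 + 2`: this term, and the dumped weight `1 - ‖S ψ‖² ≤ 2 (1 - ‖S ψ‖) ≤ 2
  -- η`.
  have h1 : ‖S ψ - χ‖ * (‖S ψ‖ + 1) ≤ η * 2 := by gcongr; linarith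
  nlinarith [norm_nonneg (S ψ)]

end Completion

/-! ### Resolutions of the identity indexed by the natural numbers. -/

section Parseval

variable {H : Type*} [NormedAddCommGroup H] [InnerProductSpace ℂ H]

/-- Padding by zero vectors is harmless, so finite and infinite dimensional spaces share the index
set of Kraus operators. -/
theorem exists_isParseval_of_countable {ι : Type*} [Countable ι] (b : ι → H)
    (hb : ∀ x : H, HasSum (fun i => ⟪b i, x⟫_ℂ • b i) x) : ∃ g : ℕ → H, IsParseval g := by
  obtain ⟨f, hf⟩ := exists_injective_nat ι
  refine ⟨Function.extend f b 0, fun x => ?_⟩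
  rw [← hf.hasSum_iff]
  · convert! hb x using 2 with i
    simp [hf.extend_apply]
  · intro i hi
    rw [Function.extend_apply' _ _ _ (by simpa using hi)]
    simp

theorem exists_isParseval_of_finiteDimensional [FiniteDimensional ℂ H] :
    ∃ g : ℕ → H, IsParseval g := by
  refine exists_isParseval_of_countable (stdOrthonormalBasis ℂ H) fun x => ?_
  have h := hasSum_fintype fun i => ⟪stdOrthonormalBasis ℂ H i, x⟫_ℂ • stdOrthonormalBasis ℂ H i
  rwa [(stdOrthonormalBasis ℂ H).sum_repr' x] at h

variable (X : Type*) [NormedAddCommGroup X] [InnerProductSpace ℂ X]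

/-- The orthogonal projection of an orthonormal basis to a closed subspace still resolves the
identity there. No occupation number basis of the symmetric space has to be constructed. -/
theorem exists_isParseval_fock : ∃ g : ℕ → Fock X, IsParseval g := by
  let e : HilbertBasis (FockIndex X) ℂ (FullFock X) :=
    HilbertBasis.ofRepr (LinearIsometryEquiv.refl ℂ _)
  refine exists_isParseval_of_countable
    (fun i => (symmetricSubspace X).orthogonalProjectionOnto (e i)) fun x => ?_
  have h := (symmetricSubspace X).orthogonalProjectionOnto.hasSum (e.hasSum_repr (x : FullFock X))
  rw [Submodule.orthogonalProjectionOnto_mem_subspace_eq_self] at h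
  convert! h using 2 with i
  rw [map_smul, e.repr_apply_apply, Submodule.inner_orthogonalProjectionOnto_eq_of_mem_right]

end Parseval

/-! ### Gram kernels and coherent vectors. -/

section Gram

theorem norm_eq_one_of_inner_self {F : Type*} [NormedAddCommGroup F] [InnerProductSpace ℂ F]
    {v : F} (h : ⟪v, v⟫_ℂ = 1) : ‖v‖ = 1 := by
  have h2 : ‖v‖ ^ 2 = 1 := by rw [@norm_sq_eq_re_inner ℂ, h]; simp
  exact (pow_eq_one_iff_of_nonneg (norm_nonneg _) two_ne_zero).1 h2

/-- A family of vectors with continuous Gram kernel is continuous. -/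
theorem continuous_of_continuous_inner {Y F : Type*} [TopologicalSpace Y] [NormedAddCommGroup F]
    [InnerProductSpace ℂ F] {c : Y → F} (h : Continuous fun p : Y × Y => ⟪c p.1, c p.2⟫_ℂ) :
    Continuous c := by
  refine continuous_iff_continuousAt.2 fun x => tendsto_iff_norm_sub_tendsto_zero.2 ?_
  have h0 : ∀ y, ‖c y - c x‖ =
      Real.sqrt (⟪c y, c y⟫_ℂ - ⟪c y, c x⟫_ℂ - ⟪c x, c y⟫_ℂ + ⟪c x, c x⟫_ℂ).re := by
    intro y
    rw [← Real.sqrt_sq (norm_nonneg (c y - c x)), @norm_sq_eq_re_inner ℂ, inner_sub_left,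
      inner_sub_right, inner_sub_right, RCLike.re_eq_complex_re]
    congr 2
    ring
  simp_rw [h0]
  have h1 : Continuous fun y => ⟪c y, c y⟫_ℂ := h.comp (continuous_id.prodMk continuous_id)
  have h2 : Continuous fun y => ⟪c y, c x⟫_ℂ := h.comp (continuous_id.prodMk continuous_const)
  have h3 : Continuous fun y => ⟪c x, c y⟫_ℂ := h.comp (continuous_const.prodMk continuous_id)
  have h4 : Continuous fun y =>
      Real.sqrt (⟪c y, c y⟫_ℂ - ⟪c y, c x⟫_ℂ - ⟪c x, c y⟫_ℂ + ⟪c x, c x⟫_ℂ).re := by fun_prop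
  convert h4.tendsto x using 2
  simp

end Gram

/-- The inner product of the Fock space is the one of its inner product space structure. -/
instance fockInner (X : Type*) [NormedAddCommGroup X] [InnerProductSpace ℂ X] :
    Inner ℂ (Fock X) :=
  InnerProductSpace.toInner

section Coherent

variable {X : Type*} [NormedAddCommGroup X] [InnerProductSpace ℂ X]

/-- The overlap of coherent vectors. -/
def gaussKernel (x y : X) : ℂ :=
  Complex.exp (-((‖x‖ ^ 2 / 2 : ℝ) : ℂ) - ((‖y‖ ^ 2 / 2 : ℝ) : ℂ) + ⟪x, y⟫_ℂ)

theorem norm_gaussKernel (x y : X) : ‖gaussKernel x y‖ = Real.exp (-(‖x - y‖ ^ 2 / 2)) := by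
  rw [gaussKernel, Complex.norm_exp]
  congr 1
  have h := norm_sub_sq (𝕜 := ℂ) x y
  simp only [Complex.add_re, Complex.sub_re, Complex.neg_re, Complex.ofReal_re]
  rw [h]
  simp only [RCLike.re_eq_complex_re]
  ring

theorem gaussKernel_self (x : X) : gaussKernel x x = 1 := by
  rw [gaussKernel, inner_self_eq_norm_sq_to_K, ← Complex.exp_zero]
  congr 1
  push_cast
  simp only [Complex.coe_algebraMap]
  ring

theorem conj_gaussKernel (x y : X) : starRingEnd ℂ (gaussKernel x y) = gaussKernel y x := by
  rw [gaussKernel, gaussKernel, ← Complex.exp_conj]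
  congr 1
  simp only [map_add, map_sub, map_neg, Complex.conj_ofReal, inner_conj_symm]
  ring

theorem continuous_gaussKernel : Continuous fun p : X × X => gaussKernel p.1 p.2 := by
  unfold gaussKernel
  fun_prop

variable [FiniteDimensional ℂ X]

/-- Summed by particle number, level `n` contributes `⟪x, y⟫ ^ n / n!`, since the sum over all words
of length `n` of a product is the `n`-th power of the sum over letters. -/
theorem inner_expVector (x y : X) : ⟪expVector x, expVector y⟫_ℂ = Complex.exp ⟪x, y⟫_ℂ := by
  have h := lp.hasSum_inner (𝕜 := ℂ) (expVector x : FullFock X) (expVector y : FullFock X)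
  have h1 := h.sigma (g := fun n : ℕ => ⟪x, y⟫_ℂ ^ n / (n.factorial : ℂ)) (fun n => ?_)
  · rw [Submodule.coe_inner]
    refine h1.unique ?_
    rw [Complex.exp_eq_exp_ℂ]
    exact NormedSpace.expSeries_div_hasSum_exp _
  · have h2 : ∀ w : Fin n → Fin (Module.finrank ℂ X),
        ⟪(expVector x : FullFock X) ⟨n, w⟩, (expVector y : FullFock X) ⟨n, w⟩⟫_ℂ =
        (n.factorial : ℂ)⁻¹ * ∏ j, (starRingEnd ℂ ((stdOrthonormalBasis ℂ X).repr x (w j)) *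
          (stdOrthonormalBasis ℂ X).repr y (w j)) := by
      intro w
      change ⟪expCoord x ⟨n, w⟩, expCoord y ⟨n, w⟩⟫_ℂ = _
      rw [RCLike.inner_apply, expCoord, expCoord, map_mul, Complex.conj_ofReal, map_prod,
        Finset.prod_mul_distrib]
      have h3 : (n.factorial : ℂ)⁻¹ =
          ((Real.sqrt n.factorial)⁻¹ : ℝ) * ((Real.sqrt n.factorial)⁻¹ : ℝ) := by
        rw [← Complex.ofReal_mul, ← mul_inv, Real.mul_self_sqrt (by positivity)]
        push_cast; rfl
      rw [h3]
      ring
    have h4 : ⟪x, y⟫_ℂ = ∑ a, starRingEnd ℂ ((stdOrthonormalBasis ℂ X).repr x a) *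
          (stdOrthonormalBasis ℂ X).repr y a := by
      rw [← (stdOrthonormalBasis ℂ X).repr.inner_map_map, PiLp.inner_apply]
      exact Finset.sum_congr rfl fun i _ => by rw [RCLike.inner_apply, mul_comm]
    simp_rw [h2]
    convert! hasSum_fintype _ using 1
    rw [← Finset.mul_sum, h4, Finset.sum_pow', ← Fintype.piFinset_univ, div_eq_inv_mul]

theorem inner_coherent (x y : X) : ⟪coherent x, coherent y⟫_ℂ = gaussKernel x y := by
  have h : ⟪coherent x, coherent y⟫_ℂ = starRingEnd ℂ ((Real.exp (-‖x‖ ^ 2 / 2) : ℝ) : ℂ) *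
      (((Real.exp (-‖y‖ ^ 2 / 2) : ℝ) : ℂ) * ⟪expVector x, expVector y⟫_ℂ) :=
    (inner_smul_left (𝕜 := ℂ) (expVector x) (coherent y) _).trans
      (congrArg _ (inner_smul_right (𝕜 := ℂ) (expVector x) (expVector y) _))
  rw [h, inner_expVector, Complex.conj_ofReal,
    Complex.ofReal_exp, Complex.ofReal_exp, ← Complex.exp_add, ← Complex.exp_add, gaussKernel]
  congr 1
  push_cast
  ring

end Coherent

/-! ### Gaussian integrals of the coherent overlap kernel. -/

section GaussianIntegrals

theorem norm_gaussKernel_sq {X : Type*} [NormedAddCommGroup X] [InnerProductSpace ℂ X]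
    (a b : X) :
    ((‖gaussKernel a b‖ ^ 2 : ℝ) : ℂ) = gaussKernel a b * gaussKernel b a := by
  rw [← conj_gaussKernel a b, Complex.mul_conj, Complex.normSq_eq_norm_sq]

variable (X : Type*) [NormedAddCommGroup X] [InnerProductSpace ℂ X] [FiniteDimensional ℂ X]

/-- Real coordinates on a complex inner product space. -/
abbrev RealCoord : Type := Fin (Module.finrank ℂ X) × Fin 2 → ℝ

variable {X}

/-- The point with given real coordinates with respect to the standard orthonormal basis. -/
def modePoint (v : RealCoord X) : X :=
  (stdOrthonormalBasis ℂ X).repr.symm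
    (WithLp.toLp 2 fun j => (v (j, 0) : ℂ) + Complex.I * (v (j, 1) : ℂ))

theorem repr_modePoint (v : RealCoord X) (j : Fin (Module.finrank ℂ X)) :
    (stdOrthonormalBasis ℂ X).repr (modePoint v) j =
      (v (j, 0) : ℂ) + Complex.I * (v (j, 1) : ℂ) := by
  simp [modePoint]

theorem continuous_modePoint : Continuous (modePoint : RealCoord X → X) := by
  unfold modePoint
  refine (LinearIsometryEquiv.continuous _).comp ((PiLp.continuous_toLp 2 _).comp ?_)
  fun_prop

theorem inner_modePoint (x : X) (v : RealCoord X) : ⟪x, modePoint v⟫_ℂ =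
    ∑ j, starRingEnd ℂ ((stdOrthonormalBasis ℂ X).repr x j) *
      ((v (j, 0) : ℂ) + Complex.I * (v (j, 1) : ℂ)) := by
  rw [← (stdOrthonormalBasis ℂ X).repr.inner_map_map, PiLp.inner_apply]
  refine Finset.sum_congr rfl fun j _ => ?_
  rw [RCLike.inner_apply, repr_modePoint, mul_comm]

theorem norm_modePoint_sq (v : RealCoord X) : ‖modePoint v‖ ^ 2 = ∑ i, v i ^ 2 := by
  rw [← (stdOrthonormalBasis ℂ X).repr.norm_map, EuclideanSpace.norm_sq_eq,
    Fintype.sum_prod_type]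
  refine Finset.sum_congr rfl fun j _ => ?_
  rw [repr_modePoint, Fin.sum_univ_two, ← Complex.normSq_eq_norm_sq, mul_comm,
    Complex.normSq_add_mul_I]

theorem abs_le_norm_modePoint (v : RealCoord X) (i) : |v i| ≤ ‖modePoint v‖ := by
  refine abs_le_of_sq_le_sq ?_ (norm_nonneg _)
  rw [norm_modePoint_sq]
  exact Finset.single_le_sum (f := fun i => v i ^ 2) (fun i _ => sq_nonneg _) (Finset.mem_univ i)

theorem modePoint_smul (t : ℝ) (v : RealCoord X) : modePoint (t • v) = (t : ℂ) • modePoint v := by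
  unfold modePoint
  rw [← map_smul]
  congr 1
  ext j
  simp
  ring

/-- This is the shape to which the Gaussian integral formula applies: a quadratic exponent plus a
linear one in the real coordinates. From `⟪a, v⟫ + ⟪v, b⟫`, real parts get the coefficient `ā + b`
and imaginary parts `i (ā - b)`. -/
theorem gaussKernel_mul_eq (a b : X) (v : RealCoord X) :
    gaussKernel a (modePoint v) * gaussKernel (modePoint v) b =
      Complex.exp (-((‖a‖ ^ 2 / 2 : ℝ) : ℂ) - ((‖b‖ ^ 2 / 2 : ℝ) : ℂ)) *
      Complex.exp (-(1 : ℂ) * ∑ i, (v i : ℂ) ^ 2 + ∑ i : Fin (Module.finrank ℂ X) × Fin 2,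
        (if i.2 = 0 then starRingEnd ℂ ((stdOrthonormalBasis ℂ X).repr a i.1) +
            (stdOrthonormalBasis ℂ X).repr b i.1
          else Complex.I * (starRingEnd ℂ ((stdOrthonormalBasis ℂ X).repr a i.1) -
            (stdOrthonormalBasis ℂ X).repr b i.1)) * v i) := by
  rw [gaussKernel, gaussKernel, ← Complex.exp_add, ← Complex.exp_add]
  congr 1
  have h1 : ((∑ i, (v i : ℂ) ^ 2) : ℂ) = ((‖modePoint v‖ ^ 2 : ℝ) : ℂ) := by
    rw [norm_modePoint_sq]; push_cast; rfl
  have h2 : ⟪modePoint v, b⟫_ℂ = ∑ j, (stdOrthonormalBasis ℂ X).repr b j *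
      ((v (j, 0) : ℂ) - Complex.I * (v (j, 1) : ℂ)) := by
    rw [← inner_conj_symm, inner_modePoint, map_sum]
    refine Finset.sum_congr rfl fun j _ => ?_
    simp only [map_mul, map_add, Complex.conj_conj, Complex.conj_ofReal, Complex.conj_I]
    ring
  rw [h1, inner_modePoint, h2, Fintype.sum_prod_type]
  simp only [Fin.sum_univ_two, if_true, Fin.one_eq_zero_iff, OfNat.ofNat_ne_one, if_false]
  have h3 : ∀ x y z w u t : ℂ, u + t = w → (-x - y + u) + (-y - z + t) = -x - z + (-1 * (2 * y) + w) := by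
    intro x y z w u t h
    rw [← h]; ring
  have h4 : ((‖modePoint v‖ ^ 2 : ℝ) : ℂ) = 2 * ((‖modePoint v‖ ^ 2 / 2 : ℝ) : ℂ) := by
    push_cast; ring
  rw [h4]
  refine h3 _ _ _ _ _ _ ?_
  rw [← Finset.sum_add_distrib]
  refine Finset.sum_congr rfl fun j _ => ?_
  ring

theorem integrable_gaussKernel_mul (a b : X) :
    Integrable fun v : RealCoord X => gaussKernel a (modePoint v) * gaussKernel (modePoint v) b := by
  simp_rw [gaussKernel_mul_eq]
  exact (GaussianFourier.integrable_cexp_neg_mul_sum_add (by simp) _).const_mul _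

/-- The reproducing property of the overlap of coherent vectors. -/
theorem integral_gaussKernel_mul (a b : X) :
    ∫ v : RealCoord X, gaussKernel a (modePoint v) * gaussKernel (modePoint v) b =
      (Real.pi : ℂ) ^ Module.finrank ℂ X * gaussKernel a b := by
  simp_rw [gaussKernel_mul_eq]
  rw [integral_const_mul, GaussianFourier.integral_cexp_neg_mul_sum_add (by simp), gaussKernel,
    Complex.exp_add]
  have h1 : ((Fintype.card (Fin (Module.finrank ℂ X) × Fin 2) : ℂ) / 2) =
      (Module.finrank ℂ X : ℂ) := by
    simp
  rw [h1, Complex.cpow_natCast, div_one, mul_left_comm]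
  congr 3
  rw [Fintype.sum_prod_type, ← (stdOrthonormalBasis ℂ X).repr.inner_map_map, PiLp.inner_apply,
    Finset.sum_div]
  refine Finset.sum_congr rfl fun j _ => ?_
  rw [Fin.sum_univ_two, RCLike.inner_apply]
  simp only [if_true, Fin.one_eq_zero_iff, OfNat.ofNat_ne_one, if_false, mul_pow, Complex.I_sq]
  ring

theorem integrable_norm_gaussKernel_sq (a : X) :
    Integrable fun v : RealCoord X => ‖gaussKernel a (modePoint v)‖ ^ 2 := by
  have h := (integrable_gaussKernel_mul a a).re
  refine h.congr (Eventually.of_forall fun v => ?_)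
  simp only [← norm_gaussKernel_sq]
  exact Complex.ofReal_re _

theorem integral_norm_gaussKernel_sq (a : X) :
    ∫ v : RealCoord X, ‖gaussKernel a (modePoint v)‖ ^ 2 = Real.pi ^ Module.finrank ℂ X := by
  have h := integral_gaussKernel_mul a a
  simp_rw [← norm_gaussKernel_sq] at h
  rw [integral_complex_ofReal, gaussKernel_self, mul_one] at h
  exact_mod_cast h

/-- Scaling by `1 / √2` halves the exponent, so the integral of the modulus reduces to the known
integral of its square. The Jacobian `√2 ^ (2 N)` is the source of the factor `2 ^ N` in later
bounds. -/
theorem norm_gaussKernel_scale (a : X) (v : RealCoord X) : ‖gaussKernel a (modePoint v)‖ =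
    ‖gaussKernel (((Real.sqrt 2)⁻¹ : ℝ) • a) (modePoint ((Real.sqrt 2)⁻¹ • v))‖ ^ 2 := by
  rw [norm_gaussKernel, norm_gaussKernel, modePoint_smul, Complex.coe_smul, ← smul_sub, norm_smul,
    ← Real.exp_nat_mul]
  congr 1
  rw [mul_pow, Real.norm_of_nonneg (by positivity), inv_pow, Real.sq_sqrt (by norm_num)]
  push_cast
  ring

theorem integrable_norm_gaussKernel (a : X) :
    Integrable fun v : RealCoord X => ‖gaussKernel a (modePoint v)‖ := by
  simp_rw [norm_gaussKernel_scale a]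
  exact (integrable_norm_gaussKernel_sq _).comp_smul (by positivity)

theorem integral_norm_gaussKernel (a : X) :
    ∫ v : RealCoord X, ‖gaussKernel a (modePoint v)‖ = (2 * Real.pi) ^ Module.finrank ℂ X := by
  simp_rw [norm_gaussKernel_scale a]
  rw [Measure.integral_comp_smul volume
    (fun v : RealCoord X => ‖gaussKernel (((Real.sqrt 2)⁻¹ : ℝ) • a) (modePoint v)‖ ^ 2),
    integral_norm_gaussKernel_sq]
  have h1 : Module.finrank ℝ (RealCoord X) = 2 * Module.finrank ℂ X := by
    simp [mul_comm]
  rw [h1, pow_mul, inv_pow, Real.sq_sqrt (by norm_num), abs_of_nonneg (by positivity), inv_pow,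
    inv_inv, smul_eq_mul, mul_pow]

/-- The mass of the squared Gaussian kernel far away from the centre. -/
theorem setIntegral_norm_gaussKernel_sq_le (a : X) {t : Set (RealCoord X)}
    (ht : MeasurableSet t) {s : ℝ} (hs : 0 ≤ s) (h : ∀ v ∈ t, s ≤ ‖a - modePoint v‖) :
    ∫ v in t, ‖gaussKernel a (modePoint v)‖ ^ 2 ≤
      Real.exp (-(s ^ 2 / 2)) * (2 * Real.pi) ^ Module.finrank ℂ X := by
  calc ∫ v in t, ‖gaussKernel a (modePoint v)‖ ^ 2
      -- One of the two factors is bounded by its value at distance `s`; the other one is kept for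
      -- integration over the whole space.
      ≤ ∫ v in t, Real.exp (-(s ^ 2 / 2)) * ‖gaussKernel a (modePoint v)‖ := by
        refine setIntegral_mono_on (integrable_norm_gaussKernel_sq a).integrableOn
          ((integrable_norm_gaussKernel a).const_mul _).integrableOn ht fun v hv => ?_
        rw [sq]
        refine mul_le_mul_of_nonneg_right ?_ (norm_nonneg _)
        rw [norm_gaussKernel]
        have := h v hv
        gcongr
    _ ≤ ∫ v, Real.exp (-(s ^ 2 / 2)) * ‖gaussKernel a (modePoint v)‖ :=
        setIntegral_le_integral ((integrable_norm_gaussKernel a).const_mul _)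
          (Eventually.of_forall fun v => by positivity)
    _ = _ := by rw [integral_const_mul, integral_norm_gaussKernel]

end GaussianIntegrals

/-! ### The transform from coherent vectors to a nearly Gaussian family, and the resulting Le Cam
bound. -/

section CoherentTransform

/-- The cube of half-width `R` in the real coordinates. -/
abbrev box (X : Type*) [NormedAddCommGroup X] [InnerProductSpace ℂ X] (R : ℝ) :
    Set (RealCoord X) := Metric.closedBall 0 R

theorem volume_box (X : Type*) [NormedAddCommGroup X] [InnerProductSpace ℂ X] {R : ℝ} (hR : 0 ≤ R) :
    (volume (box X R)).toReal = (2 * R) ^ (2 * Module.finrank ℂ X) := by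
  rw [Real.volume_pi_closedBall _ hR, ENNReal.toReal_ofReal (by positivity)]
  simp [mul_comm]

theorem inner_setIntegral_smul {X H : Type*} [NormedAddCommGroup X] [InnerProductSpace ℂ X]
    [NormedAddCommGroup H] [InnerProductSpace ℂ H] [CompleteSpace H] {t : Set (RealCoord X)} {α : RealCoord X → ℂ} {ψ : RealCoord X → H}
    (ht : IsCompact t) (hα : Continuous α) (hψ : Continuous ψ) (w : H) :
    ⟪w, ∫ v in t, α v • ψ v⟫_ℂ = ∫ v in t, α v * ⟪w, ψ v⟫_ℂ := by
  have hi : IntegrableOn (fun v => α v • ψ v) t :=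
    (hα.smul hψ).continuousOn.integrableOn_compact ht
  rw [← integral_inner hi]
  simp_rw [inner_smul_right]


variable {X : Type*} [NormedAddCommGroup X] [InnerProductSpace ℂ X] [FiniteDimensional ℂ X]
  {F : Type*} [NormedAddCommGroup F] [InnerProductSpace ℂ F]
  {H : Type*} [NormedAddCommGroup H] [InnerProductSpace ℂ H]
  {c : X → F}

theorem ofReal_norm_sq_eq_inner (f : F) : ((‖f‖ ^ 2 : ℝ) : ℂ) = ⟪f, f⟫_ℂ := by
  rw [inner_self_eq_norm_sq_to_K]; push_cast; rfl

/-- The coherent resolution of the identity on finite combinations: expand the square and integrate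
each term by the reproducing property of the kernel. -/
theorem integral_norm_inner_sq_of_mem_span (hc : ∀ x y, ⟪c x, c y⟫_ℂ = gaussKernel x y) {f : F}
    (hf : f ∈ Submodule.span ℂ (Set.range c)) :
    Integrable (fun v : RealCoord X => ‖⟪c (modePoint v), f⟫_ℂ‖ ^ 2) ∧
    ∫ v : RealCoord X, ‖⟪c (modePoint v), f⟫_ℂ‖ ^ 2 =
      Real.pi ^ Module.finrank ℂ X * ‖f‖ ^ 2 := by
  obtain ⟨l, rfl⟩ := Finsupp.mem_span_range_iff_exists_finsupp.1 hf
  rw [Finsupp.sum]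
  have h1 : ∀ v : RealCoord X,
      ((‖⟪c (modePoint v), ∑ i ∈ l.support, l i • c i⟫_ℂ‖ ^ 2 : ℝ) : ℂ) =
      ∑ i ∈ l.support, ∑ j ∈ l.support, starRingEnd ℂ (l i) * l j *
        (gaussKernel i (modePoint v) * gaussKernel (modePoint v) j) := by
    intro v
    rw [← Complex.normSq_eq_norm_sq, Complex.normSq_eq_conj_mul_self, inner_sum, map_sum,
      Finset.sum_mul_sum]
    refine Finset.sum_congr rfl fun i _ => Finset.sum_congr rfl fun j _ => ?_
    rw [inner_smul_right, inner_smul_right, hc, hc, map_mul, conj_gaussKernel]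
    ring
  have hint : ∀ i j, Integrable fun v : RealCoord X => starRingEnd ℂ (l i) * l j *
        (gaussKernel i (modePoint v) * gaussKernel (modePoint v) j) :=
    fun i j => (integrable_gaussKernel_mul i j).const_mul _
  have hI : Integrable fun v : RealCoord X =>
      ((‖⟪c (modePoint v), ∑ i ∈ l.support, l i • c i⟫_ℂ‖ ^ 2 : ℝ) : ℂ) := by
    simp_rw [h1]
    exact integrable_finsetSum _ fun i _ => integrable_finsetSum _ fun j _ => hint i j
  refine ⟨?_, ?_⟩
  · refine hI.re.congr (Eventually.of_forall fun v => ?_)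
    exact Complex.ofReal_re _
  · have h2 : ∫ v : RealCoord X,
        ((‖⟪c (modePoint v), ∑ i ∈ l.support, l i • c i⟫_ℂ‖ ^ 2 : ℝ) : ℂ) =
        ((Real.pi ^ Module.finrank ℂ X * ‖∑ i ∈ l.support, l i • c i‖ ^ 2 : ℝ) : ℂ) := by
      simp_rw [h1]
      rw [integral_finsetSum _ fun i _ => integrable_finsetSum _ fun j _ => hint i j]
      simp_rw [integral_finsetSum l.support fun j _ => hint _ j, integral_const_mul,
        integral_gaussKernel_mul]
      rw [Complex.ofReal_mul, ofReal_norm_sq_eq_inner, sum_inner, Finset.mul_sum]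
      refine Finset.sum_congr rfl fun i _ => ?_
      rw [inner_sum, Finset.mul_sum]
      refine Finset.sum_congr rfl fun j _ => ?_
      rw [inner_smul_left, inner_smul_right, hc]
      push_cast
      ring
    rw [integral_complex_ofReal] at h2
    exact_mod_cast h2

variable [CompleteSpace F]

/-- Bessel's inequality for coherent vectors. -/
theorem setIntegral_norm_inner_sq_le (hc : ∀ x y, ⟪c x, c y⟫_ℂ = gaussKernel x y) (R : ℝ) (f : F) :
    ∫ v in box X R, ‖⟪c (modePoint v), f⟫_ℂ‖ ^ 2 ≤ Real.pi ^ Module.finrank ℂ X * ‖f‖ ^ 2 := by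
  have hcont : Continuous c := continuous_of_continuous_inner (by
    simp_rw [hc]; exact continuous_gaussKernel)
  have hcm : Continuous fun v : RealCoord X => c (modePoint v) := hcont.comp continuous_modePoint
  have hc1 : ∀ x, ‖c x‖ = 1 := fun x =>
    norm_eq_one_of_inner_self (by rw [hc, gaussKernel_self])
  let q : F → ℝ := fun f => ∫ v in box X R, ‖⟪c (modePoint v), f⟫_ℂ‖ ^ 2
  have hfin : IsFiniteMeasure (volume.restrict (box X R)) :=
    ⟨by rw [Measure.restrict_apply_univ]; exact (isCompact_closedBall _ _).measure_lt_top⟩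
  have hq : Continuous q := by
    refine continuous_iff_continuousAt.2 fun f => ?_
    refine continuousAt_of_dominated (bound := fun _ => (‖f‖ + 1) ^ 2)
      (Eventually.of_forall fun g => ?_) ?_ (integrable_const _)
      (Eventually.of_forall fun v => ?_)
    · exact ((hcm.inner continuous_const).norm.pow 2).aestronglyMeasurable
    · filter_upwards [Metric.ball_mem_nhds f one_pos] with g hg
      refine Eventually.of_forall fun v => ?_
      rw [Real.norm_of_nonneg (by positivity)]
      have h1 := norm_inner_le_norm (𝕜 := ℂ) (c (modePoint v)) g
      rw [hc1, one_mul] at h1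
      have h2 : ‖g‖ ≤ ‖f‖ + 1 := by
        have := norm_le_norm_add_norm_sub' g f
        rw [Metric.mem_ball, dist_eq_norm] at hg
        linarith
      have := h1.trans h2
      gcongr
    · exact Continuous.continuousAt (by fun_prop)
  let U : Submodule ℂ F := (Submodule.span ℂ (Set.range c)).topologicalClosure
  -- The identity on the span passes to its closure as an inequality, because `q` is continuous.
  -- Replacing `f` by its projection to the closure changes no inner product with a coherent vector,
  -- so totality of these vectors is not needed.
  have hU : ∀ g ∈ U, q g ≤ Real.pi ^ Module.finrank ℂ X * ‖g‖ ^ 2 := by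
    have hcl : IsClosed {g | q g ≤ Real.pi ^ Module.finrank ℂ X * ‖g‖ ^ 2} :=
      isClosed_le hq (by fun_prop)
    intro g hg
    refine closure_minimal (fun g hg => ?_) hcl hg
    obtain ⟨hi, he⟩ := integral_norm_inner_sq_of_mem_span hc hg
    rw [Set.mem_ofPred_eq, ← he]
    exact setIntegral_le_integral hi (Eventually.of_forall fun v => by positivity)
  have hUc : IsClosed (U : Set F) := Submodule.isClosed_topologicalClosure _
  have : CompleteSpace U := hUc.completeSpace_coe
  let P := U.orthogonalProjectionOnto
  have h1 : ∀ x, ⟪c x, f⟫_ℂ = ⟪c x, (P f : F)⟫_ℂ := by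
    intro x
    have hx : c x ∈ U := Submodule.le_topologicalClosure _ (Submodule.subset_span ⟨x, rfl⟩)
    have := Submodule.inner_orthogonalProjectionOnto_eq_of_mem_left (⟨c x, hx⟩ : U) f
    rw [← this, Submodule.coe_inner]
  have h2 : ‖(P f : F)‖ ≤ ‖f‖ := by
    have := U.orthogonalProjectionOnto.le_of_opNorm_le U.orthogonalProjectionOnto_norm_le f
    rwa [one_mul] at this
  simp_rw [h1]
  refine (hU _ (P f).2).trans ?_
  gcongr

variable [CompleteSpace H]

/-- Cauchy-Schwarz in the form that the integral of `(f - mean)²` is nonnegative. -/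
theorem sq_setIntegral_le {X : Type*} [NormedAddCommGroup X] [InnerProductSpace ℂ X] {t : Set (RealCoord X)} (ht : IsCompact t) {f : RealCoord X → ℝ}
    (hf : Continuous f) (h0 : 0 < (volume t).toReal) :
    (∫ v in t, f v) ^ 2 ≤ (volume t).toReal * ∫ v in t, f v ^ 2 := by
  set A := ∫ v in t, f v
  set L := (volume t).toReal
  have hi1 : IntegrableOn f t := hf.continuousOn.integrableOn_compact ht
  have hi2 : IntegrableOn (fun v => f v ^ 2) t := (hf.pow 2).continuousOn.integrableOn_compact ht
  have hfin : IsFiniteMeasure (volume.restrict t) :=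
    ⟨by rw [Measure.restrict_apply_univ]; exact ht.measure_lt_top⟩
  have h : 0 ≤ ∫ v in t, (f v - A / L) ^ 2 := integral_nonneg fun v => by positivity
  have h1 : ∫ v in t, (f v - A / L) ^ 2 = (∫ v in t, f v ^ 2) - 2 * (A / L) * A + L * (A / L) ^ 2 := by
    have h2 : ∀ v, (f v - A / L) ^ 2 = f v ^ 2 - 2 * (A / L) * f v + (A / L) ^ 2 := fun v => by ring
    simp_rw [h2]
    have hi3 : IntegrableOn (fun v => 2 * (A / L) * f v) t := hi1.const_mul _
    have hi4 : IntegrableOn (fun v => f v ^ 2 - 2 * (A / L) * f v) t := hi2.sub hi3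
    rw [integral_add hi4 (integrable_const _), integral_sub hi2 hi3, integral_const_mul,
      integral_const]
    simp [L, A, Measure.real]
  rw [h1] at h
  have h3 : (∫ v in t, f v ^ 2) - 2 * (A / L) * A + L * (A / L) ^ 2 =
      (∫ v in t, f v ^ 2) - A ^ 2 / L := by field_simp; ring
  rw [h3, sub_nonneg, div_le_iff₀ h0] at h
  linarith

/-- The transform `π^{-N} ∫ |Ψ_v⟩⟨c_v| dv` over a cube. -/
def coherentTransform (R : ℝ) (c : X → F) (Ψ : RealCoord X → H) : F →L[ℂ] H :=
  ((Real.pi ^ Module.finrank ℂ X)⁻¹ : ℝ) •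
    ∫ v in box X R, InnerProductSpace.rankOne ℂ (Ψ v) (c (modePoint v))

theorem continuous_rankOne {Y F H : Type*} [TopologicalSpace Y] [NormedAddCommGroup F]
    [InnerProductSpace ℂ F] [NormedAddCommGroup H] [InnerProductSpace ℂ H] {a : Y → H} {b : Y → F}
    (ha : Continuous a) (hb : Continuous b) :
    Continuous fun y => InnerProductSpace.rankOne ℂ (a y) (b y) := by
  refine continuous_iff_continuousAt.2 fun y₀ => tendsto_iff_norm_sub_tendsto_zero.2 ?_
  have h : Continuous fun y => ‖a y - a y₀‖ * ‖b y‖ + ‖a y₀‖ * ‖b y - b y₀‖ := by fun_prop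
  have h0 := h.tendsto y₀
  simp only [sub_self, norm_zero, zero_mul, mul_zero, add_zero] at h0
  refine squeeze_zero (fun _ => norm_nonneg _) (fun y => ?_) h0
  have h1 : InnerProductSpace.rankOne ℂ (a y) (b y) - InnerProductSpace.rankOne ℂ (a y₀) (b y₀) =
      InnerProductSpace.rankOne ℂ (a y - a y₀) (b y) +
        InnerProductSpace.rankOne ℂ (a y₀) (b y - b y₀) := by
    ext z
    simp only [_root_.sub_apply, _root_.add_apply, InnerProductSpace.rankOne_apply, inner_sub_left,
      sub_smul, smul_sub]
    abel
  rw [h1]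
  refine (norm_add_le _ _).trans ?_
  rw [InnerProductSpace.norm_rankOne, InnerProductSpace.norm_rankOne]

theorem coherentTransform_apply {R : ℝ} {Ψ : RealCoord X → H} (hcont : Continuous c)
    (hΨ : Continuous Ψ) (f : F) : coherentTransform R c Ψ f =
      ((Real.pi ^ Module.finrank ℂ X)⁻¹ : ℝ) •
        ∫ v in box X R, ⟪c (modePoint v), f⟫_ℂ • Ψ v := by
  have hi : IntegrableOn (fun v => InnerProductSpace.rankOne ℂ (Ψ v) (c (modePoint v)))
      (box X R) :=
    (continuous_rankOne hΨ (hcont.comp continuous_modePoint)).continuousOn.integrableOn_compact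
      (isCompact_closedBall _ _)
  rw [coherentTransform, _root_.smul_apply, ContinuousLinearMap.integral_apply hi]
  rfl

/-- Only the Gram kernel of `ψ` enters on the right. Two families in different Hilbert spaces can
therefore be compared through their kernels. -/
theorem norm_setIntegral_smul_sq {X : Type*} [NormedAddCommGroup X] [InnerProductSpace ℂ X]
    {t : Set (RealCoord X)} {α : RealCoord X → ℂ}
    {ψ : RealCoord X → H} (ht : IsCompact t) (hα : Continuous α) (hψ : Continuous ψ) :
    ((‖∫ v in t, α v • ψ v‖ ^ 2 : ℝ) : ℂ) =
      ∫ u in t, starRingEnd ℂ (α u) * ∫ v in t, α v * ⟪ψ u, ψ v⟫_ℂ := by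
  rw [ofReal_norm_sq_eq_inner, ← inner_conj_symm, inner_setIntegral_smul ht hα hψ, ← integral_conj]
  refine integral_congr_ae (Eventually.of_forall fun u => ?_)
  simp only [map_mul, inner_conj_symm]
  rw [inner_setIntegral_smul ht hα hψ]

/-- Perturbation of a quadratic form under a uniform perturbation of its kernel. -/
theorem norm_setIntegral_smul_sq_le {X : Type*} [NormedAddCommGroup X]
    [InnerProductSpace ℂ X] {t : Set (RealCoord X)} {α : RealCoord X → ℂ}
    {ψ : RealCoord X → H} {e : RealCoord X → F} (ht : IsCompact t) (hα : Continuous α)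
    (hψ : Continuous ψ) (he : Continuous e) {ε : ℝ}
    (h : ∀ u ∈ t, ∀ v ∈ t, ‖⟪ψ u, ψ v⟫_ℂ - ⟪e u, e v⟫_ℂ‖ ≤ ε) :
    ‖∫ v in t, α v • ψ v‖ ^ 2 ≤ ‖∫ v in t, α v • e v‖ ^ 2 + ε * (∫ v in t, ‖α v‖) ^ 2 := by
  have hI : ∀ g : RealCoord X → ℝ, Continuous g → IntegrableOn g t := fun g hg =>
    hg.continuousOn.integrableOn_compact ht
  have hIc : ∀ g : RealCoord X → ℂ, Continuous g → IntegrableOn g t := fun g hg =>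
    hg.continuousOn.integrableOn_compact ht
  have hin : ∀ {G : Type _} [NormedAddCommGroup G] [InnerProductSpace ℂ G] [CompleteSpace G]
      (χ : RealCoord X → G), Continuous χ →
      Continuous fun u => starRingEnd ℂ (α u) * ∫ v in t, α v * ⟪χ u, χ v⟫_ℂ := by
    intro G _ _ _ χ hχ
    have h1 : ∀ u, ∫ v in t, α v * ⟪χ u, χ v⟫_ℂ = ⟪χ u, ∫ v in t, α v • χ v⟫_ℂ :=
      fun u => (inner_setIntegral_smul ht hα hχ _).symm
    simp_rw [h1]
    exact (Complex.continuous_conj.comp hα).mul (hχ.inner continuous_const)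
  have hin' : Continuous fun u => starRingEnd ℂ (α u) * ∫ v in t, α v * ⟪e u, e v⟫_ℂ := by
    have h1 : ∀ u, ∫ v in t, α v * ⟪e u, e v⟫_ℂ = ⟪e u, ∫ v in t, α v • e v⟫_ℂ :=
      fun u => (inner_setIntegral_smul ht hα he _).symm
    simp_rw [h1]
    exact (Complex.continuous_conj.comp hα).mul (he.inner continuous_const)
  have hd : ((‖∫ v in t, α v • ψ v‖ ^ 2 - ‖∫ v in t, α v • e v‖ ^ 2 : ℝ) : ℂ) =
      ∫ u in t, starRingEnd ℂ (α u) * ∫ v in t, α v * (⟪ψ u, ψ v⟫_ℂ - ⟪e u, e v⟫_ℂ) := by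
    rw [Complex.ofReal_sub, norm_setIntegral_smul_sq ht hα hψ, norm_setIntegral_smul_sq ht hα he,
      ← integral_sub (hIc _ (hin ψ hψ)) (hIc _ hin')]
    refine integral_congr_ae (Eventually.of_forall fun u => ?_)
    simp only [mul_sub]
    rw [integral_sub (hIc (fun v => α v * ⟪ψ u, ψ v⟫_ℂ) (hα.mul (continuous_const.inner hψ)))
      (hIc (fun v => α v * ⟪e u, e v⟫_ℂ) (hα.mul (continuous_const.inner he))), mul_sub]
  have hn : ‖((‖∫ v in t, α v • ψ v‖ ^ 2 - ‖∫ v in t, α v • e v‖ ^ 2 : ℝ) : ℂ)‖ ≤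
      ε * (∫ v in t, ‖α v‖) ^ 2 := by
    rw [hd]
    have h1 : ∀ u ∈ t, ‖starRingEnd ℂ (α u) * ∫ v in t, α v * (⟪ψ u, ψ v⟫_ℂ - ⟪e u, e v⟫_ℂ)‖ ≤
        ‖α u‖ * (ε * ∫ v in t, ‖α v‖) := by
      intro u hu
      rw [norm_mul, Complex.norm_conj]
      refine mul_le_mul_of_nonneg_left ?_ (norm_nonneg _)
      rw [← integral_const_mul]
      refine (norm_integral_le_integral_norm _).trans ?_
      refine setIntegral_mono_on (hI _ (hα.mul ((continuous_const.inner hψ).sub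
        (continuous_const.inner he))).norm) (hI _ (continuous_const.mul hα.norm))
        ht.measurableSet fun v hv => ?_
      rw [norm_mul, mul_comm]
      exact mul_le_mul_of_nonneg_right (h u hu v hv) (norm_nonneg _)
    calc _ ≤ ∫ u in t, ‖α u‖ * (ε * ∫ v in t, ‖α v‖) :=
          norm_integral_le_of_norm_le (hI _ (hα.norm.mul continuous_const))
            ((ae_restrict_iff' ht.measurableSet).2 (Eventually.of_forall h1))
      _ = _ := by rw [integral_mul_const]; ring
  rw [Complex.norm_real, Real.norm_eq_abs] at hn
  linarith [le_abs_self (‖∫ v in t, α v • ψ v‖ ^ 2 - ‖∫ v in t, α v • e v‖ ^ 2)]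

/-- The adjoint form of Bessel's inequality for coherent vectors. -/
theorem norm_setIntegral_smul_coherent_sq_le (hc : ∀ x y, ⟪c x, c y⟫_ℂ = gaussKernel x y) (R : ℝ)
    {α : RealCoord X → ℂ} (hα : Continuous α) :
    ‖∫ v in box X R, α v • c (modePoint v)‖ ^ 2 ≤
      Real.pi ^ Module.finrank ℂ X * ∫ v in box X R, ‖α v‖ ^ 2 := by
  have hcont : Continuous c := continuous_of_continuous_inner (by
    simp_rw [hc]; exact continuous_gaussKernel)
  have hcm : Continuous fun v : RealCoord X => c (modePoint v) := hcont.comp continuous_modePoint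
  have hB : IsCompact (box X R) := isCompact_closedBall _ _
  have hI : ∀ g : RealCoord X → ℝ, Continuous g → IntegrableOn g (box X R) := fun g hg =>
    hg.continuousOn.integrableOn_compact hB
  set w := ∫ v in box X R, α v • c (modePoint v) with hw
  have hβc : Continuous fun v : RealCoord X => ‖⟪c (modePoint v), w⟫_ℂ‖ :=
    (hcm.inner continuous_const).norm
  have hβ := setIntegral_norm_inner_sq_le hc R w
  set N := Module.finrank ℂ X
  have h1 : ‖w‖ ^ 2 ≤ ∫ v in box X R, ‖α v‖ * ‖⟪c (modePoint v), w⟫_ℂ‖ := by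
    have h2 : ‖w‖ ^ 2 = ‖⟪w, w⟫_ℂ‖ := by
      rw [← ofReal_norm_sq_eq_inner, Complex.norm_real, Real.norm_of_nonneg (by positivity)]
    have h3 : ⟪w, w⟫_ℂ = ∫ v in box X R, α v * ⟪w, c (modePoint v)⟫_ℂ := by
      conv_lhs => rw [hw]
      exact inner_setIntegral_smul hB hα hcm w
    rw [h2, h3]
    refine (norm_integral_le_integral_norm _).trans (le_of_eq ?_)
    refine integral_congr_ae (Eventually.of_forall fun v => ?_)
    simp only [norm_mul]
    rw [norm_inner_symm w]
  -- The inequality of arithmetic and geometric means, weighted by `π^N`. By Bessel's inequality for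
  -- `w` the second half is at most `‖w‖² / 2`, which is absorbed on the left.
  have h3 : ∫ v in box X R, ‖α v‖ * ‖⟪c (modePoint v), w⟫_ℂ‖ ≤
      ∫ v in box X R, (Real.pi ^ N / 2 * ‖α v‖ ^ 2 +
        (Real.pi ^ N)⁻¹ / 2 * ‖⟪c (modePoint v), w⟫_ℂ‖ ^ 2) := by
    refine setIntegral_mono_on (hI _ (hα.norm.mul hβc)) (hI _ ((continuous_const.mul
      (hα.norm.pow 2)).add (continuous_const.mul (hβc.pow 2)))) hB.measurableSet fun v _ => ?_
    have h5 : Real.pi ^ N / 2 * ‖α v‖ ^ 2 + (Real.pi ^ N)⁻¹ / 2 * ‖⟪c (modePoint v), w⟫_ℂ‖ ^ 2 -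
        ‖α v‖ * ‖⟪c (modePoint v), w⟫_ℂ‖ =
        (Real.pi ^ N)⁻¹ / 2 * (Real.pi ^ N * ‖α v‖ - ‖⟪c (modePoint v), w⟫_ℂ‖) ^ 2 := by
      field_simp; ring
    have h6 : 0 ≤ (Real.pi ^ N)⁻¹ / 2 *
      (Real.pi ^ N * ‖α v‖ - ‖⟪c (modePoint v), w⟫_ℂ‖) ^ 2 := by positivity
    linarith
  rw [integral_add (hI (fun v => Real.pi ^ N / 2 * ‖α v‖ ^ 2)
    (continuous_const.mul (hα.norm.pow 2)))
    (hI (fun v => (Real.pi ^ N)⁻¹ / 2 * ‖⟪c (modePoint v), w⟫_ℂ‖ ^ 2)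
    (continuous_const.mul (hβc.pow 2))), integral_const_mul, integral_const_mul] at h3
  have h7 : (Real.pi ^ N)⁻¹ / 2 * ∫ v in box X R, ‖⟪c (modePoint v), w⟫_ℂ‖ ^ 2 ≤ ‖w‖ ^ 2 / 2 := by
    calc _ ≤ (Real.pi ^ N)⁻¹ / 2 * (Real.pi ^ N * ‖w‖ ^ 2) := by gcongr
      _ = _ := by field_simp
  linarith

/-- With `α v = ⟨c v, f⟩`, the vector `∫ α Ψ` is compared with `∫ α c`, which Bessel's inequality
and its adjoint form control. The kernel error costs `ε (∫ |α|)²`, at most `ε` times the volume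
`(2R)^(2N)` times `∫ |α|²`. -/
theorem norm_coherentTransform_apply_sq_le (hc : ∀ x y, ⟪c x, c y⟫_ℂ = gaussKernel x y)
    {R ε : ℝ} (hR : 0 < R) (hε : 0 ≤ ε) {Ψ : RealCoord X → H} (hΨ : Continuous Ψ)
    (hgram : ∀ u ∈ box X R, ∀ v ∈ box X R,
      ‖⟪Ψ u, Ψ v⟫_ℂ - gaussKernel (modePoint u) (modePoint v)‖ ≤ ε) (f : F) :
    ‖coherentTransform R c Ψ f‖ ^ 2 ≤
      (1 + ε * (2 * R) ^ (2 * Module.finrank ℂ X) / Real.pi ^ Module.finrank ℂ X) * ‖f‖ ^ 2 := by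
  have hcont : Continuous c := continuous_of_continuous_inner (by
    simp_rw [hc]; exact continuous_gaussKernel)
  have hcm : Continuous fun v : RealCoord X => c (modePoint v) := hcont.comp continuous_modePoint
  have hB : IsCompact (box X R) := isCompact_closedBall _ _
  have hα : Continuous fun v : RealCoord X => ⟪c (modePoint v), f⟫_ℂ := hcm.inner continuous_const
  have h1 := setIntegral_norm_inner_sq_le hc R f
  have h2 := norm_setIntegral_smul_coherent_sq_le hc R hα
  have h3 := norm_setIntegral_smul_sq_le hB hα hΨ hcm (ε := ε) (fun u hu v hv => by
    rw [hc]; exact hgram u hu v hv)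
  have h4 := sq_setIntegral_le hB hα.norm (by rw [volume_box X hR.le]; positivity)
  rw [volume_box X hR.le] at h4
  rw [coherentTransform_apply hcont hΨ, norm_smul, mul_pow, Real.norm_of_nonneg (by positivity)]
  set N := Module.finrank ℂ X
  set A := ∫ v in box X R, ‖⟪c (modePoint v), f⟫_ℂ‖ ^ 2
  have hp : 0 < Real.pi ^ N := by positivity
  calc _ ≤ (Real.pi ^ N)⁻¹ ^ 2 * (Real.pi ^ N * A + ε * ((2 * R) ^ (2 * N) * A)) := by
        gcongr
        refine h3.trans ?_
        gcongr
    _ = (Real.pi ^ N)⁻¹ ^ 2 * (Real.pi ^ N + ε * (2 * R) ^ (2 * N)) * A := by ring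
    _ ≤ (Real.pi ^ N)⁻¹ ^ 2 * (Real.pi ^ N + ε * (2 * R) ^ (2 * N)) * (Real.pi ^ N * ‖f‖ ^ 2) := by
        gcongr
    _ = _ := by simp only [N]; field_simp

/-- The transform maps coherent vectors close to vectors with Gaussian overlaps. -/
theorem re_inner_coherentTransform_ge (hc : ∀ x y, ⟪c x, c y⟫_ℂ = gaussKernel x y)
    {R ε s : ℝ} (hs : 0 ≤ s) {Ψ : RealCoord X → H} (hΨ : Continuous Ψ)
    {ψ : H} {x : X} (hx : ‖x‖ + s ≤ R)
    (hcross : ∀ v ∈ box X R, ‖⟪ψ, Ψ v⟫_ℂ - gaussKernel x (modePoint v)‖ ≤ ε) :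
    1 - 2 ^ Module.finrank ℂ X * (Real.exp (-(s ^ 2 / 2)) + ε) ≤
      (⟪ψ, coherentTransform R c Ψ (c x)⟫_ℂ).re := by
  have hcont : Continuous c := continuous_of_continuous_inner (by
    simp_rw [hc]; exact continuous_gaussKernel)
  have hcm : Continuous fun v : RealCoord X => c (modePoint v) := hcont.comp continuous_modePoint
  have hB : IsCompact (box X R) := isCompact_closedBall _ _
  have hκ : Continuous fun v : RealCoord X => gaussKernel (modePoint v) x := by
    simp_rw [← hc]; exact hcm.inner continuous_const
  have hκ' : Continuous fun v : RealCoord X => gaussKernel x (modePoint v) := by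
    simp_rw [← hc]; exact continuous_const.inner hcm
  have hIc : ∀ g : RealCoord X → ℂ, Continuous g → IntegrableOn g (box X R) := fun g hg =>
    hg.continuousOn.integrableOn_compact hB
  have hI : ∀ g : RealCoord X → ℝ, Continuous g → IntegrableOn g (box X R) := fun g hg =>
    hg.continuousOn.integrableOn_compact hB
  rw [coherentTransform_apply hcont hΨ, ← Complex.coe_smul, inner_smul_right]
  simp_rw [hc]
  rw [inner_setIntegral_smul hB hκ hΨ, Complex.re_ofReal_mul]
  set N := Module.finrank ℂ X
  have hε : 0 ≤ ε := (norm_nonneg _).trans (hcross 0 (Metric.mem_closedBall_self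
    (by linarith [norm_nonneg x])))
  -- If the cross overlaps were exactly Gaussian, the integrand would be `|κ|²`, whose integral over
  -- the whole space is `π^N`. What remains are the kernel error and the mass outside the cube.
  have hsplit : ∫ v in box X R, gaussKernel (modePoint v) x * ⟪ψ, Ψ v⟫_ℂ =
      ((∫ v in box X R, ‖gaussKernel x (modePoint v)‖ ^ 2 : ℝ) : ℂ) +
      ∫ v in box X R, gaussKernel (modePoint v) x *
        (⟪ψ, Ψ v⟫_ℂ - gaussKernel x (modePoint v)) := by
    rw [← integral_complex_ofReal, ← integral_add
      (hIc (fun v => ((‖gaussKernel x (modePoint v)‖ ^ 2 : ℝ) : ℂ))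
        (Complex.continuous_ofReal.comp (hκ'.norm.pow 2)))
      (hIc (fun v => gaussKernel (modePoint v) x * (⟪ψ, Ψ v⟫_ℂ - gaussKernel x (modePoint v)))
        (hκ.mul ((continuous_const.inner hΨ).sub hκ')))]
    refine integral_congr_ae (Eventually.of_forall fun v => ?_)
    simp only [norm_gaussKernel_sq]
    ring
  have herr : ‖∫ v in box X R, gaussKernel (modePoint v) x *
        (⟪ψ, Ψ v⟫_ℂ - gaussKernel x (modePoint v))‖ ≤ ε * (2 * Real.pi) ^ N := by
    calc _ ≤ ∫ v in box X R, ε * ‖gaussKernel x (modePoint v)‖ := by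
          refine norm_integral_le_of_norm_le (hI _ (continuous_const.mul hκ'.norm))
            ((ae_restrict_iff' hB.measurableSet).2 (Eventually.of_forall fun v hv => ?_))
          rw [norm_mul, ← conj_gaussKernel, Complex.norm_conj, mul_comm]
          exact mul_le_mul_of_nonneg_right (hcross v hv) (norm_nonneg _)
      _ ≤ ∫ v, ε * ‖gaussKernel x (modePoint v)‖ :=
          setIntegral_le_integral ((integrable_norm_gaussKernel x).const_mul _)
            (Eventually.of_forall fun v => by positivity)
      _ = _ := by rw [integral_const_mul, integral_norm_gaussKernel]
  have htail : Real.pi ^ N - Real.exp (-(s ^ 2 / 2)) * (2 * Real.pi) ^ N ≤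
      ∫ v in box X R, ‖gaussKernel x (modePoint v)‖ ^ 2 := by
    have h1 := integral_add_compl hB.measurableSet (integrable_norm_gaussKernel_sq x)
    rw [integral_norm_gaussKernel_sq] at h1
    have h2 := setIntegral_norm_gaussKernel_sq_le x hB.measurableSet.compl hs (fun v hv => by
      rw [Set.mem_compl_iff, mem_closedBall_zero_iff, not_le] at hv
      -- The norm of the real coordinates is the sup norm. A point outside the cube has one
      -- coordinate beyond `R`, hence norm beyond `R ≥ ‖x‖ + s` and distance at least `s` from `x`.
      obtain ⟨i, hi⟩ : ∃ i, R < |v i| := by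
        by_contra hcon
        push Not at hcon
        exact absurd hv (not_lt.2 ((pi_norm_le_iff_of_nonneg
          (by linarith [norm_nonneg x])).2 hcon))
      have h3 := abs_le_norm_modePoint v i
      have h4 := norm_sub_norm_le (modePoint v) x
      rw [norm_sub_rev] at h4
      linarith)
    linarith
  rw [hsplit, Complex.add_re, Complex.ofReal_re]
  have h5 := (abs_le.1 ((Complex.abs_re_le_norm _).trans herr)).1
  rw [inv_mul_eq_div, le_div_iff₀ (by positivity)]
  have h6 : (1 - 2 ^ N * (Real.exp (-(s ^ 2 / 2)) + ε)) * Real.pi ^ N =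
      Real.pi ^ N - Real.exp (-(s ^ 2 / 2)) * (2 * Real.pi) ^ N - ε * (2 * Real.pi) ^ N := by
    rw [mul_pow]; ring
  linarith

theorem norm_sub_le_sqrt {G : Type*} [NormedAddCommGroup G] [InnerProductSpace ℂ G] {x y : G}
    {η : ℝ} (hx : ‖x‖ ≤ 1) (hy : ‖y‖ = 1) (h : 1 - η ≤ (⟪y, x⟫_ℂ).re) :
    ‖x - y‖ ≤ Real.sqrt (2 * η) := by
  refine Real.le_sqrt_of_sq_le ?_
  rw [norm_sub_rev, @norm_sub_sq ℂ, hy, RCLike.re_eq_complex_re]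
  nlinarith [norm_nonneg x]

/-- A bound on the Le Cam distance between a model of pure states and a coherent state model, in
terms of the Gram kernel of an auxiliary continuous family `Ψ` with nearly Gaussian overlaps. -/
theorem leCam_pureState_coherent_le {gF : ℕ → F} (hgF : IsParseval gF) {gH : ℕ → H}
    (hgH : IsParseval gH) (hc : ∀ x y, ⟪c x, c y⟫_ℂ = gaussKernel x y) {R ε s : ℝ} (hR : 0 < R)
    (hε : 0 ≤ ε) (hs : 0 ≤ s) {Ψ : RealCoord X → H} (hΨ : Continuous Ψ)
    (hgram : ∀ u ∈ box X R, ∀ v ∈ box X R,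
      ‖⟪Ψ u, Ψ v⟫_ℂ - gaussKernel (modePoint u) (modePoint v)‖ ≤ ε)
    {Θ : Type*} {ψ : Θ → H} (hψ : ∀ θ, ‖ψ θ‖ = 1) {x : Θ → X} (hx : ∀ θ, ‖x θ‖ + s ≤ R)
    (hcross : ∀ θ, ∀ v ∈ box X R, ‖⟪ψ θ, Ψ v⟫_ℂ - gaussKernel (x θ) (modePoint v)‖ ≤ ε)
    {e : H} (he : ‖e‖ = 1) :
    leCam (fun θ => pureState (ψ θ)) (fun θ => pureState (c (x θ))) ≤
      ENNReal.ofReal (4 * Real.sqrt (2 * (2 ^ Module.finrank ℂ X * (Real.exp (-(s ^ 2 / 2)) + ε) +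
        ε * (2 * R) ^ (2 * Module.finrank ℂ X) / Real.pi ^ Module.finrank ℂ X))) := by
  have hcn : ∀ x, ‖c x‖ = 1 := fun x =>
    norm_eq_one_of_inner_self (by rw [hc, gaussKernel_self])
  set N := Module.finrank ℂ X with hN
  set b := ε * (2 * R) ^ (2 * N) / Real.pi ^ N with hb
  set a := 2 ^ N * (Real.exp (-(s ^ 2 / 2)) + ε) with ha
  have hb0 : 0 ≤ b := by positivity
  have ha0 : 0 ≤ a := by positivity
  set L := Real.sqrt (1 + b) with hL
  have hL1 : 1 ≤ L := Real.one_le_sqrt.2 (by linarith)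
  have hLsq : L ^ 2 = 1 + b := Real.sq_sqrt (by linarith)
  -- Division by the norm bound gives a contraction, and since `L⁻¹ ≥ 1 - b` it lowers the real part
  -- of the overlap by at most `b`.
  let S : F →L[ℂ] H := (L⁻¹ : ℝ) • coherentTransform R c Ψ
  have hS : ‖S‖ ≤ 1 := by
    refine ContinuousLinearMap.opNorm_le_bound _ zero_le_one fun f => ?_
    have h1 := norm_coherentTransform_apply_sq_le hc hR hε hΨ hgram f
    have h2 : ‖coherentTransform R c Ψ f‖ ≤ L * ‖f‖ := by
      refine le_of_sq_le_sq ?_ (by positivity)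
      rw [mul_pow, hLsq]
      exact h1
    change ‖(L⁻¹ : ℝ) • coherentTransform R c Ψ f‖ ≤ _
    rw [norm_smul, Real.norm_of_nonneg (by positivity), one_mul, inv_mul_le_iff₀ (by positivity)]
    exact h2
  have hre : ∀ θ, 1 - (a + b) ≤ (⟪ψ θ, S (c (x θ))⟫_ℂ).re := by
    intro θ
    have h1 := re_inner_coherentTransform_ge hc hs hΨ (hx θ) (hcross θ)
    change _ ≤ (⟪ψ θ, (L⁻¹ : ℝ) • coherentTransform R c Ψ (c (x θ))⟫_ℂ).re
    rw [← Complex.coe_smul, inner_smul_right, Complex.re_ofReal_mul]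
    have h2 : L⁻¹ * (1 - a) ≤ L⁻¹ * (⟪ψ θ, coherentTransform R c Ψ (c (x θ))⟫_ℂ).re := by
      gcongr
    refine le_trans ?_ h2
    have h3 : L⁻¹ ≤ 1 := inv_le_one_of_one_le₀ hL1
    have h4 : 1 - b ≤ L⁻¹ := by
      rw [← one_div, le_div_iff₀ (by positivity)]
      nlinarith
    -- The sign of `1 - a` decides which bound on `L⁻¹` is useful: `L⁻¹ ≥ 1 - b` if it is
    -- nonnegative, `L⁻¹ ≤ 1` otherwise.
    rcases le_or_gt a 1 with h | h
    · nlinarith [mul_nonneg ha0 hb0]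
    · nlinarith
  have hSn : ∀ f, ‖S f‖ ≤ ‖f‖ := fun f => by simpa using S.le_of_opNorm_le hS f
  have hSa : ‖S.adjoint‖ ≤ 1 := by rwa [LinearIsometryEquiv.norm_map]
  have hSan : ∀ f, ‖S.adjoint f‖ ≤ ‖f‖ := fun f => by simpa using S.adjoint.le_of_opNorm_le hSa f
  obtain ⟨T₁, hT₁⟩ := exists_channel_traceNorm_le hgH S.adjoint hSa (c 0) (hcn 0)
  obtain ⟨T₂, hT₂⟩ := exists_channel_traceNorm_le hgF S hS e he
  refine max_le ?_ ?_
  -- From the output model to the coherent one the adjoint is used. Its overlap has the same real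
  -- part, so no second estimate is required.
  · refine iInf_le_of_le T₁ (iSup_le fun θ => hT₁ _ _ _ (hψ θ) (hcn _) ?_)
    refine norm_sub_le_sqrt ((hSan _).trans (hψ θ).le) (hcn _) ?_
    rw [ContinuousLinearMap.adjoint_inner_right, ← inner_conj_symm, Complex.conj_re]
    exact hre θ
  · refine iInf_le_of_le T₂ (iSup_le fun θ => hT₂ _ _ _ (hcn _) (hψ θ) ?_)
    exact norm_sub_le_sqrt ((hSn _).trans (hcn _).le) (hψ θ) (hre θ)

end CoherentTransform

/-! ### Bounds for the entrywise maximum norm of matrices. -/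

section MatrixNorm

variable {l m n : Type*} [Fintype l] [Fintype m] [Fintype n]

/-- Matrices carry the entrywise maximum norm, which is not submultiplicative. This is the source of
the dimension factors in all later constants. -/
theorem norm_matrix_mul_le (A : Matrix l m ℂ) (B : Matrix m n ℂ) :
    ‖A * B‖ ≤ Fintype.card m * ‖A‖ * ‖B‖ := by
  rw [Matrix.norm_le_iff (by positivity)]
  intro i j
  rw [Matrix.mul_apply]
  calc ‖∑ x, A i x * B x j‖ ≤ ∑ x : m, ‖A‖ * ‖B‖ := norm_sum_le_of_le _ fun x _ => by
        rw [norm_mul]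
        exact mul_le_mul (A.norm_entry_le_entrywise_sup_norm) (B.norm_entry_le_entrywise_sup_norm)
          (norm_nonneg _) (norm_nonneg _)
    _ = _ := by rw [Finset.sum_const, Finset.card_univ, nsmul_eq_mul, mul_assoc]

theorem norm_trace_le (A : Matrix n n ℂ) : ‖A.trace‖ ≤ Fintype.card n * ‖A‖ := by
  rw [Matrix.trace]
  calc _ ≤ ∑ _x : n, ‖A‖ := norm_sum_le_of_le _ fun x _ => A.norm_entry_le_entrywise_sup_norm
    _ = _ := by rw [Finset.sum_const, Finset.card_univ, nsmul_eq_mul]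

theorem norm_one_matrix_le [DecidableEq n] : ‖(1 : Matrix n n ℂ)‖ ≤ 1 := by
  rw [Matrix.norm_le_iff zero_le_one]
  intro i j
  rw [Matrix.one_apply]
  split_ifs <;> simp

theorem norm_ampliate_le {d : ℕ} (k : ℕ) (X : Matrix (Fin d) (Fin d) ℂ) :
    ‖ampliate k X‖ ≤ ‖X‖ := by
  rw [Matrix.norm_le_iff (norm_nonneg _)]
  intro i j
  rw [ampliate, Matrix.kroneckerMap_apply, norm_mul]
  calc _ ≤ ‖X‖ * 1 := mul_le_mul X.norm_entry_le_entrywise_sup_norm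
        (((1 : Matrix (Fin k) (Fin k) ℂ).norm_entry_le_entrywise_sup_norm).trans
          norm_one_matrix_le) (norm_nonneg _) (norm_nonneg _)
    _ = _ := mul_one _

/-- The mean of the squares in place of the product of the norms can be summed over words directly,
without a further Cauchy-Schwarz inequality. -/
theorem norm_dotProduct_mulVec_le (u v : EuclideanSpace ℂ n) (X : Matrix n n ℂ) :
    ‖star (WithLp.ofLp u) ⬝ᵥ X *ᵥ WithLp.ofLp v‖ ≤
      Fintype.card n * ‖X‖ * ((‖u‖ ^ 2 + ‖v‖ ^ 2) / 2) := by
  calc ‖star (WithLp.ofLp u) ⬝ᵥ X *ᵥ WithLp.ofLp v‖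
      ≤ ∑ a, ∑ b, ‖X‖ * ((‖u a‖ ^ 2 + ‖v b‖ ^ 2) / 2) := by
        rw [dotProduct]
        refine norm_sum_le_of_le _ fun a _ => ?_
        rw [Matrix.mulVec, dotProduct, Finset.mul_sum]
        refine norm_sum_le_of_le _ fun b _ => ?_
        rw [norm_mul, norm_mul, Pi.star_apply, norm_star, mul_left_comm]
        refine mul_le_mul X.norm_entry_le_entrywise_sup_norm ?_ (by positivity) (norm_nonneg _)
        nlinarith [sq_nonneg (‖u a‖ - ‖v b‖)]
    _ = _ := by
        rw [EuclideanSpace.norm_sq_eq, EuclideanSpace.norm_sq_eq]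
        have h : ∀ a, ∑ b, ‖X‖ * ((‖u a‖ ^ 2 + ‖v b‖ ^ 2) / 2) =
            ‖X‖ * ((Fintype.card n * ‖u a‖ ^ 2 + ∑ b, ‖v b‖ ^ 2) / 2) := by
          intro a
          rw [← Finset.mul_sum, ← Finset.sum_div, Finset.sum_add_distrib, Finset.sum_const,
            Finset.card_univ, nsmul_eq_mul]
        simp_rw [h]
        rw [← Finset.mul_sum, ← Finset.sum_div, Finset.sum_add_distrib, ← Finset.mul_sum,
          Finset.sum_const, Finset.card_univ, nsmul_eq_mul]
        ring

end MatrixNorm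

/-! ### Overlaps of output states as iterates of the mixed transfer operator. -/

section Words

variable {d k : ℕ}

theorem ampliate_one (k : ℕ) : ampliate k (1 : Matrix (Fin d) (Fin d) ℂ) = 1 := by
  simp [ampliate]

theorem ampliate_mul (k : ℕ) (X Y : Matrix (Fin d) (Fin d) ℂ) :
    ampliate k (X * Y) = ampliate k X * ampliate k Y := by
  rw [ampliate, ampliate, ampliate, ← Matrix.mul_kronecker_mul, one_mul]

theorem ampliate_add (k : ℕ) (X Y : Matrix (Fin d) (Fin d) ℂ) :
    ampliate k (X + Y) = ampliate k X + ampliate k Y := Matrix.add_kronecker _ _ _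

theorem ampliate_smul (k : ℕ) (c : ℂ) (X : Matrix (Fin d) (Fin d) ℂ) :
    ampliate k (c • X) = c • ampliate k X := Matrix.smul_kronecker _ _ _

theorem conjTranspose_ampliate (k : ℕ) (X : Matrix (Fin d) (Fin d) ℂ) :
    (ampliate k X)ᴴ = ampliate k Xᴴ := by
  rw [ampliate, ampliate, Matrix.conjTranspose_kronecker, Matrix.conjTranspose_one]

/-- The mixed transfer operator `X ↦ V* (X ⊗ 1) V'`. -/
def transfer (V V' : Op d k) : Matrix (Fin d) (Fin d) ℂ →ₗ[ℂ] Matrix (Fin d) (Fin d) ℂ where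
  toFun X := Vᴴ * ampliate k X * V'
  map_add' X Y := by rw [ampliate_add, Matrix.mul_add, Matrix.add_mul]
  map_smul' c X := by
    rw [ampliate_smul, Matrix.mul_smul, Matrix.smul_mul]; rfl

theorem transfer_apply (V V' : Op d k) (X : Matrix (Fin d) (Fin d) ℂ) :
    transfer V V' X = Vᴴ * ampliate k X * V' := rfl

theorem ampliate_mul_apply (X : Matrix (Fin d) (Fin d) ℂ) (V : Op d k) (a : Fin d) (i : Fin k)
    (b : Fin d) : (ampliate k X * V) (a, i) b = (X * kraus V i) a b := by
  rw [Matrix.mul_apply, Fintype.sum_prod_type, Matrix.mul_apply]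
  refine Finset.sum_congr rfl fun c _ => ?_
  simp [ampliate, Matrix.kroneckerMap_apply, kraus, Matrix.one_apply]

theorem transfer_eq_sum (V V' : Op d k) (X : Matrix (Fin d) (Fin d) ℂ) :
    transfer V V' X = ∑ i, (kraus V i)ᴴ * X * kraus V' i := by
  ext a b
  rw [transfer_apply, Matrix.mul_assoc, Matrix.mul_apply, Fintype.sum_prod_type,
    Finset.sum_comm, Matrix.sum_apply]
  refine Finset.sum_congr rfl fun i _ => ?_
  rw [Matrix.mul_assoc, Matrix.mul_apply]
  refine Finset.sum_congr rfl fun c _ => ?_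
  rw [ampliate_mul_apply]
  rfl

/-- Words are split at their last letter, in accordance with the recursion defining `krausWord`. -/
theorem sum_krausWord_succ {M : Type*} [AddCommMonoid M] (n : ℕ)
    (f : Fin k → (Fin n → Fin k) → M) :
    ∑ w : Fin (n + 1) → Fin k, f (w (Fin.last n)) (fun j => w j.castSucc) =
      ∑ w : Fin n → Fin k, ∑ i, f i w := by
  rw [Finset.sum_comm, ← Fintype.sum_prod_type']
  refine Fintype.sum_equiv (Fin.snocEquiv fun _ => Fin k).symm _ _ fun w => ?_
  rfl

/-- The Kraus operators of the last step stand next to `X`, so they are absorbed into it first and a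
sum over shorter words remains. -/
theorem sum_krausWord (V V' : Op d k) (n : ℕ) (X : Matrix (Fin d) (Fin d) ℂ) :
    ∑ w, (krausWord V n w)ᴴ * X * krausWord V' n w = (transfer V V')^[n] X := by
  induction n generalizing X with
  | zero => simp [krausWord]
  | succ n ih =>
    rw [Function.iterate_succ_apply, ← ih]
    simp only [krausWord]
    rw [sum_krausWord_succ n (fun i w => (kraus V i * krausWord V n w)ᴴ * X *
      (kraus V' i * krausWord V' n w))]
    refine Finset.sum_congr rfl fun w _ => ?_
    rw [transfer_eq_sum, Finset.mul_sum, Finset.sum_mul]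
    refine Finset.sum_congr rfl fun i _ => ?_
    rw [Matrix.conjTranspose_mul]
    simp only [Matrix.mul_assoc]

/-- The overlap `⟨Ψ_V(n), (X ⊗ 1) Ψ_V'(n)⟩` with initial vectors `φ` and `φ'`. -/
def overlap (V V' : Op d k) (φ φ' : EuclideanSpace ℂ (Fin d)) (n : ℕ)
    (X : Matrix (Fin d) (Fin d) ℂ) : ℂ :=
  star (WithLp.ofLp φ) ⬝ᵥ (transfer V V')^[n] X *ᵥ WithLp.ofLp φ'

theorem overlap_succ (V V' : Op d k) (φ φ' : EuclideanSpace ℂ (Fin d)) (n : ℕ)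
    (X : Matrix (Fin d) (Fin d) ℂ) :
    overlap V V' φ φ' (n + 1) X = overlap V V' φ φ' n (transfer V V' X) := rfl

theorem overlap_add (V V' : Op d k) (φ φ' : EuclideanSpace ℂ (Fin d)) (n : ℕ)
    (X Y : Matrix (Fin d) (Fin d) ℂ) :
    overlap V V' φ φ' n (X + Y) = overlap V V' φ φ' n X + overlap V V' φ φ' n Y := by
  rw [overlap, overlap, overlap, iterate_map_add, Matrix.add_mulVec, dotProduct_add]

theorem overlap_smul (V V' : Op d k) (φ φ' : EuclideanSpace ℂ (Fin d)) (n : ℕ) (c : ℂ)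
    (X : Matrix (Fin d) (Fin d) ℂ) :
    overlap V V' φ φ' n (c • X) = c * overlap V V' φ φ' n X := by
  have h : (transfer V V')^[n] (c • X) = c • (transfer V V')^[n] X := by
    induction n generalizing X with
    | zero => rfl
    | succ n ih => rw [Function.iterate_succ_apply, map_smul, ih, Function.iterate_succ_apply]
  rw [overlap, overlap, h, Matrix.smul_mulVec, dotProduct_smul, smul_eq_mul]

theorem overlap_eq_sum (V V' : Op d k) (φ φ' : EuclideanSpace ℂ (Fin d)) (n : ℕ)
    (X : Matrix (Fin d) (Fin d) ℂ) :
    overlap V V' φ φ' n X = ∑ w, star (krausWord V n w *ᵥ WithLp.ofLp φ) ⬝ᵥ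
      X *ᵥ (krausWord V' n w *ᵥ WithLp.ofLp φ') := by
  rw [overlap, ← sum_krausWord, Matrix.sum_mulVec, dotProduct_sum]
  refine Finset.sum_congr rfl fun w _ => ?_
  rw [Matrix.star_mulVec, Matrix.dotProduct_mulVec, Matrix.dotProduct_mulVec,
    Matrix.dotProduct_mulVec, Matrix.vecMul_vecMul, Matrix.vecMul_vecMul, Matrix.mul_assoc]

theorem inner_systemOutput (V V' : Op d k) (φ φ' : EuclideanSpace ℂ (Fin d)) (n : ℕ) :
    ⟪systemOutput φ n V, systemOutput φ' n V'⟫_ℂ = overlap V V' φ φ' n 1 := by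
  rw [overlap_eq_sum, PiLp.inner_apply, Fintype.sum_prod_type, Finset.sum_comm]
  refine Finset.sum_congr rfl fun w _ => ?_
  rw [Matrix.one_mulVec, dotProduct]
  refine Finset.sum_congr rfl fun a _ => ?_
  rw [RCLike.inner_apply, mul_comm]
  rfl

theorem overlap_self_one {V : Op d k} (hV : Vᴴ * V = 1) (φ : EuclideanSpace ℂ (Fin d)) (n : ℕ) :
    overlap V V φ φ n 1 = ⟪φ, φ⟫_ℂ := by
  have h : (transfer V V)^[n] 1 = 1 := by
    refine Function.iterate_fixed ?_ n
    rw [transfer_apply, ampliate_one, Matrix.mul_one, hV]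
  rw [overlap, h, Matrix.one_mulVec, PiLp.inner_apply, dotProduct]
  exact Finset.sum_congr rfl fun a _ => by rw [RCLike.inner_apply, mul_comm]; rfl

theorem norm_systemOutput {V : Op d k} (hV : Vᴴ * V = 1) {φ : EuclideanSpace ℂ (Fin d)}
    (hφ : ‖φ‖ = 1) (n : ℕ) : ‖systemOutput φ n V‖ = 1 := by
  refine norm_eq_one_of_inner_self ?_
  rw [inner_systemOutput, overlap_self_one hV, ← ofReal_norm_sq_eq_inner, hφ]
  simp

/-- Uniform in `n`: the squared norms of the vectors obtained from all words add up to `1`, because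
the output state of an isometry is normalised. This replaces a bound on powers of the transfer
operator. -/
theorem norm_overlap_le {V V' : Op d k} (hV : Vᴴ * V = 1) (hV' : V'ᴴ * V' = 1)
    {φ φ' : EuclideanSpace ℂ (Fin d)} (hφ : ‖φ‖ = 1) (hφ' : ‖φ'‖ = 1) (n : ℕ)
    (X : Matrix (Fin d) (Fin d) ℂ) : ‖overlap V V' φ φ' n X‖ ≤ d * ‖X‖ := by
  have hsum : ∀ {V : Op d k} (hV : Vᴴ * V = 1) {φ : EuclideanSpace ℂ (Fin d)} (hφ : ‖φ‖ = 1),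
      ∑ w, ‖(WithLp.toLp 2 (krausWord V n w *ᵥ WithLp.ofLp φ) : EuclideanSpace ℂ (Fin d))‖ ^ 2 =
        1 := by
    intro V hV φ hφ
    have h1 : ‖systemOutput φ n V‖ ^ 2 = 1 := by rw [norm_systemOutput hV hφ, one_pow]
    rw [← h1, EuclideanSpace.norm_sq_eq, Fintype.sum_prod_type, Finset.sum_comm]
    exact Finset.sum_congr rfl fun w _ => EuclideanSpace.norm_sq_eq _
  rw [overlap_eq_sum]
  calc _ ≤ ∑ w, (d : ℝ) * ‖X‖ *
        ((‖(WithLp.toLp 2 (krausWord V n w *ᵥ WithLp.ofLp φ) : EuclideanSpace ℂ (Fin d))‖ ^ 2 +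
        ‖(WithLp.toLp 2 (krausWord V' n w *ᵥ WithLp.ofLp φ') : EuclideanSpace ℂ (Fin d))‖ ^ 2)
          / 2) := norm_sum_le_of_le _ fun w _ => by
        have := norm_dotProduct_mulVec_le
          (WithLp.toLp 2 (krausWord V n w *ᵥ WithLp.ofLp φ) : EuclideanSpace ℂ (Fin d))
          (WithLp.toLp 2 (krausWord V' n w *ᵥ WithLp.ofLp φ')) X
        rwa [Fintype.card_fin] at this
    _ = _ := by
        rw [← Finset.mul_sum, ← Finset.sum_div, Finset.sum_add_distrib, hsum hV hφ, hsum hV' hφ']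
        ring

end Words

/-- A linear map on a finite dimensional normed space is bounded. -/
theorem LinearMap.exists_norm_le_of_finiteDimensional {𝕜 E F : Type*} [RCLike 𝕜]
    [NormedAddCommGroup E] [NormedSpace 𝕜 E] [FiniteDimensional 𝕜 E] [NormedAddCommGroup F]
    [NormedSpace 𝕜 F] (f : E →ₗ[𝕜] F) : ∃ C ≥ 0, ∀ x, ‖f x‖ ≤ C * ‖x‖ :=
  ⟨‖LinearMap.toContinuousLinearMap f‖, norm_nonneg _,
    (LinearMap.toContinuousLinearMap f).le_opNorm⟩

/-! ### Uniqueness of the stationary state, the Poisson equation and the identifiable projection. -/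

section Irreducible

variable {d k : ℕ}

/-- Positive definiteness is stable under small Hermitian perturbations. -/
theorem exists_posDef_of_norm_sub_lt [Nonempty (Fin d)] {ρ : Matrix (Fin d) (Fin d) ℂ}
    (hρ : ρ.PosDef) : ∃ δ > 0, ∀ Y : Matrix (Fin d) (Fin d) ℂ, Y.IsHermitian → ‖Y - ρ‖ < δ →
      Y.PosDef := by
  let q : EuclideanSpace ℂ (Fin d) → ℝ := fun x =>
    (star (WithLp.ofLp x) ⬝ᵥ ρ *ᵥ WithLp.ofLp x).re
  have hq : Continuous q := by
    refine Complex.continuous_re.comp ?_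
    have h1 : Continuous fun x : EuclideanSpace ℂ (Fin d) => WithLp.ofLp x :=
      PiLp.continuous_ofLp 2 _
    exact h1.star.dotProduct (continuous_const.matrix_mulVec h1)
  -- The minimum of the quadratic form on the unit sphere measures the room for a perturbation; the
  -- factor `1 / d` comes from the entrywise norm.
  obtain ⟨x₀, hx₀, hmin⟩ := (isCompact_sphere (0 : EuclideanSpace ℂ (Fin d)) 1).exists_isMinOn
    (NormedSpace.sphere_nonempty.2 zero_le_one) hq.continuousOn
  have hx₀n : ‖x₀‖ = 1 := by simpa using hx₀
  have hx₀0 : WithLp.ofLp x₀ ≠ 0 := fun h => by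
    have : x₀ = 0 := by ext i; exact congrFun h i
    rw [this, norm_zero] at hx₀n
    exact zero_ne_one hx₀n
  have hpos : 0 < q x₀ := (Complex.lt_def.1 (hρ.dotProduct_mulVec_pos hx₀0)).1
  have hd : (0 : ℝ) < d := by
    have : 0 < d := Fin.pos_iff_nonempty.2 inferInstance
    exact_mod_cast this
  refine ⟨q x₀ / d, by positivity, fun Y hY hYρ => ?_⟩
  refine Matrix.PosDef.of_dotProduct_mulVec_pos hY fun x hx => ?_
  have him : (star x ⬝ᵥ Y *ᵥ x).im = 0 := hY.im_star_dotProduct_mulVec_self x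
  refine Complex.lt_def.2 ⟨?_, him.symm⟩
  have hx' : (WithLp.toLp 2 x : EuclideanSpace ℂ (Fin d)) ≠ 0 := fun h => hx (by
    have := congrArg WithLp.ofLp h; simpa using this)
  set z : EuclideanSpace ℂ (Fin d) := WithLp.toLp 2 x with hz
  have hzn : 0 < ‖z‖ := norm_pos_iff.2 hx'
  have h1 : q x₀ * ‖z‖ ^ 2 ≤ q z := by
    have h2 := hmin (a := ((‖z‖⁻¹ : ℝ) : ℂ) • z) (by
      rw [mem_sphere_zero_iff_norm, norm_smul, Complex.norm_real, norm_inv, norm_norm,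
        inv_mul_cancel₀ hzn.ne'])
    have h3 : q (((‖z‖⁻¹ : ℝ) : ℂ) • z) = ‖z‖⁻¹ ^ 2 * q z := by
      simp only [q, WithLp.ofLp_smul, star_smul, Matrix.mulVec_smul, dotProduct_smul,
        smul_dotProduct, smul_eq_mul, Complex.star_def, Complex.conj_ofReal,
        Complex.re_ofReal_mul]
      ring
    rw [Set.mem_ofPred_eq, h3] at h2
    calc q x₀ * ‖z‖ ^ 2 ≤ ‖z‖⁻¹ ^ 2 * q z * ‖z‖ ^ 2 := by gcongr
      _ = q z := by field_simp
  have h4 := norm_dotProduct_mulVec_le z z (Y - ρ)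
  rw [Fintype.card_fin, Matrix.sub_mulVec, dotProduct_sub] at h4
  have h5 := (abs_le.1 ((Complex.abs_re_le_norm _).trans h4)).1
  rw [Complex.sub_re] at h5
  have h6 : (d : ℝ) * ‖Y - ρ‖ * ((‖z‖ ^ 2 + ‖z‖ ^ 2) / 2) < q x₀ * ‖z‖ ^ 2 := by
    have : (d : ℝ) * ‖Y - ρ‖ < q x₀ := by
      rwa [lt_div_iff₀ hd, mul_comm] at hYρ
    have h7 : 0 < ‖z‖ ^ 2 := by positivity
    nlinarith
  have h8 : (star x ⬝ᵥ ρ *ᵥ x).re = q z := rfl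
  change 0 < (star x ⬝ᵥ Y *ᵥ x).re
  have h9 : (star (WithLp.ofLp z) ⬝ᵥ Y *ᵥ WithLp.ofLp z).re = (star x ⬝ᵥ Y *ᵥ x).re := rfl
  have h10 : (star (WithLp.ofLp z) ⬝ᵥ ρ *ᵥ WithLp.ofLp z).re = q z := rfl
  linarith

theorem schrodinger_add (V : Op d k) (X Y : Matrix (Fin d) (Fin d) ℂ) :
    schrodinger V (X + Y) = schrodinger V X + schrodinger V Y := by
  simp [schrodinger, Matrix.mul_add, Matrix.add_mul, Finset.sum_add_distrib]

theorem schrodinger_smul (V : Op d k) (c : ℂ) (X : Matrix (Fin d) (Fin d) ℂ) :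
    schrodinger V (c • X) = c • schrodinger V X := by
  simp [schrodinger, Finset.smul_sum]

theorem schrodinger_conjTranspose (V : Op d k) (X : Matrix (Fin d) (Fin d) ℂ) :
    schrodinger V Xᴴ = (schrodinger V X)ᴴ := by
  simp [schrodinger, Matrix.conjTranspose_sum, Matrix.conjTranspose_mul, Matrix.mul_assoc]

theorem trace_schrodinger_mul (V : Op d k) (Y X : Matrix (Fin d) (Fin d) ℂ) :
    (schrodinger V Y * X).trace = (Y * transfer V V X).trace := by
  rw [schrodinger, transfer_eq_sum, Finset.sum_mul, Finset.mul_sum, Matrix.trace_sum,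
    Matrix.trace_sum]
  refine Finset.sum_congr rfl fun i _ => ?_
  rw [Matrix.mul_assoc, Matrix.mul_assoc, Matrix.trace_mul_comm]
  simp only [Matrix.mul_assoc]

theorem transfer_one {V V' : Op d k} : transfer V V' 1 = Vᴴ * V' := by
  rw [transfer_apply, ampliate_one, Matrix.mul_one]

theorem trace_schrodinger {V : Op d k} (hV : Vᴴ * V = 1) (Y : Matrix (Fin d) (Fin d) ℂ) :
    (schrodinger V Y).trace = Y.trace := by
  have h := trace_schrodinger_mul V Y 1
  rwa [transfer_one, hV, Matrix.mul_one, Matrix.mul_one] at h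

theorem nonempty_fin_of_trace_eq_one {ρ : Matrix (Fin d) (Fin d) ℂ} (h : ρ.trace = 1) :
    Nonempty (Fin d) := by
  by_contra hcon
  rw [not_nonempty_iff] at hcon
  rw [Matrix.trace_eq_zero_of_isEmpty] at h
  exact zero_ne_one h

/-- A traceless Hermitian fixed point `Z ≠ 0` would give a second faithful stationary state `ρ + ε
Z` for small `ε`. The general case follows from the Hermitian and skew-Hermitian parts. -/
theorem eq_zero_of_schrodinger_fixed (V : irreducibleIsometries d k)
    {Y : Matrix (Fin d) (Fin d) ℂ} (hY : schrodinger V.1 Y = Y) (htr : Y.trace = 0) : Y = 0 := by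
  obtain ⟨hρ, hρ1, hρS⟩ := stationaryState_spec V
  set ρ := stationaryState V
  have := nonempty_fin_of_trace_eq_one hρ1
  obtain ⟨δ, hδ, hpos⟩ := exists_posDef_of_norm_sub_lt hρ
  have hherm : ∀ Z : Matrix (Fin d) (Fin d) ℂ, Z.IsHermitian → schrodinger V.1 Z = Z →
      Z.trace = 0 → Z = 0 := by
    intro Z hZ hSZ htZ
    set ε : ℝ := δ / (2 * (‖Z‖ + 1))
    have hε : 0 < ε := by positivity
    have h1 : IsFaithfulStationary V.1 (ρ + (ε : ℂ) • Z) := by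
      refine ⟨hpos _ (hρ.isHermitian.add ?_) ?_, ?_, ?_⟩
      · rw [Matrix.IsHermitian, Matrix.conjTranspose_smul, hZ.eq]
        simp
      · rw [add_sub_cancel_left, norm_smul, Complex.norm_real, Real.norm_of_nonneg hε.le]
        have h2 : ε * (2 * (‖Z‖ + 1)) = δ := by simp only [ε]; field_simp
        nlinarith [norm_nonneg Z]
      · rw [Matrix.trace_add, Matrix.trace_smul, htZ, hρ1]; simp
      · rw [schrodinger_add, schrodinger_smul, hSZ, hρS]
    have h2 := V.2.2.unique h1 (stationaryState_spec V)
    have h3 : (ε : ℂ) • Z = 0 := add_eq_left.1 h2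
    exact (smul_eq_zero.1 h3).resolve_left (by exact_mod_cast hε.ne')
  have h1 : Y + Yᴴ = 0 := by
    refine hherm _ ?_ ?_ ?_
    · rw [Matrix.IsHermitian, Matrix.conjTranspose_add, Matrix.conjTranspose_conjTranspose,
        add_comm]
    · rw [schrodinger_add, schrodinger_conjTranspose, hY]
    · rw [Matrix.trace_add, Matrix.trace_conjTranspose, htr]; simp
  have h2 : Complex.I • (Y + (-1 : ℂ) • Yᴴ) = 0 := by
    refine hherm _ ?_ ?_ ?_
    · rw [Matrix.IsHermitian, Matrix.conjTranspose_smul, Matrix.conjTranspose_add,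
        Matrix.conjTranspose_smul, Matrix.conjTranspose_conjTranspose]
      simp only [Complex.star_def, Complex.conj_I, map_neg, map_one, smul_add, smul_smul]
      rw [add_comm]
      simp
    · rw [schrodinger_smul, schrodinger_add, schrodinger_smul, schrodinger_conjTranspose, hY]
    · rw [Matrix.trace_smul, Matrix.trace_add, Matrix.trace_smul, Matrix.trace_conjTranspose, htr]
      simp
  have h3 := (smul_eq_zero.1 h2).resolve_left Complex.I_ne_zero
  have h4 : (2 : ℂ) • Y = 0 := by
    rw [two_smul]
    calc Y + Y = (Y + Yᴴ) + (Y + (-1 : ℂ) • Yᴴ) := by rw [neg_one_smul]; abel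
      _ = 0 := by rw [h1, h3, add_zero]
  exact (smul_eq_zero.1 h4).resolve_left two_ne_zero

/-- The regularised generator `Y ↦ Y - ∑ Kᵢ Y Kᵢ* + Tr(Y) ρ` in the Schrödinger picture. -/
def schrodingerGenerator (V : Op d k) (ρ : Matrix (Fin d) (Fin d) ℂ) :
    Matrix (Fin d) (Fin d) ℂ →ₗ[ℂ] Matrix (Fin d) (Fin d) ℂ where
  toFun Y := Y - schrodinger V Y + Y.trace • ρ
  map_add' X Y := by rw [schrodinger_add, Matrix.trace_add, add_smul]; abel
  map_smul' c X := by
    rw [schrodinger_smul, Matrix.trace_smul, smul_assoc, RingHom.id_apply, smul_add, smul_sub]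

theorem schrodingerGenerator_apply (V : Op d k) (ρ Y : Matrix (Fin d) (Fin d) ℂ) :
    schrodingerGenerator V ρ Y = Y - schrodinger V Y + Y.trace • ρ := rfl

theorem trace_schrodingerGenerator {V : Op d k} (hV : Vᴴ * V = 1)
    {ρ : Matrix (Fin d) (Fin d) ℂ} (hρ : ρ.trace = 1) (Y : Matrix (Fin d) (Fin d) ℂ) :
    (schrodingerGenerator V ρ Y).trace = Y.trace := by
  rw [schrodingerGenerator_apply, Matrix.trace_add, Matrix.trace_sub, trace_schrodinger hV,
    Matrix.trace_smul, hρ]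
  simp

/-- The channel preserves the trace, so the generator does too, and its kernel is traceless. On
traceless matrices the rank one term drops out and the kernel consists of fixed points. -/
theorem schrodingerGenerator_injective (V : irreducibleIsometries d k) :
    Function.Injective (schrodingerGenerator V.1 (stationaryState V)) := by
  rw [injective_iff_map_eq_zero]
  intro Y hY
  have h1 := trace_schrodingerGenerator V.2.1 (stationaryState_spec V).2.1 Y
  rw [hY, Matrix.trace_zero] at h1
  rw [schrodingerGenerator_apply, ← h1, zero_smul, add_zero, sub_eq_zero] at hY
  exact eq_zero_of_schrodinger_fixed V hY.symm h1.symm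

/-- The regularised generator `X ↦ X - V* (X ⊗ 1) V + Tr(ρ X) 1` in the Heisenberg picture. -/
def heisenbergGenerator (V : Op d k) (ρ : Matrix (Fin d) (Fin d) ℂ) :
    Matrix (Fin d) (Fin d) ℂ →ₗ[ℂ] Matrix (Fin d) (Fin d) ℂ where
  toFun X := X - transfer V V X + (ρ * X).trace • 1
  map_add' X Y := by rw [map_add, Matrix.mul_add, Matrix.trace_add, add_smul]; abel
  map_smul' c X := by
    rw [map_smul, Matrix.mul_smul, Matrix.trace_smul, smul_assoc, RingHom.id_apply, smul_add,
      smul_sub]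

theorem heisenbergGenerator_apply (V : Op d k) (ρ X : Matrix (Fin d) (Fin d) ℂ) :
    heisenbergGenerator V ρ X = X - transfer V V X + (ρ * X).trace • 1 := rfl

theorem trace_mul_heisenbergGenerator (V : Op d k) (ρ X Y : Matrix (Fin d) (Fin d) ℂ) :
    (Y * heisenbergGenerator V ρ X).trace = (schrodingerGenerator V ρ Y * X).trace := by
  rw [heisenbergGenerator_apply, schrodingerGenerator_apply, Matrix.mul_add, Matrix.mul_sub,
    Matrix.trace_add, Matrix.trace_sub, Matrix.add_mul, Matrix.sub_mul, Matrix.trace_add,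
    Matrix.trace_sub, trace_schrodinger_mul, Matrix.mul_smul, Matrix.smul_mul, Matrix.trace_smul,
    Matrix.trace_smul, Matrix.mul_one, smul_eq_mul, smul_eq_mul, mul_comm (ρ * X).trace]

/-- The two generators are dual under the trace pairing. Pairing `X` in the kernel with a preimage
of `Xᴴ` under the other generator gives `Tr (Xᴴ X) = 0`. -/
theorem heisenbergGenerator_injective (V : irreducibleIsometries d k) :
    Function.Injective (heisenbergGenerator V.1 (stationaryState V)) := by
  rw [injective_iff_map_eq_zero]
  intro X hX
  obtain ⟨Y, hY⟩ := (LinearMap.injective_iff_surjective.1 (schrodingerGenerator_injective V)) Xᴴ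
  have h := trace_mul_heisenbergGenerator V.1 (stationaryState V) X Y
  rw [hX, Matrix.mul_zero, Matrix.trace_zero, hY] at h
  exact Matrix.trace_conjTranspose_mul_self_eq_zero_iff.1 h.symm

theorem trace_mul_transfer (V : irreducibleIsometries d k) (X : Matrix (Fin d) (Fin d) ℂ) :
    (stationaryState V * transfer V.1 V.1 X).trace = (stationaryState V * X).trace := by
  rw [← trace_schrodinger_mul, (stationaryState_spec V).2.2]

/-- Solvability of the Poisson equation, with a bound. -/
theorem exists_poisson (V : irreducibleIsometries d k) :
    ∃ C ≥ 0, ∀ M : Matrix (Fin d) (Fin d) ℂ, (stationaryState V * M).trace = 0 →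
      ∃ X, (stationaryState V * X).trace = 0 ∧ X - transfer V.1 V.1 X = M ∧ ‖X‖ ≤ C * ‖M‖ := by
  let e := LinearEquiv.ofInjectiveEndo _ (heisenbergGenerator_injective V)
  obtain ⟨C, hC0, hC⟩ := LinearMap.exists_norm_le_of_finiteDimensional (𝕜 := ℂ) e.symm.toLinearMap
  refine ⟨C, hC0, fun M hM => ⟨e.symm M, ?_⟩⟩
  have h1 : heisenbergGenerator V.1 (stationaryState V) (e.symm M) = M := e.apply_symm_apply M
  -- The trace against `ρ` of the regularised equation shows that the solution is centred, whereupon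
  -- the regularising term vanishes.
  have h2 : (stationaryState V * e.symm M).trace = 0 := by
    have h3 := congrArg (fun Z => (stationaryState V * Z).trace) h1
    simp only [heisenbergGenerator_apply, Matrix.mul_add, Matrix.mul_sub, Matrix.trace_add,
      Matrix.trace_sub, trace_mul_transfer, Matrix.mul_smul, Matrix.trace_smul, Matrix.mul_one,
      (stationaryState_spec V).2.1, hM] at h3
    simpa using h3
  refine ⟨h2, ?_, hC M⟩
  rw [heisenbergGenerator_apply, h2, zero_smul, add_zero] at h1
  exact h1

theorem poisson_unique (V : irreducibleIsometries d k) {X Y : Matrix (Fin d) (Fin d) ℂ}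
    (hX : (stationaryState V * X).trace = 0) (hY : (stationaryState V * Y).trace = 0)
    (h : X - transfer V.1 V.1 X = Y - transfer V.1 V.1 Y) : X = Y := by
  refine heisenbergGenerator_injective V ?_
  rw [heisenbergGenerator_apply, heisenbergGenerator_apply, hX, hY, h]

theorem trace_sub_meanPart (V : irreducibleIsometries d k) (A : Op d k) :
    (stationaryState V * (V.1ᴴ * A - meanPart V A • (1 : Matrix (Fin d) (Fin d) ℂ))).trace = 0 := by
  rw [Matrix.mul_sub, Matrix.trace_sub, Matrix.mul_smul, Matrix.trace_smul, Matrix.mul_one,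
    (stationaryState_spec V).2.1, meanPart]
  simp

/-- Solvability of the Poisson equation makes the choice in `gaugePart` meaningful. The map
`heisenberg V` is `transfer V V` by definition. -/
theorem gaugePart_spec (V : irreducibleIsometries d k) (A : Op d k) :
    (stationaryState V * gaugePart V A).trace = 0 ∧
      gaugePart V A - transfer V.1 V.1 (gaugePart V A) =
        V.1ᴴ * A - meanPart V A • (1 : Matrix (Fin d) (Fin d) ℂ) := by
  obtain ⟨C, -, hC⟩ := exists_poisson V
  obtain ⟨X, h1, h2, -⟩ := hC _ (trace_sub_meanPart V A)
  exact Classical.epsilon_spec (p := fun X => (stationaryState V * X).trace = 0 ∧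
    X - heisenberg V.1 X = V.1ᴴ * A - meanPart V A • (1 : Matrix (Fin d) (Fin d) ℂ)) ⟨X, h1, h2⟩

theorem norm_meanPart_le (V : irreducibleIsometries d k) :
    ∃ C ≥ 0, ∀ A : Op d k, ‖meanPart V A‖ ≤ C * ‖A‖ := by
  refine ⟨d * (d * ‖stationaryState V‖ * ((d * k : ℕ) * ‖V.1ᴴ‖)), by positivity, fun A => ?_⟩
  have h1 := norm_trace_le (stationaryState V * (V.1ᴴ * A))
  have h2 := norm_matrix_mul_le (stationaryState V) (V.1ᴴ * A)
  have h3 := norm_matrix_mul_le V.1ᴴ A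
  rw [Fintype.card_fin] at h1 h2
  rw [Fintype.card_prod, Fintype.card_fin, Fintype.card_fin] at h3
  calc ‖meanPart V A‖ ≤ d * (d * ‖stationaryState V‖ * ((d * k : ℕ) * ‖V.1ᴴ‖ * ‖A‖)) := by
        refine h1.trans ?_
        gcongr
        refine h2.trans ?_
        gcongr
    _ = _ := by ring

theorem norm_gaugePart_le (V : irreducibleIsometries d k) :
    ∃ C ≥ 0, ∀ A : Op d k, ‖gaugePart V A‖ ≤ C * ‖A‖ := by
  obtain ⟨C, hC0, hC⟩ := exists_poisson V
  obtain ⟨C', hC0', hC'⟩ := norm_meanPart_le V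
  refine ⟨C * ((d * k : ℕ) * ‖V.1ᴴ‖ + C'), by positivity, fun A => ?_⟩
  obtain ⟨X, h1, h2, h3⟩ := hC _ (trace_sub_meanPart V A)
  have h4 : gaugePart V A = X :=
    poisson_unique V (gaugePart_spec V A).1 h1 ((gaugePart_spec V A).2.trans h2.symm)
  rw [h4, mul_assoc]
  refine h3.trans (mul_le_mul_of_nonneg_left ?_ hC0)
  have h5 := norm_matrix_mul_le V.1ᴴ A
  rw [Fintype.card_prod, Fintype.card_fin, Fintype.card_fin] at h5
  calc _ ≤ ‖V.1ᴴ * A‖ + ‖meanPart V A • (1 : Matrix (Fin d) (Fin d) ℂ)‖ := norm_sub_le _ _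
    _ ≤ (d * k : ℕ) * ‖V.1ᴴ‖ * ‖A‖ + C' * ‖A‖ * 1 := by
        rw [norm_smul]
        gcongr
        · exact hC' A
        · exact norm_one_matrix_le
    _ = _ := by ring

theorem conj_meanPart (V : irreducibleIsometries d k) {A : Op d k} (hA : A ∈ tangentSpace V) :
    star (meanPart V A) = meanPart V A := by
  have h1 : Aᴴ * V.1 = V.1ᴴ * A := sub_eq_zero.1 hA
  rw [meanPart, ← Matrix.trace_conjTranspose, Matrix.conjTranspose_mul, Matrix.conjTranspose_mul,
    Matrix.conjTranspose_conjTranspose, (stationaryState_spec V).1.isHermitian.eq,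
    Matrix.trace_mul_comm, h1]

theorem conjTranspose_transfer (V V' : Op d k) (X : Matrix (Fin d) (Fin d) ℂ) :
    (transfer V V' X)ᴴ = transfer V' V Xᴴ := by
  rw [transfer_apply, transfer_apply, Matrix.conjTranspose_mul, Matrix.conjTranspose_mul,
    Matrix.conjTranspose_conjTranspose, conjTranspose_ampliate, Matrix.mul_assoc]

/-- For a tangent vector the right-hand side of the Poisson equation is Hermitian, so the adjoint of
the solution solves it as well and uniqueness applies. -/
theorem isHermitian_gaugePart (V : irreducibleIsometries d k) {A : Op d k}
    (hA : A ∈ tangentSpace V) : (gaugePart V A).IsHermitian := by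
  obtain ⟨h1, h2⟩ := gaugePart_spec V A
  have h3 : Aᴴ * V.1 = V.1ᴴ * A := sub_eq_zero.1 hA
  refine poisson_unique V ?_ h1 ?_
  · have := congrArg star h1
    rw [← Matrix.trace_conjTranspose, Matrix.conjTranspose_mul,
      (stationaryState_spec V).1.isHermitian.eq, Matrix.trace_mul_comm] at this
    simpa using this
  · rw [← conjTranspose_transfer, ← Matrix.conjTranspose_sub, h2, Matrix.conjTranspose_sub,
      Matrix.conjTranspose_smul, conj_meanPart V hA, Matrix.conjTranspose_mul,
      Matrix.conjTranspose_conjTranspose, Matrix.conjTranspose_one, h3]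

/-- The identifiable component is a lower block operator. -/
theorem conjTranspose_mul_idProj (V : irreducibleIsometries d k) (A : Op d k) :
    V.1ᴴ * idProj V A = 0 := by
  have h := (gaugePart_spec V A).2
  rw [idProj, gaugeTangent, Matrix.mul_sub, Matrix.mul_add, Matrix.mul_sub, Matrix.mul_smul,
    V.2.1, ← Matrix.mul_assoc, ← Matrix.mul_assoc, V.2.1, Matrix.one_mul, ← transfer_apply]
  have h2 : V.1ᴴ * A = gaugePart V A - transfer V.1 V.1 (gaugePart V A) +
      meanPart V A • (1 : Matrix (Fin d) (Fin d) ℂ) := by rw [h]; abel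
  rw [h2]
  abel

theorem idProj_of_conjTranspose_mul_eq_zero (V : irreducibleIsometries d k) {A : Op d k}
    (hA : V.1ᴴ * A = 0) : idProj V A = A := by
  have h1 : meanPart V A = 0 := by rw [meanPart, hA]; simp
  have h2 : gaugePart V A = 0 := by
    obtain ⟨h2, h3⟩ := gaugePart_spec V A
    refine poisson_unique V h2 (by simp) ?_
    rw [h3, hA, h1]
    simp
  rw [idProj, gaugeTangent, h1, h2]
  simp [ampliate]

theorem idProj_eq_self (V : irreducibleIsometries d k) {A : Op d k} (hA : A ∈ idTangent V) :
    idProj V A = A := by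
  obtain ⟨B, -, rfl⟩ := hA
  exact idProj_of_conjTranspose_mul_eq_zero V (conjTranspose_mul_idProj V B)

theorem coe_toMode_idProj (V : irreducibleIsometries d k) (A : Op d k) :
    ((toMode V (idProj V A)).1 : Op d k) = idProj V A := by
  change idProj V A - V.1 * (V.1ᴴ * idProj V A) = _
  rw [conjTranspose_mul_idProj, Matrix.mul_zero, sub_zero]

end Irreducible


/-! ### Scalar recursions and the exponential function. -/

section Scalar

/-- Discrete variation of constants: each of the `n` steps makes an error of at most `e`, which
later steps amplify by at most `b ^ n`. -/
theorem norm_linear_recursion_le {a : ℕ → ℂ} {z : ℂ} {e : ℝ} (he : 0 ≤ e)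
    (h : ∀ j, ‖a (j + 1) - z * a j‖ ≤ e) {b : ℝ} (hb : 1 ≤ b) (hz : ‖z‖ ≤ b) (n : ℕ) :
    ‖a n - z ^ n * a 0‖ ≤ n * e * b ^ n := by
  induction n with
  | zero => simp
  | succ n ih =>
    have h1 : a (n + 1) - z ^ (n + 1) * a 0 =
        (a (n + 1) - z * a n) + z * (a n - z ^ n * a 0) := by ring
    have h2 : 1 ≤ b ^ (n + 1) := one_le_pow₀ hb
    calc ‖a (n + 1) - z ^ (n + 1) * a 0‖ ≤ e + b * (n * e * b ^ n) := by
          rw [h1]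
          refine (norm_add_le _ _).trans (add_le_add (h n) ?_)
          rw [norm_mul]
          gcongr
      _ ≤ e * b ^ (n + 1) + b * (n * e * b ^ n) := by
          gcongr
          exact le_mul_of_one_le_right he h2
      _ = _ := by push_cast; ring

/-- The sign of the real part removes the linear term of `|1 + m|²`. The `n`-th power then grows
with `n ‖m‖²`, which stays bounded, and not with `n ‖m‖`. -/
theorem norm_one_add_le {m : ℂ} (hm : m.re ≤ 0) : ‖1 + m‖ ≤ Real.exp (‖m‖ ^ 2 / 2) := by
  have h1 : ‖1 + m‖ ^ 2 ≤ Real.exp (‖m‖ ^ 2 / 2) ^ 2 := by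
    rw [← Real.exp_nat_mul, Complex.sq_norm, Complex.normSq_apply]
    have h2 := Complex.normSq_apply m
    rw [← Complex.sq_norm] at h2
    have h3 := Real.add_one_le_exp (‖m‖ ^ 2)
    rw [show ((2 : ℕ) : ℝ) * (‖m‖ ^ 2 / 2) = ‖m‖ ^ 2 by push_cast; ring]
    simp only [Complex.add_re, Complex.one_re, Complex.add_im, Complex.one_im, zero_add]
    nlinarith
  exact le_of_sq_le_sq h1 (Real.exp_pos _).le

/-- On the left half plane, which is convex, the derivative of the exponential function has modulus
at most `1`. -/
theorem norm_exp_sub_exp_le {z w : ℂ} (hz : z.re ≤ 0) (hw : w.re ≤ 0) :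
    ‖Complex.exp z - Complex.exp w‖ ≤ ‖z - w‖ := by
  have hs : Convex ℝ {x : ℂ | x.re ≤ 0} := convex_halfSpace_re_le 0
  have := hs.norm_image_sub_le_of_norm_hasDerivWithin_le (f := Complex.exp) (f' := Complex.exp)
    (C := 1) (x := w) (y := z) (fun x _ => (Complex.hasDerivAt_exp x).hasDerivWithinAt)
    (fun x hx => by
      rw [Complex.norm_exp]
      exact Real.exp_le_one_iff.2 hx) hw hz
  simpa using this

/-- The sequence `exp (j m)` satisfies the recursion with multiplier `1 + m` up to the second order
remainder of the exponential. -/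
theorem norm_one_add_pow_sub_exp_le {m : ℂ} (hm : m.re ≤ 0) (hm1 : ‖m‖ ≤ 1) (n : ℕ) :
    ‖(1 + m) ^ n - Complex.exp (n * m)‖ ≤ n * ‖m‖ ^ 2 * Real.exp (n * (‖m‖ ^ 2 / 2)) := by
  have h1 := norm_linear_recursion_le (a := fun j : ℕ => Complex.exp (j * m)) (z := 1 + m)
    (e := ‖m‖ ^ 2) (by positivity) (fun j => by
      have h2 : Complex.exp (((j + 1 : ℕ) : ℂ) * m) - (1 + m) * Complex.exp (j * m) =
          (Complex.exp m - 1 - m) * Complex.exp (j * m) := by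
        rw [Nat.cast_add, Nat.cast_one, add_mul, one_mul, Complex.exp_add]
        ring
      rw [h2, norm_mul]
      refine (mul_le_of_le_one_right (norm_nonneg _) ?_).trans
        (Complex.norm_exp_sub_one_sub_id_le hm1)
      rw [Complex.norm_exp, Real.exp_le_one_iff]
      simp only [Complex.mul_re, Complex.natCast_re, Complex.natCast_im, zero_mul, sub_zero]
      exact mul_nonpos_of_nonneg_of_nonpos (Nat.cast_nonneg _) hm)
    (Real.one_le_exp (by positivity)) (norm_one_add_le hm) n
  rw [norm_sub_rev, Real.exp_nat_mul]
  simpa using h1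

end Scalar

/-! ### Overlaps of output states near a fixed isometry are Gaussian. -/

section Core

variable {d k : ℕ}

theorem overlap_zero (V V' : Op d k) (φ φ' : EuclideanSpace ℂ (Fin d))
    (X : Matrix (Fin d) (Fin d) ℂ) :
    overlap V V' φ φ' 0 X = star (WithLp.ofLp φ) ⬝ᵥ X *ᵥ WithLp.ofLp φ' := rfl

/-- If `1 + N` is an approximate eigenvector of the transfer operator with eigenvalue `1 + m`, then
the overlap after `n` steps is approximately `exp (n m)`. -/
theorem norm_overlap_sub_exp_le {V V' : Op d k} (hV : Vᴴ * V = 1) (hV' : V'ᴴ * V' = 1)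
    {φ φ' : EuclideanSpace ℂ (Fin d)} (hφ : ‖φ‖ = 1) (hφ' : ‖φ'‖ = 1)
    {N E X : Matrix (Fin d) (Fin d) ℂ} {m : ℂ} {ν e σ : ℝ}
    (hT : transfer V V' (1 + N) = (1 + m) • (1 + N) + E) (hm : m.re ≤ 0) (hm1 : ‖m‖ ≤ 1)
    (hN : ‖N‖ ≤ ν) (hE : ‖E‖ ≤ e) (hX : ‖X - 1‖ ≤ σ) (hφφ' : ‖φ - φ'‖ ≤ σ) (n : ℕ) :
    ‖overlap V V' φ φ' n X - Complex.exp (n * m)‖ ≤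
      d * (σ + ν) + (d * ν + σ + n * (d * e + ‖m‖ ^ 2)) * Real.exp (n * (‖m‖ ^ 2 / 2)) := by
  set B := Real.exp (n * (‖m‖ ^ 2 / 2)) with hB
  have hB1 : 1 ≤ B := Real.one_le_exp (by positivity)
  have hν : 0 ≤ ν := (norm_nonneg _).trans hN
  have hσ : 0 ≤ σ := (norm_nonneg _).trans hX
  have he : 0 ≤ e := (norm_nonneg _).trans hE
  have h1 : ‖overlap V V' φ φ' n X - overlap V V' φ φ' n (1 + N)‖ ≤ d * (σ + ν) := by
    have h2 : overlap V V' φ φ' n X = overlap V V' φ φ' n (1 + N) +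
        overlap V V' φ φ' n (X - 1 - N) := by
      rw [← overlap_add]
      congr 1
      abel
    rw [h2, add_sub_cancel_left]
    refine (norm_overlap_le hV hV' hφ hφ' n _).trans ?_
    gcongr
    exact (norm_sub_le _ _).trans (add_le_add hX hN)
  -- As a sequence in `n`, the overlap with `1 + N` obeys a scalar recursion with multiplier `1 +
  -- m`; the remainder is the overlap with `E`, bounded uniformly in the number of steps.
  have h3 : ‖overlap V V' φ φ' n (1 + N) -
      (1 + m) ^ n * overlap V V' φ φ' 0 (1 + N)‖ ≤ n * (d * e) * B := by
    rw [hB, Real.exp_nat_mul]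
    refine norm_linear_recursion_le (a := fun j => overlap V V' φ φ' j (1 + N))
      (mul_nonneg (Nat.cast_nonneg d) he) (fun j => ?_)
      (Real.one_le_exp (by positivity)) (norm_one_add_le hm) n
    rw [overlap_succ, hT, overlap_add, overlap_smul, add_sub_cancel_left]
    refine (norm_overlap_le hV hV' hφ hφ' j _).trans ?_
    gcongr
  have h4 : ‖overlap V V' φ φ' 0 (1 + N) - 1‖ ≤ d * ν + σ := by
    have h5 : overlap V V' φ φ' 0 (1 + N) - 1 =
        overlap V V' φ φ' 0 N - ⟪φ, φ - φ'⟫_ℂ := by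
      have h6 : overlap V V' φ φ' 0 1 = ⟪φ, φ'⟫_ℂ := by
        rw [overlap_zero, Matrix.one_mulVec, PiLp.inner_apply, dotProduct]
        exact Finset.sum_congr rfl fun a _ => by rw [RCLike.inner_apply, mul_comm]; rfl
      rw [overlap_add, h6, inner_sub_right, inner_self_eq_norm_sq_to_K, hφ]
      simp only [Complex.coe_algebraMap]
      push_cast
      ring
    rw [h5]
    refine (norm_sub_le _ _).trans (add_le_add ?_ ?_)
    · refine (norm_overlap_le hV hV' hφ hφ' 0 _).trans ?_
      gcongr
    · refine (norm_inner_le_norm _ _).trans ?_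
      rw [hφ, one_mul]
      exact hφφ'
  have h7 : ‖(1 + m) ^ n‖ ≤ B := by
    rw [norm_pow, hB, Real.exp_nat_mul]
    exact pow_le_pow_left₀ (norm_nonneg _) (norm_one_add_le hm) n
  have h8 := norm_one_add_pow_sub_exp_le hm hm1 n
  have h9 : overlap V V' φ φ' n X - Complex.exp (n * m) =
      (overlap V V' φ φ' n X - overlap V V' φ φ' n (1 + N)) +
      (overlap V V' φ φ' n (1 + N) - (1 + m) ^ n * overlap V V' φ φ' 0 (1 + N)) +
      (1 + m) ^ n * (overlap V V' φ φ' 0 (1 + N) - 1) +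
      ((1 + m) ^ n - Complex.exp (n * m)) := by ring
  rw [h9]
  calc _ ≤ d * (σ + ν) + n * (d * e) * B + B * (d * ν + σ) + n * ‖m‖ ^ 2 * B := by
        refine (norm_add_le _ _).trans (add_le_add ((norm_add_le _ _).trans
          (add_le_add ((norm_add_le _ _).trans (add_le_add h1 h3)) ?_)) h8)
        rw [norm_mul]
        gcongr
    _ = _ := by ring

/-- The phase velocity `Im Tr (ρ V₀* V)` of an isometry near `V₀`. -/
def phaseRate (V₀ : irreducibleIsometries d k) (V : Op d k) : ℝ := (meanPart V₀ V).im

theorem re_trace_stationary_nonneg (V₀ : irreducibleIsometries d k) (A : Op d k) :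
    0 ≤ (stationaryState V₀ * (Aᴴ * A)).trace.re := by
  rw [trace_mul_conjTranspose_mul_self]
  exact (Complex.le_def.1 ((stationaryState_spec V₀).1.posSemidef.mul_mul_conjTranspose_same
    A).trace_nonneg).1

theorem conj_trace_stationary (V₀ : irreducibleIsometries d k) (A B : Op d k) :
    star (stationaryState V₀ * (Aᴴ * B)).trace = (stationaryState V₀ * (Bᴴ * A)).trace := by
  rw [← Matrix.trace_conjTranspose, Matrix.conjTranspose_mul, Matrix.conjTranspose_mul,
    Matrix.conjTranspose_conjTranspose, (stationaryState_spec V₀).1.isHermitian.eq,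
    Matrix.trace_mul_comm]

/-- An exact expansion around `V₀`. The constraints `Vᴴ V = 1` and `V'ᴴ V' = 1` trade the real parts
of the linear terms for quadratic ones, and the imaginary parts survive as a difference of two phase
rates. -/
theorem trace_stationary_sub_one_eq (V₀ : irreducibleIsometries d k) {V V' : Op d k}
    (hV : Vᴴ * V = 1) (hV' : V'ᴴ * V' = 1) :
    (stationaryState V₀ * (Vᴴ * V' - 1)).trace =
      -(stationaryState V₀ * ((V - V₀.1)ᴴ * (V - V₀.1))).trace / 2
        - (stationaryState V₀ * ((V' - V₀.1)ᴴ * (V' - V₀.1))).trace / 2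
        + (stationaryState V₀ * ((V - V₀.1)ᴴ * (V' - V₀.1))).trace
        + Complex.I * (phaseRate V₀ V' - phaseRate V₀ V) := by
  have hg : ∀ V : Op d k, (stationaryState V₀ * (V₀.1ᴴ * V)).trace = meanPart V₀ V := fun _ => rfl
  have hg' : ∀ V : Op d k, (stationaryState V₀ * (Vᴴ * V₀.1)).trace = star (meanPart V₀ V) :=
    fun V => (conj_trace_stationary V₀ _ _).symm
  have him : ∀ V : Op d k, Complex.I * (phaseRate V₀ V : ℂ) =
      (meanPart V₀ V - star (meanPart V₀ V)) / 2 := by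
    intro V
    have := Complex.sub_conj (meanPart V₀ V)
    rw [Complex.star_def, this, phaseRate]
    push_cast
    ring
  have hexp : ∀ A B : Op d k, (stationaryState V₀ * ((A - V₀.1)ᴴ * (B - V₀.1))).trace =
      (stationaryState V₀ * (Aᴴ * B)).trace - meanPart V₀ B - star (meanPart V₀ A) + 1 := by
    intro A B
    rw [Matrix.conjTranspose_sub, Matrix.sub_mul, Matrix.mul_sub, Matrix.mul_sub V₀.1ᴴ, V₀.2.1]
    simp only [Matrix.mul_sub, Matrix.trace_sub, Matrix.mul_one, (stationaryState_spec V₀).2.1]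
    rw [hg, hg']
    ring
  rw [mul_sub Complex.I, him, him, hexp, hexp, hexp, hV, hV', Matrix.mul_sub, Matrix.trace_sub,
    Matrix.mul_one, (stationaryState_spec V₀).2.1]
  ring

/-- Expand `0 ≤ Tr (ρ (V' - V)ᴴ (V' - V)) = 2 - 2 Re Tr (ρ Vᴴ V')`. -/
theorem re_trace_stationary_sub_one_nonpos (V₀ : irreducibleIsometries d k) {V V' : Op d k}
    (hV : Vᴴ * V = 1) (hV' : V'ᴴ * V' = 1) :
    (stationaryState V₀ * (Vᴴ * V' - 1)).trace.re ≤ 0 := by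
  have h1 := re_trace_stationary_nonneg V₀ (V' - V)
  rw [Matrix.conjTranspose_sub, Matrix.sub_mul, Matrix.mul_sub V'ᴴ, Matrix.mul_sub Vᴴ, hV, hV',
    Matrix.mul_sub, Matrix.mul_sub, Matrix.mul_sub, Matrix.trace_sub, Matrix.trace_sub,
    Matrix.trace_sub, ← conj_trace_stationary V₀ V V', Matrix.mul_one,
    (stationaryState_spec V₀).2.1] at h1
  rw [Matrix.mul_sub, Matrix.trace_sub, Matrix.mul_one, (stationaryState_spec V₀).2.1]
  simp only [Complex.sub_re, Complex.one_re, Complex.star_def, Complex.conj_re] at h1 ⊢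
  linarith

theorem norm_conjTranspose_mul_le (A B : Op d k) :
    ‖Aᴴ * B‖ ≤ (d * k : ℕ) * ‖A‖ * ‖B‖ := by
  have h := norm_matrix_mul_le Aᴴ B
  rwa [Fintype.card_prod, Fintype.card_fin, Fintype.card_fin, Matrix.norm_conjTranspose] at h

theorem exists_norm_trace_mul_le (ρ : Matrix (Fin d) (Fin d) ℂ) :
    ∃ C ≥ 0, ∀ M : Matrix (Fin d) (Fin d) ℂ, ‖(ρ * M).trace‖ ≤ C * ‖M‖ := by
  refine ⟨d * (d * ‖ρ‖), by positivity, fun M => ?_⟩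
  have h1 := norm_trace_le (ρ * M)
  have h2 := norm_matrix_mul_le ρ M
  rw [Fintype.card_fin] at h1 h2
  rw [mul_assoc]
  exact h1.trans (mul_le_mul_of_nonneg_left h2 (Nat.cast_nonneg d))

theorem norm_transfer_le (V V' : Op d k) (X : Matrix (Fin d) (Fin d) ℂ) :
    ‖transfer V V' X‖ ≤ ((d * k : ℕ) : ℝ) ^ 2 * ‖V‖ * ‖V'‖ * ‖X‖ := by
  have h1 := norm_matrix_mul_le Vᴴ (ampliate k X)
  have h2 := norm_matrix_mul_le (Vᴴ * ampliate k X) V'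
  rw [Fintype.card_prod, Fintype.card_fin, Fintype.card_fin] at h1 h2
  rw [Matrix.norm_conjTranspose] at h1
  rw [transfer_apply]
  calc _ ≤ (d * k : ℕ) * ((d * k : ℕ) * ‖V‖ * ‖X‖) * ‖V'‖ := by
        refine h2.trans ?_
        gcongr
        refine h1.trans ?_
        gcongr
        exact norm_ampliate_le k X
    _ = _ := by ring

theorem transfer_sub_transfer (V V' W W' : Op d k) (X : Matrix (Fin d) (Fin d) ℂ) :
    transfer V V' X - transfer W W' X = transfer (V - W) V' X + transfer W (V' - W') X := by
  simp only [transfer_apply, Matrix.conjTranspose_sub, Matrix.sub_mul, Matrix.mul_sub]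
  abel

theorem inner_modeSpace (V : irreducibleIsometries d k) (A B : ModeSpace V) :
    ⟪A, B⟫_ℂ = (stationaryState V * ((A.1 : Op d k)ᴴ * (B.1 : Op d k))).trace := rfl

/-- The overlap of the system and output states at two nearby isometries in terms of the mean of
the transfer operator. -/
theorem exists_norm_overlap_sub_exp_le (V₀ : irreducibleIsometries d k) :
    ∃ C ≥ 0, ∃ τ₀ > 0, τ₀ ≤ 1 ∧ ∀ (n : ℕ) (V V' L L' : Op d k)
      (φ φ' : EuclideanSpace ℂ (Fin d)) (X : Matrix (Fin d) (Fin d) ℂ) (τ : ℝ),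
      Vᴴ * V = 1 → V'ᴴ * V' = 1 → ‖φ‖ = 1 → ‖φ'‖ = 1 → 0 ≤ τ → τ ≤ τ₀ → n * τ ^ 3 ≤ 1 →
      V₀.1ᴴ * L = 0 → V₀.1ᴴ * L' = 0 → ‖V - V₀.1‖ ≤ τ → ‖V' - V₀.1‖ ≤ τ →
      ‖V - V₀.1 - Complex.I • L‖ ≤ τ ^ 2 → ‖V' - V₀.1 - Complex.I • L'‖ ≤ τ ^ 2 →
      ‖X - 1‖ ≤ τ → ‖φ - φ'‖ ≤ τ →
      ‖overlap V V' φ φ' n X -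
        Complex.exp (n * (stationaryState V₀ * (Vᴴ * V' - 1)).trace)‖ ≤ C * (τ + n * τ ^ 3) := by
  obtain ⟨K, hK0, hK⟩ := exists_norm_trace_mul_le (stationaryState V₀)
  obtain ⟨P, hP0, hP⟩ := exists_poisson V₀
  obtain ⟨D, hD⟩ : ∃ D : ℝ, D = (d * k : ℕ) := ⟨_, rfl⟩
  have hD0 : 0 ≤ D := hD ▸ Nat.cast_nonneg _
  obtain ⟨b, hb⟩ : ∃ c : ℝ, c = ‖V₀.1‖ + 1 := ⟨_, rfl⟩
  have hb0 : 0 ≤ b := by rw [hb]; positivity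
  obtain ⟨C₁, hC₁⟩ : ∃ c : ℝ, c = D * b + D * b + D := ⟨_, rfl⟩
  have hC₁0 : 0 ≤ C₁ := by rw [hC₁]; positivity
  obtain ⟨C₂, hC₂⟩ : ∃ c : ℝ, c = K * C₁ := ⟨_, rfl⟩
  have hC₂0 : 0 ≤ C₂ := by rw [hC₂]; positivity
  obtain ⟨C₃, hC₃⟩ : ∃ c : ℝ, c = P * (C₁ + C₂) := ⟨_, rfl⟩
  have hC₃0 : 0 ≤ C₃ := by rw [hC₃]; positivity
  obtain ⟨C₄, hC₄⟩ : ∃ c : ℝ, c = D ^ 2 * b * C₃ + D ^ 2 * b * C₃ + C₂ * C₃ := ⟨_, rfl⟩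
  have hC₄0 : 0 ≤ C₄ := by rw [hC₄]; positivity
  -- The threshold `1 / (1 + C₂)` ensures that `‖m‖ ≤ C₂ τ² ≤ 1`.
  refine ⟨d * (1 + C₃) + (d * C₃ + 1 + (d * C₄ + C₂ ^ 2)) * Real.exp (C₂ ^ 2 / 2), by positivity,
    1 / (1 + C₂), by positivity, by rw [div_le_one (by positivity)]; linarith, ?_⟩
  intro n V V' L L' φ φ' X τ hV hV' hφ hφ' hτ hττ hnτ hL hL' hVτ hVτ' hVL hVL' hX hφφ'
  have hτ1 : τ ≤ 1 := hττ.trans (by rw [div_le_one (by positivity)]; linarith)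
  have hτsq : τ ^ 2 ≤ τ := by nlinarith
  have hC₂τ : C₂ * τ ^ 2 ≤ 1 := by
    have : τ * (1 + C₂) ≤ 1 := by rwa [le_div_iff₀ (by positivity)] at hττ
    nlinarith
  -- The first order part maps to the complement of the range of `V₀`, so the component of `V - V₀`
  -- along that range is of second order. Hence `M` below is of second order.
  have hblock : ∀ {V L : Op d k}, V₀.1ᴴ * L = 0 → ‖V - V₀.1 - Complex.I • L‖ ≤ τ ^ 2 →
      ‖V₀.1ᴴ * (V - V₀.1)‖ ≤ D * b * τ ^ 2 := by
    intro V L hL h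
    have h1 : V₀.1ᴴ * (V - V₀.1) = V₀.1ᴴ * (V - V₀.1 - Complex.I • L) := by
      rw [Matrix.mul_sub _ _ (Complex.I • L), Matrix.mul_smul, hL, smul_zero, sub_zero]
    rw [h1]
    refine (norm_conjTranspose_mul_le _ _).trans ?_
    rw [← hD]
    gcongr
    rw [hb]; linarith
  set M := Vᴴ * V' - 1 with hM
  set m := (stationaryState V₀ * M).trace with hm
  have hMeq : M = V₀.1ᴴ * (V' - V₀.1) + (V₀.1ᴴ * (V - V₀.1))ᴴ + (V - V₀.1)ᴴ * (V' - V₀.1) := by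
    rw [hM, ← V₀.2.1]
    simp only [Matrix.conjTranspose_mul, Matrix.conjTranspose_sub, Matrix.conjTranspose_conjTranspose,
      Matrix.mul_sub, Matrix.sub_mul]
    abel
  have hMn : ‖M‖ ≤ C₁ * τ ^ 2 := by
    rw [hMeq]
    calc _ ≤ D * b * τ ^ 2 + D * b * τ ^ 2 + D * τ * τ := by
          refine (norm_add_le _ _).trans (add_le_add ((norm_add_le _ _).trans
            (add_le_add (hblock hL' hVL') ?_)) ?_)
          · rw [Matrix.norm_conjTranspose]
            exact hblock hL hVL
          · refine (norm_conjTranspose_mul_le _ _).trans ?_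
            rw [← hD]
            gcongr
      _ = _ := by rw [hC₁]; ring
  have hmn : ‖m‖ ≤ C₂ * τ ^ 2 := by
    refine (hK M).trans ?_
    rw [hC₂, mul_assoc]
    gcongr
  -- Subtracting the mean `m` makes the right-hand side solvable; `1 + N` is then the first order
  -- perturbation of the eigenvector `1` of the transfer operator.
  obtain ⟨N, -, hN, hNn⟩ := hP (M - m • 1) (by
    rw [Matrix.mul_sub, Matrix.trace_sub, Matrix.mul_smul, Matrix.trace_smul, Matrix.mul_one,
      (stationaryState_spec V₀).2.1, smul_eq_mul, mul_one, sub_self])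
  have hNn' : ‖N‖ ≤ C₃ * τ ^ 2 := by
    refine hNn.trans ?_
    rw [hC₃, mul_assoc]
    gcongr
    refine (norm_sub_le _ _).trans ?_
    rw [norm_smul, add_mul]
    refine add_le_add hMn ((mul_le_of_le_one_right (norm_nonneg _) norm_one_matrix_le).trans hmn)
  have hnV : ‖V'‖ ≤ b := by
    have := norm_le_norm_add_norm_sub' V' V₀.1
    rw [hb]; linarith
  -- The defect of the approximate eigenvector: `N` is of order `τ²`, and each map applied to it is
  -- of order at least `τ`.
  have hE : ‖transfer V V' N - transfer V₀.1 V₀.1 N - m • N‖ ≤ C₄ * τ ^ 3 := by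
    rw [transfer_sub_transfer]
    have h1 := norm_transfer_le (V - V₀.1) V' N
    have h2 := norm_transfer_le V₀.1 (V' - V₀.1) N
    rw [← hD] at h1 h2
    have h3 : ‖V₀.1‖ ≤ b := by rw [hb]; linarith
    calc _ ≤ D ^ 2 * τ * b * (C₃ * τ ^ 2) + D ^ 2 * b * τ * (C₃ * τ ^ 2)
          + C₂ * τ ^ 2 * (C₃ * τ ^ 2) := by
          refine (norm_sub_le _ _).trans (add_le_add ((norm_add_le _ _).trans
            (add_le_add (h1.trans ?_) (h2.trans ?_))) ?_)
          · gcongr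
          · gcongr
          · rw [norm_smul]
            gcongr
      _ ≤ D ^ 2 * τ * b * (C₃ * τ ^ 2) + D ^ 2 * b * τ * (C₃ * τ ^ 2)
          + C₂ * τ * (C₃ * τ ^ 2) := by gcongr
      _ = _ := by rw [hC₄]; ring
  have hT : transfer V V' (1 + N) = (1 + m) • (1 + N) +
      (transfer V V' N - transfer V₀.1 V₀.1 N - m • N) := by
    have h1 : transfer V₀.1 V₀.1 N = N - (M - m • 1) := by rw [← hN]; abel
    rw [map_add, transfer_one, h1, hM, add_smul, one_smul, smul_add]
    abel
  refine (norm_overlap_sub_exp_le hV hV' hφ hφ' hT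
    (re_trace_stationary_sub_one_nonpos V₀ hV hV') (hmn.trans hC₂τ) hNn' hE hX hφφ' n).trans ?_
  have hm2 : ‖m‖ ^ 2 ≤ C₂ ^ 2 * τ ^ 3 := by
    calc ‖m‖ ^ 2 ≤ (C₂ * τ ^ 2) ^ 2 := by gcongr
      _ = C₂ ^ 2 * (τ ^ 3 * τ) := by ring
      _ ≤ C₂ ^ 2 * (τ ^ 3 * 1) := by gcongr
      _ = _ := by ring
  have hexp : Real.exp (n * (‖m‖ ^ 2 / 2)) ≤ Real.exp (C₂ ^ 2 / 2) := by
    refine Real.exp_le_exp.2 ?_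
    calc (n : ℝ) * (‖m‖ ^ 2 / 2) ≤ n * (C₂ ^ 2 * τ ^ 3 / 2) := by gcongr
      _ = n * τ ^ 3 * (C₂ ^ 2 / 2) := by ring
      _ ≤ 1 * (C₂ ^ 2 / 2) := by gcongr
      _ = _ := one_mul _
  have hτ3 : 0 ≤ n * τ ^ 3 := by positivity
  calc _ ≤ d * (τ + C₃ * τ) + (d * (C₃ * τ) + τ + n * (d * (C₄ * τ ^ 3) + C₂ ^ 2 * τ ^ 3)) *
        Real.exp (C₂ ^ 2 / 2) := by gcongr
    _ = d * (1 + C₃) * τ + ((d * C₃ + 1) * τ + (d * C₄ + C₂ ^ 2) * (n * τ ^ 3)) *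
        Real.exp (C₂ ^ 2 / 2) := by ring
    _ ≤ d * (1 + C₃) * (τ + n * τ ^ 3) + ((d * C₃ + 1) * (τ + n * τ ^ 3) +
        (d * C₄ + C₂ ^ 2) * (τ + n * τ ^ 3)) * Real.exp (C₂ ^ 2 / 2) := by
        gcongr <;> linarith
    _ = _ := by ring

/-- The overlap of the system and output states at two nearby isometries is close to that of the
corresponding coherent states, up to a phase which is a coboundary. -/
theorem exists_norm_overlap_sub_gaussKernel_le (V₀ : irreducibleIsometries d k) :
    ∃ C ≥ 0, ∃ τ₀ > 0, τ₀ ≤ 1 ∧ ∀ (n : ℕ) (V V' : Op d k) (L L' : ModeSpace V₀)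
      (φ φ' : EuclideanSpace ℂ (Fin d)) (X : Matrix (Fin d) (Fin d) ℂ) (τ : ℝ),
      Vᴴ * V = 1 → V'ᴴ * V' = 1 → ‖φ‖ = 1 → ‖φ'‖ = 1 → 0 ≤ τ → τ ≤ τ₀ → n * τ ^ 3 ≤ 1 →
      ‖V - V₀.1‖ ≤ τ → ‖V' - V₀.1‖ ≤ τ →
      ‖V - V₀.1 - Complex.I • (L.1 : Op d k)‖ ≤ τ ^ 2 →
      ‖V' - V₀.1 - Complex.I • (L'.1 : Op d k)‖ ≤ τ ^ 2 →
      ‖X - 1‖ ≤ τ → ‖φ - φ'‖ ≤ τ →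
      ‖Complex.exp (-(Complex.I * (n * (phaseRate V₀ V' - phaseRate V₀ V)))) *
          overlap V V' φ φ' n X - gaussKernel (((√n : ℝ) : ℂ) • L) (((√n : ℝ) : ℂ) • L')‖ ≤
        C * (τ + n * τ ^ 3) := by
  obtain ⟨C, hC0, τ₀, hτ₀, hτ₀1, hC⟩ := exists_norm_overlap_sub_exp_le V₀
  obtain ⟨K, hK0, hK⟩ := exists_norm_trace_mul_le (stationaryState V₀)
  obtain ⟨D, hD⟩ : ∃ D : ℝ, D = (d * k : ℕ) := ⟨_, rfl⟩
  have hD0 : 0 ≤ D := hD ▸ Nat.cast_nonneg _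
  refine ⟨C + 6 * (K * D), by positivity, τ₀, hτ₀, hτ₀1, ?_⟩
  intro n V V' L L' φ φ' X τ hV hV' hφ hφ' hτ hττ hnτ hVτ hVτ' hVL hVL' hX hφφ'
  have h1 := hC n V V' L.1 L'.1 φ φ' X τ hV hV' hφ hφ' hτ hττ hnτ L.2 L'.2 hVτ hVτ' hVL hVL' hX hφφ'
  have hτsq : τ ^ 2 ≤ τ := by nlinarith
  -- The factor `i` cancels between the two arguments of the sesquilinear form, so exchanging `V -
  -- V₀` for its tangent vector costs only third order.
  have hform : ∀ {A B A' B' : Op d k}, ‖A‖ ≤ τ → ‖B‖ ≤ τ → ‖A - Complex.I • A'‖ ≤ τ ^ 2 →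
      ‖B - Complex.I • B'‖ ≤ τ ^ 2 → ‖(stationaryState V₀ * (Aᴴ * B)).trace -
        (stationaryState V₀ * (A'ᴴ * B')).trace‖ ≤ 3 * (K * D) * τ ^ 3 := by
    intro A B A' B' hA hB hAA hBB
    have h2 : (stationaryState V₀ * (Aᴴ * B)).trace - (stationaryState V₀ * (A'ᴴ * B')).trace =
        (stationaryState V₀ * ((A - Complex.I • A')ᴴ * B)).trace +
        (stationaryState V₀ * ((Complex.I • A')ᴴ * (B - Complex.I • B'))).trace := by
      rw [← Matrix.trace_sub, ← Matrix.trace_add, ← Matrix.mul_sub, ← Matrix.mul_add]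
      congr 2
      simp only [Matrix.conjTranspose_sub, Matrix.conjTranspose_smul, Matrix.sub_mul,
        Matrix.mul_sub, Matrix.smul_mul, Matrix.mul_smul, smul_smul, Complex.star_def,
        Complex.conj_I, mul_neg, Complex.I_mul_I, neg_neg, one_smul]
      abel
    have h3 : ‖Complex.I • A'‖ ≤ 2 * τ := by
      have := norm_sub_norm_le A (A - Complex.I • A')
      have h4 := norm_sub_le A (A - Complex.I • A')
      rw [sub_sub_cancel] at h4
      linarith
    rw [h2]
    calc _ ≤ K * (D * τ ^ 2 * τ) + K * (D * (2 * τ) * τ ^ 2) := by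
          refine (norm_add_le _ _).trans (add_le_add ((hK _).trans ?_) ((hK _).trans ?_))
          · gcongr
            refine (norm_conjTranspose_mul_le _ _).trans ?_
            rw [← hD]
            gcongr
          · gcongr
            refine (norm_conjTranspose_mul_le _ _).trans ?_
            rw [← hD]
            gcongr
      _ = _ := by ring
  set q : Op d k → Op d k → ℂ := fun A B => -(stationaryState V₀ * (Aᴴ * A)).trace / 2
        - (stationaryState V₀ * (Bᴴ * B)).trace / 2 + (stationaryState V₀ * (Aᴴ * B)).trace with hq
  have hgk : gaussKernel (((√n : ℝ) : ℂ) • L) (((√n : ℝ) : ℂ) • L') =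
      Complex.exp (n * q L.1 L'.1) := by
    have hnn : ((√n : ℝ) : ℂ) * ((√n : ℝ) : ℂ) = n := by
      rw [← Complex.ofReal_mul, Real.mul_self_sqrt (Nat.cast_nonneg n)]
      simp
    rw [gaussKernel, Complex.ofReal_div, Complex.ofReal_div, ofReal_norm_sq_eq_inner,
      ofReal_norm_sq_eq_inner]
    simp only [inner_smul_left, inner_smul_right, Complex.conj_ofReal, inner_modeSpace, hq]
    congr 1
    rw [← hnn]
    push_cast
    ring
  -- After the phase has been removed, the exponent is exactly the Gaussian form evaluated at `V -
  -- V₀` and `V' - V₀`.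
  have hz : Complex.exp (-(Complex.I * (n * (phaseRate V₀ V' - phaseRate V₀ V)))) *
      Complex.exp (n * (stationaryState V₀ * (Vᴴ * V' - 1)).trace) =
      Complex.exp (n * q (V - V₀.1) (V' - V₀.1)) := by
    rw [← Complex.exp_add, trace_stationary_sub_one_eq V₀ hV hV']
    congr 1
    simp only [hq]
    ring
  have hre1 : (n * q (V - V₀.1) (V' - V₀.1) : ℂ).re ≤ 0 := by
    rw [← Real.exp_le_one_iff, ← Complex.norm_exp, ← hz, norm_mul]
    have h5 : ‖Complex.exp (-(Complex.I * (n * (phaseRate V₀ V' - phaseRate V₀ V))))‖ = 1 := by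
      have : -(Complex.I * (n * (phaseRate V₀ V' - phaseRate V₀ V))) =
          ((-(n * (phaseRate V₀ V' - phaseRate V₀ V)) : ℝ) : ℂ) * Complex.I := by push_cast; ring
      rw [this, Complex.norm_exp_ofReal_mul_I]
    rw [h5, one_mul, Complex.norm_exp, Real.exp_le_one_iff]
    simp only [Complex.mul_re, Complex.natCast_re, Complex.natCast_im, zero_mul, sub_zero]
    exact mul_nonpos_of_nonneg_of_nonpos (Nat.cast_nonneg _)
      (re_trace_stationary_sub_one_nonpos V₀ hV hV')
  have hre2 : (n * q L.1 L'.1 : ℂ).re ≤ 0 := by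
    rw [← Real.exp_le_one_iff, ← Complex.norm_exp, ← hgk, norm_gaussKernel, Real.exp_le_one_iff]
    rw [neg_nonpos]
    positivity
  have h6 : ‖Complex.exp (n * q (V - V₀.1) (V' - V₀.1)) - Complex.exp (n * q L.1 L'.1)‖ ≤
      6 * (K * D) * (n * τ ^ 3) := by
    refine (norm_exp_sub_exp_le hre1 hre2).trans ?_
    rw [← mul_sub, norm_mul, Complex.norm_natCast]
    have h7 : ‖q (V - V₀.1) (V' - V₀.1) - q L.1 L'.1‖ ≤ 6 * (K * D) * τ ^ 3 := by
      have e1 := hform hVτ hVτ hVL hVL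
      have e2 := hform hVτ' hVτ' hVL' hVL'
      have e3 := hform hVτ hVτ' hVL hVL'
      have h8 : q (V - V₀.1) (V' - V₀.1) - q L.1 L'.1 =
          -((stationaryState V₀ * ((V - V₀.1)ᴴ * (V - V₀.1))).trace -
            (stationaryState V₀ * ((L.1 : Op d k)ᴴ * L.1)).trace) / 2 -
          ((stationaryState V₀ * ((V' - V₀.1)ᴴ * (V' - V₀.1))).trace -
            (stationaryState V₀ * ((L'.1 : Op d k)ᴴ * L'.1)).trace) / 2 +
          ((stationaryState V₀ * ((V - V₀.1)ᴴ * (V' - V₀.1))).trace -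
            (stationaryState V₀ * ((L.1 : Op d k)ᴴ * L'.1)).trace) := by
        simp only [hq]; ring
      rw [h8]
      refine (norm_add_le _ _).trans ((add_le_add (norm_sub_le _ _) le_rfl).trans ?_)
      rw [norm_div, norm_div, norm_neg, Complex.norm_ofNat]
      linarith
    calc _ ≤ n * (6 * (K * D) * τ ^ 3) := by gcongr
      _ = _ := by ring
  have h9 : ‖Complex.exp (-(Complex.I * (n * (phaseRate V₀ V' - phaseRate V₀ V)))) *
      overlap V V' φ φ' n X - Complex.exp (n * q (V - V₀.1) (V' - V₀.1))‖ ≤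
      C * (τ + n * τ ^ 3) := by
    rw [← hz, ← mul_sub, norm_mul]
    have h5 : ‖Complex.exp (-(Complex.I * (n * (phaseRate V₀ V' - phaseRate V₀ V))))‖ = 1 := by
      have : -(Complex.I * (n * (phaseRate V₀ V' - phaseRate V₀ V))) =
          ((-(n * (phaseRate V₀ V' - phaseRate V₀ V)) : ℝ) : ℂ) * Complex.I := by push_cast; ring
      rw [this, Complex.norm_exp_ofReal_mul_I]
    rw [h5, one_mul]
    exact h1
  rw [hgk]
  refine (norm_sub_le_norm_sub_add_norm_sub _ (Complex.exp (n * q (V - V₀.1) (V' - V₀.1))) _).trans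
    ((add_le_add h9 h6).trans ?_)
  have : 0 ≤ K * D := by positivity
  nlinarith

end Core


/-! ### Irreducibility is stable under small perturbations. -/

section Stability

variable {d k : ℕ}

theorem norm_kraus_le (V : Op d k) (i : Fin k) : ‖kraus V i‖ ≤ ‖V‖ := by
  rw [Matrix.norm_le_iff (norm_nonneg _)]
  intro a b
  exact V.norm_entry_le_entrywise_sup_norm

theorem kraus_sub (V V' : Op d k) (i : Fin k) : kraus (V - V') i = kraus V i - kraus V' i := rfl

theorem norm_schrodinger_sub_le (V V' : Op d k) (X : Matrix (Fin d) (Fin d) ℂ) :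
    ‖schrodinger V X - schrodinger V' X‖ ≤
      (k * (d ^ 2 * (‖V‖ + ‖V'‖))) * ‖V - V'‖ * ‖X‖ := by
  have h1 : schrodinger V X - schrodinger V' X = ∑ i, (kraus (V - V') i * X * (kraus V i)ᴴ +
      kraus V' i * X * (kraus (V - V') i)ᴴ) := by
    rw [schrodinger, schrodinger, ← Finset.sum_sub_distrib]
    refine Finset.sum_congr rfl fun i _ => ?_
    rw [kraus_sub, Matrix.conjTranspose_sub, Matrix.sub_mul, Matrix.sub_mul, Matrix.mul_sub]
    abel
  have h2 : ∀ A B : Matrix (Fin d) (Fin d) ℂ, ‖A * X * Bᴴ‖ ≤ d ^ 2 * ‖A‖ * ‖X‖ * ‖B‖ := by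
    intro A B
    have h3 := norm_matrix_mul_le (A * X) Bᴴ
    have h4 := norm_matrix_mul_le A X
    rw [Fintype.card_fin] at h3 h4
    rw [Matrix.norm_conjTranspose] at h3
    calc _ ≤ d * (d * ‖A‖ * ‖X‖) * ‖B‖ := h3.trans (by gcongr)
      _ = _ := by ring
  rw [h1]
  calc _ ≤ ∑ _i : Fin k, (d ^ 2 * ‖V - V'‖ * ‖X‖ * ‖V‖ + d ^ 2 * ‖V'‖ * ‖X‖ * ‖V - V'‖) := by
        refine norm_sum_le_of_le _ fun i _ => (norm_add_le _ _).trans (add_le_add ?_ ?_)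
        · refine (h2 _ _).trans ?_
          have e1 := norm_kraus_le (V - V') i
          have e2 := norm_kraus_le V i
          gcongr
        · refine (h2 _ _).trans ?_
          have e1 := norm_kraus_le (V - V') i
          have e2 := norm_kraus_le V' i
          gcongr
    _ = _ := by
        rw [Finset.sum_const, Finset.card_univ, Fintype.card_fin, nsmul_eq_mul]
        ring

/-- Irreducibility is an open property of isometries. -/
theorem exists_mem_irreducibleIsometries (V₀ : irreducibleIsometries d k) :
    ∃ ε > 0, ∀ V : Op d k, Vᴴ * V = 1 → ‖V - V₀.1‖ < ε → V ∈ irreducibleIsometries d k := by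
  obtain ⟨hρ, hρ1, hρS⟩ := stationaryState_spec V₀
  set ρ := stationaryState V₀ with hρdef
  have := nonempty_fin_of_trace_eq_one hρ1
  obtain ⟨δ, hδ, hpos⟩ := exists_posDef_of_norm_sub_lt hρ
  let e₀ := LinearEquiv.ofInjectiveEndo _ (schrodingerGenerator_injective V₀)
  obtain ⟨C, hC0, hC⟩ := LinearMap.exists_norm_le_of_finiteDimensional (𝕜 := ℂ) e₀.symm.toLinearMap
  have hC' : ∀ Y, ‖Y‖ ≤ C * ‖schrodingerGenerator V₀.1 ρ Y‖ := by
    intro Y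
    have := hC (e₀ Y)
    rwa [LinearEquiv.coe_coe, e₀.symm_apply_apply] at this
  set c : ℝ := k * (d ^ 2 * ((‖V₀.1‖ + 1) + ‖V₀.1‖)) with hc
  have hc0 : 0 ≤ c := by positivity
  have hpert : ∀ V : Op d k, ‖V - V₀.1‖ ≤ 1 → ∀ Y,
      ‖schrodingerGenerator V ρ Y - schrodingerGenerator V₀.1 ρ Y‖ ≤ c * ‖V - V₀.1‖ * ‖Y‖ := by
    intro V hV Y
    rw [schrodingerGenerator_apply, schrodingerGenerator_apply, add_sub_add_right_eq_sub,
      sub_sub_sub_cancel_left, norm_sub_rev]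
    refine (norm_schrodinger_sub_le V V₀.1 Y).trans ?_
    have h2 : ‖V‖ ≤ ‖V₀.1‖ + 1 := (norm_le_norm_add_norm_sub' V V₀.1).trans (by linarith)
    rw [hc]
    gcongr
  -- The value `1 / 2` keeps the perturbed generator injective. The other value gives `‖σ - ρ‖ < δ`,
  -- and hence positivity of the perturbed stationary state.
  set q : ℝ := min (1 / 2) (δ / (4 * (‖ρ‖ + 1))) with hq
  have hq0 : 0 < q := by positivity
  refine ⟨min 1 (q / (C * c + 1)), by positivity, fun V hV hVV => ?_⟩
  have hV1 : ‖V - V₀.1‖ ≤ 1 := (hVV.trans_le (min_le_left _ _)).le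
  have hsmall : C * (c * ‖V - V₀.1‖) ≤ q := by
    have h1 := (hVV.trans_le (min_le_right _ _)).le
    rw [le_div_iff₀ (by positivity)] at h1
    nlinarith [norm_nonneg (V - V₀.1)]
  have hq2 : q ≤ 1 / 2 := min_le_left _ _
  have hlow : ∀ Y, ‖Y‖ ≤ 2 * (C * ‖schrodingerGenerator V ρ Y‖) := by
    intro Y
    have h1 : ‖schrodingerGenerator V₀.1 ρ Y‖ ≤
        ‖schrodingerGenerator V ρ Y‖ + c * ‖V - V₀.1‖ * ‖Y‖ := by
      have := norm_le_norm_add_norm_sub (schrodingerGenerator V ρ Y)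
        (schrodingerGenerator V₀.1 ρ Y)
      have h := hpert V hV1 Y
      linarith
    have h2 := (hC' Y).trans (mul_le_mul_of_nonneg_left h1 hC0)
    have h3 : C * (c * ‖V - V₀.1‖) * ‖Y‖ ≤ 1 / 2 * ‖Y‖ :=
      mul_le_mul_of_nonneg_right (hsmall.trans hq2) (norm_nonneg _)
    nlinarith
  have hinj : Function.Injective (schrodingerGenerator V ρ) := by
    rw [injective_iff_map_eq_zero]
    intro Y hY
    have := hlow Y
    rw [hY, norm_zero, mul_zero, mul_zero] at this
    exact norm_le_zero_iff.1 this
  -- The regularised generator of `V` keeps the old state `ρ` in its rank one term. Matrices of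
  -- trace one that are fixed by the channel are precisely the preimages of `ρ`, which yields
  -- existence and uniqueness together.
  obtain ⟨σ, hσ⟩ := (LinearMap.injective_iff_surjective.1 hinj) ρ
  have htr : σ.trace = 1 := by rw [← trace_schrodingerGenerator hV hρ1, hσ, hρ1]
  have hfix : schrodinger V σ = σ := by
    rw [schrodingerGenerator_apply, htr, one_smul, add_eq_right, sub_eq_zero] at hσ
    exact hσ.symm
  have hstat : ∀ Y, schrodinger V Y = Y → Y.trace = 1 → Y = σ := by
    intro Y hY hYt
    refine hinj ?_
    rw [hσ, schrodingerGenerator_apply, hY, hYt, sub_self, one_smul, zero_add]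
  have hherm : σ.IsHermitian := by
    refine hstat _ ?_ ?_
    · rw [schrodinger_conjTranspose, hfix]
    · rw [Matrix.trace_conjTranspose, htr, star_one]
  have hclose : ‖σ - ρ‖ < δ := by
    have h1 : schrodingerGenerator V₀.1 ρ (σ - ρ) =
        -(schrodingerGenerator V ρ σ - schrodingerGenerator V₀.1 ρ σ) := by
      have : schrodingerGenerator V₀.1 ρ ρ = ρ := by
        rw [schrodingerGenerator_apply, hρS, hρ1, sub_self, one_smul, zero_add]
      rw [map_sub, this, hσ]
      abel
    have h2 := hC' (σ - ρ)
    rw [h1, norm_neg] at h2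
    have h3 := h2.trans (mul_le_mul_of_nonneg_left (hpert V hV1 σ) hC0)
    have h4 : ‖σ‖ ≤ ‖ρ‖ + ‖σ - ρ‖ := norm_le_norm_add_norm_sub' σ ρ
    have h5 : C * (c * ‖V - V₀.1‖ * ‖σ‖) ≤ q * (‖ρ‖ + ‖σ - ρ‖) := by
      rw [← mul_assoc]
      exact mul_le_mul hsmall h4 (norm_nonneg _) hq0.le
    have h6 : q * (4 * (‖ρ‖ + 1)) ≤ δ := by
      rw [← le_div_iff₀ (by positivity)]
      exact min_le_right _ _
    nlinarith [norm_nonneg (σ - ρ), norm_nonneg ρ]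
  exact ⟨hV, σ, ⟨hpos σ hherm hclose, htr, hfix⟩, fun Y hY => hstat Y hY.2.2 hY.2.1⟩

end Stability

/-! ### The Cayley transform of skew-Hermitian matrices. -/

section Cayley

variable {n : Type*} [Fintype n] [DecidableEq n]

theorem isUnit_one_sub_of_conjTranspose_eq_neg {S : Matrix n n ℂ} (hS : Sᴴ = -S) :
    IsUnit (1 - S) := by
  have h1 : (1 - S)ᴴ * (1 - S) = 1 + Sᴴ * S := by
    rw [Matrix.conjTranspose_sub, Matrix.conjTranspose_one, hS]
    noncomm_ring
  have h2 : ((1 - S)ᴴ * (1 - S)).PosDef := by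
    rw [h1]
    exact Matrix.PosDef.one.add_posSemidef (Matrix.posSemidef_conjTranspose_mul_self S)
  have h3 := (Matrix.isUnit_iff_isUnit_det _).1 h2.isUnit
  rw [Matrix.det_mul] at h3
  exact (Matrix.isUnit_iff_isUnit_det _).2 (isUnit_of_mul_isUnit_right h3)

/-- The Cayley transform. -/
def cayley (S : Matrix n n ℂ) : Matrix n n ℂ := (1 + S) * (1 - S)⁻¹

theorem cayley_mul_one_sub {S : Matrix n n ℂ} (hS : Sᴴ = -S) : cayley S * (1 - S) = 1 + S := by
  rw [cayley, Matrix.mul_assoc, Matrix.nonsing_inv_mul _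
    ((Matrix.isUnit_iff_isUnit_det _).1 (isUnit_one_sub_of_conjTranspose_eq_neg hS)),
    Matrix.mul_one]

theorem conjTranspose_cayley_mul_cayley {S : Matrix n n ℂ} (hS : Sᴴ = -S) :
    (cayley S)ᴴ * cayley S = 1 := by
  have hu := isUnit_one_sub_of_conjTranspose_eq_neg hS
  have hu' : IsUnit (1 - S)ᴴ := by
    rw [Matrix.isUnit_iff_isUnit_det, Matrix.det_conjTranspose]
    exact ((Matrix.isUnit_iff_isUnit_det _).1 hu).star
  refine hu'.mul_left_cancel (hu.mul_right_cancel ?_)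
  have h1 : (1 - S)ᴴ * (cayley S)ᴴ = (1 + S)ᴴ := by
    rw [← Matrix.conjTranspose_mul, cayley_mul_one_sub hS]
  rw [← mul_assoc, h1, mul_assoc, cayley_mul_one_sub hS, Matrix.mul_one]
  simp only [Matrix.conjTranspose_sub, Matrix.conjTranspose_add, Matrix.conjTranspose_one, hS]
  noncomm_ring

theorem norm_le_one_of_conjTranspose_mul_self {U : Matrix n n ℂ} (hU : Uᴴ * U = 1) : ‖U‖ ≤ 1 := by
  rw [Matrix.norm_le_iff zero_le_one]
  intro i j
  exact entry_norm_bound_of_unitary (Matrix.mem_unitaryGroup_iff'.2 hU) i j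

/-- As the entries of a unitary matrix are bounded by `1`, this identity and its iteration give
Taylor bounds for every skew-Hermitian `S`, small or not. -/
theorem cayley_sub_one {S : Matrix n n ℂ} (hS : Sᴴ = -S) : cayley S - 1 = S + cayley S * S := by
  have h := cayley_mul_one_sub hS
  rw [Matrix.mul_sub, Matrix.mul_one, sub_eq_iff_eq_add] at h
  nth_rewrite 1 [h]
  abel

theorem norm_cayley_sub_one_le {S : Matrix n n ℂ} (hS : Sᴴ = -S) :
    ‖cayley S - 1‖ ≤ (1 + Fintype.card n) * ‖S‖ := by
  have h1 := norm_matrix_mul_le (cayley S) S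
  have h2 := norm_le_one_of_conjTranspose_mul_self (conjTranspose_cayley_mul_cayley hS)
  rw [cayley_sub_one hS]
  calc _ ≤ ‖S‖ + Fintype.card n * 1 * ‖S‖ := by
        refine (norm_add_le _ _).trans (add_le_add le_rfl (h1.trans ?_))
        gcongr
    _ = _ := by ring

theorem norm_cayley_sub_one_sub_le {S : Matrix n n ℂ} (hS : Sᴴ = -S) :
    ‖cayley S - 1 - 2 • S‖ ≤ Fintype.card n * (1 + Fintype.card n) * ‖S‖ ^ 2 := by
  have h1 : cayley S - 1 - 2 • S = (cayley S - 1) * S := by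
    rw [Matrix.sub_mul, Matrix.one_mul, cayley_sub_one hS, two_smul]
    abel
  rw [h1]
  calc _ ≤ Fintype.card n * ((1 + Fintype.card n) * ‖S‖) * ‖S‖ := by
        refine (norm_matrix_mul_le _ _).trans ?_
        gcongr
        exact norm_cayley_sub_one_le hS
    _ = _ := by ring

end Cayley

/-! ### The Cayley chart of the manifold of isometries. -/

section Chart

variable {d k : ℕ}

/-- The skew-Hermitian operator generating the direction `i L` at `V`. -/
def chartGenerator (V L : Op d k) : Matrix (Fin d × Fin k) (Fin d × Fin k) ℂ :=
  Complex.I • (L * Vᴴ + V * Lᴴ - V * (Vᴴ * L) * Vᴴ)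

/-- A chart of the manifold of isometries around `V`. -/
def chart (V L : Op d k) : Op d k := cayley ((2⁻¹ : ℂ) • chartGenerator V L) * V

theorem conjTranspose_half_chartGenerator {V L : Op d k} (hL : Lᴴ * V = Vᴴ * L) :
    ((2⁻¹ : ℂ) • chartGenerator V L)ᴴ = -((2⁻¹ : ℂ) • chartGenerator V L) := by
  rw [chartGenerator]
  simp only [Matrix.conjTranspose_smul, Matrix.conjTranspose_sub, Matrix.conjTranspose_add,
    Matrix.conjTranspose_mul, Matrix.conjTranspose_conjTranspose, Complex.star_def, Complex.conj_I,
    map_inv₀, map_ofNat, neg_smul, smul_neg]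
  rw [hL, add_comm (V * Lᴴ), Matrix.mul_assoc V]

/-- The term `V (Vᴴ L) Vᴴ` in the generator removes the component along the range of `V`, which the
two other terms count twice. -/
theorem chartGenerator_mul {V L : Op d k} (hV : Vᴴ * V = 1) (hL : Lᴴ * V = Vᴴ * L) :
    chartGenerator V L * V = Complex.I • L := by
  rw [chartGenerator, Matrix.smul_mul, Matrix.sub_mul, Matrix.add_mul, Matrix.mul_assoc L, hV,
    Matrix.mul_assoc V Lᴴ, hL, Matrix.mul_assoc _ Vᴴ V, hV, Matrix.mul_one, Matrix.mul_one,
    add_sub_cancel_right]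

theorem conjTranspose_chart_mul_chart {V L : Op d k} (hV : Vᴴ * V = 1) (hL : Lᴴ * V = Vᴴ * L) :
    (chart V L)ᴴ * chart V L = 1 := by
  rw [chart, Matrix.conjTranspose_mul, Matrix.mul_assoc, ← Matrix.mul_assoc _ _ V,
    conjTranspose_cayley_mul_cayley (conjTranspose_half_chartGenerator hL), Matrix.one_mul, hV]

theorem norm_mul_conjTranspose_le (A B : Op d k) : ‖A * Bᴴ‖ ≤ d * ‖A‖ * ‖B‖ := by
  have h := norm_matrix_mul_le A Bᴴ
  rwa [Fintype.card_fin, Matrix.norm_conjTranspose] at h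

theorem norm_chartGenerator_le (V : Op d k) :
    ∃ C ≥ 0, ∀ L : Op d k, ‖chartGenerator V L‖ ≤ C * ‖L‖ := by
  refine ⟨d * ‖V‖ + d * ‖V‖ + d * (d * ‖V‖ * ((d * k : ℕ) * ‖V‖)) * ‖V‖, by positivity,
    fun L => ?_⟩
  rw [chartGenerator, norm_smul, Complex.norm_I, one_mul]
  calc _ ≤ d * ‖L‖ * ‖V‖ + d * ‖V‖ * ‖L‖ + d * (d * ‖V‖ * ((d * k : ℕ) * ‖V‖ * ‖L‖)) * ‖V‖ := by
        refine (norm_sub_le _ _).trans (add_le_add ((norm_add_le _ _).trans (add_le_add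
          (norm_mul_conjTranspose_le _ _) (norm_mul_conjTranspose_le _ _)))
          ((norm_mul_conjTranspose_le _ _).trans ?_))
        have h := norm_matrix_mul_le V (Vᴴ * L)
        rw [Fintype.card_fin] at h
        have h2 := norm_conjTranspose_mul_le V L
        gcongr
        exact h.trans (by gcongr)
    _ = _ := by ring

/-- The chart agrees with `V + i L` to first order. -/
theorem norm_chart_sub_le {V : Op d k} (hV : Vᴴ * V = 1) :
    ∃ C ≥ 0, ∀ L : Op d k, Lᴴ * V = Vᴴ * L →
      ‖chart V L - V - Complex.I • L‖ ≤ C * ‖L‖ ^ 2 := by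
  obtain ⟨C, hC0, hC⟩ := norm_chartGenerator_le V
  refine ⟨(d * k : ℕ) * (((d * k : ℕ) * (1 + (d * k : ℕ))) * C ^ 2) * ‖V‖, by positivity,
    fun L hL => ?_⟩
  set S := (2⁻¹ : ℂ) • chartGenerator V L with hS
  have hskew := conjTranspose_half_chartGenerator hL
  have h1 : chart V L - V - Complex.I • L = (cayley S - 1 - 2 • S) * V := by
    rw [Matrix.sub_mul, Matrix.sub_mul, Matrix.one_mul, chart, ← hS, ← chartGenerator_mul hV hL]
    congr 1
    rw [hS, ← Nat.cast_smul_eq_nsmul ℂ, smul_smul]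
    norm_num
  have h2 := norm_cayley_sub_one_sub_le hskew
  rw [← hS, Fintype.card_prod, Fintype.card_fin, Fintype.card_fin] at h2
  have h3 : ‖S‖ ≤ C * ‖L‖ := by
    rw [hS, norm_smul, norm_inv, Complex.norm_ofNat]
    have := hC L
    have := norm_nonneg (chartGenerator V L)
    linarith
  have h4 := norm_matrix_mul_le (cayley S - 1 - 2 • S) V
  rw [Fintype.card_prod, Fintype.card_fin, Fintype.card_fin] at h4
  rw [h1]
  calc _ ≤ (d * k : ℕ) * (((d * k : ℕ) * (1 + (d * k : ℕ))) * (C * ‖L‖) ^ 2) * ‖V‖ := by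
        refine h4.trans ?_
        gcongr
        exact h2.trans (by gcongr)
    _ = _ := by ring

end Chart

/-! ### Gauge transformations and removal of the non-identifiable component. -/

section GaugeFixing

variable {d k : ℕ}

theorem norm_ampliate_mul_mul_le (X : Matrix (Fin d) (Fin d) ℂ) (V : Op d k)
    (Y : Matrix (Fin d) (Fin d) ℂ) :
    ‖ampliate k X * V * Y‖ ≤ d * (d * k : ℕ) * ‖X‖ * ‖V‖ * ‖Y‖ := by
  have h1 := norm_matrix_mul_le (ampliate k X * V) Y
  have h2 := norm_matrix_mul_le (ampliate k X) V
  rw [Fintype.card_fin] at h1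
  rw [Fintype.card_prod, Fintype.card_fin, Fintype.card_fin] at h2
  have h3 := norm_ampliate_le k X
  calc _ ≤ d * ((d * k : ℕ) * ‖X‖ * ‖V‖) * ‖Y‖ := by
        refine h1.trans ?_
        gcongr
        refine h2.trans ?_
        gcongr
    _ = _ := by ring

/-- The transfer operator intertwines the gauge action. -/
theorem iterate_transfer_gaugeAction {W : Matrix (Fin d) (Fin d) ℂ} (hW : Wᴴ * W = 1) (c : ℂ)
    (V V' : Op d k) (n : ℕ) (X : Matrix (Fin d) (Fin d) ℂ) :
    (transfer (gaugeAction c W V) V')^[n] (W * X) = c ^ n • (W * (transfer V V')^[n] X) := by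
  have h1 : ∀ X, transfer (gaugeAction c W V) V' (W * X) = c • (W * transfer V V' X) := by
    intro X
    have h2 : ampliate k Wᴴ * ampliate k W = 1 := by rw [← ampliate_mul, hW, ampliate_one]
    rw [transfer_apply, transfer_apply, gaugeAction, Matrix.conjTranspose_smul,
      Matrix.conjTranspose_mul, Matrix.conjTranspose_mul, Matrix.conjTranspose_conjTranspose,
      conjTranspose_ampliate, ampliate_mul]
    simp only [Matrix.smul_mul, Complex.star_def, Complex.conj_conj]
    congr 1
    calc _ = W * (Vᴴ * ((ampliate k Wᴴ * ampliate k W) * (ampliate k X * V'))) := by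
          simp only [Matrix.mul_assoc]
      _ = _ := by rw [h2, Matrix.one_mul, Matrix.mul_assoc]
  induction n generalizing X with
  | zero => simp
  | succ n ih =>
    have h3 : ∀ (n : ℕ) (c : ℂ) (Y : Matrix (Fin d) (Fin d) ℂ) (A B : Op d k),
        (transfer A B)^[n] (c • Y) = c • (transfer A B)^[n] Y := by
      intro n c Y A B
      induction n generalizing Y with
      | zero => rfl
      | succ n ih => rw [Function.iterate_succ_apply, map_smul, ih, Function.iterate_succ_apply]
    rw [Function.iterate_succ_apply, h1, h3, ih, smul_smul, Function.iterate_succ_apply, pow_succ']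

/-- The action of a matrix on a vector of `ℂ^d`. -/
def applyVec (W : Matrix (Fin d) (Fin d) ℂ) (φ : EuclideanSpace ℂ (Fin d)) :
    EuclideanSpace ℂ (Fin d) := WithLp.toLp 2 (W *ᵥ WithLp.ofLp φ)

theorem inner_applyVec (W : Matrix (Fin d) (Fin d) ℂ) (φ : EuclideanSpace ℂ (Fin d)) :
    ⟪applyVec W φ, applyVec W φ⟫_ℂ =
      star (WithLp.ofLp φ) ⬝ᵥ (Wᴴ * W) *ᵥ WithLp.ofLp φ := by
  rw [PiLp.inner_apply]
  rw [← Matrix.mulVec_mulVec, Matrix.dotProduct_mulVec, ← Matrix.star_mulVec, dotProduct]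
  exact Finset.sum_congr rfl fun a _ => by rw [RCLike.inner_apply, mul_comm]; rfl

theorem norm_applyVec_le (W : Matrix (Fin d) (Fin d) ℂ) {φ : EuclideanSpace ℂ (Fin d)}
    (hφ : ‖φ‖ = 1) : ‖applyVec W φ‖ ≤ d * ‖W‖ := by
  have h1 := norm_dotProduct_mulVec_le φ φ (Wᴴ * W)
  rw [← inner_applyVec, ← ofReal_norm_sq_eq_inner, Complex.norm_real, hφ, Fintype.card_fin,
    Real.norm_of_nonneg (by positivity)] at h1
  have h2 := norm_matrix_mul_le Wᴴ W
  rw [Fintype.card_fin, Matrix.norm_conjTranspose] at h2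
  refine le_of_sq_le_sq ?_ (by positivity)
  calc _ ≤ d * ‖Wᴴ * W‖ * ((1 ^ 2 + 1 ^ 2) / 2) := h1
    _ ≤ d * (d * ‖W‖ * ‖W‖) * ((1 ^ 2 + 1 ^ 2) / 2) := by gcongr
    _ = _ := by ring

theorem norm_applyVec_of_isometry {W : Matrix (Fin d) (Fin d) ℂ} (hW : Wᴴ * W = 1)
    {φ : EuclideanSpace ℂ (Fin d)} (hφ : ‖φ‖ = 1) : ‖applyVec W φ‖ = 1 := by
  refine norm_eq_one_of_inner_self ?_
  rw [inner_applyVec, hW, ← Matrix.conjTranspose_one, ← Matrix.mul_one (1 : Matrix _ _ ℂ)ᴴ,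
    ← inner_applyVec]
  have : applyVec 1 φ = φ := by
    rw [applyVec, Matrix.one_mulVec]
  rw [this, ← ofReal_norm_sq_eq_inner, hφ]
  simp

/-- The unitaries cancel between consecutive steps. Only the phase `c ^ n` and the two ends survive:
`W` acts on the initial vector and stands as an observable after the last step. -/
theorem overlap_gaugeAction {W : Matrix (Fin d) (Fin d) ℂ} (hW : Wᴴ * W = 1) (c : ℂ)
    (V V' : Op d k) (φ φ' : EuclideanSpace ℂ (Fin d)) (n : ℕ) :
    overlap (gaugeAction c W V) V' (applyVec W φ) φ' n W = c ^ n * overlap V V' φ φ' n 1 := by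
  have h := iterate_transfer_gaugeAction hW c V V' n 1
  rw [Matrix.mul_one] at h
  rw [overlap, h, Matrix.smul_mulVec, dotProduct_smul, smul_eq_mul, overlap]
  congr 1
  rw [applyVec, Matrix.star_mulVec, ← Matrix.dotProduct_mulVec, Matrix.mulVec_mulVec,
    ← Matrix.mul_assoc, hW, Matrix.one_mul]

theorem conjTranspose_gaugeAction_mul {W : Matrix (Fin d) (Fin d) ℂ} (hW : Wᴴ * W = 1)
    {c : ℂ} (hc : ‖c‖ = 1) {V : Op d k} (hV : Vᴴ * V = 1) :
    (gaugeAction c W V)ᴴ * gaugeAction c W V = 1 := by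
  have h2 : ampliate k Wᴴ * ampliate k W = 1 := by rw [← ampliate_mul, hW, ampliate_one]
  have h3 : c * starRingEnd ℂ c = 1 := by rw [Complex.mul_conj, Complex.normSq_eq_norm_sq, hc]; simp
  rw [gaugeAction, Matrix.conjTranspose_smul, Matrix.conjTranspose_mul, Matrix.conjTranspose_mul,
    Matrix.conjTranspose_conjTranspose, conjTranspose_ampliate]
  simp only [Matrix.smul_mul, Matrix.mul_smul, Complex.star_def, Complex.conj_conj, smul_smul,
    mul_comm _ c, h3, one_smul]
  calc _ = W * (Vᴴ * ((ampliate k Wᴴ * ampliate k W) * (V * Wᴴ))) := by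
        simp only [Matrix.mul_assoc]
    _ = W * ((Vᴴ * V) * Wᴴ) := by rw [h2, Matrix.one_mul, Matrix.mul_assoc]
    _ = 1 := by rw [hV, Matrix.one_mul, mul_eq_one_comm.1 hW]

theorem norm_gaugeAction_le {W : Matrix (Fin d) (Fin d) ℂ} (hW : Wᴴ * W = 1)
    {c : ℂ} (hc : ‖c‖ = 1) (V : Op d k) :
    ‖gaugeAction c W V‖ ≤ d * (d * k : ℕ) * ‖V‖ := by
  rw [gaugeAction, norm_smul, RCLike.norm_conj, hc, one_mul]
  refine (norm_ampliate_mul_mul_le _ _ _).trans ?_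
  have h1 := norm_le_one_of_conjTranspose_mul_self hW
  have h2 : ‖Wᴴ‖ ≤ 1 := by rwa [Matrix.norm_conjTranspose]
  calc _ ≤ d * (d * k : ℕ) * 1 * ‖V‖ * 1 := by gcongr
    _ = _ := by ring

/-- Second order expansion of the gauge action at `V`, for `c = exp (i θ)` and `W = 1 + i K`. -/
theorem norm_gaugeAction_sub_sub_le (V : Op d k) {W K : Matrix (Fin d) (Fin d) ℂ} {θ t : ℝ}
    (ht0 : 0 ≤ t) (ht : t ≤ 1) (hK : K.IsHermitian) (hKt : ‖K‖ ≤ t)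
    (hWK : ‖W - 1 - Complex.I • K‖ ≤ t ^ 2) (hθ : |θ| ≤ t) :
    ‖gaugeAction (Complex.exp (θ * Complex.I)) W V - V -
      Complex.I • (ampliate k K * V - V * K - (θ : ℂ) • V)‖ ≤
      22 * ((d * (d * k : ℕ) + 1) * ‖V‖) * t ^ 2 := by
  set B : ℝ := d * (d * k : ℕ) * ‖V‖ with hB
  have hB0 : 0 ≤ B := by positivity
  have hP : ∀ X Y : Matrix (Fin d) (Fin d) ℂ, ‖ampliate k X * V * Y‖ ≤ B * (‖X‖ * ‖Y‖) := by
    intro X Y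
    refine (norm_ampliate_mul_mul_le X V Y).trans (le_of_eq ?_)
    rw [hB]; ring
  obtain ⟨R, hR⟩ : ∃ R, R = W - 1 - Complex.I • K := ⟨_, rfl⟩
  have hW : W = 1 + Complex.I • K + R := by rw [hR]; abel
  rw [← hR] at hWK
  have h1 : ‖(1 : Matrix (Fin d) (Fin d) ℂ)‖ ≤ 1 := norm_one_matrix_le
  have hw : ‖Complex.I • K + R‖ ≤ 2 * t := by
    refine (norm_add_le _ _).trans ?_
    rw [norm_smul, Complex.norm_I, one_mul]
    nlinarith
  set Q := ampliate k K * V * (1 : Matrix (Fin d) (Fin d) ℂ) -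
    ampliate k (1 : Matrix (Fin d) (Fin d) ℂ) * V * K with hQ
  have hQn : ‖Q‖ ≤ 2 * B * t := by
    calc _ ≤ B * (t * 1) + B * (1 * t) := by
          refine (norm_sub_le _ _).trans (add_le_add ((hP _ _).trans ?_) ((hP _ _).trans ?_))
          · gcongr
          · gcongr
      _ = _ := by ring
  set E := ampliate k R * V * (1 : Matrix (Fin d) (Fin d) ℂ) +
    ampliate k (1 : Matrix (Fin d) (Fin d) ℂ) * V * Rᴴ +
    ampliate k (Complex.I • K + R) * V * (Complex.I • K + R)ᴴ with hE
  have hEn : ‖E‖ ≤ 6 * B * t ^ 2 := by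
    calc _ ≤ B * (t ^ 2 * 1) + B * (1 * t ^ 2) + B * ((2 * t) * (2 * t)) := by
          refine (norm_add_le _ _).trans (add_le_add ((norm_add_le _ _).trans (add_le_add
            ((hP _ _).trans ?_) ((hP _ _).trans ?_))) ((hP _ _).trans ?_))
          · gcongr
          · rw [Matrix.norm_conjTranspose]
            gcongr
          · rw [Matrix.norm_conjTranspose]
            gcongr
      _ = _ := by ring
  -- Here `Q` is the commutator-like first order term and `E` collects the remainder of `W` on
  -- either side and the product of both first order terms.
  have hU : ampliate k W * V * Wᴴ = V + Complex.I • Q + E := by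
    rw [hW, hQ, hE]
    simp only [Matrix.conjTranspose_add, Matrix.conjTranspose_smul, Matrix.conjTranspose_one, hK.eq,
      ampliate_add, ampliate_smul, ampliate_one, Matrix.add_mul, Matrix.mul_add, Matrix.one_mul,
      Matrix.mul_one, smul_sub, Complex.star_def, Complex.conj_I, Matrix.smul_mul, Matrix.mul_smul]
    module
  have hc1 : ‖starRingEnd ℂ (Complex.exp (θ * Complex.I)) - 1 + θ * Complex.I‖ ≤ t ^ 2 := by
    have hh : ‖-((θ : ℂ) * Complex.I)‖ = |θ| := by
      rw [norm_neg, norm_mul, Complex.norm_I, mul_one, Complex.norm_real, Real.norm_eq_abs]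
    have h2 := Complex.norm_exp_sub_one_sub_id_le (x := -((θ : ℂ) * Complex.I))
      (by rw [hh]; linarith)
    rw [hh, sub_neg_eq_add] at h2
    rw [← Complex.exp_conj, map_mul, Complex.conj_ofReal, Complex.conj_I, mul_neg]
    exact h2.trans (pow_le_pow_left₀ (abs_nonneg _) hθ 2)
  have hc2 : ‖starRingEnd ℂ (Complex.exp (θ * Complex.I)) - 1‖ ≤ 2 * t := by
    have h3 : starRingEnd ℂ (Complex.exp (θ * Complex.I)) - 1 =
        (starRingEnd ℂ (Complex.exp (θ * Complex.I)) - 1 + θ * Complex.I) - θ * Complex.I := by ring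
    rw [h3]
    refine (norm_sub_le _ _).trans ?_
    rw [norm_mul, Complex.norm_I, mul_one, Complex.norm_real, Real.norm_eq_abs]
    nlinarith
  set c := starRingEnd ℂ (Complex.exp (θ * Complex.I)) with hc
  have hmain : gaugeAction (Complex.exp (θ * Complex.I)) W V - V -
      Complex.I • (ampliate k K * V - V * K - (θ : ℂ) • V) =
      (c - 1 + θ * Complex.I) • V + (c - 1) • (Complex.I • Q + E) + E := by
    have hQ' : ampliate k K * V - V * K = Q := by
      rw [hQ, Matrix.mul_one, ampliate_one, Matrix.one_mul]
    rw [gaugeAction, ← hc, hU, hQ']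
    module
  rw [hmain]
  have hV0 := norm_nonneg V
  have htt : t ^ 2 ≤ t := by nlinarith
  -- The constant is `22 = 2 * (2 + 6) + 6`.
  calc _ ≤ t ^ 2 * ‖V‖ + (2 * t) * (2 * B * t + 6 * B * t) + 6 * B * t ^ 2 := by
        refine (norm_add_le _ _).trans (add_le_add ((norm_add_le _ _).trans (add_le_add ?_ ?_)) hEn)
        · rw [norm_smul]
          gcongr
        · rw [norm_smul]
          gcongr
          refine (norm_add_le _ _).trans (add_le_add ?_ (hEn.trans ?_))
          · rw [norm_smul, Complex.norm_I, one_mul]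
            exact hQn
          · gcongr
    _ = (‖V‖ + 22 * B) * t ^ 2 := by ring
    _ ≤ 22 * ((d * (d * k : ℕ) + 1) * ‖V‖) * t ^ 2 := by
        gcongr
        rw [hB]
        linarith

theorem norm_gaugeAction_sub_le (A : Op d k) {W K : Matrix (Fin d) (Fin d) ℂ} {θ t : ℝ}
    (ht0 : 0 ≤ t) (ht : t ≤ 1) (hK : K.IsHermitian) (hKt : ‖K‖ ≤ t)
    (hWK : ‖W - 1 - Complex.I • K‖ ≤ t ^ 2) (hθ : |θ| ≤ t) :
    ‖gaugeAction (Complex.exp (θ * Complex.I)) W A - A‖ ≤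
      25 * ((d * (d * k : ℕ) + 1) * ‖A‖) * t := by
  have h1 := norm_gaugeAction_sub_sub_le A ht0 ht hK hKt hWK hθ
  have hn : ‖(1 : Matrix (Fin d) (Fin d) ℂ)‖ ≤ 1 := norm_one_matrix_le
  have e1 : ‖ampliate k K * A‖ ≤ d * (d * k : ℕ) * t * ‖A‖ * 1 := by
    have := norm_ampliate_mul_mul_le K A 1
    rw [Matrix.mul_one] at this
    exact this.trans (by gcongr)
  have e2 : ‖A * K‖ ≤ d * (d * k : ℕ) * 1 * ‖A‖ * t := by
    have := norm_ampliate_mul_mul_le 1 A K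
    rw [ampliate_one, Matrix.one_mul] at this
    exact this.trans (by gcongr)
  have h2 : ‖Complex.I • (ampliate k K * A - A * K - (θ : ℂ) • A)‖ ≤
      2 * (d * (d * k : ℕ)) * ‖A‖ * t + t * ‖A‖ := by
    rw [norm_smul, Complex.norm_I, one_mul]
    calc _ ≤ d * (d * k : ℕ) * t * ‖A‖ * 1 + d * (d * k : ℕ) * 1 * ‖A‖ * t + t * ‖A‖ := by
          refine (norm_sub_le _ _).trans (add_le_add ((norm_sub_le _ _).trans (add_le_add e1 e2)) ?_)
          rw [norm_smul, Complex.norm_real, Real.norm_eq_abs]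
          gcongr
      _ = _ := by ring
  have h3 := norm_add_le (gaugeAction (Complex.exp (θ * Complex.I)) W A - A -
    Complex.I • (ampliate k K * A - A * K - (θ : ℂ) • A))
    (Complex.I • (ampliate k K * A - A * K - (θ : ℂ) • A))
  rw [sub_add_cancel] at h3
  have htt : t ^ 2 ≤ t := by nlinarith
  have h4 : 0 ≤ (d * (d * k : ℕ) : ℝ) * ‖A‖ * t := by positivity
  have h5 : 0 ≤ ‖A‖ * t := by positivity
  calc _ ≤ 22 * ((d * (d * k : ℕ) + 1) * ‖A‖) * t ^ 2 +
        (2 * (d * (d * k : ℕ)) * ‖A‖ * t + t * ‖A‖) := h3.trans (add_le_add h1 h2)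
    _ ≤ 22 * ((d * (d * k : ℕ) + 1) * ‖A‖) * t +
        (2 * (d * (d * k : ℕ)) * ‖A‖ * t + t * ‖A‖) := by gcongr
    _ ≤ _ := by nlinarith

set_option maxHeartbeats 400000 in
/-- Every isometry near `V₀` in a tangent direction `A` can be rotated by the gauge group in such
a way that it lies in the direction of the identifiable component of `A`, to second order. -/
theorem exists_gaugeAction_near (V₀ : irreducibleIsometries d k) {M : ℝ} (hM : 0 ≤ M) :
    ∃ κ ≥ 1, ∃ r > 0, ∀ (A V : Op d k) (t : ℝ), A ∈ tangentSpace V₀ → ‖A‖ ≤ t → t ≤ r →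
      ‖V - V₀.1 - Complex.I • A‖ ≤ M * t ^ 2 →
      ∃ (c : ℂ) (W : Matrix (Fin d) (Fin d) ℂ), ‖c‖ = 1 ∧ Wᴴ * W = 1 ∧ ‖W - 1‖ ≤ κ * t ∧
        ‖gaugeAction c W V - V₀.1‖ ≤ κ * t ∧
        ‖gaugeAction c W V - V₀.1 - Complex.I • idProj V₀ A‖ ≤ (κ * t) ^ 2 := by
  obtain ⟨C₁, hC₁0, hC₁⟩ := norm_meanPart_le V₀
  obtain ⟨C₂, hC₂0, hC₂⟩ := norm_gaugePart_le V₀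
  obtain ⟨s, hs⟩ : ∃ s : ℝ, s = C₂ * (1 + d) + C₁ + 1 := ⟨_, rfl⟩
  have hsC₂ : C₂ * (1 + d) ≤ s := by rw [hs]; linarith
  have hsC₂' : C₂ ≤ s := by
    have : 0 ≤ C₂ * d := by positivity
    rw [hs]; linarith
  have hsC₁ : C₁ ≤ s := by
    have : 0 ≤ C₂ * (1 + d) := by positivity
    rw [hs]; linarith
  have hs1 : 1 ≤ s := by
    have : 0 ≤ C₂ * (1 + d) := by positivity
    rw [hs]; linarith
  have hs0 : 0 ≤ s := zero_le_one.trans hs1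
  obtain ⟨D, hD⟩ : ∃ D : ℝ, D = d * (d * k : ℕ) + 1 := ⟨_, rfl⟩
  have hD0 : 0 ≤ D := by rw [hD]; positivity
  obtain ⟨b, hb⟩ : ∃ b : ℝ, b = ‖V₀.1‖ := ⟨_, rfl⟩
  have hb0 : 0 ≤ b := hb ▸ norm_nonneg _
  obtain ⟨κ, hκ1, hκa, hκb, hκc⟩ : ∃ κ : ℝ, 1 ≤ κ ∧ s ≤ κ ∧
      D * (M + 1) + 25 * (D * b) * s ≤ κ ∧ D * M + 25 * D * s + 22 * (D * b) * s ^ 2 ≤ κ :=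
    ⟨max s (max (D * (M + 1) + 25 * (D * b) * s) (D * M + 25 * D * s + 22 * (D * b) * s ^ 2)),
      hs1.trans (le_max_left _ _), le_max_left _ _, (le_max_left _ _).trans (le_max_right _ _),
      (le_max_right _ _).trans (le_max_right _ _)⟩
  refine ⟨κ, hκ1, 1 / s, by positivity, fun A V t hA hAt ht hV => ?_⟩
  have ht0 : 0 ≤ t := (norm_nonneg _).trans hAt
  have hst : s * t ≤ 1 := by
    rw [le_div_iff₀ (by positivity)] at ht
    linarith
  have ht1 : t ≤ 1 := by nlinarith
  set K := gaugePart V₀ A with hK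
  have hKh : K.IsHermitian := isHermitian_gaugePart V₀ hA
  obtain ⟨θ, hθ⟩ : ∃ θ : ℝ, (θ : ℂ) = meanPart V₀ A := Complex.conj_eq_iff_real.1
    (conj_meanPart V₀ hA) |>.imp fun _ h => h.symm
  have hθt : |θ| ≤ s * t := by
    have h := hC₁ A
    rw [← hθ, Complex.norm_real, Real.norm_eq_abs] at h
    refine h.trans ?_
    gcongr
  have hKt' : ‖K‖ ≤ C₂ * t := (hC₂ A).trans (by gcongr)
  have hKt : ‖K‖ ≤ s * t := hKt'.trans (by gcongr)
  -- The Cayley transform of `i K / 2` is exactly unitary and equals `1 + i K` up to second order.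
  set S : Matrix (Fin d) (Fin d) ℂ := (Complex.I / 2) • K with hS
  have hSskew : Sᴴ = -S := by
    rw [hS, Matrix.conjTranspose_smul, hKh.eq, ← neg_smul]
    congr 1
    simp [neg_div]
  have hSn : ‖S‖ ≤ C₂ * t := by
    rw [hS, norm_smul, norm_div, Complex.norm_I, Complex.norm_ofNat]
    have := norm_nonneg K
    linarith
  have hW1 := norm_cayley_sub_one_le hSskew
  have hW2 := norm_cayley_sub_one_sub_le hSskew
  rw [Fintype.card_fin] at hW1 hW2
  have hSK : (2 : ℕ) • S = Complex.I • K := by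
    rw [hS, ← Nat.cast_smul_eq_nsmul ℂ, smul_smul]
    congr 1
    push_cast
    ring
  have hWK : ‖cayley S - 1 - Complex.I • K‖ ≤ (s * t) ^ 2 := by
    rw [← hSK]
    refine hW2.trans ?_
    have h1 : (1 + d) * ‖S‖ ≤ s * t := by
      calc (1 + d) * ‖S‖ ≤ (1 + d) * (C₂ * t) := by gcongr
        _ = (C₂ * (1 + d)) * t := by ring
        _ ≤ s * t := by gcongr
    calc d * (1 + d) * ‖S‖ ^ 2 ≤ (1 + d) * (1 + d) * ‖S‖ ^ 2 := by gcongr; linarith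
      _ = ((1 + d) * ‖S‖) ^ 2 := by ring
      _ ≤ _ := by gcongr
  have hWW := conjTranspose_cayley_mul_cayley hSskew
  have hst0 : 0 ≤ s * t := by positivity
  have hcn : ‖Complex.exp (θ * Complex.I)‖ = 1 := Complex.norm_exp_ofReal_mul_I θ
  have g1 := norm_gaugeAction_sub_sub_le V₀.1 hst0 hst hKh hKt hWK hθt
  have g2 := norm_gaugeAction_sub_le (Complex.I • A) hst0 hst hKh hKt hWK hθt
  have g3 := norm_gaugeAction_le hWW hcn (V - V₀.1 - Complex.I • A)
  have g4 := norm_gaugeAction_sub_le V₀.1 hst0 hst hKh hKt hWK hθt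
  have g5 := norm_gaugeAction_le hWW hcn (V - V₀.1)
  set g := gaugeAction (k := k) (Complex.exp (θ * Complex.I)) (cayley S) with hg
  have hadd : ∀ X Y : Op d k, g (X + Y) = g X + g Y := by
    intro X Y
    rw [hg]
    simp only [gaugeAction, Matrix.mul_add, Matrix.add_mul, smul_add]
  have hsub : ∀ X Y : Op d k, g (X - Y) = g X - g Y := by
    intro X Y
    have := hadd (X - Y) Y
    rw [sub_add_cancel] at this
    rw [this, add_sub_cancel_right]
  rw [norm_smul, Complex.norm_I, one_mul, ← hD] at g2
  rw [← hD, ← hb] at g1 g4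
  have hdk : (d * (d * k : ℕ) : ℝ) ≤ D := by rw [hD]; linarith
  have hVn : ‖V - V₀.1‖ ≤ (M + 1) * t := by
    have h1 := norm_add_le (V - V₀.1 - Complex.I • A) (Complex.I • A)
    rw [sub_add_cancel, norm_smul, Complex.norm_I, one_mul] at h1
    have h2 : M * t ^ 2 ≤ M * t := by
      gcongr
      nlinarith
    linarith
  refine ⟨Complex.exp (θ * Complex.I), cayley S, hcn, hWW, ?_, ?_, ?_⟩
  · refine hW1.trans ?_
    calc (1 + d) * ‖S‖ ≤ (1 + d) * (C₂ * t) := by gcongr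
      _ = (C₂ * (1 + d)) * t := by ring
      _ ≤ s * t := by gcongr
      _ ≤ κ * t := by gcongr
  · have h1 : g V - V₀.1 = g (V - V₀.1) + (g V₀.1 - V₀.1) := by rw [hsub]; abel
    rw [h1]
    calc _ ≤ D * ((M + 1) * t) + 25 * (D * b) * (s * t) := by
          refine (norm_add_le _ _).trans (add_le_add (g5.trans ?_) g4)
          gcongr
      _ = (D * (M + 1) + 25 * (D * b) * s) * t := by ring
      _ ≤ κ * t := by gcongr
  -- With `θ` and `K` taken from the definition of `idProj`, the linear terms cancel. What remains
  -- is the error of `V`, the effect of the gauge on `i A`, and the second order error of the gauge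
  -- orbit at `V₀`.
  · have h1 : g V - V₀.1 - Complex.I • idProj V₀ A = g (V - V₀.1 - Complex.I • A) +
        (g (Complex.I • A) - Complex.I • A) +
        (g V₀.1 - V₀.1 - Complex.I • (ampliate k K * V₀.1 - V₀.1 * K - (θ : ℂ) • V₀.1)) := by
      rw [hsub, hsub, idProj, gaugeTangent, ← hθ, ← hK]
      module
    rw [h1]
    calc _ ≤ D * (M * t ^ 2) + 25 * (D * t) * (s * t) + 22 * (D * b) * (s * t) ^ 2 := by
          refine (norm_add_le _ _).trans (add_le_add ((norm_add_le _ _).trans (add_le_add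
            (g3.trans ?_) (g2.trans ?_))) g1)
          · gcongr
          · gcongr
      _ = (D * M + 25 * D * s + 22 * (D * b) * s ^ 2) * t ^ 2 := by ring
      _ ≤ κ * t ^ 2 := by gcongr
      _ ≤ κ ^ 2 * t ^ 2 := by
        gcongr
        exact le_self_pow₀ hκ1 two_ne_zero
      _ = _ := by ring

end GaugeFixing


/-! ### Smoothness of matrix operations and of the chart. -/

section SmoothMatrix

variable {E : Type*} [NormedAddCommGroup E] [NormedSpace ℝ E] {l m n : Type*} [Fintype l]
  [Fintype m] [Fintype n] {r : WithTop ℕ∞} {x : E}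

theorem contDiffAt_matrix {f : E → Matrix m n ℂ} :
    ContDiffAt ℝ r f x ↔ ∀ i j, ContDiffAt ℝ r (fun y => f y i j) x := by
  constructor
  · intro h i j
    exact contDiffAt_pi.1 (contDiffAt_pi.1 h i) j
  · intro h
    exact contDiffAt_pi.2 fun i => contDiffAt_pi.2 fun j => h i j

theorem _root_.ContDiffAt.matrix_mul {f : E → Matrix l m ℂ} {g : E → Matrix m n ℂ}
    (hf : ContDiffAt ℝ r f x) (hg : ContDiffAt ℝ r g x) :
    ContDiffAt ℝ r (fun y => f y * g y) x := by
  rw [contDiffAt_matrix] at hf hg ⊢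
  intro i j
  simp only [Matrix.mul_apply]
  exact ContDiffAt.sum fun a _ => (hf i a).mul (hg a j)

theorem _root_.ContDiffAt.matrix_conjTranspose {f : E → Matrix m n ℂ} (hf : ContDiffAt ℝ r f x) :
    ContDiffAt ℝ r (fun y => (f y)ᴴ) x := by
  rw [contDiffAt_matrix] at hf ⊢
  intro i j
  exact (Complex.conjCLE : ℂ ≃L[ℝ] ℂ).contDiff.contDiffAt.comp x (hf j i)

variable [DecidableEq n]

theorem _root_.ContDiffAt.matrix_det {f : E → Matrix n n ℂ} (hf : ContDiffAt ℝ r f x) :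
    ContDiffAt ℝ r (fun y => (f y).det) x := by
  rw [contDiffAt_matrix] at hf
  simp only [Matrix.det_apply]
  refine ContDiffAt.sum fun σ _ => ?_
  have : ContDiffAt ℝ r (fun y => ∏ i, f y (σ i) i) x := contDiffAt_prod fun i _ => hf _ _
  simp only [Units.smul_def, ← Int.cast_smul_eq_zsmul ℝ]
  exact this.const_smul _

/-- By Cramer's rule: the inverse is the adjugate, polynomial in the entries, divided by the
determinant. -/
theorem _root_.ContDiffAt.matrix_inv {f : E → Matrix n n ℂ} (hf : ContDiffAt ℝ r f x)
    (hx : IsUnit (f x)) : ContDiffAt ℝ r (fun y => (f y)⁻¹) x := by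
  have hdet : (f x).det ≠ 0 := ((Matrix.isUnit_iff_isUnit_det _).1 hx).ne_zero
  simp only [Matrix.inv_def, Ring.inverse_eq_inv']
  refine (hf.matrix_det.inv hdet).smul ?_
  rw [contDiffAt_matrix]
  intro i j
  simp only [Matrix.adjugate_apply]
  refine ContDiffAt.matrix_det ?_
  rw [contDiffAt_matrix] at hf ⊢
  intro a b
  by_cases h : a = j
  · subst h
    simp only [Matrix.updateRow_self]
    exact contDiffAt_const
  · simp only [Matrix.updateRow_ne h]
    exact hf a b

theorem _root_.ContDiffAt.cayley {f : E → Matrix n n ℂ} (hf : ContDiffAt ℝ r f x)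
    (hx : (f x)ᴴ = -f x) : ContDiffAt ℝ r (fun y => cayley (f y)) x := by
  simp only [QMC.cayley]
  exact (contDiffAt_const.add hf).matrix_mul
    ((contDiffAt_const.sub hf).matrix_inv (isUnit_one_sub_of_conjTranspose_eq_neg hx))

/-- Tangency is needed only at the base point: there the generator is skew-Hermitian, so the matrix
inverted in the Cayley transform is invertible, which is an open condition. -/
theorem contDiffAt_chart {d k : ℕ} {V : Op d k} {f : E → Op d k} (hf : ContDiffAt ℝ r f x)
    (hx : (f x)ᴴ * V = Vᴴ * f x) : ContDiffAt ℝ r (fun y => chart V (f y)) x := by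
  have h1 : ContDiffAt ℝ r (fun y => ((2⁻¹ : ℂ) • chartGenerator V (f y))) x := by
    simp only [chartGenerator, smul_smul]
    refine ContDiffAt.const_smul _ (((hf.matrix_mul contDiffAt_const).add
      (contDiffAt_const.matrix_mul hf.matrix_conjTranspose)).sub
      ((contDiffAt_const.matrix_mul (contDiffAt_const.matrix_mul hf)).matrix_mul contDiffAt_const))
  exact (h1.cayley (conjTranspose_half_chartGenerator hx)).matrix_mul contDiffAt_const

end SmoothMatrix

/-! ### Reference states along the chart and their Gram kernel. -/

section LocalGram

variable {d k : ℕ}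

theorem continuous_systemOutput (φ : EuclideanSpace ℂ (Fin d)) (n : ℕ) :
    Continuous fun V : Op d k => systemOutput φ n V := by
  have hk : ∀ i, Continuous fun V : Op d k => kraus V i := fun i =>
    continuous_matrix fun a b => (continuous_apply b).comp (continuous_apply (a, i))
  have hw : ∀ n (w : Fin n → Fin k), Continuous fun V : Op d k => krausWord V n w := by
    intro n
    induction n with
    | zero => exact fun w => continuous_const
    | succ n ih => exact fun w => (hk _).matrix_mul (ih _)
  refine (PiLp.continuous_toLp 2 _).comp (continuous_pi fun p => ?_)
  exact (continuous_apply p.1).comp ((hw n p.2).matrix_mulVec continuous_const)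

theorem continuous_phaseRate (V₀ : irreducibleIsometries d k) : Continuous (phaseRate V₀) := by
  refine Complex.continuous_im.comp ?_
  exact (continuous_const.matrix_mul (continuous_const.matrix_mul continuous_id)).matrix_trace

theorem LinearMap.continuous_of_finiteDimensional_normed {𝕜 E F : Type*} [RCLike 𝕜]
    [NormedAddCommGroup E] [NormedSpace 𝕜 E] [FiniteDimensional 𝕜 E] [NormedAddCommGroup F]
    [NormedSpace 𝕜 F] (f : E →ₗ[𝕜] F) : Continuous f :=
  LinearMap.continuous_of_finiteDimensional f

/-- The system and output state along the chart, with a convenient choice of the phase. -/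
def referenceState (V₀ : irreducibleIsometries d k) (φ : EuclideanSpace ℂ (Fin d)) (n : ℕ)
    (L : ModeSpace V₀) : EuclideanSpace ℂ (Fin d × (Fin n → Fin k)) :=
  Complex.exp (-(Complex.I * (n * phaseRate V₀ (chart V₀.1 L.1)))) •
    systemOutput φ n (chart V₀.1 L.1)

theorem conjTranspose_mul_eq_of_mem_lowerBlock (V₀ : irreducibleIsometries d k) {L : Op d k}
    (hL : V₀.1ᴴ * L = 0) : Lᴴ * V₀.1 = V₀.1ᴴ * L := by
  have h := congrArg Matrix.conjTranspose hL
  rw [Matrix.conjTranspose_mul, Matrix.conjTranspose_conjTranspose,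
    Matrix.conjTranspose_zero] at h
  rw [h, hL]

theorem exists_norm_val_le (V₀ : irreducibleIsometries d k) :
    ∃ C ≥ 0, ∀ L : ModeSpace V₀, ‖(L.1 : Op d k)‖ ≤ C * ‖L‖ :=
  LinearMap.exists_norm_le_of_finiteDimensional (𝕜 := ℂ)
    (E := ModeSpace V₀) (F := Op d k) (lowerBlock V₀).subtype

theorem continuous_referenceState (V₀ : irreducibleIsometries d k)
    (φ : EuclideanSpace ℂ (Fin d)) (n : ℕ) : Continuous (referenceState V₀ φ n) := by
  have hval : Continuous fun L : ModeSpace V₀ => (L.1 : Op d k) :=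
    LinearMap.continuous_of_finiteDimensional_normed (𝕜 := ℂ) (E := ModeSpace V₀) (F := Op d k)
      (lowerBlock V₀).subtype
  have hchart : Continuous fun L : ModeSpace V₀ => chart V₀.1 L.1 := by
    refine continuous_iff_continuousAt.2 fun L => ?_
    have h := (contDiffAt_chart (r := 0) (V := V₀.1) (f := fun y : Op d k => y) (x := L.1)
      contDiffAt_id (conjTranspose_mul_eq_of_mem_lowerBlock V₀ L.2)).continuousAt
    exact ContinuousAt.comp (f := fun L : ModeSpace V₀ => (L.1 : Op d k)) h hval.continuousAt
  have hout : Continuous fun L : ModeSpace V₀ => systemOutput φ n (chart V₀.1 L.1) :=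
    (continuous_systemOutput φ n).comp hchart
  refine Continuous.smul (f := fun L : ModeSpace V₀ =>
    Complex.exp (-(Complex.I * (n * phaseRate V₀ (chart V₀.1 L.1))))) ?_ hout
  refine Complex.continuous_exp.comp (continuous_const.mul (continuous_const.mul
    (Complex.continuous_ofReal.comp ((continuous_phaseRate V₀).comp hchart)))).neg

/-- The phases of both vectors combine to the phase in `exists_norm_overlap_sub_gaussKernel_le`. The
phase rate may belong to an isometry `V''` other than the one producing the state, namely to the
gauge transform of `V`. -/
theorem inner_smul_systemOutput (V₀ : irreducibleIsometries d k)
    (φ : EuclideanSpace ℂ (Fin d)) (n : ℕ) (V V' V'' : Op d k) (z : ℂ) :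
    ⟪(starRingEnd ℂ (Complex.exp (Complex.I * (n * phaseRate V₀ V'')) * z)) • systemOutput φ n V,
      Complex.exp (-(Complex.I * (n * phaseRate V₀ V'))) • systemOutput φ n V'⟫_ℂ =
    Complex.exp (-(Complex.I * (n * (phaseRate V₀ V' - phaseRate V₀ V'')))) *
      (z * overlap V V' φ φ n 1) := by
  rw [inner_smul_left, inner_smul_right, Complex.conj_conj, inner_systemOutput]
  have h : Complex.exp (-(Complex.I * (n * (phaseRate V₀ V' - phaseRate V₀ V'')))) =
      Complex.exp (Complex.I * (n * phaseRate V₀ V'')) *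
        Complex.exp (-(Complex.I * (n * phaseRate V₀ V'))) := by
    rw [← Complex.exp_add]
    congr 1
    ring
  rw [h]
  ring

theorem norm_exp_I_mul (a : ℂ) (h : a.im = 0) : ‖Complex.exp (Complex.I * a)‖ = 1 := by
  rw [Complex.norm_exp]
  simp [h]

/-- Local asymptotic Gaussianity of the inner products between the reference states and the system
and output states at isometries `V = V₀ + i A + O(|A|²)`. -/
theorem exists_norm_inner_referenceState_sub_le (V₀ : irreducibleIsometries d k)
    {φ : EuclideanSpace ℂ (Fin d)} (hφ : ‖φ‖ = 1) {M : ℝ} (hM : 0 ≤ M) :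
    ∃ C ≥ 0, ∃ r > 0, ∀ (n : ℕ) (t : ℝ), 0 ≤ t → t ≤ r → n * t ^ 3 ≤ r →
      (∀ L L' : ModeSpace V₀, ‖(L.1 : Op d k)‖ ≤ t → ‖(L'.1 : Op d k)‖ ≤ t →
        ‖⟪referenceState V₀ φ n L, referenceState V₀ φ n L'⟫_ℂ -
          gaussKernel (((√n : ℝ) : ℂ) • L) (((√n : ℝ) : ℂ) • L')‖ ≤ C * (t + n * t ^ 3)) ∧
      ∀ A V : Op d k, A ∈ tangentSpace V₀ → ‖A‖ ≤ t → Vᴴ * V = 1 →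
        ‖V - V₀.1 - Complex.I • A‖ ≤ M * t ^ 2 →
        ∃ z : ℂ, ‖z‖ = 1 ∧ ∀ L' : ModeSpace V₀, ‖(L'.1 : Op d k)‖ ≤ t →
          ‖⟪z • systemOutput φ n V, referenceState V₀ φ n L'⟫_ℂ -
            gaussKernel (((√n : ℝ) : ℂ) • toMode V₀ (idProj V₀ A)) (((√n : ℝ) : ℂ) • L')‖ ≤
            C * (t + n * t ^ 3) := by
  obtain ⟨C, hC0, τ₀, hτ₀, hτ₀1, hC⟩ := exists_norm_overlap_sub_gaussKernel_le V₀
  obtain ⟨κ₀, hκ₀, r₀, hr₀, hG⟩ := exists_gaugeAction_near V₀ hM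
  obtain ⟨c, hc0, hc⟩ := norm_chart_sub_le V₀.2.1
  obtain ⟨κ, hκ1, hκa, hκb⟩ : ∃ κ : ℝ, 1 ≤ κ ∧ (d + 1) * κ₀ ≤ κ ∧ 1 + c ≤ κ :=
    ⟨max ((d + 1) * κ₀) (1 + c), by
      have : (1 : ℝ) ≤ 1 + c := by linarith
      exact this.trans (le_max_right _ _), le_max_left _ _, le_max_right _ _⟩
  have hκ0 : 0 ≤ κ := zero_le_one.trans hκ1
  have hκκ : κ₀ ≤ κ := by
    have : (0 : ℝ) ≤ d * κ₀ := by positivity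
    linarith
  -- The overlap estimate is applied at scale `τ = κ t`, where `κ` dominates the constants of the
  -- chart and of the gauge fixing. Hence the requirements `κ r ≤ τ₀` and `κ³ r ≤ 1`.
  obtain ⟨r, hr, hr1, hr2, hr3, hr4⟩ : ∃ r : ℝ, 0 < r ∧ r ≤ 1 ∧ r ≤ r₀ ∧ κ * r ≤ τ₀ ∧
      κ ^ 3 * r ≤ 1 := by
    have hκp : 0 < κ := by linarith
    refine ⟨min (min 1 r₀) (min (τ₀ / κ) (1 / κ ^ 3)), by positivity,
      (min_le_left _ _).trans (min_le_left _ _), (min_le_left _ _).trans (min_le_right _ _), ?_, ?_⟩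
    · rw [mul_comm, ← le_div_iff₀ hκp]
      exact (min_le_right _ _).trans (min_le_left _ _)
    · rw [mul_comm, ← le_div_iff₀ (by positivity)]
      exact (min_le_right _ _).trans (min_le_right _ _)
  refine ⟨C * κ ^ 3, by positivity, r, hr, fun n t ht htr hnt => ?_⟩
  have ht1 : t ≤ 1 := htr.trans hr1
  have hκt0 : 0 ≤ κ * t := by positivity
  have hκt : κ * t ≤ τ₀ := (by gcongr : κ * t ≤ κ * r).trans hr3
  have hκn : n * (κ * t) ^ 3 ≤ 1 := by
    calc n * (κ * t) ^ 3 = κ ^ 3 * (n * t ^ 3) := by ring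
      _ ≤ κ ^ 3 * r := by gcongr
      _ ≤ 1 := hr4
  have hfin : C * (κ * t + n * (κ * t) ^ 3) ≤ C * κ ^ 3 * (t + n * t ^ 3) := by
    have h1 : κ ≤ κ ^ 3 := le_self_pow₀ hκ1 (by norm_num)
    calc C * (κ * t + n * (κ * t) ^ 3) ≤ C * (κ ^ 3 * t + n * (κ * t) ^ 3) := by gcongr
      _ = _ := by ring
  have hch : ∀ L : ModeSpace V₀, ‖(L.1 : Op d k)‖ ≤ t →
      (chart V₀.1 L.1)ᴴ * chart V₀.1 L.1 = 1 ∧ ‖chart V₀.1 L.1 - V₀.1‖ ≤ κ * t ∧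
      ‖chart V₀.1 L.1 - V₀.1 - Complex.I • (L.1 : Op d k)‖ ≤ (κ * t) ^ 2 := by
    intro L hL
    have hLt := conjTranspose_mul_eq_of_mem_lowerBlock V₀ L.2
    have h1 : ‖chart V₀.1 L.1 - V₀.1 - Complex.I • (L.1 : Op d k)‖ ≤ c * t ^ 2 :=
      (hc L.1 hLt).trans (by gcongr)
    refine ⟨conjTranspose_chart_mul_chart V₀.2.1 hLt, ?_, h1.trans ?_⟩
    · have h2 := norm_add_le (chart V₀.1 L.1 - V₀.1 - Complex.I • (L.1 : Op d k))
        (Complex.I • (L.1 : Op d k))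
      rw [sub_add_cancel, norm_smul, Complex.norm_I, one_mul] at h2
      calc _ ≤ c * t ^ 2 + t := h2.trans (add_le_add h1 hL)
        _ ≤ c * t + t := by
          gcongr
          nlinarith
        _ = (1 + c) * t := by ring
        _ ≤ κ * t := by gcongr
    · calc c * t ^ 2 ≤ κ * t ^ 2 := by gcongr; linarith
        _ ≤ κ ^ 2 * t ^ 2 := by gcongr; exact le_self_pow₀ hκ1 two_ne_zero
        _ = _ := by ring
  refine ⟨fun L L' hL hL' => ?_, fun A V hA hAt hV hVA => ?_⟩
  · obtain ⟨a1, a2, a3⟩ := hch L hL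
    obtain ⟨b1, b2, b3⟩ := hch L' hL'
    have h1 := hC n _ _ L L' φ φ 1 (κ * t) a1 b1 hφ hφ hκt0 hκt hκn a2 b2 a3 b3
      (by rw [sub_self, norm_zero]; exact hκt0) (by rw [sub_self, norm_zero]; exact hκt0)
    have h2 := inner_smul_systemOutput V₀ φ n (chart V₀.1 L.1) (chart V₀.1 L'.1)
      (chart V₀.1 L.1) 1
    have h3 : starRingEnd ℂ (Complex.exp (Complex.I * (n * phaseRate V₀ (chart V₀.1 L.1))) * 1) =
        Complex.exp (-(Complex.I * (n * phaseRate V₀ (chart V₀.1 L.1)))) := by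
      rw [mul_one, ← Complex.exp_conj]
      simp
    rw [h3, one_mul] at h2
    rw [referenceState, referenceState, h2]
    exact h1.trans hfin
  · obtain ⟨c', W, hc', hW, hW1, hg1, hg2⟩ := hG A V t hA hAt (htr.trans hr2) hVA
    -- This phase supplies the factor `c' ^ n` of the gauge transformation and the phase of the
    -- transformed isometry; it depends on `V` only, not on the reference point `L'`.
    refine ⟨starRingEnd ℂ (Complex.exp (Complex.I * (n * phaseRate V₀ (gaugeAction c' W V))) *
      c' ^ n), ?_, fun L' hL' => ?_⟩
    · rw [RCLike.norm_conj, norm_mul, norm_pow, hc', one_pow, mul_one]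
      exact norm_exp_I_mul _ (by simp)
    · obtain ⟨b1, b2, b3⟩ := hch L' hL'
      have hκ₀t : κ₀ * t ≤ κ * t := by gcongr
      have hWt : ‖W - 1‖ ≤ κ * t := hW1.trans hκ₀t
      have hφt : ‖applyVec W φ - φ‖ ≤ κ * t := by
        have h1 : applyVec W φ - φ = applyVec (W - 1) φ := by
          rw [applyVec, applyVec, Matrix.sub_mulVec, Matrix.one_mulVec]
          rfl
        rw [h1]
        refine (norm_applyVec_le _ hφ).trans ?_
        calc d * ‖W - 1‖ ≤ d * (κ₀ * t) := by gcongr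
          _ ≤ (d + 1) * κ₀ * t := by nlinarith [mul_nonneg (zero_le_one.trans hκ₀) ht]
          _ ≤ κ * t := by gcongr
      have h1 := hC n _ _ (toMode V₀ (idProj V₀ A)) L' (applyVec W φ) φ W (κ * t)
        (conjTranspose_gaugeAction_mul hW hc' hV) b1 (norm_applyVec_of_isometry hW hφ) hφ hκt0 hκt
        hκn (hg1.trans hκ₀t) b2 (by
          rw [coe_toMode_idProj]
          exact hg2.trans (by gcongr)) b3 hWt hφt
      rw [overlap_gaugeAction hW] at h1
      rw [referenceState, inner_smul_systemOutput]
      exact h1.trans hfin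

end LocalGram


/-! ### Lagrangian mechanics in a chart: Taylor expansion and existence of extremals. -/

section Variational

set_option maxSynthPendingDepth 3

variable {E : Type*} [NormedAddCommGroup E] [NormedSpace ℝ E]

/-- Taylor's formula with a uniform quadratic remainder on compact convex sets. -/
theorem exists_norm_sub_sub_fderiv_le {G : Type*} [NormedAddCommGroup G] [NormedSpace ℝ G]
    {g : E → G} {U K : Set E} (hU : IsOpen U) (hg : ContDiffOn ℝ ∞ g U) (hK : IsCompact K)
    (hKc : Convex ℝ K) (hKU : K ⊆ U) :
    ∃ C ≥ 0, ∀ y ∈ K, ∀ z ∈ K, ‖g z - g y - fderiv ℝ g y (z - y)‖ ≤ C * ‖z - y‖ ^ 2 := by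
  have h1 : ContDiffOn ℝ 1 (fderiv ℝ g) U := hg.fderiv_of_isOpen hU (by norm_cast)
  obtain ⟨C, hC⟩ := (h1.mono hKU).exists_lipschitzOnWith one_ne_zero hKc hK
  refine ⟨C, C.2, fun y hy z hz => ?_⟩
  have hseg : segment ℝ y z ⊆ K := hKc.segment_subset hy hz
  have h2 := (convex_segment y z).norm_image_sub_le_of_norm_hasFDerivWithin_le'
    (f := g) (f' := fderiv ℝ g) (φ := fderiv ℝ g y) (C := C * ‖z - y‖)
    (fun w hw => ((hg.contDiffAt (hU.mem_nhds (hKU (hseg hw)))).differentiableAt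
      (by simp)).hasFDerivAt.hasFDerivWithinAt)
    (fun w hw => by
      refine (hC.norm_sub_le (hseg hw) hy).trans ?_
      gcongr
      exact norm_sub_le_of_mem_segment hw)
    (left_mem_segment ℝ y z) (right_mem_segment ℝ y z)
  calc _ ≤ C * ‖z - y‖ * ‖z - y‖ := h2
    _ = _ := by ring

/-- The Lagrangian `½ B_x(v, v)` of a Riemannian metric. -/
def lagrangian (B : E → E →L[ℝ] E →L[ℝ] ℝ) (y : E × E) : ℝ := 1 / 2 * B y.1 y.2 y.2

/-- The derivative of the Lagrangian with respect to the position. -/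
def force (B : E → E →L[ℝ] E →L[ℝ] ℝ) (x v : E) : E →L[ℝ] ℝ :=
  (1 / 2 : ℝ) • ((fderiv ℝ B x).flip v).flip v

theorem force_apply (B : E → E →L[ℝ] E →L[ℝ] ℝ) (x v w : E) :
    force B x v w = 1 / 2 * fderiv ℝ B x w v v := rfl

theorem force_smul (B : E → E →L[ℝ] E →L[ℝ] ℝ) (x v : E) (c : ℝ) :
    force B x (c • v) = c ^ 2 • force B x v := by
  ext w
  rw [force_apply, smul_apply, force_apply]
  simp only [map_smul, smul_apply, smul_eq_mul]
  ring

theorem norm_force_le (B : E → E →L[ℝ] E →L[ℝ] ℝ) (x v : E) :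
    ‖force B x v‖ ≤ ‖fderiv ℝ B x‖ * ‖v‖ ^ 2 := by
  refine ContinuousLinearMap.opNorm_le_bound _ (by positivity) fun w => ?_
  rw [force_apply, norm_mul]
  have h1 : ‖fderiv ℝ B x w v v‖ ≤ ‖fderiv ℝ B x‖ * ‖w‖ * ‖v‖ * ‖v‖ := by
    refine ((fderiv ℝ B x w v).le_opNorm v).trans ?_
    gcongr
    refine ((fderiv ℝ B x w).le_opNorm v).trans ?_
    gcongr
    exact (fderiv ℝ B x).le_opNorm w
  have h2 : ‖(1 / 2 : ℝ)‖ ≤ 1 := by norm_num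
  calc _ ≤ 1 * (‖fderiv ℝ B x‖ * ‖w‖ * ‖v‖ * ‖v‖) := by gcongr
    _ = _ := by ring

variable {B : E → E →L[ℝ] E →L[ℝ] ℝ} {ρ : ℝ}

theorem contDiffOn_lagrangian (hB : ContDiffOn ℝ ∞ B (Metric.ball 0 ρ)) :
    ContDiffOn ℝ ∞ (lagrangian B) (Metric.ball 0 ρ ×ˢ univ) := by
  have h : ContDiffOn ℝ ∞ (fun y : E × E => B y.1) (Metric.ball 0 ρ ×ˢ univ) :=
    hB.comp contDiff_fst.contDiffOn fun y hy => hy.1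
  exact contDiffOn_const.mul ((h.clm_apply contDiff_snd.contDiffOn).clm_apply
    contDiff_snd.contDiffOn)

theorem contDiffOn_force_comp {G : Type*} [NormedAddCommGroup G] [NormedSpace ℝ G]
    (hB : ContDiffOn ℝ ∞ B (Metric.ball 0 ρ)) {f g : G → E} {s : Set G} (hf : ContDiffOn ℝ ∞ f s)
    (hg : ContDiffOn ℝ ∞ g s) (hs : ∀ y ∈ s, f y ∈ Metric.ball (0 : E) ρ) :
    ContDiffOn ℝ ∞ (fun y => force B (f y) (g y)) s := by
  have h1 : ContDiffOn ℝ ∞ (fderiv ℝ B) (Metric.ball 0 ρ) :=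
    hB.fderiv_of_isOpen Metric.isOpen_ball (by norm_cast)
  have h2 : ContDiffOn ℝ ∞ (fun y => fderiv ℝ B (f y)) s := h1.comp hf hs
  have h3 : ContDiffOn ℝ ∞ (fun y => (fderiv ℝ B (f y)).flip) s :=
    (ContinuousLinearMap.flipₗᵢ ℝ E E (E →L[ℝ] ℝ)).contDiff.comp_contDiffOn h2
  have h4 := h3.clm_apply hg
  have h5 : ContDiffOn ℝ ∞ (fun y => ((fderiv ℝ B (f y)).flip (g y)).flip) s :=
    (ContinuousLinearMap.flipₗᵢ ℝ E E ℝ).contDiff.comp_contDiffOn h4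
  exact (h5.clm_apply hg).const_smul (1 / 2 : ℝ)

/-- Symmetry of `B` merges the two velocity terms, so the factor `1 / 2` disappears and the momentum
is `B x v`. -/
theorem fderiv_lagrangian (hB : ContDiffOn ℝ ∞ B (Metric.ball 0 ρ))
    (hsymm : ∀ x ∈ Metric.ball (0 : E) ρ, ∀ v w, B x v w = B x w v) {y : E × E}
    (hy : y.1 ∈ Metric.ball (0 : E) ρ) (z : E × E) :
    fderiv ℝ (lagrangian B) y z = force B y.1 y.2 z.1 + B y.1 y.2 z.2 := by
  have h1 : HasFDerivAt B (fderiv ℝ B y.1) y.1 :=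
    ((hB.contDiffAt (Metric.isOpen_ball.mem_nhds hy)).differentiableAt (by simp)).hasFDerivAt
  have h2 : HasFDerivAt (fun y : E × E => B y.1) _ y :=
    HasFDerivAt.comp (𝕜 := ℝ) (f := fun y : E × E => y.1) y h1 hasFDerivAt_fst
  have h3 := ((h2.clm_apply (hasFDerivAt_snd (𝕜 := ℝ) (E := E) (F := E) (p := y))).clm_apply
    (hasFDerivAt_snd (𝕜 := ℝ) (E := E) (F := E) (p := y))).const_mul (1 / 2 : ℝ)
  have h4 := h3.fderiv
  change fderiv ℝ (fun y : E × E => 1 / 2 * B y.1 y.2 y.2) y z = _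
  rw [h4, force_apply]
  simp only [smul_apply, add_apply, ContinuousLinearMap.comp_apply, ContinuousLinearMap.flip_apply,
    ContinuousLinearMap.coe_snd', ContinuousLinearMap.coe_fst', smul_eq_mul]
  rw [hsymm _ hy z.2 y.2]
  ring

theorem exists_lagrangian_taylor [FiniteDimensional ℝ E] (hB : ContDiffOn ℝ ∞ B (Metric.ball 0 ρ))
    (hsymm : ∀ x ∈ Metric.ball (0 : E) ρ, ∀ v w, B x v w = B x w v) {ρ₁ : ℝ} (hρ₁ : ρ₁ < ρ)
    (R : ℝ) :
    ∃ C ≥ 0, ∀ x v x' v' : E, ‖x‖ ≤ ρ₁ → ‖x'‖ ≤ ρ₁ → ‖v‖ ≤ R → ‖v'‖ ≤ R → ∀ a ≥ 0,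
      ‖x' - x‖ ≤ a → ‖v' - v‖ ≤ a →
      |lagrangian B (x', v') - lagrangian B (x, v) -
        (force B x v (x' - x) + B x v (v' - v))| ≤ C * a ^ 2 := by
  obtain ⟨C, hC0, hC⟩ := exists_norm_sub_sub_fderiv_le (U := Metric.ball (0 : E) ρ ×ˢ univ)
    (K := Metric.closedBall (0 : E) ρ₁ ×ˢ Metric.closedBall (0 : E) R)
    (Metric.isOpen_ball.prod isOpen_univ) (contDiffOn_lagrangian hB)
    ((isCompact_closedBall _ _).prod (isCompact_closedBall _ _))
    ((convex_closedBall _ _).prod (convex_closedBall _ _))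
    (fun y hy => ⟨Metric.closedBall_subset_ball hρ₁ hy.1, mem_univ _⟩)
  refine ⟨C, hC0, fun x v x' v' hx hx' hv hv' a ha hxa hva => ?_⟩
  have h := hC (x, v) ⟨by simpa using hx, by simpa using hv⟩ (x', v')
    ⟨by simpa using hx', by simpa using hv'⟩
  rw [fderiv_lagrangian hB hsymm (by simpa using hx.trans_lt hρ₁), Real.norm_eq_abs] at h
  refine h.trans ?_
  gcongr
  exact max_le hxa hva

section Existence

variable [FiniteDimensional ℝ E]

theorem isInvertible_of_pos {x : E} (hpos : ∀ v : E, v ≠ 0 → 0 < B x v v) :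
    (B x).IsInvertible := by
  have hinj : Function.Injective (B x) := by
    rw [injective_iff_map_eq_zero]
    intro v hv
    by_contra hne
    have := hpos v hne
    rw [hv] at this
    exact lt_irrefl _ this
  have hfr : Module.finrank ℝ E = Module.finrank ℝ (E →L[ℝ] ℝ) := by
    rw [← (LinearMap.toContinuousLinearMap (𝕜 := ℝ) (E := E) (F' := ℝ)).finrank_eq]
    exact (Subspace.dual_finrank_eq (K := ℝ) (V := E)).symm
  exact ⟨(LinearEquiv.ofInjectiveOfFinrankEq (B x).toLinearMap hinj hfr).toContinuousLinearEquiv,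
    rfl⟩

/-- Solutions of an autonomous differential equation exist on `[0, 1]` after slowing down time. -/
theorem exists_slow_solution {G : Type*} [NormedAddCommGroup G] [NormedSpace ℝ G]
    [FiniteDimensional ℝ G] {h : G → G} {U : Set G} (hh : ContDiffOn ℝ ∞ h U) {a : ℝ}
    (ha : 0 < a) (hU : Metric.closedBall 0 a ⊆ U) :
    ∃ c : ℝ, 0 < c ∧ ∀ y₀ : G, ‖y₀‖ ≤ a / 2 → ∃ y : ℝ → G, y 0 = y₀ ∧ ContDiffOn ℝ ∞ y (Icc 0 1) ∧
      ∀ t ∈ Icc (0 : ℝ) 1, ‖y t‖ ≤ a ∧ HasDerivWithinAt y (c • h (y t)) (Icc 0 1) t := by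
  have hKc : IsCompact (Metric.closedBall (0 : G) a) := isCompact_closedBall _ _
  obtain ⟨κ, hκ⟩ := (hh.mono hU).exists_lipschitzOnWith (by simp) (convex_closedBall _ _) hKc
  obtain ⟨L, hL⟩ := hKc.exists_bound_of_continuousOn (hh.continuousOn.mono hU)
  obtain ⟨L', hL', hL'0⟩ : ∃ L' : ℝ, L ≤ L' ∧ 0 < L' := ⟨max L 1, le_max_left _ _, by positivity⟩
  -- Slowed down by `c`, the vector field has speed at most `a / 2`. A solution starting in the ball
  -- of radius `a / 2` thus stays in that of radius `a` up to time `1`.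
  obtain ⟨c, hc⟩ : ∃ c : ℝ, c = a / (2 * L') := ⟨_, rfl⟩
  have hc0 : 0 < c := by rw [hc]; positivity
  have hPL : IsPicardLindelof (fun _ => fun y => c • h y) (tmin := 0) (tmax := 1)
      ⟨0, by simp⟩ (0 : G) (.mk a ha.le) (.mk (a / 2) (half_pos ha).le)
      (.mk (a / 2) (half_pos ha).le) (.mk c hc0.le * κ) := by
    refine IsPicardLindelof.of_time_independent (fun y hy => ?_) ?_ ?_
    · rw [norm_smul, Real.norm_of_nonneg hc0.le]
      have h1 : ‖h y‖ ≤ L' := (hL y hy).trans hL'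
      calc c * ‖h y‖ ≤ c * L' := by gcongr
        _ = a / 2 := by rw [hc]; field_simp
    · refine LipschitzOnWith.of_dist_le_mul fun y hy z hz => ?_
      rw [dist_smul₀, Real.norm_of_nonneg hc0.le]
      have := hκ.dist_le_mul y hy z hz
      calc c * dist (h y) (h z) ≤ c * (κ * dist y z) := by gcongr
        _ = _ := by push_cast; ring_nf
    · simp
      linarith
  refine ⟨c, hc0, fun y₀ hy₀ => ?_⟩
  obtain ⟨α, hα⟩ := ODE.FunSpace.exists_isFixedPt_next hPL (x := y₀)
    (mem_closedBall_zero_iff.2 hy₀)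
  rw [ODE.FunSpace.isFixedPt_next_iff] at hα
  set y := α.compProj with hy
  have hyK : ∀ t, y t ∈ Metric.closedBall (0 : G) a := fun t =>
    α.compProj_mem_closedBall hPL.mul_max_le
  have hypic : ∀ t ∈ Icc (0 : ℝ) 1, y t = ODE.picard (fun _ y => c • h y) 0 y₀ y t := by
    intro t ht
    rw [hy, ODE.FunSpace.compProj_of_mem ht]
    exact hα ⟨t, ht⟩
  have hfc : ContDiffOn ℝ ∞ (Function.uncurry fun (_ : ℝ) y => c • h y) (Icc 0 1 ×ˢ U) := by
    have : ContDiffOn ℝ ∞ (fun q : ℝ × G => h q.2) (Icc 0 1 ×ˢ U) :=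
      hh.comp contDiff_snd.contDiffOn fun q hq => hq.2
    exact this.const_smul c
  have hyd : ∀ t ∈ Icc (0 : ℝ) 1, HasDerivWithinAt y (c • h (y t)) (Icc 0 1) t := by
    intro t ht
    have h1 := ODE.hasDerivWithinAt_picard_Icc (f := fun _ y => c • h y) (u := U) (α := y)
      (left_mem_Icc.2 zero_le_one) hfc.continuousOn α.continuous_compProj.continuousOn
      (fun s _ => hU (hyK s)) y₀ ht
    exact h1.congr hypic (hypic t ht)
  refine ⟨y, ?_, ODE.contDiffOn_enat_Icc_of_hasDerivWithinAt (n := ⊤) hfc hyd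
    fun s _ => hU (hyK s), fun t ht => ⟨mem_closedBall_zero_iff.1 (hyK t), hyd t ht⟩⟩
  rw [hypic 0 (left_mem_Icc.2 zero_le_one), ODE.picard_apply₀]

/-- Extremals of the Lagrangian exist on `[0, 1]`, for small initial velocities. -/
theorem exists_extremal (hB : ContDiffOn ℝ ∞ B (Metric.ball 0 ρ))
    (hpos : ∀ x ∈ Metric.ball (0 : E) ρ, ∀ v : E, v ≠ 0 → 0 < B x v v) {ρ₁ : ℝ} (hρ₁0 : 0 < ρ₁)
    (hρ₁ : ρ₁ < ρ) :
    ∃ r > 0, ∀ A : E, ‖A‖ ≤ r → ∃ x v : ℝ → E, x 0 = 0 ∧ v 0 = A ∧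
      ContDiffOn ℝ ∞ x (Icc 0 1) ∧ ContDiffOn ℝ ∞ v (Icc 0 1) ∧ ∀ t ∈ Icc (0 : ℝ) 1,
        ‖x t‖ ≤ ρ₁ ∧ HasDerivWithinAt x (v t) (Icc 0 1) t ∧
        HasDerivWithinAt (fun t => B (x t) (v t)) (force B (x t) (v t)) (Icc 0 1) t := by
  set U : Set (E × (E →L[ℝ] ℝ)) := Metric.ball 0 ρ ×ˢ univ with hU
  have hinv : ∀ x ∈ Metric.ball (0 : E) ρ, (B x).IsInvertible := fun x hx =>
    isInvertible_of_pos (hpos x hx)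
  have hI : ContDiffOn ℝ ∞ (fun y : E × (E →L[ℝ] ℝ) => (B y.1).inverse y.2) U := by
    have h1 : ContDiffOn ℝ ∞ (fun x => (B x).inverse) (Metric.ball 0 ρ) := fun x hx =>
      (hinv x hx).contDiffAt_map_inverse.comp_contDiffWithinAt x (hB x hx)
    exact (h1.comp contDiff_fst.contDiffOn fun y hy => hy.1).clm_apply contDiff_snd.contDiffOn
  -- Hamilton's equations in position and momentum form a first order system. Slowing time by `c`
  -- again gives an extremal, with velocity and momentum multiplied by `c`, since the force is
  -- homogeneous of degree two in the velocity.
  set h : E × (E →L[ℝ] ℝ) → E × (E →L[ℝ] ℝ) := fun y =>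
    ((B y.1).inverse y.2, force B y.1 ((B y.1).inverse y.2)) with hh
  have hhs : ContDiffOn ℝ ∞ h U := by
    have h2 := contDiffOn_force_comp hB contDiff_fst.contDiffOn hI fun y hy => hy.1
    exact hI.prodMk h2
  have hKU : Metric.closedBall (0 : E × (E →L[ℝ] ℝ)) ρ₁ ⊆ U := fun y hy => by
    rw [mem_closedBall_zero_iff] at hy
    refine ⟨?_, mem_univ _⟩
    rw [mem_ball_zero_iff]
    exact (le_max_left _ _ |>.trans hy).trans_lt hρ₁
  obtain ⟨c, hc0, hc⟩ := exists_slow_solution hhs hρ₁0 hKU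
  refine ⟨c * (ρ₁ / 2) / (‖B 0‖ + 1), by positivity, fun A hA => ?_⟩
  have h0 : (0 : E) ∈ Metric.ball (0 : E) ρ := by simpa using hρ₁0.trans hρ₁
  -- The factor `c⁻¹` compensates the slowing of time, so that the initial velocity is `A`.
  set p₀ : E →L[ℝ] ℝ := c⁻¹ • B 0 A with hp₀
  have hp₀n : ‖p₀‖ ≤ ρ₁ / 2 := by
    rw [hp₀, norm_smul, norm_inv, Real.norm_of_nonneg hc0.le, inv_mul_le_iff₀ hc0]
    rw [le_div_iff₀ (by positivity)] at hA
    refine ((B 0).le_opNorm A).trans ?_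
    nlinarith [norm_nonneg A]
  have hinit : ‖((0 : E), p₀)‖ ≤ ρ₁ / 2 := max_le (by rw [norm_zero]; positivity) hp₀n
  obtain ⟨y, hy0, hys, hyt⟩ := hc _ hinit
  have hyU : ∀ t ∈ Icc (0 : ℝ) 1, (y t).1 ∈ Metric.ball (0 : E) ρ := fun t ht =>
    (hKU (mem_closedBall_zero_iff.2 (hyt t ht).1)).1
  have hBv : ∀ t ∈ Icc (0 : ℝ) 1, B (y t).1 ((B (y t).1).inverse (c • (y t).2)) = c • (y t).2 := by
    intro t ht
    obtain ⟨e, he⟩ := hinv _ (hyU t ht)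
    rw [← he, ContinuousLinearMap.inverse_equiv]
    exact e.apply_symm_apply _
  refine ⟨fun t => (y t).1, fun t => (B (y t).1).inverse (c • (y t).2), by simp only [hy0], ?_,
    contDiff_fst.comp_contDiffOn hys, ?_, fun t ht => ⟨?_, ?_, ?_⟩⟩
  · simp only [hy0, hp₀, smul_smul, mul_inv_cancel₀ hc0.ne', one_smul]
    obtain ⟨e, he⟩ := hinv _ h0
    rw [← he, ContinuousLinearMap.inverse_equiv]
    exact e.symm_apply_apply _
  · have h1 : ContDiffOn ℝ ∞ (fun t => (B (y t).1).inverse (y t).2) (Icc 0 1) :=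
      hI.comp hys fun t ht => hKU (mem_closedBall_zero_iff.2 (hyt t ht).1)
    have h2 := h1.const_smul c
    refine h2.congr fun t _ => ?_
    exact map_smul _ _ _
  · exact (le_max_left _ _).trans (hyt t ht).1
  · have h1 : HasDerivWithinAt (fun t => (y t).1) (c • (B (y t).1).inverse (y t).2) (Icc 0 1) t :=
      (ContinuousLinearMap.fst ℝ E (E →L[ℝ] ℝ)).hasFDerivAt.comp_hasDerivWithinAt t (hyt t ht).2
    rw [← map_smul] at h1
    exact h1
  · have h1 : HasDerivWithinAt (fun t => c • (y t).2)
        (c • (c • force B (y t).1 ((B (y t).1).inverse (y t).2))) (Icc 0 1) t :=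
      (((ContinuousLinearMap.snd ℝ E (E →L[ℝ] ℝ)).hasFDerivAt.comp_hasDerivWithinAt t
        (hyt t ht).2).const_smul c :)
    beta_reduce
    rw [map_smul, force_smul, pow_two, mul_smul]
    exact h1.congr hBv (hBv t ht)

end Existence

end Variational


/-! ### Extremals are critical points of the action. -/

section Variational

set_option maxSynthPendingDepth 3

variable {E : Type*} [NormedAddCommGroup E] [NormedSpace ℝ E]
  {B : E → E →L[ℝ] E →L[ℝ] ℝ} {ρ : ℝ}

theorem continuousOn_lagrangian_comp (hB : ContDiffOn ℝ ∞ B (Metric.ball 0 ρ)) {x v : ℝ → E}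
    {s : Set ℝ} (hx : ContinuousOn x s) (hv : ContinuousOn v s)
    (hs : ∀ t ∈ s, x t ∈ Metric.ball (0 : E) ρ) :
    ContinuousOn (fun t => lagrangian B (x t, v t)) s :=
  (contDiffOn_lagrangian hB).continuousOn.comp (hx.prodMk hv) fun t ht => ⟨hs t ht, mem_univ _⟩

theorem continuousOn_force_comp (hB : ContDiffOn ℝ ∞ B (Metric.ball 0 ρ)) {x v : ℝ → E}
    {s : Set ℝ} (hx : ContinuousOn x s) (hv : ContinuousOn v s)
    (hs : ∀ t ∈ s, x t ∈ Metric.ball (0 : E) ρ) :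
    ContinuousOn (fun t => force B (x t) (v t)) s := by
  have h1 : ContinuousOn (fderiv ℝ B) (Metric.ball 0 ρ) :=
    (hB.fderiv_of_isOpen (m := ∞) Metric.isOpen_ball (by norm_cast)).continuousOn
  have h2 : ContinuousOn (fun t => fderiv ℝ B (x t)) s := h1.comp hx hs
  have h3 : ContinuousOn (fun t => (fderiv ℝ B (x t)).flip) s :=
    (ContinuousLinearMap.flipₗᵢ ℝ E E (E →L[ℝ] ℝ)).continuous.comp_continuousOn h2
  have h5 : ContinuousOn (fun t => ((fderiv ℝ B (x t)).flip (v t)).flip) s :=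
    (ContinuousLinearMap.flipₗᵢ ℝ E E ℝ).continuous.comp_continuousOn (h3.clm_apply hv)
  exact (h5.clm_apply hv).const_smul (1 / 2 : ℝ)

theorem continuousOn_momentum (hB : ContDiffOn ℝ ∞ B (Metric.ball 0 ρ)) {x v : ℝ → E}
    {s : Set ℝ} (hx : ContinuousOn x s) (hv : ContinuousOn v s)
    (hs : ∀ t ∈ s, x t ∈ Metric.ball (0 : E) ρ) :
    ContinuousOn (fun t => B (x t) (v t)) s :=
  (hB.continuousOn.comp hx hs).clm_apply hv

theorem exists_action_taylor [FiniteDimensional ℝ E] (hB : ContDiffOn ℝ ∞ B (Metric.ball 0 ρ))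
    (hsymm : ∀ x ∈ Metric.ball (0 : E) ρ, ∀ v w, B x v w = B x w v) {ρ₁ : ℝ} (hρ₁ : ρ₁ < ρ)
    (R : ℝ) :
    ∃ C ≥ 0, ∀ b ∈ Icc (0 : ℝ) 1, ∀ x v y w : ℝ → E, ContinuousOn x (Icc 0 b) →
      ContinuousOn v (Icc 0 b) → ContinuousOn y (Icc 0 b) → ContinuousOn w (Icc 0 b) → ∀ a ≥ 0,
      (∀ t ∈ Icc 0 b, ‖x t‖ ≤ ρ₁ ∧ ‖v t‖ ≤ R ∧ ‖y t‖ ≤ ρ₁ ∧ ‖w t‖ ≤ R ∧ ‖y t - x t‖ ≤ a ∧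
        ‖w t - v t‖ ≤ a) →
      |(∫ t in 0..b, lagrangian B (y t, w t)) - (∫ t in 0..b, lagrangian B (x t, v t)) -
        ∫ t in 0..b, (force B (x t) (v t) (y t - x t) + B (x t) (v t) (w t - v t))| ≤
        C * a ^ 2 := by
  obtain ⟨C, hC0, hC⟩ := exists_lagrangian_taylor hB hsymm hρ₁ R
  refine ⟨C, hC0, fun b hb x v y w hx hv hy hw a ha h => ?_⟩
  have hball : ∀ z : E, ‖z‖ ≤ ρ₁ → z ∈ Metric.ball (0 : E) ρ := fun z hz => by
    rw [mem_ball_zero_iff]; exact hz.trans_lt hρ₁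
  have hxb : ∀ t ∈ Icc 0 b, x t ∈ Metric.ball (0 : E) ρ := fun t ht => hball _ (h t ht).1
  have hyb : ∀ t ∈ Icc 0 b, y t ∈ Metric.ball (0 : E) ρ := fun t ht => hball _ (h t ht).2.2.1
  have h1 : IntervalIntegrable (fun t => lagrangian B (y t, w t)) volume 0 b :=
    (continuousOn_lagrangian_comp hB hy hw hyb).intervalIntegrable_of_Icc hb.1
  have h2 : IntervalIntegrable (fun t => lagrangian B (x t, v t)) volume 0 b :=
    (continuousOn_lagrangian_comp hB hx hv hxb).intervalIntegrable_of_Icc hb.1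
  have h3 : IntervalIntegrable (fun t => force B (x t) (v t) (y t - x t) +
      B (x t) (v t) (w t - v t)) volume 0 b :=
    (((continuousOn_force_comp hB hx hv hxb).clm_apply (hy.sub hx)).add
      ((continuousOn_momentum hB hx hv hxb).clm_apply (hw.sub hv))).intervalIntegrable_of_Icc hb.1
  rw [← intervalIntegral.integral_sub h1 h2, ← intervalIntegral.integral_sub (h1.sub h2) h3,
    ← Real.norm_eq_abs]
  have h4 := intervalIntegral.norm_integral_le_of_norm_le_const (a := 0) (b := b)
    (C := C * a ^ 2) (f := fun t => lagrangian B (y t, w t) - lagrangian B (x t, v t) -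
      (force B (x t) (v t) (y t - x t) + B (x t) (v t) (w t - v t))) fun t ht => by
    rw [uIoc_of_le hb.1] at ht
    obtain ⟨g1, g2, g3, g4, g5, g6⟩ := h t (Ioc_subset_Icc_self ht)
    exact hC _ _ _ _ g1 g3 g2 g4 a ha g5 g6
  refine h4.trans (mul_le_of_le_one_right (by positivity) ?_)
  rw [sub_zero, abs_of_nonneg hb.1]
  exact hb.2

/-- Partial derivatives in time of a smooth family of curves. -/
theorem exists_time_deriv {G : Type*} [NormedAddCommGroup G] [NormedSpace ℝ G] {δ b : ℝ}
    (hb : 0 < b) {X : ℝ → ℝ → G}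
    (hX : ContDiffOn ℝ ∞ (fun p : ℝ × ℝ => X p.1 p.2) (Ioo (-δ) δ ×ˢ Icc 0 b)) :
    ∃ Y : ℝ → ℝ → G, ContDiffOn ℝ ∞ (fun p : ℝ × ℝ => Y p.1 p.2) (Ioo (-δ) δ ×ˢ Icc 0 b) ∧
      ∀ s ∈ Ioo (-δ) δ, ∀ t ∈ Icc 0 b, HasDerivWithinAt (X s) (Y s t) (Icc 0 b) t := by
  have hu : UniqueDiffOn ℝ (Ioo (-δ) δ ×ˢ Icc 0 b) :=
    isOpen_Ioo.uniqueDiffOn.prod (uniqueDiffOn_Icc hb)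
  refine ⟨fun s t => fderivWithin ℝ (fun p : ℝ × ℝ => X p.1 p.2) (Ioo (-δ) δ ×ˢ Icc 0 b) (s, t)
    (0, 1), ?_, fun s hs t ht => ?_⟩
  · exact (hX.fderivWithin hu (m := ∞) (by norm_cast)).clm_apply contDiffOn_const
  · have h1 := ((hX.differentiableOn (by simp)) (s, t) ⟨hs, ht⟩).hasFDerivWithinAt
    have h2 : HasDerivWithinAt (fun t : ℝ => (s, t)) ((0 : ℝ), (1 : ℝ)) (Icc 0 b) t :=
      (hasDerivWithinAt_const t _ s).prodMk (hasDerivWithinAt_id t _)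
    exact h1.comp_hasDerivWithinAt t h2 fun t' ht' => ⟨hs, ht'⟩

/-- The end points are left out because curves are controlled only on closed intervals, where the
two-sided derivative in the energy has no meaning at the ends. -/
theorem integral_congr_Ioo {f g : ℝ → ℝ} {a b : ℝ} (hab : a ≤ b) (h : ∀ t ∈ Ioo a b, f t = g t) :
    ∫ t in a..b, f t = ∫ t in a..b, g t := by
  rw [intervalIntegral.integral_of_le hab, intervalIntegral.integral_of_le hab,
    ← integral_Ioc_eq_integral_Ioo' (by simp) |>.symm, ← integral_Ioc_eq_integral_Ioo' (by simp) |>.symm]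
  exact setIntegral_congr_fun measurableSet_Ioo h

/-- Extremals are critical points of the action. -/
theorem hasDerivAt_action_of_extremal [FiniteDimensional ℝ E]
    (hB : ContDiffOn ℝ ∞ B (Metric.ball 0 ρ))
    (hsymm : ∀ x ∈ Metric.ball (0 : E) ρ, ∀ v w, B x v w = B x w v) {ρ₁ : ℝ} (hρ₁ : ρ₁ < ρ)
    {x v : ℝ → E} (hv : ContinuousOn v (Icc 0 1))
    (hxv : ∀ t ∈ Icc (0 : ℝ) 1, ‖x t‖ ≤ ρ₁ ∧ HasDerivWithinAt x (v t) (Icc 0 1) t ∧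
      HasDerivWithinAt (fun t => B (x t) (v t)) (force B (x t) (v t)) (Icc 0 1) t)
    {δ : ℝ} (hδ : 0 < δ) {X : ℝ → ℝ → E}
    (hX : ContDiffOn ℝ ∞ (fun p : ℝ × ℝ => X p.1 p.2) (Ioo (-δ) δ ×ˢ Icc 0 1))
    (hX0 : ∀ t ∈ Icc (0 : ℝ) 1, X 0 t = x t) (ha : ∀ s ∈ Ioo (-δ) δ, X s 0 = x 0)
    (hb : ∀ s ∈ Ioo (-δ) δ, X s 1 = x 1) :
    HasDerivAt (fun s => ∫ t in (0 : ℝ)..1, lagrangian B (X s t, deriv (X s) t)) 0 0 := by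
  obtain ⟨Y, hY, hXY⟩ := exists_time_deriv one_pos hX
  set K : Set (ℝ × ℝ) := Icc (-(δ / 2)) (δ / 2) ×ˢ Icc 0 1 with hK
  have hKS : K ⊆ Ioo (-δ) δ ×ˢ Icc 0 1 := fun p hp => by
    refine ⟨⟨?_, ?_⟩, hp.2⟩
    · linarith [hp.1.1]
    · linarith [hp.1.2]
  have hKc : IsCompact K := isCompact_Icc.prod isCompact_Icc
  have hKx : Convex ℝ K := (convex_Icc _ _).prod (convex_Icc _ _)
  obtain ⟨C₁, hC₁⟩ := (hX.mono hKS).exists_lipschitzOnWith (by simp) hKx hKc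
  obtain ⟨C₂, hC₂⟩ := (hY.mono hKS).exists_lipschitzOnWith (by simp) hKx hKc
  obtain ⟨R, hR⟩ := hKc.exists_bound_of_continuousOn (hY.continuousOn.mono hKS)
  obtain ⟨ρ₂, hρ₁₂, hρ₂⟩ := exists_between hρ₁
  obtain ⟨C, hC0, hC⟩ := exists_action_taylor hB hsymm hρ₂ R
  have h0S : (0 : ℝ) ∈ Ioo (-δ) δ := ⟨by linarith, hδ⟩
  have hxc : ContinuousOn x (Icc 0 1) := fun t ht => (hxv t ht).2.1.continuousWithinAt
  have hvY : ∀ t ∈ Icc (0 : ℝ) 1, v t = Y 0 t := fun t ht => by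
    have h1 := (hXY 0 h0S t ht).congr (fun t' ht' => (hX0 t' ht').symm) (hX0 t ht).symm
    exact (uniqueDiffOn_Icc one_pos t ht).eq_deriv _ (hxv t ht).2.1 h1
  have hXY' : ∀ s ∈ Ioo (-δ) δ, ∫ t in (0 : ℝ)..1, lagrangian B (X s t, deriv (X s) t) =
      ∫ t in (0 : ℝ)..1, lagrangian B (X s t, Y s t) := fun s hs => by
    refine integral_congr_Ioo zero_le_one fun t ht => ?_
    rw [((hXY s hs t (Ioo_subset_Icc_self ht)).hasDerivAt (Icc_mem_nhds ht.1 ht.2)).deriv]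
  obtain ⟨c, hc0, hcle, hcρ⟩ : ∃ c : ℝ, 0 < c ∧ c ≤ δ / 2 ∧ C₁ * c ≤ ρ₂ - ρ₁ := by
    refine ⟨min (δ / 2) ((ρ₂ - ρ₁) / (C₁ + 1)), lt_min (by positivity)
      (div_pos (by linarith) (by positivity)), min_le_left _ _, ?_⟩
    calc (C₁ : ℝ) * min (δ / 2) ((ρ₂ - ρ₁) / (C₁ + 1))
        ≤ (C₁ + 1) * ((ρ₂ - ρ₁) / (C₁ + 1)) := by
          gcongr
          · exact le_add_of_nonneg_right (zero_le_one' ℝ)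
          · exact min_le_right _ _
      _ = ρ₂ - ρ₁ := by field_simp
  -- The action changes only by `O(s²)`, which gives derivative zero without differentiating under
  -- the integral.
  have hbound : ∀ s, |s| ≤ c →
      |(∫ t in (0 : ℝ)..1, lagrangian B (X s t, deriv (X s) t)) -
        ∫ t in (0 : ℝ)..1, lagrangian B (X 0 t, deriv (X 0) t)| ≤
        C * (max C₁ C₂ : ℝ) ^ 2 * s ^ 2 := by
    intro s hs
    have hsI : s ∈ Icc (-(δ / 2)) (δ / 2) := abs_le.1 (hs.trans hcle)
    have hsS : s ∈ Ioo (-δ) δ := ⟨by linarith [hsI.1], by linarith [hsI.2]⟩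
    have h0I : (0 : ℝ) ∈ Icc (-(δ / 2)) (δ / 2) := ⟨by linarith, by linarith⟩
    have hXs : ∀ t ∈ Icc (0 : ℝ) 1, ‖X s t - x t‖ ≤ C₁ * |s| := fun t ht => by
      have := hC₁.norm_sub_le (x := (s, t)) (y := (0, t)) ⟨hsI, ht⟩ ⟨h0I, ht⟩
      rw [← hX0 t ht]
      simpa using this
    have hYs : ∀ t ∈ Icc (0 : ℝ) 1, ‖Y s t - v t‖ ≤ C₂ * |s| := fun t ht => by
      have := hC₂.norm_sub_le (x := (s, t)) (y := (0, t)) ⟨hsI, ht⟩ ⟨h0I, ht⟩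
      rw [hvY t ht]
      simpa using this
    have hXc : ContinuousOn (X s) (Icc 0 1) := fun t ht =>
      (hXY s hsS t ht).continuousWithinAt
    have hYc : ContinuousOn (Y s) (Icc 0 1) :=
      hY.continuousOn.comp (continuousOn_const.prodMk continuousOn_id) fun t ht => ⟨hsS, ht⟩
    have h1 := hC 1 ⟨zero_le_one, le_rfl⟩ x v (X s) (Y s) hxc hv hXc hYc
      ((max C₁ C₂ : ℝ) * |s|) (by positivity) fun t ht => by
        refine ⟨(hxv t ht).1.trans hρ₁₂.le, ?_, ?_, hR (s, t) ⟨hsI, ht⟩, (hXs t ht).trans ?_,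
          (hYs t ht).trans ?_⟩
        · rw [hvY t ht]
          exact hR (0, t) ⟨h0I, ht⟩
        · have h2 : ‖X s t‖ ≤ ‖x t‖ + ‖X s t - x t‖ := norm_le_insert' _ _
          have h3 : (C₁ : ℝ) * |s| ≤ C₁ * c := by gcongr
          linarith [(hxv t ht).1, hXs t ht]
        · gcongr; exact le_max_left _ _
        · gcongr; exact le_max_right _ _
    -- By the Euler-Lagrange equation the integrand is the derivative of the momentum paired with `X
    -- s - x`, which vanishes at both ends.
    have hftc : ∫ t in (0 : ℝ)..1, (force B (x t) (v t) (X s t - x t) +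
        B (x t) (v t) (Y s t - v t)) = 0 := by
      have hball : ∀ t ∈ Icc (0 : ℝ) 1, x t ∈ Metric.ball (0 : E) ρ := fun t ht => by
        rw [mem_ball_zero_iff]; exact (hxv t ht).1.trans_lt hρ₁
      rw [intervalIntegral.integral_eq_sub_of_hasDerivAt_of_le
        (f := fun t => B (x t) (v t) (X s t - x t)) zero_le_one]
      · simp [ha s hsS, hb s hsS]
      · exact (continuousOn_momentum hB hxc hv hball).clm_apply (hXc.sub hxc)
      · intro t ht
        have htI := Ioo_subset_Icc_self ht
        have hn := Icc_mem_nhds ht.1 ht.2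
        exact ((hxv t htI).2.2.hasDerivAt hn).clm_apply
          (((hXY s hsS t htI).hasDerivAt hn).sub ((hxv t htI).2.1.hasDerivAt hn))
      · exact (((continuousOn_force_comp hB hxc hv hball).clm_apply (hXc.sub hxc)).add
          ((continuousOn_momentum hB hxc hv hball).clm_apply
            (hYc.sub hv))).intervalIntegrable_of_Icc zero_le_one
    rw [hftc, sub_zero, mul_pow, sq_abs, ← mul_assoc] at h1
    rw [hXY' s hsS, hXY' 0 h0S]
    have h2 : ∫ t in (0 : ℝ)..1, lagrangian B (X 0 t, Y 0 t) =
        ∫ t in (0 : ℝ)..1, lagrangian B (x t, v t) := by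
      refine integral_congr_Ioo zero_le_one fun t ht => ?_
      rw [hX0 t (Ioo_subset_Icc_self ht), hvY t (Ioo_subset_Icc_self ht)]
    rw [h2]
    exact h1
  rw [hasDerivAt_iff_isLittleO_nhds_zero]
  refine Asymptotics.IsBigO.trans_isLittleO (g := fun s : ℝ => s ^ 2) ?_ ?_
  · refine Asymptotics.IsBigO.of_bound (C * (max C₁ C₂ : ℝ) ^ 2) ?_
    filter_upwards [Metric.closedBall_mem_nhds (0 : ℝ) hc0] with s hs
    have := hbound s (by simpa using hs)
    simpa using this
  · simpa using Asymptotics.isLittleO_pow_id (𝕜 := ℝ) one_lt_two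

end Variational


/-! ### The Euler-Lagrange equation for critical curves, and its solutions of small velocity. -/

section Variational

set_option maxSynthPendingDepth 3

variable {E : Type*} [NormedAddCommGroup E] [NormedSpace ℝ E] [FiniteDimensional ℝ E]
  {B : E → E →L[ℝ] E →L[ℝ] ℝ} {ρ : ℝ}

/-- The first variation of the action in the direction of a localized perturbation. -/
theorem hasDerivAt_action_variation (hB : ContDiffOn ℝ ∞ B (Metric.ball 0 ρ))
    (hsymm : ∀ x ∈ Metric.ball (0 : E) ρ, ∀ v w, B x v w = B x w v) {ρ₁ : ℝ} (hρ₁ : ρ₁ < ρ)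
    {b : ℝ} (hb : b ∈ Icc (0 : ℝ) 1) {x v : ℝ → E} (hx : ContinuousOn x (Icc 0 b))
    (hv : ContinuousOn v (Icc 0 b)) (hxρ : ∀ t ∈ Icc 0 b, ‖x t‖ ≤ ρ₁) {η : ℝ → ℝ}
    (hη : ContDiff ℝ ∞ η) (w : E) (τ : ℝ) :
    HasDerivAt (fun s => ∫ t in 0..b, lagrangian B (x t + (τ * Real.sin s) • η t • w,
      v t + (τ * Real.sin s) • deriv η t • w))
      (τ * ∫ t in 0..b, (force B (x t) (v t) (η t • w) + B (x t) (v t) (deriv η t • w))) 0 := by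
  have hη' : Continuous (deriv η) := hη.continuous_deriv (by simp)
  obtain ⟨M₀, hM₀⟩ := (isCompact_Icc (a := (0 : ℝ)) (b := b)).exists_bound_of_continuousOn
    hη.continuous.continuousOn
  obtain ⟨M₁, hM₁⟩ := (isCompact_Icc (a := (0 : ℝ)) (b := b)).exists_bound_of_continuousOn
    hη'.continuousOn
  obtain ⟨R, hR⟩ := (isCompact_Icc (a := (0 : ℝ)) (b := b)).exists_bound_of_continuousOn hv
  obtain ⟨M, hM⟩ : ∃ M : ℝ, M = (|M₀| + |M₁|) * ‖w‖ := ⟨_, rfl⟩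
  have hM0 : 0 ≤ M := by rw [hM]; positivity
  have hηM : ∀ t ∈ Icc 0 b, ‖η t • w‖ ≤ M := fun t ht => by
    rw [norm_smul, hM]
    gcongr
    linarith [hM₀ t ht, le_abs_self M₀, abs_nonneg M₁]
  have hηM' : ∀ t ∈ Icc 0 b, ‖deriv η t • w‖ ≤ M := fun t ht => by
    rw [norm_smul, hM]
    gcongr
    linarith [hM₁ t ht, le_abs_self M₁, abs_nonneg M₀]
  obtain ⟨ρ₂, hρ₁₂, hρ₂⟩ := exists_between hρ₁
  obtain ⟨C, hC0, hC⟩ := exists_action_taylor hB hsymm hρ₂ (R + 1)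
  obtain ⟨I, hI⟩ : ∃ I : ℝ, I = ∫ t in 0..b,
    (force B (x t) (v t) (η t • w) + B (x t) (v t) (deriv η t • w)) := ⟨_, rfl⟩
  rw [← hI]
  obtain ⟨c, hc0, hc1, hcρ⟩ : ∃ c : ℝ, 0 < c ∧ |τ| * c * M ≤ 1 ∧ |τ| * c * M ≤ ρ₂ - ρ₁ := by
    have hm : 0 < min 1 (ρ₂ - ρ₁) := lt_min one_pos (by linarith)
    have key : |τ| * (min 1 (ρ₂ - ρ₁) / (|τ| * M + 1)) * M ≤ min 1 (ρ₂ - ρ₁) := by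
      rw [mul_div_assoc', div_mul_eq_mul_div, div_le_iff₀ (by positivity)]
      nlinarith
    exact ⟨min 1 (ρ₂ - ρ₁) / (|τ| * M + 1), by positivity, key.trans (min_le_left _ _),
      key.trans (min_le_right _ _)⟩
  set g : ℝ → ℝ := fun s => ∫ t in 0..b, lagrangian B (x t + (τ * Real.sin s) • η t • w,
      v t + (τ * Real.sin s) • deriv η t • w) with hg
  have hbound : ∀ s, |s| ≤ c → |g s - g 0 - τ * Real.sin s * I| ≤ C * (|τ| * M) ^ 2 * s ^ 2 := by
    intro s hs
    have hsin : |τ * Real.sin s| ≤ |τ| * |s| := by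
      rw [abs_mul]
      exact mul_le_mul_of_nonneg_left Real.abs_sin_le_abs (abs_nonneg _)
    have hsc : |τ| * |s| * M ≤ |τ| * c * M := by gcongr
    have h1 : ∀ u : E, ‖u‖ ≤ M → ‖(τ * Real.sin s) • u‖ ≤ |τ| * |s| * M := fun u hu => by
      rw [norm_smul, Real.norm_eq_abs]
      gcongr
    have h2 := hC b hb x v (fun t => x t + (τ * Real.sin s) • η t • w)
      (fun t => v t + (τ * Real.sin s) • deriv η t • w) hx hv
      (hx.add ((hη.continuous.smul continuous_const).const_smul _).continuousOn)
      (hv.add ((hη'.smul continuous_const).const_smul _).continuousOn) (|τ| * |s| * M)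
      (by positivity) fun t ht => by
        have e1 := h1 _ (hηM t ht)
        have e2 := h1 _ (hηM' t ht)
        refine ⟨(hxρ t ht).trans hρ₁₂.le, by linarith [hR t ht], ?_, ?_, ?_, ?_⟩
        · linarith [norm_add_le (x t) ((τ * Real.sin s) • η t • w), hxρ t ht]
        · linarith [norm_add_le (v t) ((τ * Real.sin s) • deriv η t • w), hR t ht]
        · rwa [add_sub_cancel_left]
        · rwa [add_sub_cancel_left]
    have h3 : ∫ t in 0..b, (force B (x t) (v t) (x t + (τ * Real.sin s) • η t • w - x t) +
        B (x t) (v t) (v t + (τ * Real.sin s) • deriv η t • w - v t)) = τ * Real.sin s * I := by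
      rw [hI, ← intervalIntegral.integral_const_mul]
      refine integral_congr_Ioo hb.1 fun t _ => ?_
      rw [add_sub_cancel_left, add_sub_cancel_left]
      simp only [map_smul, smul_eq_mul]
      ring
    have h4 : g 0 = ∫ t in 0..b, lagrangian B (x t, v t) := by simp [hg]
    rw [h3, ← h4] at h2
    refine h2.trans (le_of_eq ?_)
    rw [mul_right_comm, mul_pow _ |s|, sq_abs, mul_assoc]
  have h1 : HasDerivAt (fun s => g s - τ * Real.sin s * I) 0 0 := by
    rw [hasDerivAt_iff_isLittleO_nhds_zero]
    refine Asymptotics.IsBigO.trans_isLittleO (g := fun s : ℝ => s ^ 2) ?_ ?_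
    · refine Asymptotics.IsBigO.of_bound (C * (|τ| * M) ^ 2) ?_
      filter_upwards [Metric.closedBall_mem_nhds (0 : ℝ) hc0] with s hs
      have := hbound s (by simpa using hs)
      rw [sub_right_comm] at this
      simpa using this
    · simpa using Asymptotics.isLittleO_pow_id (𝕜 := ℝ) one_lt_two
  have h2 : HasDerivAt (fun s => τ * Real.sin s * I) (τ * I) 0 := by
    simpa using ((Real.hasDerivAt_sin 0).const_mul τ).mul_const I
  have h3 := h1.add h2
  rw [zero_add] at h3
  exact h3.congr_of_eventuallyEq (Eventually.of_forall fun s => (sub_add_cancel _ _).symm)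

/-- The Euler–Lagrange equation of a curve which is critical for localized perturbations. -/
theorem hasDerivWithinAt_momentum_of_critical (hB : ContDiffOn ℝ ∞ B (Metric.ball 0 ρ))
    (hsymm : ∀ x ∈ Metric.ball (0 : E) ρ, ∀ v w, B x v w = B x w v) {ρ₁ : ℝ} (hρ₁ : ρ₁ < ρ)
    {b : ℝ} (hb0 : 0 < b) (hb1 : b ≤ 1) {x v : ℝ → E} (hx : ContDiffOn ℝ ∞ x (Icc 0 b))
    (hv : ContDiffOn ℝ ∞ v (Icc 0 b)) (hxρ : ∀ t ∈ Icc 0 b, ‖x t‖ ≤ ρ₁)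
    (hcrit : ∀ η : ℝ → ℝ, ContDiff ℝ ∞ η → tsupport η ⊆ Ioo 0 b → ∀ w : E,
      ∃ τ : ℝ, 0 < τ ∧ HasDerivAt (fun s => ∫ t in 0..b,
        lagrangian B (x t + (τ * Real.sin s) • η t • w,
          v t + (τ * Real.sin s) • deriv η t • w)) 0 0) :
    ∀ t ∈ Icc 0 b, HasDerivWithinAt (fun t => B (x t) (v t)) (force B (x t) (v t)) (Icc 0 b) t := by
  have hball : ∀ t ∈ Icc 0 b, x t ∈ Metric.ball (0 : E) ρ := fun t ht => by
    rw [mem_ball_zero_iff]; exact (hxρ t ht).trans_lt hρ₁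
  set p : ℝ → E →L[ℝ] ℝ := fun t => B (x t) (v t) with hp
  have hps : ContDiffOn ℝ ∞ p (Icc 0 b) := (hB.comp hx hball).clm_apply hv
  have hpd : ∀ t ∈ Icc 0 b, HasDerivWithinAt p (derivWithin p (Icc 0 b) t) (Icc 0 b) t :=
    fun t ht => (hps.differentiableOn (by simp) t ht).hasDerivWithinAt
  have hpc : ContinuousOn (derivWithin p (Icc 0 b)) (Icc 0 b) :=
    hps.continuousOn_derivWithin (uniqueDiffOn_Icc hb0) (by simp)
  have hfc : ContinuousOn (fun t => force B (x t) (v t)) (Icc 0 b) :=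
    continuousOn_force_comp hB hx.continuousOn hv.continuousOn hball
  have hIoo : EqOn (derivWithin p (Icc 0 b)) (fun t => force B (x t) (v t)) (Ioo 0 b) := by
    have hw : ∀ w : E, EqOn (fun t => force B (x t) (v t) w - derivWithin p (Icc 0 b) t w)
        (fun _ => 0) (Ioo 0 b) := by
      intro w
      have hc : ContinuousOn (fun t => force B (x t) (v t) w - derivWithin p (Icc 0 b) t w)
          (Icc 0 b) := (hfc.clm_apply continuousOn_const).sub (hpc.clm_apply continuousOn_const)
      -- The fundamental lemma of the calculus of variations, applied after integration by parts to
      -- the force minus the derivative of the momentum. Both are continuous, so the equality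
      -- extends to every point of the closed interval.
      have hae := isOpen_Ioo.ae_eq_zero_of_integral_contDiff_smul_eq_zero (μ := volume)
        ((hc.mono Ioo_subset_Icc_self).locallyIntegrableOn measurableSet_Ioo)
        fun η hη _ hsupp => by
          obtain ⟨τ, hτ, hd⟩ := hcrit η hη hsupp w
          have hI := (hasDerivAt_action_variation hB hsymm hρ₁ ⟨hb0.le, hb1⟩ hx.continuousOn
            hv.continuousOn hxρ hη w τ).unique hd
          rw [mul_eq_zero, or_iff_right hτ.ne'] at hI
          have hη' : Continuous (deriv η) := hη.continuous_deriv (by simp)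
          have hz : ∀ t, t ∉ Ioo 0 b → η t = 0 := fun t ht =>
            image_eq_zero_of_notMem_tsupport fun h => ht (hsupp h)
          have hηw : Continuous fun t => η t • w := hη.continuous.smul continuous_const
          have hηw' : Continuous fun t => deriv η t • w := hη'.smul continuous_const
          have hftc : ∫ t in 0..b, (derivWithin p (Icc 0 b) t (η t • w) +
              p t (deriv η t • w)) = 0 := by
            rw [intervalIntegral.integral_eq_sub_of_hasDerivAt_of_le
              (f := fun t => p t (η t • w)) hb0.le]
            · simp [hz 0 (by simp), hz b (by simp)]
            · exact hps.continuousOn.clm_apply hηw.continuousOn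
            · intro t ht
              exact ((hpd t (Ioo_subset_Icc_self ht)).hasDerivAt
                (Icc_mem_nhds ht.1 ht.2)).clm_apply
                (((hη.differentiable (by simp) t).hasDerivAt).smul_const w)
            · exact ((hpc.clm_apply hηw.continuousOn).add (hps.continuousOn.clm_apply
                hηw'.continuousOn)).intervalIntegrable_of_Icc hb0.le
          have i1 : IntervalIntegrable (fun t => force B (x t) (v t) (η t • w) +
              p t (deriv η t • w)) volume 0 b :=
            ((hfc.clm_apply hηw.continuousOn).add (hps.continuousOn.clm_apply
              hηw'.continuousOn)).intervalIntegrable_of_Icc hb0.le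
          have i2 : IntervalIntegrable (fun t => derivWithin p (Icc 0 b) t (η t • w) +
              p t (deriv η t • w)) volume 0 b :=
            ((hpc.clm_apply hηw.continuousOn).add (hps.continuousOn.clm_apply
              hηw'.continuousOn)).intervalIntegrable_of_Icc hb0.le
          have h1 := intervalIntegral.integral_sub i1 i2
          rw [hftc, sub_zero, hI] at h1
          rw [← setIntegral_eq_integral_of_forall_compl_eq_zero (s := Ioc 0 b) fun t ht => by
            rw [hz t fun h => ht (Ioo_subset_Ioc_self h), zero_smul],
            ← intervalIntegral.integral_of_le hb0.le]
          refine Eq.trans ?_ h1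
          refine integral_congr_Ioo hb0.le fun t _ => ?_
          simp only [map_smul, smul_eq_mul]
          ring
      refine Measure.eqOn_open_of_ae_eq (μ := volume) ?_ isOpen_Ioo (hc.mono Ioo_subset_Icc_self)
        continuousOn_const
      exact (ae_restrict_iff' measurableSet_Ioo).2 hae
    intro t ht
    ext w
    exact (sub_eq_zero.1 (hw w ht)).symm
  have hIcc : EqOn (derivWithin p (Icc 0 b)) (fun t => force B (x t) (v t)) (Icc 0 b) :=
    hIoo.of_subset_closure hpc hfc Ioo_subset_Icc_self (closure_Ioo hb0.ne).ge
  intro t ht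
  have := hpd t ht
  rwa [hIcc ht] at this

/-- Extremals with small velocity are almost straight. -/
theorem exists_norm_velocity_sub_le (hB : ContDiffOn ℝ ∞ B (Metric.ball 0 ρ))
    (hpos : ∀ x ∈ Metric.ball (0 : E) ρ, ∀ v : E, v ≠ 0 → 0 < B x v v) {ρ₁ : ℝ} (hρ₁0 : 0 < ρ₁)
    (hρ₁ : ρ₁ < ρ) {R : ℝ} (hR : 0 ≤ R) :
    ∃ C ≥ 0, ∀ b ∈ Icc (0 : ℝ) 1, ∀ a ≥ 0, ∀ x v : ℝ → E, x 0 = 0 →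
      (∀ t ∈ Icc 0 b, ‖x t‖ ≤ ρ₁ ∧ ‖v t‖ ≤ R * a ∧ HasDerivWithinAt x (v t) (Icc 0 b) t ∧
        HasDerivWithinAt (fun t => B (x t) (v t)) (force B (x t) (v t)) (Icc 0 b) t) →
      ∀ t ∈ Icc 0 b, ‖x t‖ ≤ R * a ∧ ‖v t - v 0‖ ≤ C * a ^ 2 := by
  have hsub : Metric.closedBall (0 : E) ρ₁ ⊆ Metric.ball 0 ρ := Metric.closedBall_subset_ball hρ₁
  have hKc : IsCompact (Metric.closedBall (0 : E) ρ₁) := isCompact_closedBall _ _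
  obtain ⟨κ, hκ⟩ := (hB.mono hsub).exists_lipschitzOnWith (by simp) (convex_closedBall _ _) hKc
  obtain ⟨L, hL⟩ := hKc.exists_bound_of_continuousOn
    ((hB.fderiv_of_isOpen (m := ∞) Metric.isOpen_ball (by norm_cast)).continuousOn.mono hsub)
  have h0 : (0 : E) ∈ Metric.ball (0 : E) ρ := by simpa using hρ₁0.trans hρ₁
  obtain ⟨e, he⟩ := isInvertible_of_pos (hpos 0 h0)
  obtain ⟨q, hq⟩ : ∃ q : ℝ, q = ‖(e.symm : (E →L[ℝ] ℝ) →L[ℝ] E)‖ := ⟨_, rfl⟩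
  have hq0 : 0 ≤ q := hq ▸ norm_nonneg _
  have hinv : ∀ u, ‖u‖ ≤ q * ‖B 0 u‖ := fun u => by
    rw [hq, ← he]
    simpa using (e.symm : (E →L[ℝ] ℝ) →L[ℝ] E).le_opNorm (e u)
  have hL0 : 0 ≤ L := (norm_nonneg _).trans (hL 0 (by simpa using hρ₁0.le))
  refine ⟨q * (L * R ^ 2 + κ * R ^ 2), by positivity, fun b hb a ha x v hx0 h t ht => ?_⟩
  have h0b : (0 : ℝ) ∈ Icc 0 b := ⟨le_rfl, hb.1⟩
  have ht1 : |t| ≤ 1 := by rw [abs_of_nonneg ht.1]; exact ht.2.trans hb.2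
  have hxt : ‖x t‖ ≤ R * a := by
    have h1 := (convex_Icc 0 b).norm_image_sub_le_of_norm_hasDerivWithin_le
      (fun s hs => (h s hs).2.2.1) (fun s hs => (h s hs).2.1) h0b ht
    rw [hx0, sub_zero, sub_zero, Real.norm_eq_abs] at h1
    exact h1.trans (mul_le_of_le_one_right (by positivity) ht1)
  refine ⟨hxt, ?_⟩
  -- The momentum moves by `O(a²)` because the force is quadratic in the velocity. Measuring it by
  -- the metric at the origin costs another `O(a) * O(a)`, as `x t` is of order `a`.
  have hpt : ‖B (x t) (v t) - B (x 0) (v 0)‖ ≤ L * (R * a) ^ 2 := by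
    have h1 := (convex_Icc 0 b).norm_image_sub_le_of_norm_hasDerivWithin_le
      (C := L * (R * a) ^ 2) (fun s hs => (h s hs).2.2.2) (fun s hs => by
        refine (norm_force_le B _ _).trans ?_
        gcongr
        · exact hL _ (by simpa using (h s hs).1)
        · exact (h s hs).2.1) h0b ht
    rw [sub_zero, Real.norm_eq_abs] at h1
    exact h1.trans (mul_le_of_le_one_right (by positivity) ht1)
  have hBt : ‖B (x t) (v t) - B 0 (v t)‖ ≤ κ * (R * a) * (R * a) := by
    rw [← _root_.sub_apply]
    refine ((B (x t) - B 0).le_opNorm _).trans ?_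
    have h1 := hκ.norm_sub_le (x := x t) (y := 0) (by simpa using (h t ht).1)
      (by simpa using hρ₁0.le)
    rw [sub_zero] at h1
    gcongr
    · exact h1.trans (by gcongr)
    · exact (h t ht).2.1
  have h2 := hinv (v t - v 0)
  have h3 : B 0 (v t - v 0) = (B (x t) (v t) - B (x 0) (v 0)) - (B (x t) (v t) - B 0 (v t)) := by
    rw [map_sub, hx0]
    abel
  rw [h3] at h2
  calc ‖v t - v 0‖ ≤ q * (L * (R * a) ^ 2 + κ * (R * a) * (R * a)) := by
        refine h2.trans ?_
        gcongr
        exact (norm_sub_le _ _).trans (add_le_add hpt hBt)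
    _ = _ := by ring

end Variational


/-! ### Critical curves of the energy on a submanifold, studied in a chart. -/

section CriticalCurve

variable {E F : Type*} [NormedAddCommGroup E] [NormedSpace ℝ E] [NormedAddCommGroup F]
  [NormedSpace ℝ F]

/-- Smooth curves in `N` which are critical for the energy with density `½ Q`, with respect to
smooth variations with fixed end points. -/
structure IsCriticalCurve (N : Set F) (Q : F → F → ℝ) (γ : ℝ → F) : Prop where
  smooth : ContDiffOn ℝ ∞ γ (Icc 0 1)
  mem : ∀ t ∈ Icc (0 : ℝ) 1, γ t ∈ N
  critical : ∀ Γ : ℝ → ℝ → F,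
    ContDiffOn ℝ ∞ (fun p : ℝ × ℝ => Γ p.1 p.2) (univ ×ˢ Icc 0 1) →
    (∀ s, ∀ t ∈ Icc (0 : ℝ) 1, Γ s t ∈ N) → (∀ t ∈ Icc (0 : ℝ) 1, Γ 0 t = γ t) →
    (∀ s, Γ s 0 = γ 0) → (∀ s, Γ s 1 = γ 1) →
    HasDerivAt (fun s => (1 / 2) * ∫ t in (0 : ℝ)..1, Q (Γ s t) (deriv (Γ s) t)) 0 0

/-- A chart around `p` of a submanifold `N`, together with the coordinates `B` of a Riemannian
metric with quadratic form `Q`. -/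
structure MetricChart (E : Type*) [NormedAddCommGroup E] [NormedSpace ℝ E] (N : Set F)
    (Q : F → F → ℝ) (p : F) where
  toFun : E → F
  inv : F → E
  coef : E → E →L[ℝ] E →L[ℝ] ℝ
  radius : ℝ
  source : Set F
  radius_pos : 0 < radius
  isOpen_source : IsOpen source
  continuousOn_quad : ContinuousOn (fun y : F × F => Q y.1 y.2) (N ×ˢ univ)
  contDiffOn_toFun : ContDiffOn ℝ ∞ toFun (Metric.ball 0 radius)
  contDiffOn_inv : ContDiffOn ℝ ∞ inv source
  contDiffOn_coef : ContDiffOn ℝ ∞ coef (Metric.ball 0 radius)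
  symm : ∀ x ∈ Metric.ball (0 : E) radius, ∀ v w, coef x v w = coef x w v
  pos : ∀ x ∈ Metric.ball (0 : E) radius, ∀ v : E, v ≠ 0 → 0 < coef x v v
  map_zero : toFun 0 = p
  map_mem : ∀ x ∈ Metric.ball (0 : E) radius, toFun x ∈ N
  map_mem_source : ∀ x ∈ Metric.ball (0 : E) radius, toFun x ∈ source
  left_inv : ∀ x ∈ Metric.ball (0 : E) radius, inv (toFun x) = x
  right_inv : ∀ V ∈ N, V ∈ source → inv V ∈ Metric.ball (0 : E) radius → toFun (inv V) = V
  coef_self : ∀ x ∈ Metric.ball (0 : E) radius, ∀ v,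
    coef x v v = Q (toFun x) (fderiv ℝ toFun x v)

namespace MetricChart

variable {N : Set F} {Q : F → F → ℝ} {p : F} (c : MetricChart E N Q p)

theorem differentiableAt_toFun {x : E} (hx : x ∈ Metric.ball (0 : E) c.radius) :
    DifferentiableAt ℝ c.toFun x :=
  (c.contDiffOn_toFun.contDiffAt (Metric.isOpen_ball.mem_nhds hx)).differentiableAt (by simp)

/-- By the chain rule, the energy density of a curve is the Lagrangian of its coordinates; only the
germ of the curve at `t` matters. -/
theorem half_quad_deriv {X : ℝ → E} {γ : ℝ → F} {t : ℝ} {v : E} (hX : HasDerivAt X v t)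
    (hXt : X t ∈ Metric.ball (0 : E) c.radius) (h : γ =ᶠ[𝓝 t] fun t => c.toFun (X t)) :
    1 / 2 * Q (γ t) (deriv γ t) = lagrangian c.coef (X t, v) := by
  have h1 : HasDerivAt (fun t => c.toFun (X t)) (fderiv ℝ c.toFun (X t) v) t :=
    (c.differentiableAt_toFun hXt).hasFDerivAt.comp_hasDerivAt t hX
  rw [h.deriv_eq, h1.deriv, h.eq_of_nhds, ← c.coef_self _ hXt]
  rfl

theorem isOpen_domain : IsOpen (c.source ∩ c.inv ⁻¹' Metric.ball 0 c.radius) :=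
  c.contDiffOn_inv.continuousOn.isOpen_inter_preimage c.isOpen_source Metric.isOpen_ball

theorem zero_mem_ball : (0 : E) ∈ Metric.ball (0 : E) c.radius := by
  simpa using c.radius_pos

theorem base_mem_source : p ∈ c.source := by
  have := c.map_mem_source 0 c.zero_mem_ball
  rwa [c.map_zero] at this

theorem inv_base : c.inv p = 0 := by
  have := c.left_inv 0 c.zero_mem_ball
  rwa [c.map_zero] at this

variable [FiniteDimensional ℝ E]

/-- Critical curves exist for small initial velocities. -/
theorem exists_isCriticalCurve :
    ∃ r > 0, ∀ A : E, ‖A‖ ≤ r → ∃ γ : ℝ → F, IsCriticalCurve N Q γ ∧ γ 0 = p ∧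
      derivWithin γ (Icc 0 1) 0 = fderiv ℝ c.toFun 0 A := by
  have hρ := c.radius_pos
  obtain ⟨r, hr, h⟩ := exists_extremal c.contDiffOn_coef c.pos (half_pos hρ) (half_lt_self hρ)
  refine ⟨r, hr, fun A hA => ?_⟩
  obtain ⟨x, v, hx0, hv0, hx, hv, hxv⟩ := h A hA
  have hball : ∀ t ∈ Icc (0 : ℝ) 1, x t ∈ Metric.ball (0 : E) c.radius := fun t ht => by
    rw [mem_ball_zero_iff]; exact (hxv t ht).1.trans_lt (half_lt_self hρ)
  have h01 : (0 : ℝ) ∈ Icc (0 : ℝ) 1 := ⟨le_rfl, zero_le_one⟩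
  refine ⟨fun t => c.toFun (x t), ⟨c.contDiffOn_toFun.comp hx hball,
    fun t ht => c.map_mem _ (hball t ht), fun Γ hΓ hΓN hΓ0 hΓa hΓb => ?_⟩, ?_, ?_⟩
  · obtain ⟨u, huo, hu⟩ := continuousOn_iff'.1 hΓ.continuousOn _ c.isOpen_domain
    have hsub : ({0} : Set ℝ) ×ˢ Icc (0 : ℝ) 1 ⊆ u := by
      rintro ⟨s, t⟩ ⟨hs, ht⟩
      rw [mem_singleton_iff] at hs
      have : (s, t) ∈ u ∩ univ ×ˢ Icc (0 : ℝ) 1 := by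
        rw [← hu]
        refine ⟨?_, mem_univ _, ht⟩
        change Γ s t ∈ c.source ∩ c.inv ⁻¹' Metric.ball 0 c.radius
        simp only at hs ht
        rw [hs, hΓ0 t ht]
        refine ⟨c.map_mem_source _ (hball t ht), ?_⟩
        rw [mem_preimage, c.left_inv _ (hball t ht)]
        exact hball t ht
      exact this.1
    -- The variation at `s = 0` lies in the open domain of the chart, and `[0, 1]` is compact. Hence
    -- it lies there for all small `s`, uniformly in time.
    obtain ⟨u₁, v₁, hu₁, hv₁, hu0, hv0', huv⟩ := generalized_tube_lemma isCompact_singleton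
      isCompact_Icc huo hsub
    obtain ⟨δ, hδ, hδu⟩ := Metric.isOpen_iff.1 hu₁ 0 (hu0 rfl)
    rw [Real.ball_eq_Ioo, zero_sub, zero_add] at hδu
    have hdom : ∀ s ∈ Ioo (-δ) δ, ∀ t ∈ Icc (0 : ℝ) 1,
        Γ s t ∈ c.source ∩ c.inv ⁻¹' Metric.ball 0 c.radius := fun s hs t ht => by
      have h1 : (s, t) ∈ u ∩ univ ×ˢ Icc (0 : ℝ) 1 :=
        ⟨huv ⟨hδu hs, hv0' ht⟩, mem_univ _, ht⟩
      rw [← hu] at h1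
      exact h1.1
    have hX : ContDiffOn ℝ ∞ (fun q : ℝ × ℝ => c.inv (Γ q.1 q.2)) (Ioo (-δ) δ ×ˢ Icc 0 1) :=
      c.contDiffOn_inv.comp (hΓ.mono (prod_mono (subset_univ _) subset_rfl))
        fun q hq => (hdom q.1 hq.1 q.2 hq.2).1
    have hX0 : ∀ t ∈ Icc (0 : ℝ) 1, c.inv (Γ 0 t) = x t := fun t ht => by
      rw [hΓ0 t ht, c.left_inv _ (hball t ht)]
    have h11 : (1 : ℝ) ∈ Icc (0 : ℝ) 1 := ⟨zero_le_one, le_rfl⟩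
    have hd := hasDerivAt_action_of_extremal c.contDiffOn_coef c.symm (half_lt_self hρ)
      hv.continuousOn hxv hδ (X := fun s t => c.inv (Γ s t)) hX hX0
      (fun s _ => by rw [hΓa s, c.left_inv _ (hball 0 h01)])
      (fun s _ => by rw [hΓb s, c.left_inv _ (hball 1 h11)])
    refine hd.congr_of_eventuallyEq ?_
    filter_upwards [Ioo_mem_nhds (neg_lt_zero.2 hδ) hδ] with s hs
    rw [← intervalIntegral.integral_const_mul]
    refine integral_congr_Ioo zero_le_one fun t ht => ?_
    have htI := Ioo_subset_Icc_self ht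
    have hn := Icc_mem_nhds ht.1 ht.2
    have hXd : DifferentiableAt ℝ (fun t => c.inv (Γ s t)) t := by
      have h1 : ContDiffOn ℝ ∞ (fun t => c.inv (Γ s t)) (Icc 0 1) :=
        hX.comp (f := fun t => (s, t)) (contDiffOn_const.prodMk contDiffOn_id)
          fun t ht => ⟨hs, ht⟩
      exact (h1.contDiffAt hn).differentiableAt (by simp)
    refine c.half_quad_deriv hXd.hasDerivAt (hdom s hs t htI).2 ?_
    filter_upwards [hn] with t' ht'
    exact (c.right_inv _ (hΓN s t' ht') (hdom s hs t' ht').1 (hdom s hs t' ht').2).symm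
  · simp only [hx0, c.map_zero]
  · have h1 : HasFDerivAt c.toFun (fderiv ℝ c.toFun 0) (x 0) := by
      rw [hx0]
      exact (c.differentiableAt_toFun c.zero_mem_ball).hasFDerivAt
    have h2 := h1.comp_hasDerivWithinAt 0 (hxv 0 h01).2.1
    rw [hv0] at h2
    exact h2.derivWithin (uniqueDiffOn_Icc one_pos 0 h01)

/-- In the chart, critical curves satisfy the Euler–Lagrange equation. -/
theorem hasDerivWithinAt_momentum {γ : ℝ → F} (hγ : IsCriticalCurve N Q γ) {b ρ₁ : ℝ} (hb0 : 0 < b)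
    (hb1 : b ≤ 1) (hρ₁ : ρ₁ < c.radius) (hs : ∀ t ∈ Icc 0 b, γ t ∈ c.source)
    (hr : ∀ t ∈ Icc 0 b, ‖c.inv (γ t)‖ ≤ ρ₁) :
    ∀ t ∈ Icc 0 b, HasDerivWithinAt
      (fun t => c.coef (c.inv (γ t)) (derivWithin (fun t => c.inv (γ t)) (Icc 0 b) t))
      (force c.coef (c.inv (γ t)) (derivWithin (fun t => c.inv (γ t)) (Icc 0 b) t)) (Icc 0 b) t := by
  have hI : Icc 0 b ⊆ Icc (0 : ℝ) 1 := Icc_subset_Icc_right hb1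
  obtain ⟨x, hxdef⟩ : ∃ x : ℝ → E, x = fun t => c.inv (γ t) := ⟨_, rfl⟩
  have hxt : ∀ t, x t = c.inv (γ t) := fun t => by rw [hxdef]
  rw [← hxdef]
  simp only [← hxt] at hr ⊢
  have hball : ∀ t ∈ Icc 0 b, x t ∈ Metric.ball (0 : E) c.radius := fun t ht => by
    rw [mem_ball_zero_iff]; exact (hr t ht).trans_lt hρ₁
  have hx1 : ∀ t ∈ Icc 0 b, ContDiffWithinAt ℝ ∞ x (Icc 0 1) t := fun t ht => by
    rw [hxdef]
    exact (c.contDiffOn_inv.contDiffAt (c.isOpen_source.mem_nhds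
      (hs t ht))).comp_contDiffWithinAt t (hγ.smooth t (hI ht))
  have hx : ContDiffOn ℝ ∞ x (Icc 0 b) := fun t ht => (hx1 t ht).mono hI
  have hv : ContDiffOn ℝ ∞ (derivWithin x (Icc 0 b)) (Icc 0 b) :=
    hx.derivWithin (uniqueDiffOn_Icc hb0) (by norm_cast)
  have hγx : ∀ t ∈ Icc 0 b, c.toFun (x t) = γ t := fun t ht => by
    rw [hxt]
    exact c.right_inv _ (hγ.mem t (hI ht)) (hs t ht) (by rw [← hxt]; exact hball t ht)
  refine hasDerivWithinAt_momentum_of_critical c.contDiffOn_coef c.symm hρ₁ hb0 hb1 hx hv hr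
    fun η hη hsupp w => ?_
  obtain ⟨M, hM⟩ := (isCompact_Icc (a := (0 : ℝ)) (b := b)).exists_bound_of_continuousOn
    hη.continuous.continuousOn
  have hM0 : 0 ≤ M := (norm_nonneg _).trans (hM 0 ⟨le_rfl, hb0.le⟩)
  -- Variations must be defined for every real `s`. The amplitude `τ sin s` is bounded, so with this
  -- `τ` the perturbed curve never leaves the chart.
  obtain ⟨τ, hτ, hτM⟩ : ∃ τ : ℝ, 0 < τ ∧ τ * (M * ‖w‖) < c.radius - ρ₁ := by
    refine ⟨(c.radius - ρ₁) / (M * ‖w‖ + 1), div_pos (by linarith) (by positivity), ?_⟩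
    rw [div_mul_eq_mul_div, div_lt_iff₀ (by positivity)]
    nlinarith
  refine ⟨τ, hτ, ?_⟩
  have hz : ∀ t, t ∉ Ioo 0 b → η t = 0 := fun t ht =>
    image_eq_zero_of_notMem_tsupport fun h => ht (hsupp h)
  have hXball : ∀ s, ∀ t ∈ Icc 0 b,
      x t + (τ * Real.sin s) • η t • w ∈ Metric.ball (0 : E) c.radius := fun s t ht => by
    rw [mem_ball_zero_iff]
    have h1 : ‖(τ * Real.sin s) • η t • w‖ ≤ τ * 1 * (M * ‖w‖) := by
      rw [norm_smul, norm_smul, norm_mul, Real.norm_of_nonneg hτ.le]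
      gcongr
      · exact Real.abs_sin_le_one s
      · exact hM t ht
    linarith [norm_add_le (x t) ((τ * Real.sin s) • η t • w), hr t ht]
  -- Written as `γ` plus a difference of chart values, the variation is `γ` itself wherever `η`
  -- vanishes. This continues it smoothly past `b`, where `γ` may leave the chart.
  set Γ : ℝ → ℝ → F := fun s t =>
    γ t + (c.toFun (x t + (τ * Real.sin s) • η t • w) - c.toFun (x t)) with hΓ
  have hΓin : ∀ s, ∀ t ∈ Icc 0 b, Γ s t = c.toFun (x t + (τ * Real.sin s) • η t • w) :=
    fun s t ht => by simp only [hΓ]; rw [hγx t ht]; abel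
  have hΓout : ∀ s t, η t = 0 → Γ s t = γ t := fun s t ht => by simp [hΓ, ht]
  have hd := hγ.critical Γ ?_ ?_ ?_ ?_ ?_
  rotate_left
  · rintro ⟨s, t⟩ ⟨-, ht⟩
    have hγ2 : ContDiffWithinAt ℝ ∞ (fun q : ℝ × ℝ => γ q.2) (univ ×ˢ Icc 0 1) (s, t) :=
      ContDiffWithinAt.comp (t := Icc 0 1) (s, t) (hγ.smooth t ht) contDiffWithinAt_snd
        fun q hq => hq.2
    by_cases htb : t ≤ b
    · have hx2 : ContDiffWithinAt ℝ ∞ (fun q : ℝ × ℝ => x q.2) (univ ×ˢ Icc 0 1) (s, t) :=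
        ContDiffWithinAt.comp (t := Icc 0 1) (s, t) (hx1 t ⟨ht.1, htb⟩) contDiffWithinAt_snd
          fun q hq => hq.2
      have hX2 : ContDiffWithinAt ℝ ∞ (fun q : ℝ × ℝ => x q.2 + (τ * Real.sin q.1) • η q.2 • w)
          (univ ×ˢ Icc 0 1) (s, t) :=
        hx2.add ((contDiff_const.mul (Real.contDiff_sin.comp contDiff_fst)).smul
          ((hη.comp contDiff_snd).smul contDiff_const)).contDiffWithinAt
      have hb' : t ∈ Icc 0 b := ⟨ht.1, htb⟩
      have h1 := ContDiffAt.comp_contDiffWithinAt (g := c.toFun) (s, t)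
        (c.contDiffOn_toFun.contDiffAt (Metric.isOpen_ball.mem_nhds (hXball s t hb'))) hX2
      have h2 := ContDiffAt.comp_contDiffWithinAt (g := c.toFun) (s, t)
        (c.contDiffOn_toFun.contDiffAt (Metric.isOpen_ball.mem_nhds (hball t hb'))) hx2
      exact hγ2.add (h1.sub h2)
    · push Not at htb
      refine hγ2.congr_of_eventuallyEq ?_ (hΓout s t (hz t fun h => htb.not_gt h.2))
      have : ∀ᶠ q : ℝ × ℝ in 𝓝 (s, t), b < q.2 :=
        continuous_snd.continuousAt.eventually (lt_mem_nhds htb)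
      filter_upwards [this.filter_mono nhdsWithin_le_nhds] with q hq
      exact hΓout _ _ (hz _ fun h => hq.not_gt h.2)
  · intro s t ht
    by_cases htb : t ≤ b
    · rw [hΓin s t ⟨ht.1, htb⟩]
      exact c.map_mem _ (hXball s t ⟨ht.1, htb⟩)
    · rw [hΓout s t (hz t fun h => htb h.2.le)]
      exact hγ.mem t ht
  · intro t ht
    simp [hΓ]
  · intro s
    exact hΓout s 0 (hz 0 (by simp))
  · intro s
    exact hΓout s 1 (hz 1 fun h => hb1.not_gt h.2)
  have hγ' : ContinuousOn (derivWithin γ (Icc 0 1)) (Icc 0 1) :=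
    hγ.smooth.continuousOn_derivWithin (uniqueDiffOn_Icc one_pos) (by simp)
  have hi2 : IntervalIntegrable (fun t => Q (γ t) (derivWithin γ (Icc 0 1) t)) volume b 1 := by
    have h1 : ContinuousOn (fun t => Q (γ t) (derivWithin γ (Icc 0 1) t)) (Icc 0 1) :=
      c.continuousOn_quad.comp (hγ.smooth.continuousOn.prodMk hγ') fun t ht =>
        ⟨hγ.mem t ht, mem_univ _⟩
    exact (h1.mono (Icc_subset_Icc_left hb0.le)).intervalIntegrable_of_Icc hb1
  have hη' : Continuous (deriv η) := hη.continuous_deriv (by simp)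
  have hlag : ∀ s, ContinuousOn (fun t => lagrangian c.coef (x t + (τ * Real.sin s) • η t • w,
      derivWithin x (Icc 0 b) t + (τ * Real.sin s) • deriv η t • w)) (Icc 0 b) := fun s =>
    continuousOn_lagrangian_comp c.contDiffOn_coef
      (hx.continuousOn.add ((hη.continuous.smul continuous_const).const_smul _).continuousOn)
      (hv.continuousOn.add ((hη'.smul continuous_const).const_smul _).continuousOn) (hXball s)
  -- Beyond `b` the energy does not depend on `s`, so criticality of the whole curve is criticality
  -- of the action on `[0, b]`.
  have hsplit : ∀ s, (1 / 2) * ∫ t in (0 : ℝ)..1, Q (Γ s t) (deriv (Γ s) t) =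
      (∫ t in 0..b, lagrangian c.coef (x t + (τ * Real.sin s) • η t • w,
        derivWithin x (Icc 0 b) t + (τ * Real.sin s) • deriv η t • w)) +
      (1 / 2) * ∫ t in b..1, Q (γ t) (derivWithin γ (Icc 0 1) t) := by
    intro s
    have e1 : ∀ t ∈ Ioo 0 b, Q (Γ s t) (deriv (Γ s) t) =
        2 * lagrangian c.coef (x t + (τ * Real.sin s) • η t • w,
          derivWithin x (Icc 0 b) t + (τ * Real.sin s) • deriv η t • w) := fun t ht => by
      have htI := Ioo_subset_Icc_self ht
      have hn := Icc_mem_nhds ht.1 ht.2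
      have hXd : HasDerivAt (fun t => x t + (τ * Real.sin s) • η t • w)
          (derivWithin x (Icc 0 b) t + (τ * Real.sin s) • deriv η t • w) t := by
        have d1 := ((hx.differentiableOn (by simp) t htI).hasDerivWithinAt).hasDerivAt hn
        have d2 := (((hη.differentiable (by simp) t).hasDerivAt).smul_const w).const_smul
          (τ * Real.sin s)
        exact d1.add d2
      have := c.half_quad_deriv (γ := Γ s) hXd (hXball s t htI) (by
        filter_upwards [hn] with t' ht'
        exact hΓin s t' ht')
      rw [← this]
      ring
    have e2 : ∀ t ∈ Ioo b 1, Q (Γ s t) (deriv (Γ s) t) = Q (γ t) (derivWithin γ (Icc 0 1) t) :=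
      fun t ht => by
        have h1 : Γ s =ᶠ[𝓝 t] γ := by
          filter_upwards [lt_mem_nhds ht.1] with t' ht'
          exact hΓout _ _ (hz _ fun h => ht'.not_gt h.2)
        rw [h1.deriv_eq, h1.eq_of_nhds,
          derivWithin_of_mem_nhds (Icc_mem_nhds (hb0.trans ht.1) ht.2)]
    have i1 : IntervalIntegrable (fun t => Q (Γ s t) (deriv (Γ s) t)) volume 0 b := by
      have := ((hlag s).const_smul (2 : ℝ)).intervalIntegrable_of_Icc (μ := volume) hb0.le
      rw [intervalIntegrable_iff_integrableOn_Ioo_of_le hb0.le] at this ⊢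
      exact this.congr_fun (fun t ht => (e1 t ht).symm) measurableSet_Ioo
    have i2 : IntervalIntegrable (fun t => Q (Γ s t) (deriv (Γ s) t)) volume b 1 := by
      rw [intervalIntegrable_iff_integrableOn_Ioo_of_le hb1] at hi2 ⊢
      exact hi2.congr_fun (fun t ht => (e2 t ht).symm) measurableSet_Ioo
    rw [← intervalIntegral.integral_add_adjacent_intervals i1 i2, integral_congr_Ioo hb0.le e1,
      integral_congr_Ioo hb1 e2, intervalIntegral.integral_const_mul]
    ring
  simp only [hsplit] at hd
  simpa using hd.sub_const ((1 / 2) * ∫ t in b..1, Q (γ t) (derivWithin γ (Icc 0 1) t))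

/-- Critical curves with small initial velocity are almost straight. -/
theorem exists_norm_sub_le_of_isCriticalCurve (c : MetricChart E N Q p) :
    ∃ C ≥ 0, ∃ r > 0, ∀ a : ℝ, 0 < a → a ≤ r → ∀ γ : ℝ → F, IsCriticalCurve N Q γ → γ 0 = p →
      ∀ u, derivWithin γ (Icc 0 1) 0 = u → ‖u‖ ≤ a → ‖γ 1 - p - u‖ ≤ C * a ^ 2 := by
  have hρ := c.radius_pos
  obtain ⟨ρ₁, hρ₁⟩ : ∃ ρ₁ : ℝ, ρ₁ = c.radius / 2 := ⟨_, rfl⟩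
  have hρ₁0 : 0 < ρ₁ := by rw [hρ₁]; positivity
  have hρ₁ρ : ρ₁ < c.radius := by rw [hρ₁]; exact half_lt_self hρ
  have hsub : Metric.closedBall (0 : E) ρ₁ ⊆ Metric.ball 0 c.radius :=
    Metric.closedBall_subset_ball hρ₁ρ
  have hic : ContinuousAt c.inv p :=
    (c.contDiffOn_inv.contDiffAt (c.isOpen_source.mem_nhds c.base_mem_source)).continuousAt
  have hidc : ContinuousAt (fderiv ℝ c.inv) p :=
    (c.contDiffOn_inv.fderiv_of_isOpen (m := ∞) c.isOpen_source (by norm_cast)).continuousOn.continuousAt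
      (c.isOpen_source.mem_nhds c.base_mem_source)
  obtain ⟨K, hK⟩ : ∃ K : ℝ, K = ‖fderiv ℝ c.inv p‖ + 1 := ⟨_, rfl⟩
  have hK0 : 0 ≤ K := by rw [hK]; positivity
  obtain ⟨ρ', hρ'0, hρ'⟩ : ∃ ρ' : ℝ, 0 < ρ' ∧ ∀ V : F, ‖V - p‖ ≤ ρ' →
      V ∈ c.source ∧ ‖c.inv V‖ ≤ ρ₁ ∧ ‖fderiv ℝ c.inv V‖ ≤ K := by
    have h1 : ∀ᶠ V in 𝓝 p, V ∈ c.source := c.isOpen_source.mem_nhds c.base_mem_source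
    have h2 : ∀ᶠ V in 𝓝 p, ‖c.inv V‖ < ρ₁ :=
      hic.norm.eventually (gt_mem_nhds (by beta_reduce; rw [c.inv_base, norm_zero]; exact hρ₁0))
    have h3 : ∀ᶠ V in 𝓝 p, ‖fderiv ℝ c.inv V‖ < K :=
      hidc.norm.eventually (gt_mem_nhds (by rw [hK]; exact lt_add_one _))
    obtain ⟨ε, hε, h⟩ := Metric.eventually_nhds_iff.1 (h1.and (h2.and h3))
    refine ⟨ε / 2, half_pos hε, fun V hV => ?_⟩
    have := h (y := V) (by rw [dist_eq_norm]; linarith)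
    exact ⟨this.1, this.2.1.le, this.2.2.le⟩
  obtain ⟨κ, hκ⟩ := ((c.contDiffOn_toFun.fderiv_of_isOpen (m := 1) Metric.isOpen_ball
    (by norm_cast)).mono hsub).exists_lipschitzOnWith one_ne_zero (convex_closedBall _ _)
    (isCompact_closedBall _ _)
  obtain ⟨C₁, hC₁0, hC₁⟩ := exists_norm_velocity_sub_le c.contDiffOn_coef c.pos hρ₁0 hρ₁ρ
    (R := K * 2) (by positivity)
  obtain ⟨D, hD⟩ : ∃ D : ℝ, D = ‖fderiv ℝ c.toFun 0‖ := ⟨_, rfl⟩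
  have hD0 : 0 ≤ D := hD ▸ norm_nonneg _
  obtain ⟨C, hC⟩ : ∃ C : ℝ, C = κ * (K * 2) ^ 2 + D * C₁ := ⟨_, rfl⟩
  have hC0 : 0 ≤ C := by rw [hC]; positivity
  -- The first bound keeps a curve of speed at most `2 a` inside the neighbourhood of radius `ρ'`.
  -- The second gives `C a² ≤ a / 2`, which makes the improved speed bound `3 a / 2` strictly
  -- smaller than `2 a`.
  refine ⟨C, hC0, min (ρ' / 2) (1 / (2 * (C + 1))), by positivity, fun a ha har γ hγ hγ0 u hu' hu => ?_⟩
  subst hu'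
  have har1 : 2 * a ≤ ρ' := by linarith [har.trans (min_le_left _ _)]
  have har2 : C * a ^ 2 ≤ a / 2 := by
    have := har.trans (min_le_right _ _)
    rw [le_div_iff₀ (by positivity)] at this
    nlinarith
  set γ' := derivWithin γ (Icc 0 1) with hγ'
  have hγd : ∀ t ∈ Icc (0 : ℝ) 1, HasDerivWithinAt γ (γ' t) (Icc 0 1) t := fun t ht =>
    (hγ.smooth.differentiableOn (by simp) t ht).hasDerivWithinAt
  have hγc : ContinuousOn γ' (Icc 0 1) :=
    hγ.smooth.continuousOn_derivWithin (uniqueDiffOn_Icc one_pos) (by simp)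
  -- The bootstrap step: as long as the speed is at most `2 a` the curve stays in the chart, and the
  -- Euler-Lagrange equation shows that its velocity is almost constant.
  have key : ∀ b : ℝ, 0 < b → b ≤ 1 → (∀ t ∈ Icc 0 b, ‖γ' t‖ ≤ 2 * a) →
      ∀ t ∈ Icc 0 b, ‖γ' t - γ' 0‖ ≤ C * a ^ 2 := by
    intro b hb0 hb1 hb
    have hI : Icc 0 b ⊆ Icc (0 : ℝ) 1 := Icc_subset_Icc_right hb1
    have h0b : (0 : ℝ) ∈ Icc 0 b := ⟨le_rfl, hb0.le⟩
    have hγdb : ∀ t ∈ Icc 0 b, HasDerivWithinAt γ (γ' t) (Icc 0 b) t := fun t ht =>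
      (hγd t (hI ht)).mono hI
    have hnear : ∀ t ∈ Icc 0 b, ‖γ t - p‖ ≤ ρ' := fun t ht => by
      have h1 := (convex_Icc 0 b).norm_image_sub_le_of_norm_hasDerivWithin_le hγdb hb h0b ht
      rw [hγ0, sub_zero, Real.norm_of_nonneg ht.1] at h1
      refine h1.trans (le_trans ?_ har1)
      exact mul_le_of_le_one_right (by positivity) (ht.2.trans hb1)
    have hsrc : ∀ t ∈ Icc 0 b, γ t ∈ c.source := fun t ht => (hρ' _ (hnear t ht)).1
    have hEL := c.hasDerivWithinAt_momentum hγ hb0 hb1 hρ₁ρ hsrc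
      fun t ht => (hρ' _ (hnear t ht)).2.1
    set x : ℝ → E := fun t => c.inv (γ t) with hx
    have hxd : ∀ t ∈ Icc 0 b,
        HasDerivWithinAt x (fderiv ℝ c.inv (γ t) (γ' t)) (Icc 0 b) t := fun t ht =>
      ((c.contDiffOn_inv.contDiffAt (c.isOpen_source.mem_nhds (hsrc t ht))).differentiableAt
        (by simp)).hasFDerivAt.comp_hasDerivWithinAt t (hγdb t ht)
    have hxd' : ∀ t ∈ Icc 0 b, derivWithin x (Icc 0 b) t = fderiv ℝ c.inv (γ t) (γ' t) :=
      fun t ht => (hxd t ht).derivWithin (uniqueDiffOn_Icc hb0 t ht)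
    have hxρ : ∀ t ∈ Icc 0 b, ‖x t‖ ≤ ρ₁ := fun t ht => (hρ' _ (hnear t ht)).2.1
    have hvb : ∀ t ∈ Icc 0 b, ‖derivWithin x (Icc 0 b) t‖ ≤ K * 2 * a := fun t ht => by
      rw [hxd' t ht, mul_assoc]
      refine (ContinuousLinearMap.le_opNorm _ _).trans ?_
      gcongr
      · exact (hρ' _ (hnear t ht)).2.2
      · exact hb t ht
    have hx0 : x 0 = 0 := by rw [hx]; simp only [hγ0, c.inv_base]
    have hest := hC₁ b ⟨hb0.le, hb1⟩ a ha.le x (derivWithin x (Icc 0 b)) hx0 fun t ht =>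
      ⟨hxρ t ht, hvb t ht, (hxd t ht).differentiableWithinAt.hasDerivWithinAt, hEL t ht⟩
    have hball : ∀ t ∈ Icc 0 b, x t ∈ Metric.ball (0 : E) c.radius := fun t ht =>
      hsub (by simpa using hxρ t ht)
    have hγ'x : ∀ t ∈ Icc 0 b,
        γ' t = fderiv ℝ c.toFun (x t) (derivWithin x (Icc 0 b) t) := fun t ht => by
      have h1 := (c.differentiableAt_toFun (hball t ht)).hasFDerivAt.comp_hasDerivWithinAt t
        (hxd t ht).differentiableWithinAt.hasDerivWithinAt
      have h2 := (hγdb t ht).congr (f₁ := c.toFun ∘ x)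
        (fun t' ht' => c.right_inv _ (hγ.mem t' (hI ht')) (hsrc t' ht') (hball t' ht'))
        (c.right_inv _ (hγ.mem t (hI ht)) (hsrc t ht) (hball t ht))
      exact (uniqueDiffOn_Icc hb0 t ht).eq_deriv _ h2 h1
    intro t ht
    obtain ⟨hxt, hvt⟩ := hest t ht
    have hdec : γ' t - γ' 0 = (fderiv ℝ c.toFun (x t) - fderiv ℝ c.toFun 0)
        (derivWithin x (Icc 0 b) t) +
        fderiv ℝ c.toFun 0 (derivWithin x (Icc 0 b) t - derivWithin x (Icc 0 b) 0) := by
      rw [hγ'x t ht, hγ'x 0 h0b, hx0, _root_.sub_apply, map_sub]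
      abel
    have h1 : ‖fderiv ℝ c.toFun (x t) - fderiv ℝ c.toFun 0‖ ≤ κ * (K * 2 * a) := by
      have := hκ.norm_sub_le (x := x t) (y := 0) (by simpa using hxρ t ht)
        (by simpa using hρ₁0.le)
      rw [sub_zero] at this
      exact this.trans (by gcongr)
    rw [hdec]
    calc _ ≤ κ * (K * 2 * a) * (K * 2 * a) + D * (C₁ * a ^ 2) := by
          refine (norm_add_le _ _).trans (add_le_add ?_ ?_)
          · refine (ContinuousLinearMap.le_opNorm _ _).trans ?_
            gcongr
            exact hvb t ht
          · refine (ContinuousLinearMap.le_opNorm _ _).trans ?_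
            rw [← hD]
            gcongr
      _ = C * a ^ 2 := by rw [hC]; ring
  have hlt : ∀ v : F, ‖v - γ' 0‖ ≤ C * a ^ 2 → ‖v‖ < 2 * a := fun v hv => by
    linarith [norm_le_insert' v (γ' 0)]
  have h01 : (0 : ℝ) ∈ Icc (0 : ℝ) 1 := ⟨le_rfl, zero_le_one⟩
  have hall : ∀ t ∈ Icc (0 : ℝ) 1, ‖γ' t‖ ≤ 2 * a := by
    by_contra! hbad
    obtain ⟨t₁, ht₁, ht₁a⟩ := hbad
    have hT : IsCompact {t ∈ Icc (0 : ℝ) 1 | 2 * a ≤ ‖γ' t‖} := by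
      have := hγc.norm.preimage_isClosed_of_isClosed isClosed_Icc (isClosed_Ici (a := 2 * a))
      exact isCompact_Icc.of_isClosed_subset this fun t ht => ht.1
    -- At the first time the speed reaches `2 a`, the bootstrap applies on `[0, b]` and shows the
    -- speed there to be smaller, a contradiction.
    obtain ⟨b, ⟨hbI, hba⟩, hbmin⟩ := hT.exists_isLeast ⟨t₁, ht₁, ht₁a.le⟩
    have hb0 : 0 < b := by
      refine lt_of_le_of_ne hbI.1 fun h => ?_
      rw [← h] at hba
      linarith
    have hbefore : ∀ t ∈ Icc 0 b, t ≠ b → ‖γ' t‖ < 2 * a := fun t ht hne => by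
      by_contra! h
      exact hne (le_antisymm ht.2 (hbmin ⟨⟨ht.1, ht.2.trans hbI.2⟩, h⟩))
    have hbeq : ‖γ' b‖ ≤ 2 * a := by
      by_contra! h
      obtain ⟨s, hs, hsa⟩ := intermediate_value_Icc hb0.le
        (hγc.norm.mono (Icc_subset_Icc_right hbI.2)) (show 2 * a ∈ Icc ‖γ' 0‖ ‖γ' b‖ from
          ⟨by linarith, h.le⟩)
      have hsb : s ≠ b := fun hsb => by rw [hsb] at hsa; linarith
      exact (hbefore s hs hsb).ne hsa
    have h1 := key b hb0 hbI.2 (fun t ht => by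
      by_cases h : t = b
      · rw [h]; exact hbeq
      · exact (hbefore t ht h).le) b ⟨hb0.le, le_rfl⟩
    linarith [hlt _ h1]
  have hfin := key 1 one_pos le_rfl hall
  have h2 := (convex_Icc (0 : ℝ) 1).norm_image_sub_le_of_norm_hasDerivWithin_le
    (f := fun t => γ t - t • γ' 0) (f' := fun t => γ' t - γ' 0)
    (fun t ht => by
      have := (hγd t ht).sub ((hasDerivWithinAt_id t (Icc (0 : ℝ) 1)).smul_const (γ' 0))
      rw [one_smul] at this
      exact this) hfin h01 (right_mem_Icc.2 zero_le_one)
  simp only [one_smul, zero_smul, sub_zero, norm_one, mul_one, hγ0] at h2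
  rwa [sub_right_comm] at h2

end MetricChart

end CriticalCurve


/-! ### Metric charts from parametrizations of a submanifold. -/

section BuildChart

set_option maxSynthPendingDepth 3

variable {E F : Type*} [NormedAddCommGroup E] [NormedSpace ℝ E] [NormedAddCommGroup F]
  [NormedSpace ℝ F]

theorem fderiv_zero_apply_of_norm_sub_le [FiniteDimensional ℝ E] {f : E → F} (f' : E →ₗ[ℝ] F) {C : ℝ}
    (h : ∀ x, ‖f x - f 0 - f' x‖ ≤ C * ‖x‖ ^ 2) (v : E) : fderiv ℝ f 0 v = f' v := by
  have h1 : HasFDerivAt f (LinearMap.toContinuousLinearMap f') 0 := by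
    rw [hasFDerivAt_iff_isLittleO_nhds_zero]
    refine Asymptotics.IsBigO.trans_isLittleO (g := fun x : E => ‖x‖ ^ 2) ?_
      (Asymptotics.isLittleO_norm_pow_id one_lt_two)
    refine Asymptotics.IsBigO.of_bound C (Eventually.of_forall fun x => ?_)
    rw [zero_add, norm_pow, norm_norm]
    exact h x
  rw [h1.fderiv]
  rfl

variable [FiniteDimensional ℝ F]

/-- A bilinear form on a finite dimensional space, as a continuous bilinear map. -/
def continuousBilin (g : LinearMap.BilinForm ℝ F) : F →L[ℝ] F →L[ℝ] ℝ :=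
  LinearMap.toContinuousBilinearMap g

theorem contDiffOn_continuousBilin {g : F → LinearMap.BilinForm ℝ F} {N : Set F}
    (hg : ∀ A B, ContDiffOn ℝ ∞ (fun V => g V A B) N) :
    ContDiffOn ℝ ∞ (fun V => continuousBilin (g V)) N :=
  contDiffOn_clm_apply.2 fun A => contDiffOn_clm_apply.2 fun B => hg A B

/-- The coordinates of a symmetrized bilinear form in a chart. -/
def chartCoef (g : F → LinearMap.BilinForm ℝ F) (Φ : E → F) (x : E) : E →L[ℝ] E →L[ℝ] ℝ :=
  (1 / 2 : ℝ) • ((continuousBilin (g (Φ x))).bilinearComp (fderiv ℝ Φ x) (fderiv ℝ Φ x) +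
    ((continuousBilin (g (Φ x))).bilinearComp (fderiv ℝ Φ x) (fderiv ℝ Φ x)).flip)

theorem chartCoef_apply (g : F → LinearMap.BilinForm ℝ F) (Φ : E → F) (x v w : E) :
    chartCoef g Φ x v w = 1 / 2 * (g (Φ x) (fderiv ℝ Φ x v) (fderiv ℝ Φ x w) +
      g (Φ x) (fderiv ℝ Φ x w) (fderiv ℝ Φ x v)) := rfl

variable [FiniteDimensional ℝ E]

theorem contDiffOn_chartCoef {g : F → LinearMap.BilinForm ℝ F} {N : Set F}
    (hg : ∀ A B, ContDiffOn ℝ ∞ (fun V => g V A B) N) {Φ : E → F} {U : Set E} (hU : IsOpen U)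
    (hΦ : ContDiffOn ℝ ∞ Φ U) (hN : ∀ x ∈ U, Φ x ∈ N) : ContDiffOn ℝ ∞ (chartCoef g Φ) U := by
  have h1 : ContDiffOn ℝ ∞ (fderiv ℝ Φ) U := hΦ.fderiv_of_isOpen hU (by norm_cast)
  have h2 : ContDiffOn ℝ ∞ (fun x => continuousBilin (g (Φ x))) U :=
    (contDiffOn_continuousBilin hg).comp hΦ hN
  have h3 : ∀ v w, ContDiffOn ℝ ∞ (fun x => g (Φ x) (fderiv ℝ Φ x v) (fderiv ℝ Φ x w)) U :=
    fun v w => (h2.clm_apply (h1.clm_apply contDiffOn_const)).clm_apply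
      (h1.clm_apply contDiffOn_const)
  refine contDiffOn_clm_apply.2 fun v => contDiffOn_clm_apply.2 fun w => ?_
  simp only [chartCoef_apply]
  exact contDiffOn_const.mul ((h3 v w).add (h3 w v))

/-- A chart of a submanifold, as the restriction of a map on the ambient space, gives a metric
chart for every Riemannian metric. -/
theorem exists_metricChart {N S W : Set F} {T : F → Set F} {g : F → LinearMap.BilinForm ℝ F}
    (hg : ∀ A B, ContDiffOn ℝ ∞ (fun V => g V A B) N)
    (hpos : ∀ V ∈ N, ∀ A ∈ T V, A ≠ 0 → 0 < g V A A) {p : F} {ε : ℝ} (hε : 0 < ε)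
    (hSN : ∀ V ∈ S, ‖V - p‖ < ε → V ∈ N) (hNS : N ⊆ S) {ι : E →ₗ[ℝ] F} {π : F →ₗ[ℝ] E}
    (hπι : ∀ x, π (ι x) = x) {ψ χ : F → F} (hψ : ∀ x, ContDiffAt ℝ ∞ (fun x => ψ (ι x)) x)
    (hψS : ∀ x, ψ (ι x) ∈ S) (hψ0 : ψ 0 = p) (hW : IsOpen W) (hχ : ContDiffOn ℝ ∞ χ W)
    (hψW : ∀ x, ψ (ι x) ∈ W) (hχψ : ∀ x, χ (ψ (ι x)) = ι x)
    (hψχ : ∀ V ∈ S, V ∈ W → ∃ x, ι x = χ V ∧ ψ (χ V) = V)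
    (hT : ∀ x v, fderiv ℝ (fun x => ψ (ι x)) x v ∈ T (ψ (ι x))) :
    ∃ c : MetricChart E N (fun V U => g V U U) p, c.toFun = fun x => ψ (ι x) := by
  have hΦ0 : ψ (ι 0) = p := by rw [map_zero, hψ0]
  obtain ⟨r, hr, hrN⟩ : ∃ r > 0, ∀ x ∈ Metric.ball (0 : E) r, ψ (ι x) ∈ N := by
    have h1 : ∀ᶠ x in 𝓝 (0 : E), ‖ψ (ι x) - p‖ < ε := by
      have h2 : ContinuousAt (fun x => ‖ψ (ι x) - p‖) 0 :=
        ((hψ 0).continuousAt.sub continuousAt_const).norm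
      refine h2.eventually (gt_mem_nhds ?_)
      beta_reduce
      rw [hΦ0, sub_self, norm_zero]
      exact hε
    obtain ⟨r, hr, h⟩ := Metric.eventually_nhds_iff_ball.1 h1
    exact ⟨r, hr, fun x hx => hSN _ (hψS x) (h x hx)⟩
  have hΦs : ContDiff ℝ ∞ (fun x => ψ (ι x)) := contDiff_iff_contDiffAt.2 hψ
  have hπs : ContDiff ℝ ∞ π := (LinearMap.toContinuousLinearMap π).contDiff
  have hinv : ContDiffOn ℝ ∞ (fun V => π (χ V)) W := hπs.comp_contDiffOn hχ
  refine ⟨{ toFun := fun x => ψ (ι x), inv := fun V => π (χ V),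
            coef := chartCoef g fun x => ψ (ι x), radius := r, source := W, radius_pos := hr
            isOpen_source := hW
            continuousOn_quad := ?_
            contDiffOn_toFun := hΦs.contDiffOn
            contDiffOn_inv := hinv
            contDiffOn_coef := contDiffOn_chartCoef hg Metric.isOpen_ball hΦs.contDiffOn hrN
            -- Symmetrising changes neither the quadratic form nor the energy, and makes symmetry of
            -- the coefficients automatic.
            symm := fun x _ v w => by rw [chartCoef_apply, chartCoef_apply, add_comm]
            pos := ?_
            map_zero := hΦ0
            map_mem := hrN
            map_mem_source := fun x _ => hψW x
            left_inv := fun x _ => by rw [hχψ, hπι]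
            right_inv := fun V hV hVW _ => ?_
            coef_self := fun x _ v => by rw [chartCoef_apply]; ring }, rfl⟩
  · have h1 : ContinuousOn (fun y : F × F => continuousBilin (g y.1)) (N ×ˢ univ) :=
      (contDiffOn_continuousBilin hg).continuousOn.comp continuousOn_fst fun y hy => hy.1
    exact (h1.clm_apply continuousOn_snd).clm_apply continuousOn_snd
  · intro x hx v hv
    have h1 : 0 < g (ψ (ι x)) (fderiv ℝ (fun x => ψ (ι x)) x v)
        (fderiv ℝ (fun x => ψ (ι x)) x v) := by
      refine hpos _ (hrN x hx) _ (hT x v) fun h0 => hv ?_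
      -- The differential of the chart is injective since the chart has a differentiable left
      -- inverse; so a nonzero `v` gives a nonzero tangent vector.
      have h2 : HasFDerivAt (fun x => π (χ (ψ (ι x)))) _ x :=
        HasFDerivAt.comp (g := fun V => π (χ V)) (f := fun x => ψ (ι x)) x
          ((hinv.contDiffAt (hW.mem_nhds (hψW x))).differentiableAt (by simp)).hasFDerivAt
          ((hψ x).differentiableAt (by simp)).hasFDerivAt
      have h3 : (fun x => π (χ (ψ (ι x)))) = id := funext fun y => by rw [hχψ, hπι]; rfl
      rw [h3] at h2
      have h4 := congrArg (fun L : E →L[ℝ] E => L v) (h2.unique (hasFDerivAt_id x))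
      simp only [ContinuousLinearMap.comp_apply, h0, map_zero] at h4
      exact h4.symm
    rw [chartCoef_apply]
    linarith
  · obtain ⟨x, hx, hV⟩ := hψχ V (hNS hV) hVW
    rw [← hx, hπι, hx, hV]

/-- A parametrization of a subspace with a linear retraction. -/
theorem exists_parametrization (S : Submodule ℝ F) :
    ∃ (ι : EuclideanSpace ℝ (Fin (Module.finrank ℝ S)) →ₗ[ℝ] F)
      (π : F →ₗ[ℝ] EuclideanSpace ℝ (Fin (Module.finrank ℝ S))),
      (∀ x, π (ι x) = x) ∧ ∀ A, A ∈ S ↔ ∃ x, ι x = A := by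
  let e : EuclideanSpace ℝ (Fin (Module.finrank ℝ S)) ≃ₗ[ℝ] S :=
    LinearEquiv.ofFinrankEq _ _ (by simp)
  have hinj : LinearMap.ker (S.subtype ∘ₗ e.toLinearMap) = ⊥ := by
    rw [LinearMap.ker_eq_bot]
    exact S.injective_subtype.comp e.injective
  obtain ⟨π, hπ⟩ := LinearMap.exists_leftInverse_of_injective _ hinj
  refine ⟨S.subtype ∘ₗ e.toLinearMap, π, fun x => LinearMap.congr_fun hπ x, fun A => ⟨fun hA =>
    ⟨e.symm ⟨A, hA⟩, by simp⟩, ?_⟩⟩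
  rintro ⟨x, rfl⟩
  exact (e x).2

end BuildChart

/-! ### Inversion of the Cayley chart. -/

section StiefelChart

variable {d k : ℕ} {V₀ : Op d k}

/-- The inverse of the chart of the manifold of isometries. -/
def chartInv (V₀ V : Op d k) : Op d k :=
  (-2 * Complex.I) • ((V - V₀) * (V₀ᴴ * V + 1)⁻¹ - (2⁻¹ : ℂ) •
    (V₀ * (V₀ᴴ * ((V - V₀) * (V₀ᴴ * V + 1)⁻¹) + ((V - V₀) * (V₀ᴴ * V + 1)⁻¹)ᴴ * V₀)))

theorem half_chartGenerator_eq (V L : Op d k) :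
    (2⁻¹ : ℂ) • chartGenerator V L = ((Complex.I / 2) • L) * Vᴴ - V * ((Complex.I / 2) • L)ᴴ -
      V * (Vᴴ * ((Complex.I / 2) • L)) * Vᴴ := by
  have h : star (Complex.I / 2) = -(Complex.I / 2) := by
    simp [neg_div]
  have h2 : (2⁻¹ : ℂ) * Complex.I = Complex.I / 2 := by ring
  rw [chartGenerator, Matrix.conjTranspose_smul, h, smul_smul, h2]
  simp only [Matrix.smul_mul, Matrix.mul_smul, smul_sub, smul_add, neg_smul, Matrix.mul_neg,
    sub_neg_eq_add]

/-- Replaces the inverse in the Cayley transform by an equation linear in `S`, which is easier both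
to solve and to verify. -/
theorem eq_cayley_mul_of_mul_add_eq {n m : Type*} [Fintype n] [DecidableEq n]
    {S : Matrix n n ℂ} (hS : Sᴴ = -S) {V V₀ : Matrix n m ℂ} :
    S * (V + V₀) = V - V₀ ↔ cayley S * V₀ = V := by
  have hu := isUnit_one_sub_of_conjTranspose_eq_neg hS
  have hdet := (Matrix.isUnit_iff_isUnit_det _).1 hu
  have hc : (1 - S) * cayley S = 1 + S := by
    have h1 : (1 - S) * (1 + S) = (1 + S) * (1 - S) := by noncomm_ring
    rw [cayley, ← Matrix.mul_assoc, h1, Matrix.mul_assoc, Matrix.mul_nonsing_inv _ hdet,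
      Matrix.mul_one]
  have h2 : S * (V + V₀) = V - V₀ ↔ (1 - S) * V = (1 + S) * V₀ := by
    rw [Matrix.mul_add, Matrix.sub_mul, Matrix.add_mul, Matrix.one_mul, Matrix.one_mul,
      ← sub_eq_zero (a := S * V + S * V₀), ← sub_eq_zero (a := V - S * V), ← neg_eq_zero]
    have : -(S * V + S * V₀ - (V - V₀)) = V - S * V - (V₀ + S * V₀) := by abel
    rw [this]
  rw [h2, ← hc, Matrix.mul_assoc]
  constructor
  · intro h
    have h3 := congrArg ((1 - S)⁻¹ * ·) h
    simp only [← Matrix.mul_assoc, Matrix.nonsing_inv_mul _ hdet, Matrix.one_mul] at h3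
    exact h3.symm
  · intro h
    rw [h]

/-- The chart in terms of its inverse. -/
theorem exists_chart_factorization (hV₀ : V₀ᴴ * V₀ = 1) {L : Op d k} (hL : Lᴴ * V₀ = V₀ᴴ * L) :
    ∃ y : Matrix (Fin d) (Fin d) ℂ, yᴴ = y ∧ IsUnit (V₀ᴴ * chart V₀ L + 1) ∧
      (chart V₀ L - V₀) * (V₀ᴴ * chart V₀ L + 1)⁻¹ = (Complex.I / 2) • L + V₀ * y := by
  have hskew := conjTranspose_half_chartGenerator hL
  have hSU := (eq_cayley_mul_of_mul_add_eq hskew (V := chart V₀ L) (V₀ := V₀)).2 rfl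
  rw [half_chartGenerator_eq] at hSU
  set D : Op d k := (Complex.I / 2) • L with hD
  set V := chart V₀ L with hV
  set a := V₀ᴴ * D with ha
  have hstar : star (Complex.I / 2) = -(Complex.I / 2) := by simp [neg_div]
  have hDV : Dᴴ * V₀ = -a := by
    rw [ha, hD, Matrix.conjTranspose_smul, hstar, Matrix.smul_mul, Matrix.mul_smul, hL, neg_smul]
  have haH : aᴴ = -a := by
    rw [ha, Matrix.conjTranspose_mul, Matrix.conjTranspose_conjTranspose, hDV]
  set Q := V₀ᴴ * V + 1 with hQ
  clear_value Q a
  have hVU : V₀ᴴ * (V + V₀) = Q := by rw [Matrix.mul_add, hV₀, ← hQ]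
  have h1 : D * Q - V₀ * (Dᴴ * (V + V₀)) - V₀ * (a * Q) = V - V₀ := by
    rw [← hSU, Matrix.sub_mul, Matrix.sub_mul, Matrix.mul_assoc D, hVU, Matrix.mul_assoc V₀,
      Matrix.mul_assoc (V₀ * a), hVU, Matrix.mul_assoc V₀]
  -- Multiplication by `V₀ᴴ` makes the two terms containing `a` cancel. Substituted back, this
  -- expresses `V + V₀` through `Q` and exhibits `N₂ / 2` as a left inverse of `Q`.
  have h2 : Dᴴ * (V + V₀) = 1 + 1 - Q := by
    have h3 := congrArg (V₀ᴴ * ·) h1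
    simp only [Matrix.mul_sub, ← Matrix.mul_assoc, hV₀, Matrix.one_mul] at h3
    rw [← ha, sub_right_comm, sub_self, zero_sub] at h3
    rw [hQ, ← neg_inj, h3]
    abel
  have hU : V + V₀ = (D + V₀ * (1 - a)) * Q := by
    have h3 : V + V₀ = (V - V₀) + (V₀ + V₀) := by abel
    rw [h3, ← h1, h2]
    simp only [Matrix.add_mul, Matrix.mul_assoc, Matrix.sub_mul, Matrix.mul_sub, Matrix.mul_add,
      Matrix.mul_one]
    abel
  set N₂ : Matrix (Fin d) (Fin d) ℂ := 1 - a + a * a + Dᴴ * D with hN₂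
  have hNQ : ((2⁻¹ : ℂ) • N₂) * Q = 1 := by
    have h3 : N₂ * Q = 1 + 1 := by
      rw [hU, ← Matrix.mul_assoc, Matrix.mul_add, ← Matrix.mul_assoc Dᴴ V₀, hDV] at h2
      have h4 := eq_sub_iff_add_eq.1 h2
      rw [← h4, hN₂]
      noncomm_ring
    rw [Matrix.smul_mul, h3, ← two_smul ℂ (1 : Matrix (Fin d) (Fin d) ℂ), smul_smul]
    norm_num
  have hQu : IsUnit Q := by
    rw [Matrix.isUnit_iff_isUnit_det]
    exact Matrix.isUnit_det_of_left_inverse hNQ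
  refine ⟨-(a * a + Dᴴ * D), ?_, hQu, ?_⟩
  · rw [Matrix.conjTranspose_neg, Matrix.conjTranspose_add, Matrix.conjTranspose_mul,
      Matrix.conjTranspose_mul, Matrix.conjTranspose_conjTranspose, haH, neg_mul_neg]
  · have h3 : V - V₀ = (V + V₀) - (V₀ + V₀) := by abel
    have h4 : (V₀ + V₀) * ((2⁻¹ : ℂ) • N₂) = V₀ * N₂ := by
      rw [← two_smul ℂ V₀, Matrix.smul_mul, Matrix.mul_smul, smul_smul]
      norm_num
    rw [h3, Matrix.sub_mul, hU, Matrix.mul_assoc, Matrix.mul_nonsing_inv _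
      ((Matrix.isUnit_iff_isUnit_det _).1 hQu), Matrix.mul_one, Matrix.inv_eq_left_inv hNQ, h4,
      hN₂]
    simp only [Matrix.mul_sub, Matrix.mul_add, Matrix.mul_neg, Matrix.mul_one]
    abel

/-- In the factorization `(i / 2) L + V₀ y` the matrix `y` is Hermitian while `V₀ᴴ (i L)` is
skew-Hermitian. The Hermitian part of `V₀ᴴ` times the sum is therefore `y`, which `chartInv`
subtracts. -/
theorem chartInv_chart (hV₀ : V₀ᴴ * V₀ = 1) {L : Op d k} (hL : Lᴴ * V₀ = V₀ᴴ * L) :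
    chartInv V₀ (chart V₀ L) = L := by
  obtain ⟨y, hy, -, hZ⟩ := exists_chart_factorization hV₀ hL
  rw [chartInv, hZ]
  have hstar : star (Complex.I / 2) = -(Complex.I / 2) := by simp [neg_div]
  have h1 : V₀ᴴ * ((Complex.I / 2) • L + V₀ * y) + ((Complex.I / 2) • L + V₀ * y)ᴴ * V₀ =
      y + y := by
    rw [Matrix.conjTranspose_add, Matrix.conjTranspose_mul, Matrix.conjTranspose_smul, hstar, hy,
      Matrix.mul_add, Matrix.add_mul, ← Matrix.mul_assoc V₀ᴴ V₀, hV₀, Matrix.mul_assoc y, hV₀,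
      Matrix.one_mul, Matrix.mul_one, Matrix.smul_mul, Matrix.mul_smul, hL, neg_smul]
    abel
  rw [h1, ← two_smul ℂ y, Matrix.mul_smul, smul_smul]
  have h2 : (2⁻¹ : ℂ) * 2 = 1 := by norm_num
  have h3 : -2 * Complex.I * (Complex.I / 2) = 1 := by linear_combination -Complex.I_mul_I
  rw [h2, one_smul, add_sub_cancel_right, smul_smul, h3, one_smul]

/-- Removing the Hermitian part makes the result tangent at `V₀`. The Cayley equation then reduces
to `Zᴴ (V + V₀) + a Q = 0`, which is verified after multiplication by the invertible `Qᴴ`, where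
both isometry relations apply. -/
theorem chart_chartInv (hV₀ : V₀ᴴ * V₀ = 1) {V : Op d k} (hV : Vᴴ * V = 1)
    (hQ : IsUnit (V₀ᴴ * V + 1)) :
    (chartInv V₀ V)ᴴ * V₀ = V₀ᴴ * chartInv V₀ V ∧ chart V₀ (chartInv V₀ V) = V := by
  obtain ⟨Q, hQdef⟩ : ∃ Q, Q = V₀ᴴ * V + 1 := ⟨_, rfl⟩
  obtain ⟨Z, hZdef⟩ : ∃ Z, Z = (V - V₀) * Q⁻¹ := ⟨_, rfl⟩
  rw [← hQdef] at hQ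
  have hQdet := (Matrix.isUnit_iff_isUnit_det _).1 hQ
  have hZQ : Z * Q = V - V₀ := by
    rw [hZdef, Matrix.mul_assoc, Matrix.nonsing_inv_mul _ hQdet, Matrix.mul_one]
  obtain ⟨h, hh⟩ : ∃ h : Matrix (Fin d) (Fin d) ℂ, h = (2⁻¹ : ℂ) • (V₀ᴴ * Z + Zᴴ * V₀) := ⟨_, rfl⟩
  obtain ⟨D, hD⟩ : ∃ D : Op d k, D = Z - V₀ * h := ⟨_, rfl⟩
  obtain ⟨L, hL⟩ : ∃ L, L = chartInv V₀ V := ⟨_, rfl⟩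
  have hLD : L = (-2 * Complex.I) • D := by
    rw [hL, chartInv, ← hQdef, ← hZdef, hD, hh, Matrix.mul_smul]
  have hDL : (Complex.I / 2) • L = D := by
    rw [hLD, smul_smul]
    have : Complex.I / 2 * (-2 * Complex.I) = 1 := by linear_combination -Complex.I_mul_I
    rw [this, one_smul]
  have hhH : hᴴ = h := by
    rw [hh, Matrix.conjTranspose_smul, Matrix.conjTranspose_add, Matrix.conjTranspose_mul,
      Matrix.conjTranspose_mul, Matrix.conjTranspose_conjTranspose,
      Matrix.conjTranspose_conjTranspose, add_comm]
    congr 1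
    simp
  have hhh : h + h = V₀ᴴ * Z + Zᴴ * V₀ := by
    rw [hh, ← two_smul ℂ, smul_smul]
    norm_num
  obtain ⟨a, ha⟩ : ∃ a, a = V₀ᴴ * D := ⟨_, rfl⟩
  have ha' : a = V₀ᴴ * Z - h := by
    rw [ha, hD, Matrix.mul_sub, ← Matrix.mul_assoc, hV₀, Matrix.one_mul]
  have hDV : Dᴴ * V₀ = -a := by
    rw [hD, Matrix.conjTranspose_sub, Matrix.conjTranspose_mul, hhH, Matrix.sub_mul,
      Matrix.mul_assoc, hV₀, Matrix.mul_one, ha', ← sub_eq_zero]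
    rw [← sub_eq_zero] at hhh
    rw [← neg_eq_zero, ← hhh]
    abel
  have hLt : Lᴴ * V₀ = V₀ᴴ * L := by
    have hstar : star (-2 * Complex.I) = 2 * Complex.I := by simp
    rw [hLD, Matrix.conjTranspose_smul, hstar, Matrix.smul_mul, hDV, Matrix.mul_smul, ← ha,
      smul_neg, ← neg_smul, neg_mul]
  rw [← hL]
  refine ⟨hLt, ?_⟩
  rw [chart]
  refine (eq_cayley_mul_of_mul_add_eq (conjTranspose_half_chartGenerator hLt)).1 ?_
  rw [half_chartGenerator_eq, hDL, ← ha]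
  have hVU : V₀ᴴ * (V + V₀) = Q := by rw [Matrix.mul_add, hV₀, hQdef]
  have hQH : Qᴴ = Vᴴ * V₀ + 1 := by
    rw [hQdef, Matrix.conjTranspose_add, Matrix.conjTranspose_mul,
      Matrix.conjTranspose_conjTranspose, Matrix.conjTranspose_one]
  have hQHu : IsUnit Qᴴ := by
    rw [Matrix.isUnit_iff_isUnit_det, Matrix.det_conjTranspose]
    exact hQdet.star
  have hZQH : Qᴴ * Zᴴ = Vᴴ - V₀ᴴ := by
    rw [← Matrix.conjTranspose_mul, hZQ, Matrix.conjTranspose_sub]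
  have key : Zᴴ * (V + V₀) + a * Q = 0 := by
    refine hQHu.mul_left_cancel ?_
    have h1 : Qᴴ * (Zᴴ * (V + V₀)) = Vᴴ * V₀ - V₀ᴴ * V := by
      rw [← Matrix.mul_assoc, hZQH, Matrix.mul_add, Matrix.sub_mul, Matrix.sub_mul, hV, hV₀]
      abel
    have h2 : Qᴴ * ((a + a) * Q) = (V₀ᴴ * V - Vᴴ * V₀) + (V₀ᴴ * V - Vᴴ * V₀) := by
      have e1 : a + a = V₀ᴴ * Z - Zᴴ * V₀ := by
        rw [← sub_eq_zero] at hhh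
        rw [ha', ← sub_eq_zero, ← neg_eq_zero, ← hhh]
        abel
      rw [e1, Matrix.sub_mul, Matrix.mul_sub, Matrix.mul_assoc V₀ᴴ, hZQ, Matrix.mul_assoc Zᴴ,
        ← Matrix.mul_assoc Qᴴ Zᴴ, hZQH, hQH, hQdef]
      simp only [Matrix.mul_sub, Matrix.sub_mul, Matrix.add_mul, Matrix.mul_add, Matrix.one_mul,
        Matrix.mul_one, hV₀]
      have e2 : Vᴴ * V₀ * (V₀ᴴ * V) = Vᴴ * (V₀ * (V₀ᴴ * V)) := Matrix.mul_assoc _ _ _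
      have e3 : V₀ᴴ * (V₀ * (V₀ᴴ * V)) = V₀ᴴ * V := by rw [← Matrix.mul_assoc, hV₀, Matrix.one_mul]
      rw [e2, e3]
      abel
    have h3 : Qᴴ * (a * Q) = V₀ᴴ * V - Vᴴ * V₀ := by
      rw [Matrix.add_mul, Matrix.mul_add, ← two_smul ℂ (Qᴴ * (a * Q)),
        ← two_smul ℂ (V₀ᴴ * V - Vᴴ * V₀)] at h2
      exact smul_right_injective _ (two_ne_zero (α := ℂ)) h2
    rw [Matrix.mul_add, h1, h3, Matrix.mul_zero]
    abel
  have hDU : Dᴴ * (V + V₀) = Zᴴ * (V + V₀) - h * Q := by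
    rw [hD, Matrix.conjTranspose_sub, Matrix.conjTranspose_mul, hhH, Matrix.sub_mul,
      Matrix.mul_assoc h, hVU]
  have hDQ : D * Q = (V - V₀) - V₀ * (h * Q) := by
    rw [hD, Matrix.sub_mul, hZQ, Matrix.mul_assoc]
  rw [Matrix.sub_mul, Matrix.sub_mul, Matrix.mul_assoc D, hVU, Matrix.mul_assoc V₀ Dᴴ, hDU,
    Matrix.mul_assoc (V₀ * a), hVU, Matrix.mul_assoc V₀ a, hDQ, Matrix.mul_sub,
    eq_neg_of_add_eq_zero_left key, Matrix.mul_neg]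
  abel

end StiefelChart


/-! ### The Riemannian exponential map to first order. -/

section RiemannianExp

variable {d k : ℕ}

/-- The tangent space as a real subspace. -/
def tangentSubmodule (V₀ : irreducibleIsometries d k) : Submodule ℝ (Op d k) where
  carrier := tangentSpace V₀
  zero_mem' := by simp [tangentSpace]
  add_mem' := by
    intro A B hA hB
    simp only [tangentSpace, mem_ofPred_eq, Matrix.conjTranspose_add, Matrix.add_mul,
      Matrix.mul_add] at hA hB ⊢
    rw [add_sub_add_comm, hA, hB, add_zero]
  smul_mem' := by
    intro c A hA
    simp only [tangentSpace, mem_ofPred_eq, Matrix.conjTranspose_smul, Matrix.smul_mul,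
      Matrix.mul_smul, star_trivial] at hA ⊢
    rw [← smul_sub, hA, smul_zero]

theorem mem_tangentSubmodule {V₀ : irreducibleIsometries d k} {A : Op d k} :
    A ∈ tangentSubmodule V₀ ↔ A ∈ tangentSpace V₀ := Iff.rfl

theorem contDiffAt_chartInv {V₀ V : Op d k} (hV : IsUnit (V₀ᴴ * V + 1)) :
    ContDiffAt ℝ ∞ (chartInv V₀) V := by
  have hid : ContDiffAt ℝ ∞ (fun V : Op d k => V) V := contDiffAt_id
  have h1 : ContDiffAt ℝ ∞ (fun V : Op d k => (V - V₀) * (V₀ᴴ * V + 1)⁻¹) V :=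
    (hid.sub contDiffAt_const).matrix_mul
      ((((contDiffAt_const (c := V₀ᴴ)).matrix_mul hid).add contDiffAt_const).matrix_inv hV)
  have h2 : ContDiffAt ℝ ∞ (fun V : Op d k => (2⁻¹ : ℂ) •
    (V₀ * (V₀ᴴ * ((V - V₀) * (V₀ᴴ * V + 1)⁻¹) + ((V - V₀) * (V₀ᴴ * V + 1)⁻¹)ᴴ * V₀))) V :=
    ContDiffAt.const_smul _ ((contDiffAt_const (c := V₀)).matrix_mul
      (((contDiffAt_const (c := V₀ᴴ)).matrix_mul h1).add
        (h1.matrix_conjTranspose.matrix_mul contDiffAt_const)))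
  exact (h1.sub h2).const_smul _

/-- Velocities of curves of isometries are tangent vectors. -/
theorem conjTranspose_mul_add_of_hasDerivAt {γ : ℝ → Op d k} {U : Op d k} {t : ℝ}
    (hγ : HasDerivAt γ U t) (h : ∀ s, (γ s)ᴴ * γ s = 1) : Uᴴ * γ t + (γ t)ᴴ * U = 0 := by
  have hent : ∀ a i, HasDerivAt (fun s => γ s a i) (U a i) t := fun a i =>
    hasDerivAt_pi.1 (hasDerivAt_pi.1 hγ a) i
  ext i j
  have h1 : HasDerivAt (fun s => ∑ a, star (γ s a i) * γ s a j)
      (∑ a, (star (U a i) * γ t a j + star (γ t a i) * U a j)) t :=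
    HasDerivAt.fun_sum fun a _ => (hent a i).star.mul (hent a j)
  have h2 : (fun s => ∑ a, star (γ s a i) * γ s a j) = fun _ => (1 : Matrix _ _ ℂ) i j :=
    funext fun s => by rw [← h s]; rfl
  rw [h2] at h1
  have h3 := h1.unique (hasDerivAt_const t _)
  rw [Finset.sum_add_distrib] at h3
  exact h3

theorem conjTranspose_fderiv_mul_add {E : Type*} [NormedAddCommGroup E] [NormedSpace ℝ E]
    {f : E → Op d k} {x : E} (hf : DifferentiableAt ℝ f x) (h : ∀ x, (f x)ᴴ * f x = 1) (v : E) :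
    (fderiv ℝ f x v)ᴴ * f x + (f x)ᴴ * fderiv ℝ f x v = 0 := by
  have h1 : HasDerivAt (fun s : ℝ => x + s • v) v 0 := by
    simpa using ((hasDerivAt_id (0 : ℝ)).smul_const v).const_add x
  have h0 : x + (0 : ℝ) • v = x := by rw [zero_smul, add_zero]
  have h2 : HasFDerivAt f (fderiv ℝ f x) (x + (0 : ℝ) • v) := by
    rw [h0]
    exact hf.hasFDerivAt
  have h3 : HasDerivAt (fun s : ℝ => f (x + s • v)) (fderiv ℝ f x v) 0 :=
    h2.comp_hasDerivAt (0 : ℝ) h1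
  have h4 := conjTranspose_mul_add_of_hasDerivAt h3 fun s => h _
  rwa [h0] at h4

/-- Multiplication by `-i`, which takes velocities to tangent vectors. -/
def velocityMap (d k : ℕ) : Op d k →ₗ[ℝ] Op d k :=
  LinearMap.restrictScalars ℝ ((-Complex.I) • (LinearMap.id : Op d k →ₗ[ℂ] Op d k))

theorem velocityMap_apply (A : Op d k) : velocityMap d k A = (-Complex.I) • A := rfl

/-- The Riemannian metric as a bilinear form on velocities. -/
def velocityForm (ν : GaugeMetric d k) (V : Op d k) : LinearMap.BilinForm ℝ (Op d k) :=
  (ν.form V).compl₁₂ (velocityMap d k) (velocityMap d k)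

theorem isGeodesic_iff (ν : GaugeMetric d k) (γ : ℝ → Op d k) :
    IsGeodesic ν γ ↔ IsCriticalCurve (irreducibleIsometries d k)
      (fun V U => velocityForm ν V U U) γ :=
  ⟨fun h => ⟨h.smooth, h.mem, h.critical⟩, fun h => ⟨h.smooth, h.mem, h.critical⟩⟩

theorem velocityForm_pos (ν : GaugeMetric d k) {V : Op d k} (hV : V ∈ irreducibleIsometries d k)
    {A : Op d k} (hA : Aᴴ * V + Vᴴ * A = 0) (hne : A ≠ 0) : 0 < velocityForm ν V A A := by
  have h1 : velocityMap d k A ∈ tangentSpace ⟨V, hV⟩ := by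
    change ((-Complex.I) • A)ᴴ * V - Vᴴ * ((-Complex.I) • A) = 0
    have hstar : star (-Complex.I) = Complex.I := by simp
    rw [Matrix.conjTranspose_smul, hstar, Matrix.smul_mul, Matrix.mul_smul, neg_smul,
      sub_neg_eq_add, ← smul_add, hA, smul_zero]
  have h2 : velocityMap d k A ≠ 0 := by
    rw [velocityMap_apply]
    simpa using hne
  exact ν.pos ⟨V, hV⟩ _ h1 h2

/-- The Cayley chart, restricted to real coordinates of the tangent space, is a metric chart. A
small ball stays irreducible because irreducibility is open among isometries, and the differential
at the origin is multiplication by `i`. -/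
theorem exists_metricChart_isometry (ν : GaugeMetric d k) (V₀ : irreducibleIsometries d k) :
    ∃ (m : ℕ) (ι : EuclideanSpace ℝ (Fin m) →ₗ[ℝ] Op d k)
      (π : Op d k →ₗ[ℝ] EuclideanSpace ℝ (Fin m))
      (c : MetricChart (EuclideanSpace ℝ (Fin m)) (irreducibleIsometries d k)
        (fun V U => velocityForm ν V U U) V₀.1),
      (∀ x, π (ι x) = x) ∧ (∀ A, A ∈ tangentSpace V₀ ↔ ∃ x, ι x = A) ∧
        ∀ x, fderiv ℝ c.toFun 0 x = Complex.I • ι x := by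
  obtain ⟨ι, π, hπι, hι⟩ := exists_parametrization (tangentSubmodule V₀)
  simp only [mem_tangentSubmodule] at hι
  have hV₀ := V₀.2.1
  have hιt : ∀ x, (ι x)ᴴ * V₀.1 = V₀.1ᴴ * ι x := fun x => sub_eq_zero.1 ((hι (ι x)).2 ⟨x, rfl⟩)
  obtain ⟨ε, hε, hopen⟩ := exists_mem_irreducibleIsometries V₀
  have hιs : ∀ x, ContDiffAt ℝ ∞ ι x := fun x =>
    (LinearMap.toContinuousLinearMap ι).contDiff.contDiffAt
  have hψ : ∀ x, ContDiffAt ℝ ∞ (fun x => chart V₀.1 (ι x)) x := fun x =>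
    contDiffAt_chart (hιs x) (hιt x)
  have hψS : ∀ x, (chart V₀.1 (ι x))ᴴ * chart V₀.1 (ι x) = 1 := fun x =>
    conjTranspose_chart_mul_chart hV₀ (hιt x)
  have hW : IsOpen {V : Op d k | IsUnit (V₀.1ᴴ * V + 1)} := by
    have h1 : Continuous fun V : Op d k => (V₀.1ᴴ * V + 1).det :=
      ((continuous_const.matrix_mul continuous_id).add continuous_const).matrix_det
    have h2 : {V : Op d k | IsUnit (V₀.1ᴴ * V + 1)} =
        (fun V : Op d k => (V₀.1ᴴ * V + 1).det) ⁻¹' {0}ᶜ := by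
      ext V
      simp [Matrix.isUnit_iff_isUnit_det]
    rw [h2]
    exact isOpen_compl_singleton.preimage h1
  obtain ⟨C, hC0, hC⟩ := norm_chart_sub_le hV₀
  have hchart0 : chart V₀.1 0 = V₀.1 := by
    have := hC 0 (by simp)
    simpa [sub_eq_zero] using this
  have hψχ : ∀ V ∈ {V : Op d k | Vᴴ * V = 1}, V ∈ {V : Op d k | IsUnit (V₀.1ᴴ * V + 1)} →
      ∃ x, ι x = chartInv V₀.1 V ∧ chart V₀.1 (chartInv V₀.1 V) = V := fun V hV hVW => by
    obtain ⟨h1, h2⟩ := chart_chartInv hV₀ hV hVW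
    obtain ⟨x, hx⟩ := (hι (chartInv V₀.1 V)).1 (sub_eq_zero.2 h1)
    exact ⟨x, hx, h2⟩
  have hT : ∀ x v, fderiv ℝ (fun x => chart V₀.1 (ι x)) x v ∈
      {U : Op d k | Uᴴ * chart V₀.1 (ι x) + (chart V₀.1 (ι x))ᴴ * U = 0} := fun x v => by
    exact conjTranspose_fderiv_mul_add ((hψ x).differentiableAt (by simp)) hψS v
  have hχ : ContDiffOn ℝ ∞ (chartInv V₀.1) {V : Op d k | IsUnit (V₀.1ᴴ * V + 1)} := fun V hV =>
    (contDiffAt_chartInv hV).contDiffWithinAt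
  have hψW : ∀ x, chart V₀.1 (ι x) ∈ {V : Op d k | IsUnit (V₀.1ᴴ * V + 1)} := fun x =>
    (exists_chart_factorization hV₀ (hιt x)).choose_spec.2.1
  obtain ⟨c, hc⟩ := exists_metricChart (F := Op d k) (N := irreducibleIsometries d k)
    (S := {V | Vᴴ * V = 1}) (W := {V : Op d k | IsUnit (V₀.1ᴴ * V + 1)})
    (T := fun V => {U | Uᴴ * V + Vᴴ * U = 0}) (g := velocityForm ν)
    (fun A B => ν.smooth _ _) (fun V hV A hA hne => velocityForm_pos ν hV hA hne) (p := V₀.1) hε hopen (fun V hV => hV.1) (ι := ι) (π := π) hπι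
    (ψ := chart V₀.1) (χ := chartInv V₀.1) hψ hψS hchart0 hW hχ hψW
    (fun x => chartInv_chart hV₀ (hιt x)) hψχ hT
  refine ⟨Module.finrank ℝ (tangentSubmodule V₀), ι, π, c, hπι, hι, ?_⟩
  intro x
  obtain ⟨K, hK0, hK⟩ := LinearMap.exists_norm_le_of_finiteDimensional (𝕜 := ℝ) ι
  obtain ⟨f', hf'⟩ : ∃ f' : EuclideanSpace ℝ (Fin _) →ₗ[ℝ] Op d k,
      ∀ x, f' x = Complex.I • ι x :=
    ⟨(LinearMap.restrictScalars ℝ (Complex.I • (LinearMap.id : Op d k →ₗ[ℂ] Op d k))) ∘ₗ ι,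
      fun x => rfl⟩
  have hbound : ∀ x, ‖chart V₀.1 (ι x) - chart V₀.1 (ι 0) - f' x‖ ≤ C * K ^ 2 * ‖x‖ ^ 2 := by
    intro x
    rw [map_zero, hchart0, hf', mul_assoc, ← mul_pow]
    refine (hC (ι x) (hιt x)).trans ?_
    gcongr
    exact hK x
  rw [hc]
  have hfd := fderiv_zero_apply_of_norm_sub_le (f := fun x => chart V₀.1 (ι x)) f' hbound x
  rw [hf'] at hfd
  exact hfd

/-- The exponential map to first order. -/
theorem exists_norm_riemannianExp_sub_le (ν : GaugeMetric d k) (V₀ : irreducibleIsometries d k) :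
    ∃ M ≥ 0, ∃ r > 0, ∀ A ∈ tangentSpace V₀, ∀ t : ℝ, 0 < t → t ≤ r → ‖A‖ ≤ t →
      (riemannianExp ν V₀ A)ᴴ * riemannianExp ν V₀ A = 1 ∧
      ‖riemannianExp ν V₀ A - V₀.1 - Complex.I • A‖ ≤ M * t ^ 2 := by
  obtain ⟨m, ι, π, c, hπι, hι, hd⟩ := exists_metricChart_isometry ν V₀
  obtain ⟨r₁, hr₁, hex⟩ := c.exists_isCriticalCurve
  obtain ⟨M, hM0, r₂, hr₂, hest⟩ := c.exists_norm_sub_le_of_isCriticalCurve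
  obtain ⟨K, hK0, hK⟩ := LinearMap.exists_norm_le_of_finiteDimensional (𝕜 := ℝ) π
  refine ⟨M, hM0, min (r₁ / (K + 1)) r₂, lt_min (by positivity) hr₂, fun A hA t ht htr hAt => ?_⟩
  have hnI : ‖Complex.I • A‖ = ‖A‖ := by rw [norm_smul, Complex.norm_I, one_mul]
  have h : ∃ γ : ℝ → Op d k, IsGeodesic ν γ ∧ γ 0 = V₀.1 ∧
      derivWithin γ (Icc 0 1) 0 = Complex.I • A := by
    obtain ⟨x, hx⟩ := (hι A).1 hA
    obtain ⟨γ, hγ, hγ0, hγd⟩ := hex x (by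
      rw [← hπι x, hx]
      refine (hK A).trans ?_
      have h1 := htr.trans (min_le_left _ _)
      rw [le_div_iff₀ (by positivity)] at h1
      nlinarith [norm_nonneg A])
    exact ⟨γ, (isGeodesic_iff ν γ).2 hγ, hγ0, hγd.trans ((hd x).trans (by rw [hx]))⟩
  -- Some geodesic is chosen here. The estimate holds for every geodesic with these initial data, so
  -- uniqueness is not required.
  have hexp : riemannianExp ν V₀ A = h.choose 1 := dif_pos h
  obtain ⟨hγ, hγ0, hγd⟩ := h.choose_spec
  rw [hexp]
  refine ⟨(hγ.mem 1 ⟨zero_le_one, le_rfl⟩).1, ?_⟩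
  exact hest t ht (htr.trans (min_le_right _ _)) _ ((isGeodesic_iff ν _).1 hγ) hγ0 _ hγd
    (by rw [hnI]; exact hAt)

end RiemannianExp


/-! ### Restriction of parameters and comparison of norms. -/

section LeCam

variable {H K : Type*}
  [NormedAddCommGroup H] [InnerProductSpace ℂ H] [CompleteSpace H]
  [NormedAddCommGroup K] [InnerProductSpace ℂ K] [CompleteSpace K]

theorem deficiency_comp_le {Θ Θ' : Type*} (f : Θ' → Θ) (ρ : Θ → (H →L[ℂ] H))
    (σ : Θ → (K →L[ℂ] K)) : deficiency (fun θ => ρ (f θ)) (fun θ => σ (f θ)) ≤ deficiency ρ σ :=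
  iInf_mono fun T => iSup_le fun θ => le_iSup (fun θ => traceNorm (T.apply (ρ θ) - σ θ)) (f θ)

theorem leCam_comp_le {Θ Θ' : Type*} (f : Θ' → Θ) (ρ : Θ → (H →L[ℂ] H))
    (σ : Θ → (K →L[ℂ] K)) : leCam (fun θ => ρ (f θ)) (fun θ => σ (f θ)) ≤ leCam ρ σ :=
  max_le_max (deficiency_comp_le f ρ σ) (deficiency_comp_le f σ ρ)

end LeCam

section FormBound

variable {F : Type*} [NormedAddCommGroup F] [NormedSpace ℝ F] [FiniteDimensional ℝ F]

/-- The form has a positive minimum on the compact unit sphere of `S`. This turns balls of the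
Riemannian metric into bounds for the matrix norm. -/
theorem exists_norm_le_sqrt_form (S : Submodule ℝ F) (g : LinearMap.BilinForm ℝ F)
    (hg : ∀ A ∈ S, A ≠ 0 → 0 < g A A) : ∃ C ≥ 0, ∀ A ∈ S, ‖A‖ ≤ C * √(g A A) := by
  have hcont : Continuous fun A => g A A :=
    ((continuousBilin g).continuous.clm_apply continuous_id)
  have hK : IsCompact ((S : Set F) ∩ Metric.sphere 0 1) :=
    (isCompact_sphere (0 : F) 1).inter_left S.closed_of_finiteDimensional
  have hne : ∀ A ∈ (S : Set F) ∩ Metric.sphere 0 1, 0 < g A A := fun A hA =>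
    hg A hA.1 (ne_zero_of_mem_unit_sphere ⟨A, hA.2⟩)
  obtain ⟨c, hc, hmin⟩ : ∃ c : ℝ, 0 < c ∧ ∀ A ∈ (S : Set F) ∩ Metric.sphere 0 1, c ≤ g A A := by
    rcases ((S : Set F) ∩ Metric.sphere 0 1).eq_empty_or_nonempty with h | h
    · exact ⟨1, one_pos, fun A hA => by rw [h] at hA; exact hA.elim⟩
    · obtain ⟨A, hA, hmin⟩ := hK.exists_isMinOn h hcont.continuousOn
      exact ⟨g A A, hne A hA, fun B hB => hmin hB⟩
  refine ⟨(√c)⁻¹, by positivity, fun A hA => ?_⟩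
  rcases eq_or_ne A 0 with rfl | hA0
  · simp
  have hn : 0 < ‖A‖ := norm_pos_iff.2 hA0
  have h1 := hmin (‖A‖⁻¹ • A) ⟨S.smul_mem _ hA, by simp [norm_smul, hn.ne']⟩
  simp only [map_smul, LinearMap.smul_apply, smul_eq_mul] at h1
  have h2 : c * ‖A‖ ^ 2 ≤ g A A := by
    calc c * ‖A‖ ^ 2 ≤ ‖A‖⁻¹ * (‖A‖⁻¹ * g A A) * ‖A‖ ^ 2 := by gcongr
      _ = g A A := by field_simp
  rw [← div_eq_inv_mul, le_div_iff₀ (Real.sqrt_pos.2 hc)]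
  calc ‖A‖ * √c = √(c * ‖A‖ ^ 2) := by
        rw [Real.sqrt_mul hc.le, Real.sqrt_sq hn.le, mul_comm]
    _ ≤ √(g A A) := Real.sqrt_le_sqrt h2

end FormBound

/-! ### The Le Cam bound for a fixed number of steps. -/

section LocalModels

variable {d k : ℕ}

theorem idDistance_le_extendedDistance (ν : GaugeMetric d k) (V : irreducibleIsometries d k)
    (φ : EuclideanSpace ℂ (Fin d)) (n : ℕ) (r : ℝ) :
    idDistance ν V φ n r ≤ extendedDistance ν V φ n r := by
  have h := leCam_comp_le (fun A : idBall ν V r => (⟨A.1, A.2.1⟩ : tangentBall ν V r))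
    (fun A => localState ν V φ n A) (fun A => gaussianState V (idProj V A))
  have h1 : (fun A : idBall ν V r => gaussianState V (idProj V A.1)) =
      fun A : idBall ν V r => gaussianState V A.1 :=
    funext fun A => by rw [idProj_eq_self V A.2.2]
  rw [idDistance, ← h1]
  exact h

/-- The mode space is the kernel of `A ↦ Vᴴ A`, which maps onto the square matrices because `Vᴴ (V
X) = X`. -/
theorem finrank_modeSpace (V : irreducibleIsometries d k) :
    (Module.finrank ℂ (ModeSpace V) : ℝ) = (d : ℝ) ^ 2 * ((k : ℝ) - 1) := by
  let f : Op d k →ₗ[ℂ] Matrix (Fin d) (Fin d) ℂ :=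
    { toFun := fun A => V.1ᴴ * A
      map_add' := fun A B => Matrix.mul_add _ _ _
      map_smul' := fun c A => Matrix.mul_smul _ _ _ }
  have hker : LinearMap.ker f = lowerBlock V := by
    ext A
    rfl
  have hsurj : LinearMap.range f = ⊤ := by
    rw [LinearMap.range_eq_top]
    intro X
    refine ⟨V.1 * X, ?_⟩
    change V.1ᴴ * (V.1 * X) = X
    rw [← Matrix.mul_assoc, V.2.1, Matrix.one_mul]
  have h := LinearMap.finrank_range_add_finrank_ker f
  rw [hker, hsurj, finrank_top, Module.finrank_matrix, Module.finrank_matrix] at h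
  simp only [Fintype.card_prod, Fintype.card_fin, Module.finrank_self, mul_one] at h
  have h2 : Module.finrank ℂ (ModeSpace V) = Module.finrank ℂ (lowerBlock V) := rfl
  rw [h2]
  have h3 : (d : ℝ) * d + Module.finrank ℂ (lowerBlock V) = d * k * d := by exact_mod_cast h
  linear_combination h3

theorem idProj_smul (V : irreducibleIsometries d k) (c : ℂ) (A : Op d k) :
    idProj V (c • A) = c • idProj V A := by
  have hm : meanPart V (c • A) = c * meanPart V A := by
    rw [meanPart, meanPart, Matrix.mul_smul, Matrix.mul_smul, Matrix.trace_smul, smul_eq_mul]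
  have hg : gaugePart V (c • A) = c • gaugePart V A := by
    obtain ⟨h1, h2⟩ := gaugePart_spec V A
    obtain ⟨h3, h4⟩ := gaugePart_spec V (c • A)
    refine poisson_unique V h3 ?_ ?_
    · rw [Matrix.mul_smul, Matrix.trace_smul, h1, smul_zero]
    · rw [h4, hm, Matrix.mul_smul, mul_smul, ← smul_sub, ← h2, map_smul, smul_sub]
  rw [idProj, idProj, gaugeTangent, gaugeTangent, hm, hg]
  have ha : ampliate k (c • gaugePart V A) = c • ampliate k (gaugePart V A) :=
    Matrix.smul_kronecker _ _ _
  rw [ha, Matrix.smul_mul, Matrix.mul_smul, mul_smul, ← smul_sub, ← smul_add, ← smul_sub]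

theorem toMode_smul (V : irreducibleIsometries d k) (c : ℂ) (A : Op d k) :
    toMode V (c • A) = c • toMode V A := by
  refine Subtype.ext ?_
  change c • A - V.1 * (V.1ᴴ * (c • A)) = c • (A - V.1 * (V.1ᴴ * A))
  rw [Matrix.mul_smul, Matrix.mul_smul, smul_sub]

theorem exists_norm_toMode_le (V : irreducibleIsometries d k) :
    ∃ C ≥ 0, ∀ A : Op d k, ‖toMode V A‖ ≤ C * ‖A‖ := by
  let f : Op d k →ₗ[ℂ] ModeSpace V :=
    { toFun := toMode V
      map_add' := fun A B => by
        refine Subtype.ext ?_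
        change A + B - V.1 * (V.1ᴴ * (A + B)) =
          (A - V.1 * (V.1ᴴ * A)) + (B - V.1 * (V.1ᴴ * B))
        rw [Matrix.mul_add, Matrix.mul_add]
        abel
      map_smul' := toMode_smul V }
  exact LinearMap.exists_norm_le_of_finiteDimensional (𝕜 := ℂ) f

theorem exists_norm_toMode_idProj_le (V : irreducibleIsometries d k) :
    ∃ C ≥ 0, ∀ A : Op d k, ‖toMode V (idProj V A)‖ ≤ C * ‖A‖ := by
  obtain ⟨C₁, hC₁, h₁⟩ := exists_norm_toMode_le V
  obtain ⟨C₂, hC₂, h₂⟩ := norm_meanPart_le V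
  obtain ⟨C₃, hC₃, h₃⟩ := norm_gaugePart_le V
  refine ⟨C₁ * (1 + (C₂ * ‖V.1‖ + (d * k : ℕ) * C₃ * ‖V.1‖ + d * ‖V.1‖ * C₃)), by positivity,
    fun A => (h₁ _).trans ?_⟩
  rw [mul_assoc]
  gcongr
  have e1 := norm_matrix_mul_le (ampliate k (gaugePart V A)) V.1
  have e2 := norm_matrix_mul_le V.1 (gaugePart V A)
  have e3 := norm_ampliate_le k (gaugePart V A)
  rw [Fintype.card_prod, Fintype.card_fin, Fintype.card_fin] at e1
  rw [Fintype.card_fin] at e2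
  calc ‖idProj V A‖ ≤ ‖A‖ + (‖meanPart V A‖ * ‖V.1‖ +
        (d * k : ℕ) * ‖ampliate k (gaugePart V A)‖ * ‖V.1‖ + d * ‖V.1‖ * ‖gaugePart V A‖) := by
        rw [idProj, gaugeTangent]
        refine (norm_sub_le _ _).trans (add_le_add le_rfl ((norm_add_le _ _).trans
          (add_le_add ((norm_sub_le _ _).trans (add_le_add ?_ e1)) e2)))
        rw [norm_smul]
    _ ≤ ‖A‖ + (C₂ * ‖A‖ * ‖V.1‖ +
        (d * k : ℕ) * (C₃ * ‖A‖) * ‖V.1‖ + d * ‖V.1‖ * (C₃ * ‖A‖)) := by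
        gcongr
        · exact h₂ A
        · exact e3.trans (h₃ A)
        · exact h₃ A
    _ = _ := by ring

theorem norm_modePoint_le {X : Type*} [NormedAddCommGroup X] [InnerProductSpace ℂ X]
    [FiniteDimensional ℂ X] {R : ℝ} (hR : 0 ≤ R) {v : RealCoord X} (hv : v ∈ box X R) :
    ‖modePoint v‖ ≤ (2 * Module.finrank ℂ X + 1 : ℝ) * R := by
  have h1 : ‖modePoint v‖ ^ 2 ≤ 2 * Module.finrank ℂ X * R ^ 2 := by
    rw [norm_modePoint_sq]
    calc ∑ i, v i ^ 2 ≤ ∑ _i : Fin (Module.finrank ℂ X) × Fin 2, R ^ 2 :=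
          Finset.sum_le_sum fun i _ => by
            have h := abs_le.1 ((norm_le_pi_norm v i).trans (mem_closedBall_zero_iff.1 hv))
            exact sq_le_sq' h.1 h.2
      _ = _ := by
          rw [Finset.sum_const, Finset.card_univ, Fintype.card_prod, Fintype.card_fin,
            Fintype.card_fin, nsmul_eq_mul]
          push_cast
          ring
  have hN : (0 : ℝ) ≤ Module.finrank ℂ X := Nat.cast_nonneg _
  refine le_of_sq_le_sq (h1.trans ?_) (by positivity)
  nlinarith [sq_nonneg R, mul_nonneg hN (sq_nonneg R), mul_nonneg (mul_nonneg hN hN) (sq_nonneg R)]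

/-- A bound on the Le Cam distance of the extended models for a fixed number of steps. -/
theorem exists_extendedDistance_le (ν : GaugeMetric d k) (V₀ : irreducibleIsometries d k)
    {φ : EuclideanSpace ℂ (Fin d)} (hφ : ‖φ‖ = 1) {C : ℝ} (hC : 0 < C) :
    ∃ κ > 0, ∃ a ≥ 0, ∃ C' ≥ 0, ∃ r > 0, ∀ (n : ℕ) (p t : ℝ), 1 ≤ n → 0 < p → t = κ * p / √n →
      t ≤ r → n * t ^ 3 ≤ r → extendedDistance ν V₀ φ n (C * p) ≤
        ENNReal.ofReal (4 * √(2 * (2 ^ Module.finrank ℂ (ModeSpace V₀) *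
          (Real.exp (-(p ^ 2 / 2)) + C' * (t + n * t ^ 3)) +
          C' * (t + n * t ^ 3) * (2 * ((a + 1) * p)) ^ (2 * Module.finrank ℂ (ModeSpace V₀)) /
            Real.pi ^ Module.finrank ℂ (ModeSpace V₀)))) := by
  obtain ⟨M, hM0, r₁, hr₁, hexp⟩ := exists_norm_riemannianExp_sub_le ν V₀
  obtain ⟨C', hC'0, r₂, hr₂, hcore⟩ := exists_norm_inner_referenceState_sub_le V₀ hφ hM0
  obtain ⟨K₁, hK₁0, hK₁⟩ := exists_norm_le_sqrt_form (tangentSubmodule V₀) (ν.form V₀)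
    (ν.pos V₀)
  obtain ⟨K₂, hK₂0, hK₂⟩ := exists_norm_toMode_idProj_le V₀
  obtain ⟨K₃, hK₃0, hK₃⟩ := exists_norm_val_le V₀
  obtain ⟨gF, hgF⟩ := exists_isParseval_fock (ModeSpace V₀)
  obtain ⟨a, ha⟩ : ∃ a : ℝ, a = K₂ * (K₁ * C) := ⟨_, rfl⟩
  have ha0 : 0 ≤ a := by rw [ha]; positivity
  obtain ⟨b, hb⟩ : ∃ b : ℝ, b = (2 * Module.finrank ℂ (ModeSpace V₀) + 1 : ℝ) * (a + 1) := ⟨_, rfl⟩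
  have hb0 : 0 ≤ b := by rw [hb]; positivity
  -- With this `κ`, the scale `t` bounds both the rescaled tangent vectors, of size `K₁ C p / √n`,
  -- and the rescaled points of the cube, of size `K₃ b p / √n`; the `1` makes it positive.
  refine ⟨K₁ * C + K₃ * b + 1, by positivity, a, ha0, C', hC'0, min r₁ r₂, lt_min hr₁ hr₂,
    fun n p t hn hp ht htr hntr => ?_⟩
  have hn0 : (0 : ℝ) < √n := Real.sqrt_pos.2 (by exact_mod_cast hn)
  have ht0 : 0 < t := by rw [ht]; positivity
  obtain ⟨gH, hgH⟩ := exists_isParseval_of_finiteDimensional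
    (H := EuclideanSpace ℂ (Fin d × (Fin n → Fin k)))
  obtain ⟨hgram, hcross⟩ := hcore n t ht0.le (htr.trans (min_le_right _ _))
    (hntr.trans (min_le_right _ _))
  have hA1 : ∀ A : tangentBall ν V₀ (C * p), ‖A.1‖ ≤ K₁ * C * p := fun A => by
    refine (hK₁ A.1 A.2.1).trans ?_
    rw [mul_assoc]
    exact mul_le_mul_of_nonneg_left A.2.2 hK₁0
  have hAn : ∀ A : tangentBall ν V₀ (C * p), ‖(√n : ℝ)⁻¹ • A.1‖ ≤ t := fun A => by
    rw [norm_smul, norm_inv, Real.norm_of_nonneg hn0.le, ht, ← div_eq_inv_mul]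
    gcongr
    refine (hA1 A).trans ?_
    gcongr
    nlinarith [mul_nonneg hK₃0 hb0]
  have hAt : ∀ A : tangentBall ν V₀ (C * p), (√n : ℝ)⁻¹ • A.1 ∈ tangentSpace V₀ := fun A =>
    (tangentSubmodule V₀).smul_mem _ A.2.1
  have hV := fun A : tangentBall ν V₀ (C * p) => hexp _ (hAt A) t ht0
    (htr.trans (min_le_left _ _)) (hAn A)
  choose z hz hzc using fun A : tangentBall ν V₀ (C * p) =>
    hcross _ _ (hAt A) (hAn A) (hV A).1 (hV A).2
  have hvL : ∀ v ∈ box (ModeSpace V₀) ((a + 1) * p),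
      ‖((((√n : ℝ)⁻¹ : ℝ) : ℂ) • modePoint v : ModeSpace V₀).1‖ ≤ t := fun v hv => by
    refine (hK₃ _).trans ?_
    rw [norm_smul, Complex.norm_real, norm_inv, Real.norm_of_nonneg hn0.le, ht, ← div_eq_inv_mul,
      mul_div_assoc']
    refine div_le_div_of_nonneg_right ?_ hn0.le
    have h1 := norm_modePoint_le (by positivity) hv
    calc K₃ * ‖modePoint v‖ ≤ K₃ * (b * p) := by
          rw [hb, mul_assoc _ (a + 1)]
          gcongr
      _ ≤ (K₁ * C + K₃ * b + 1) * p := by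
          rw [← mul_assoc]
          gcongr
          nlinarith [mul_nonneg hK₁0 hC.le]
  have hΨ : Continuous fun v : RealCoord (ModeSpace V₀) =>
      (((√n : ℝ)⁻¹ : ℝ) : ℂ) • (modePoint v : ModeSpace V₀) :=
    (continuous_modePoint (X := ModeSpace V₀)).const_smul (((√n : ℝ)⁻¹ : ℝ) : ℂ)
  have hcancel : ∀ L : ModeSpace V₀,
      ((√n : ℝ) : ℂ) • ((((√n : ℝ)⁻¹ : ℝ) : ℂ) • L) = L := fun L => by
    rw [smul_smul, ← Complex.ofReal_mul, mul_inv_cancel₀ hn0.ne', Complex.ofReal_one, one_smul]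
  have hmode : ∀ A : Op d k, ((√n : ℝ) : ℂ) • toMode V₀ (idProj V₀ ((√n : ℝ)⁻¹ • A)) =
      toMode V₀ (idProj V₀ A) := fun A => by
    have h1 : (√n : ℝ)⁻¹ • A = (((√n : ℝ)⁻¹ : ℝ) : ℂ) • A := (Complex.coe_smul _ _).symm
    rw [h1, idProj_smul, toMode_smul, hcancel]
  have hψn : ∀ A : tangentBall ν V₀ (C * p),
      ‖z A • systemOutput φ n (riemannianExp ν V₀ ((√n : ℝ)⁻¹ • A.1))‖ = 1 := fun A => by
    rw [norm_smul, hz A, one_mul, norm_systemOutput (hV A).1 hφ]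
  -- The cube has half-width `(a + 1) p`: the modes of the parameters have norm at most `a p`, and a
  -- margin `s = p` remains for the Gaussian tail.
  have h := leCam_pureState_coherent_le hgF hgH (inner_coherent (X := ModeSpace V₀))
    (R := (a + 1) * p) (ε := C' * (t + n * t ^ 3)) (s := p) (by positivity) (by positivity) hp.le
    (Ψ := fun v => referenceState V₀ φ n ((((√n : ℝ)⁻¹ : ℝ) : ℂ) • modePoint v))
    ((continuous_referenceState V₀ φ n).comp hΨ)
    (fun u hu v hv => by
      have := hgram _ _ (hvL u hu) (hvL v hv)
      rwa [hcancel, hcancel] at this)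
    (Θ := tangentBall ν V₀ (C * p)) hψn (x := fun A => toMode V₀ (idProj V₀ A.1))
    (fun A => by
      have h1 := (hK₂ A.1).trans (mul_le_mul_of_nonneg_left (hA1 A) hK₂0)
      rw [ha]
      nlinarith)
    (fun A v hv => by
      have := hzc A _ (hvL v hv)
      rwa [hcancel, hmode] at this)
    (e := systemOutput φ n V₀.1) (norm_systemOutput V₀.2.1 hφ n)
  have hst : (fun A : tangentBall ν V₀ (C * p) =>
      pureState (z A • systemOutput φ n (riemannianExp ν V₀ ((√n : ℝ)⁻¹ • A.1)))) =
      fun A => localState ν V₀ φ n A.1 :=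
    funext fun A => pureState_smul (hz A) _
  rw [hst] at h
  exact h

end LocalModels


/-! ### Asymptotics of the error terms and convergence. -/

section Rates

theorem tendsto_natCast_rpow_of_neg {β : ℝ} (hβ : β < 0) :
    Tendsto (fun n : ℕ => (n : ℝ) ^ β) atTop (𝓝 0) := by
  have := (tendsto_rpow_neg_atTop (neg_pos.2 hβ)).comp tendsto_natCast_atTop_atTop
  rwa [neg_neg] at this

theorem tendsto_natCast_rpow_mul_exp {δ : ℝ} (hδ : 0 < δ) (w : ℝ) :
    Tendsto (fun n : ℕ => (n : ℝ) ^ w * Real.exp (-(((n : ℝ) ^ δ) ^ 2 / 2))) atTop (𝓝 0) := by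
  have h1 : Tendsto (fun n : ℕ => (n : ℝ) ^ (2 * δ)) atTop atTop :=
    (tendsto_rpow_atTop (by positivity)).comp tendsto_natCast_atTop_atTop
  have h2 := (tendsto_rpow_mul_exp_neg_mul_atTop_nhds_zero (w / (2 * δ)) (1 / 2) (by norm_num)).comp h1
  refine h2.congr fun n => ?_
  have hn : (0 : ℝ) ≤ n := Nat.cast_nonneg n
  simp only [Function.comp_apply]
  rw [← Real.rpow_mul hn, mul_div_cancel₀ _ (by positivity : 2 * δ ≠ 0), mul_comm 2 δ,
    Real.rpow_mul hn, Real.rpow_two]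
  congr 2
  ring

variable {κ δ : ℝ}

theorem localScale_eq {n : ℕ} (hn : 1 ≤ n) :
    κ * (n : ℝ) ^ δ / √n = κ * (n : ℝ) ^ (δ - 1 / 2) := by
  have hn0 : (0 : ℝ) < n := by exact_mod_cast hn
  rw [Real.rpow_sub hn0, ← Real.sqrt_eq_rpow, mul_div_assoc]

theorem mul_localScale_pow_three_eq {n : ℕ} (hn : 1 ≤ n) :
    n * (κ * (n : ℝ) ^ δ / √n) ^ 3 = κ ^ 3 * (n : ℝ) ^ (3 * δ - 1 / 2) := by
  have hn0 : (0 : ℝ) < n := by exact_mod_cast hn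
  have h1 : (n : ℝ) ^ (3 * δ - 1 / 2) = n * ((n : ℝ) ^ (δ - 1 / 2)) ^ 3 := by
    rw [← Real.rpow_natCast, ← Real.rpow_mul hn0.le]
    nth_rewrite 2 [← Real.rpow_one (n : ℝ)]
    rw [← Real.rpow_add hn0]
    congr 1
    push_cast
    ring
  rw [localScale_eq hn, h1]
  ring

theorem tendsto_localScale (h : δ < 1 / 2) :
    Tendsto (fun n : ℕ => κ * (n : ℝ) ^ δ / √n) atTop (𝓝 0) := by
  have h1 := (tendsto_natCast_rpow_of_neg (sub_neg.2 h)).const_mul κ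
  rw [mul_zero] at h1
  refine h1.congr' ?_
  filter_upwards [eventually_ge_atTop 1] with n hn
  exact (localScale_eq hn).symm

theorem tendsto_mul_localScale_pow_three (h : 3 * δ < 1 / 2) :
    Tendsto (fun n : ℕ => n * (κ * (n : ℝ) ^ δ / √n) ^ 3) atTop (𝓝 0) := by
  have h1 := (tendsto_natCast_rpow_of_neg (sub_neg.2 h)).const_mul (κ ^ 3)
  rw [mul_zero] at h1
  refine h1.congr' ?_
  filter_upwards [eventually_ge_atTop 1] with n hn
  exact (mul_localScale_pow_three_eq hn).symm

theorem tendsto_rpow_mul_localError (hδ : 0 < δ) {w : ℝ} (h : w + 3 * δ < 1 / 2) :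
    Tendsto (fun n : ℕ => (n : ℝ) ^ w * (κ * (n : ℝ) ^ δ / √n +
      n * (κ * (n : ℝ) ^ δ / √n) ^ 3)) atTop (𝓝 0) := by
  have h1 := ((tendsto_natCast_rpow_of_neg (β := w + (δ - 1 / 2)) (by linarith)).const_mul κ).add
    ((tendsto_natCast_rpow_of_neg (β := w + (3 * δ - 1 / 2)) (by linarith)).const_mul (κ ^ 3))
  rw [mul_zero, mul_zero, add_zero] at h1
  refine h1.congr' ?_
  filter_upwards [eventually_ge_atTop 1] with n hn
  have hn0 : (0 : ℝ) < n := by exact_mod_cast hn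
  rw [mul_localScale_pow_three_eq hn, localScale_eq hn, Real.rpow_add hn0, Real.rpow_add hn0]
  ring

/-- Under the square root the prefactor becomes `n^(2w)`. The largest term is the kernel error
`n^(3δ - 1/2)` times the volume factor `n^(2Nδ)`, whence the condition; the Gaussian tail decays
faster than any power. -/
theorem tendsto_rpow_mul_leCamBound (hδ : 0 < δ) {w : ℝ} (N : ℕ)
    (h : 2 * w + (2 * N + 3) * δ < 1 / 2) (a C : ℝ) :
    Tendsto (fun n : ℕ => (n : ℝ) ^ w * (4 * √(2 * (2 ^ N *
      (Real.exp (-(((n : ℝ) ^ δ) ^ 2 / 2)) +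
        C * (κ * (n : ℝ) ^ δ / √n + n * (κ * (n : ℝ) ^ δ / √n) ^ 3)) +
      C * (κ * (n : ℝ) ^ δ / √n + n * (κ * (n : ℝ) ^ δ / √n) ^ 3) *
        (2 * ((a + 1) * (n : ℝ) ^ δ)) ^ (2 * N) / Real.pi ^ N)))) atTop (𝓝 0) := by
  have hNδ : 0 ≤ 2 * (N : ℝ) * δ := by positivity
  have e1 := (tendsto_natCast_rpow_mul_exp hδ (2 * w)).const_mul (2 * 2 ^ N)
  have e2 := (tendsto_rpow_mul_localError (κ := κ) hδ (w := 2 * w)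
    (by linarith)).const_mul (2 * 2 ^ N * C)
  have e3 := (tendsto_rpow_mul_localError (κ := κ) hδ (w := 2 * w + 2 * N * δ)
    (by linarith)).const_mul (2 * C * (2 * (a + 1)) ^ (2 * N) / Real.pi ^ N)
  have e4 := (((e1.add e2).add e3).sqrt).const_mul 4
  simp only [mul_zero, add_zero, Real.sqrt_zero] at e4
  refine e4.congr' ?_
  filter_upwards [eventually_ge_atTop 1] with n hn
  have hn0 : (0 : ℝ) < n := by exact_mod_cast hn
  have h1 : (n : ℝ) ^ w = √((n : ℝ) ^ (2 * w)) := by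
    rw [mul_comm, Real.rpow_mul hn0.le, Real.rpow_two, Real.sqrt_sq (by positivity)]
  have h2 : (n : ℝ) ^ (2 * w + 2 * N * δ) = (n : ℝ) ^ (2 * w) * ((n : ℝ) ^ δ) ^ (2 * N) := by
    rw [Real.rpow_add hn0, ← Real.rpow_natCast ((n : ℝ) ^ δ), ← Real.rpow_mul hn0.le]
    congr 2
    push_cast
    ring
  rw [h2, h1, mul_left_comm (√((n : ℝ) ^ (2 * w))) 4, ← Real.sqrt_mul (by positivity)]
  congr 2
  rw [← mul_assoc 2 (a + 1), mul_pow (2 * (a + 1)) ((n : ℝ) ^ δ)]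
  ring

end Rates

section Convergence

variable {d k : ℕ}

/-- All three claims are instances of this one, with `w = 0` or `w = 2 δ`. The same condition on the
exponents also guarantees that `t` and `n t³` become small. -/
theorem tendsto_extendedDistance (ν : GaugeMetric d k) (V₀ : irreducibleIsometries d k)
    {φ : EuclideanSpace ℂ (Fin d)} (hφ : ‖φ‖ = 1) {C δ w : ℝ} (hC : 0 < C) (hδ : 0 < δ)
    (hw : 0 ≤ w) (h : 2 * w + (dId d k + 3) * δ < 1 / 2) :
    Tendsto (fun n : ℕ => ENNReal.ofReal ((n : ℝ) ^ w) *
      extendedDistance ν V₀ φ n (C * (n : ℝ) ^ δ)) atTop (𝓝 0) := by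
  obtain ⟨κ, hκ, a, -, C', -, r, hr, hbound⟩ := exists_extendedDistance_le ν V₀ hφ hC
  have hN : dId d k = 2 * (Module.finrank ℂ (ModeSpace V₀) : ℝ) := by
    rw [finrank_modeSpace, dId]
    ring
  rw [hN] at h
  have hNδ : 0 ≤ 2 * (Module.finrank ℂ (ModeSpace V₀) : ℝ) * δ := by positivity
  have h0 := (ENNReal.tendsto_ofReal (tendsto_rpow_mul_leCamBound (κ := κ) hδ
    (Module.finrank ℂ (ModeSpace V₀)) h a C'))
  rw [ENNReal.ofReal_zero] at h0
  refine tendsto_of_tendsto_of_tendsto_of_le_of_le' tendsto_const_nhds h0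
    (Eventually.of_forall fun n => zero_le) ?_
  filter_upwards [eventually_ge_atTop 1,
    (tendsto_localScale (κ := κ) (δ := δ) (by linarith)).eventually (gt_mem_nhds hr),
    (tendsto_mul_localScale_pow_three (κ := κ) (δ := δ) (by linarith)).eventually (gt_mem_nhds hr)]
    with n hn h1 h2
  have hn0 : (0 : ℝ) < n := by exact_mod_cast hn
  rw [ENNReal.ofReal_mul (by positivity)]
  gcongr
  exact hbound n _ _ hn (by positivity) rfl h1.le h2.le

end Convergence

end QMC

end

theorem theorem5p5 (d k : ℕ) (ν : QMC.GaugeMetric d k) (V₀ : QMC.irreducibleIsometries d k)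
    (φ : EuclideanSpace ℂ (Fin d)) (hφ : ‖φ‖ = 1) (C δ : ℝ) (hC : 0 < C) (hδ : 0 < δ) :
    (δ < (2 * (QMC.dId d k + 3))⁻¹ →
      Tendsto (fun n : ℕ => QMC.idDistance ν V₀ φ n (C * (n : ℝ) ^ δ)) atTop (𝓝 0)) ∧
    (δ < (2 * (11 + 2 * QMC.dId d k))⁻¹ →
      Tendsto (fun n : ℕ => ENNReal.ofReal ((n : ℝ) ^ (2 * δ)) *
        QMC.idDistance ν V₀ φ n (C * (n : ℝ) ^ δ)) atTop (𝓝 0)) ∧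
    (δ < (2 * (QMC.dId d k + 3))⁻¹ →
      Tendsto (fun n : ℕ => QMC.extendedDistance ν V₀ φ n (C * (n : ℝ) ^ δ)) atTop (𝓝 0)) := by
  have hD : 0 ≤ QMC.dId d k := by
    have h := QMC.finrank_modeSpace V₀
    have h2 : QMC.dId d k = 2 * (Module.finrank ℂ (QMC.ModeSpace V₀) : ℝ) := by
      rw [h, QMC.dId]
      ring
    rw [h2]
    positivity
  have hext : δ < (2 * (QMC.dId d k + 3))⁻¹ → Tendsto
      (fun n : ℕ => QMC.extendedDistance ν V₀ φ n (C * (n : ℝ) ^ δ)) atTop (𝓝 0) := by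
    intro h
    rw [← one_div, lt_div_iff₀ (by positivity)] at h
    have h1 := QMC.tendsto_extendedDistance ν V₀ hφ hC hδ le_rfl (w := 0) (by linarith)
    simpa using h1
  refine ⟨fun h => ?_, fun h => ?_, hext⟩
  · exact tendsto_of_tendsto_of_tendsto_of_le_of_le tendsto_const_nhds (hext h)
      (fun n => zero_le) fun n => QMC.idDistance_le_extendedDistance ν V₀ φ n _
  · rw [← one_div, lt_div_iff₀ (by positivity)] at h
    -- The weight `n^(2δ)` requires `(dId + 7) δ < 1 / 2`, which follows from `(11 + 2 dId) δ < 1 /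
    -- 2` as `dId` is nonnegative.
    have h1 := QMC.tendsto_extendedDistance ν V₀ hφ hC hδ (w := 2 * δ) (by positivity)
      (by nlinarith [mul_nonneg hD hδ.le])
    refine tendsto_of_tendsto_of_tendsto_of_le_of_le tendsto_const_nhds h1
      (fun n => zero_le) fun n => ?_
    exact mul_le_mul_right (QMC.idDistance_le_extendedDistance ν V₀ φ n _) _
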